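/- **Theorem 1.** Let $M$ be a smooth $(n+1)$-dimensional manifold with boundary $X=\partial M$, let $g$ be a Lorentzian b-metric on $M$ of signature $(1,n)$ (a smooth nondegenerate symmetric form on the b-tangent bundle ${}^bTM$), and let $\tau$ be a global boundary defining function such that $d\tau/\tau$ is timelike on $X$; causal b-covectors are time-oriented by declaring $-d\tau/\tau$ to be future-directed. Let $G(\varpi)=g^{-1}(\varpi,\varpi)$ on ${}^bT^*M$, let $H_G$ be its Hamilton vector field, which is tangent to ${}^bT^*_XM$, let ${}^bS^*_XM=({}^bT^*_XM\setminus 0)/\mathbb R_+$, and let $\widehat\rho=|2g^{-1}(-d\tau/\tau,\cdot)|^{-1}$ where $g^{-1}(d\tau/\tau,\cdot)\neq0$. Split ${}^bT_XM=\mathbb R\,\tau\partial_\tau\oplus TX$ by means of $\tau$. Let $V$ be a smooth vector field on $X$, $K=\tau\partial_\tau+V$ and $\mu=g(K,K)$, a function on $X$. Let $H\subset X$ be a compact connected component of $\{\mu=0\}$ on which $d\mu^\sharp=2\varkappa K$ for some function $\varkappa:H\to\mathbb R$ (the surface gravity), where $\varkappa$ has no zeros, and assume that either $V=0$, or - $V\mu$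 vanishes quadratically along $H$ (that is, $V\mu=0$ and $d(V\mu)=0$ on $H$), - $V\varkappa=0$ along $H$, and - there is a Riemannian metric on $H$ for which $V|_H$ is a Killing vector field. So $H$ is a nondegenerate b-horizon, generated by $\tau\partial_\tau$ or by $K$. Let $\mathcal R_\pm$ be the set of nonzero future/past-directed null b-covectors in the b-conormal bundle ${}^bN^*H$ (the b-covectors over $H$ annihilating all b-vectors tangent to $H$), and let $L_\pm\subset{}^bS^*_XM$ be its image. Let $\beta=|H_G\widehat\rho\,|$, a function on ${}^bS^*_XM$ near $L_\pm$. Then $\operatorname{sgn}\varkappa$ is constant on $H$, and: 1. $L_+$ and $L_-$ are invariant under the flow of $\widehat\rho H_G$. 2. Within ${}^bS^*_XM$, the set $L_{+\operatorname{sgn}\varkappa}$ is a source and the set $L_{-\operatorname{sgn}\varkappa}$ is a sink for the flow of $\widehat\rho H_G$. (A sink is a set $L$ that has a neighbourhood whose points have flow lines for all positive times, converging to $L$ uniformly, and such that flow lines starting close enough to $L$ stay in any prescribed neighbourhood of $L$; a source is a sink for the reversed flow.) 3. $\beta=|\varkappa|$ at $L_\pm$, $\beta>0$ near $L_\pm$,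 and for each $\delta>0$ there are nondegenerate quadratic defining functions $\rho_\pm$ for $L_\pm$ within ${}^bS^*_XM$ (functions that are, near $L_\pm$, smooth, nonnegative and zero exactly on $L_\pm$, and whose Hessian at points of $L_\pm$ is positive in all directions transversal to $L_\pm$) such that $$\pm(\operatorname{sgn}\varkappa)\,\widehat\rho H_G\rho_\pm\ \ge\ 2(1-\delta)\,\beta\,\rho_\pm\qquad\text{in a neighbourhood of }L_\pm .$$ -/

import Mathlib

open Set Topology Manifold Bundle
open scoped ContDiff

noncomputable section

namespace BHorizon

/-! ## Differentials and tangent vectors to a subset -/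

/-- The differential `df_p`, as a real-valued linear form on the tangent space. -/
def diff {E₀ H₀ P : Type*} [NormedAddCommGroup E₀] [NormedSpace ℝ E₀] [TopologicalSpace H₀]
    (J : ModelWithCorners ℝ E₀ H₀) [TopologicalSpace P] [ChartedSpace H₀ P]
    (f : P → ℝ) (p : P) : TangentSpace J p →L[ℝ] ℝ :=
  mfderiv J 𝓘(ℝ) f p

/-- The tangent space at `p` of a subset `S` of a manifold: the tangent vectors annihilated by the
differentials of all smooth functions vanishing on `S`. For an embedded submanifold `S` this is the
usual tangent space. -/
def tangentTo {E₀ H₀ P : Type*} [NormedAddCommGroup E₀] [NormedSpace ℝ E₀] [TopologicalSpace H₀]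
    (J : ModelWithCorners ℝ E₀ H₀) [TopologicalSpace P] [ChartedSpace H₀ P]
    (S : Set P) (p : P) : Set (TangentSpace J p) :=
  {v | ∀ f : P → ℝ, ContMDiff J 𝓘(ℝ) ∞ f → (∀ q ∈ S, f q = 0) →
    diff J f p v = 0}

/-! ## The manifold with boundary, the b-tangent bundle and Lorentzian b-metrics -/

section Setup

/-- `τ` is a (global) boundary defining function of `M`. -/
structure IsBoundaryDefining (n : ℕ) {M : Type*} [TopologicalSpace M]
    [ChartedSpace (EuclideanHalfSpace (n + 1)) M] (τ : M → ℝ) : Prop where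
  smooth : ContMDiff (𝓡∂ (n + 1)) 𝓘(ℝ) ∞ τ
  nonneg : ∀ q, 0 ≤ τ q
  zero_iff : ∀ q, τ q = 0 ↔ q ∈ (𝓡∂ (n + 1)).boundary M
  mfderiv_ne_zero : ∀ q ∈ (𝓡∂ (n + 1)).boundary M,
    diff (𝓡∂ (n + 1)) τ q ≠ 0

/-- `ι : X → M` exhibits the boundaryless manifold `X` as the boundary of `M`: it is a smooth
embedding with image `∂M`. -/
structure IsBoundaryInclusion (n : ℕ) {M : Type*} [TopologicalSpace M]
    [ChartedSpace (EuclideanHalfSpace (n + 1)) M] {X : Type*} [TopologicalSpace X]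
    [ChartedSpace (EuclideanSpace ℝ (Fin n)) X] (ι : X → M) : Prop where
  smooth : ContMDiff (𝓡 n) (𝓡∂ (n + 1)) ∞ ι
  isEmbedding : IsEmbedding ι
  injective_mfderiv : ∀ x, Function.Injective (mfderiv (𝓡 n) (𝓡∂ (n + 1)) ι x)
  range_eq : range ι = (𝓡∂ (n + 1)).boundary M

/-- The b-tangent space `ᵇT_qM`. The map `v ↦ (i(v), ⟨v, dτ/τ⟩)` identifies `ᵇTM` with the smooth
rank `n + 1` subbundle `{(v, a) : dτ(v) = τ a}` of `TM ⊕ ℝ`; the smooth sections of this subbundle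
are exactly the smooth vector fields tangent to the boundary. At a boundary point the b-vector
`τ∂_τ` is `(0, 1)`. -/
def bTangentSpace (n : ℕ) {M : Type*} [TopologicalSpace M]
    [ChartedSpace (EuclideanHalfSpace (n + 1)) M] (τ : M → ℝ) (q : M) :
    Submodule ℝ (TangentSpace (𝓡∂ (n + 1)) q × ℝ) :=
  LinearMap.ker ((diff (𝓡∂ (n + 1)) τ q).comp (ContinuousLinearMap.fst ℝ _ ℝ)
    - τ q • ContinuousLinearMap.snd ℝ (TangentSpace (𝓡∂ (n + 1)) q) ℝ).toLinearMap

/-- A smooth Lorentzian b-metric of signature `(1, n)`: a symmetric bilinear form on each fibre of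
`ᵇTM`, having one positive and `n` negative directions, which is smooth up to the boundary, that is,
of the form `a (dτ/τ)² + (dτ/τ ⊗ b + b ⊗ dτ/τ) + c` with a smooth function `a`, a smooth one-form
`b` and a smooth symmetric two-tensor `c` on `M`. -/
structure LorentzianBMetric (n : ℕ) {M : Type*} [TopologicalSpace M]
    [ChartedSpace (EuclideanHalfSpace (n + 1)) M] [IsManifold (𝓡∂ (n + 1)) ∞ M] (τ : M → ℝ) where
  form : ∀ q : M, bTangentSpace n τ q →L[ℝ] bTangentSpace n τ q →L[ℝ] ℝ
  symm : ∀ q u w, form q u w = form q w u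
  signature : ∀ q, ∃ u, 0 < form q u u ∧ ∀ w, form q u w = 0 → w ≠ 0 → form q w w < 0
  smooth : ∃ (a : M → ℝ) (b : ∀ q : M, TangentSpace (𝓡∂ (n + 1)) q →L[ℝ] ℝ)
    (c : ∀ q : M, TangentSpace (𝓡∂ (n + 1)) q →L[ℝ] TangentSpace (𝓡∂ (n + 1)) q →L[ℝ] ℝ),
    ContMDiff (𝓡∂ (n + 1)) 𝓘(ℝ) ∞ a ∧
    ContMDiff (𝓡∂ (n + 1))
      ((𝓡∂ (n + 1)).prod 𝓘(ℝ, EuclideanSpace ℝ (Fin (n + 1)) →L[ℝ] ℝ)) ∞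
      (fun q => TotalSpace.mk' (EuclideanSpace ℝ (Fin (n + 1)) →L[ℝ] ℝ)
        (E := fun q : M => TangentSpace (𝓡∂ (n + 1)) q →L[ℝ] ℝ) q (b q)) ∧
    ContMDiff (𝓡∂ (n + 1))
      ((𝓡∂ (n + 1)).prod 𝓘(ℝ, EuclideanSpace ℝ (Fin (n + 1)) →L[ℝ]
        EuclideanSpace ℝ (Fin (n + 1)) →L[ℝ] ℝ)) ∞
      (fun q => TotalSpace.mk' (EuclideanSpace ℝ (Fin (n + 1)) →L[ℝ]
          EuclideanSpace ℝ (Fin (n + 1)) →L[ℝ] ℝ)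
        (E := fun q : M => TangentSpace (𝓡∂ (n + 1)) q →L[ℝ]
          TangentSpace (𝓡∂ (n + 1)) q →L[ℝ] ℝ) q (c q)) ∧
    (∀ q v w, c q v w = c q w v) ∧
    ∀ q (u w : bTangentSpace n τ q),
      form q u w = a q * u.1.2 * w.1.2 + (u.1.2 * b q w.1.1 + w.1.2 * b q u.1.1)
        + c q u.1.1 w.1.1

end Setup

/-! ## The boundary data -/

section Boundary

variable {n : ℕ} {M : Type*} [TopologicalSpace M] [ChartedSpace (EuclideanHalfSpace (n + 1)) M]
  {X : Type*} [TopologicalSpace X] [ChartedSpace (EuclideanSpace ℝ (Fin n)) X]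
  {τ : M → ℝ} {ι : X → M}

theorem mem_bTangentSpace (hτ : IsBoundaryDefining n τ) (hι : IsBoundaryInclusion n ι) (x : X)
    (a : ℝ) (w : TangentSpace (𝓡 n) x) :
    ((mfderiv (𝓡 n) (𝓡∂ (n + 1)) ι x w, a) : TangentSpace (𝓡∂ (n + 1)) (ι x) × ℝ) ∈
      bTangentSpace n τ (ι x) := by
  have h0 : ∀ y, τ (ι y) = 0 := fun y => (hτ.zero_iff _).2 (hι.range_eq ▸ mem_range_self y)
  have hc : mfderiv (𝓡 n) 𝓘(ℝ) (τ ∘ ι) x = (mfderiv (𝓡∂ (n + 1)) 𝓘(ℝ) τ (ι x)).comp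
      (mfderiv (𝓡 n) (𝓡∂ (n + 1)) ι x) :=
    mfderiv_comp x ((hτ.smooth _).mdifferentiableAt (by simp))
      ((hι.smooth x).mdifferentiableAt (by simp))
  have hz : τ ∘ ι = fun _ => (0 : ℝ) := funext h0
  have hd : mfderiv (𝓡 n) 𝓘(ℝ) (τ ∘ ι) x = 0 := by rw [hz]; exact mfderiv_const
  rw [hc] at hd
  have h : diff (𝓡∂ (n + 1)) τ (ι x) (mfderiv (𝓡 n) (𝓡∂ (n + 1)) ι x w) = 0 :=
    congrArg (fun L => L w) hd
  rw [bTangentSpace, LinearMap.mem_ker]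
  change diff (𝓡∂ (n + 1)) τ (ι x) (mfderiv (𝓡 n) (𝓡∂ (n + 1)) ι x w) - τ (ι x) * a = 0
  rw [h, h0, zero_mul, sub_zero]

/-- The splitting `ᵇT_xM = ℝ τ∂_τ ⊕ T_xX` at a boundary point `x`: the b-vector
`a τ∂_τ + w`. -/
def bVector (hτ : IsBoundaryDefining n τ) (hι : IsBoundaryInclusion n ι) (x : X) :
    (ℝ × TangentSpace (𝓡 n) x) →L[ℝ] bTangentSpace n τ (ι x) where
  toFun u := ⟨(mfderiv (𝓡 n) (𝓡∂ (n + 1)) ι x u.2, u.1), mem_bTangentSpace hτ hι x u.1 u.2⟩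
  map_add' u w := by
    apply Subtype.ext
    exact Prod.ext (map_add _ _ _) rfl
  map_smul' c u := by
    apply Subtype.ext
    exact Prod.ext (map_smul _ _ _) rfl
  cont := by
    apply Continuous.subtype_mk
    exact ((mfderiv (𝓡 n) (𝓡∂ (n + 1)) ι x).continuous.comp continuous_snd).prodMk continuous_fst

end Boundary

/-- The setting: a manifold `M` of dimension `n + 1` with boundary `X`, a global boundary defining
function `τ`, and a Lorentzian b-metric `g`. -/
structure Setting (n : ℕ) (M : Type*) [TopologicalSpace M]
    [ChartedSpace (EuclideanHalfSpace (n + 1)) M] [IsManifold (𝓡∂ (n + 1)) ∞ M]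
    (X : Type*) [TopologicalSpace X] [ChartedSpace (EuclideanSpace ℝ (Fin n)) X] where
  τ : M → ℝ
  isBoundaryDefining : IsBoundaryDefining n τ
  ι : X → M
  isBoundaryInclusion : IsBoundaryInclusion n ι
  g : LorentzianBMetric n τ

/-! ## The b-cotangent bundle and the b-cosphere bundle over the boundary -/

section Cotangent

/-- The bundle `ᵇT*_XM = ℝ dτ/τ ⊕ T*X` over `X`. The point `(σ, ⟨x, η⟩)` is the b-covector
`σ dτ/τ + η` at `x`; its pairing with `a τ∂_τ + w` is `σ a + η(w)`. -/
abbrev BCotangent (n : ℕ) (X : Type*) [TopologicalSpace X]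
    [ChartedSpace (EuclideanSpace ℝ (Fin n)) X] : Type _ :=
  ℝ × TotalSpace (EuclideanSpace ℝ (Fin n) →L[ℝ] ℝ) (fun x : X => TangentSpace (𝓡 n) x →L[ℝ] ℝ)

/-- The model of `ᵇT*_XM` as a boundaryless manifold of dimension `2n + 1`. -/
abbrev cotModel (n : ℕ) :=
  𝓘(ℝ, ℝ).prod ((𝓡 n).prod 𝓘(ℝ, EuclideanSpace ℝ (Fin n) →L[ℝ] ℝ))

variable {n : ℕ} {X : Type*} [TopologicalSpace X] [ChartedSpace (EuclideanSpace ℝ (Fin n)) X]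

/-- The linear form `σ dτ/τ + η` on `ᵇT_xM = ℝ τ∂_τ ⊕ T_xX`. -/
def covector (x : X) (σ : ℝ) (η : TangentSpace (𝓡 n) x →L[ℝ] ℝ) :
    (ℝ × TangentSpace (𝓡 n) x) →L[ℝ] ℝ :=
  σ • ContinuousLinearMap.fst ℝ ℝ (TangentSpace (𝓡 n) x)
    + η.comp (ContinuousLinearMap.snd ℝ ℝ (TangentSpace (𝓡 n) x))

/-- The base point in `X` of a b-covector. -/
def base (p : BCotangent n X) : X := p.2.proj

/-- A point of `ᵇT*_XM` as a linear form on `ᵇT_xM`. -/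
def toForm (p : BCotangent n X) : (ℝ × TangentSpace (𝓡 n) (base p)) →L[ℝ] ℝ :=
  covector (base p) p.1 p.2.snd

/-- Dilation in the fibres. -/
def dilate (c : ℝ) (p : BCotangent n X) : BCotangent n X := (c * p.1, ⟨p.2.proj, c • p.2.snd⟩)

/-- The complement of the zero section. -/
abbrev Nonzero (n : ℕ) (X : Type*) [TopologicalSpace X]
    [ChartedSpace (EuclideanSpace ℝ (Fin n)) X] : Type _ :=
  {p : BCotangent n X // ¬(p.1 = 0 ∧ p.2.snd = 0)}

/-- Two nonzero b-covectors lie on the same ray. -/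
def raySetoid (n : ℕ) (X : Type*) [TopologicalSpace X]
    [ChartedSpace (EuclideanSpace ℝ (Fin n)) X] : Setoid (Nonzero n X) where
  r p q := ∃ c : ℝ, 0 < c ∧ q.1 = dilate c p.1
  iseqv := by
    refine ⟨fun p => ⟨1, one_pos, ?_⟩, ?_, ?_⟩
    · simp [dilate]
    · rintro p q ⟨c, hc, h⟩
      refine ⟨c⁻¹, inv_pos.2 hc, ?_⟩
      rw [h]
      obtain ⟨⟨σ, ⟨x, η⟩⟩, hp⟩ := p
      have h1 : c⁻¹ • c • η = η := inv_smul_smul₀ hc.ne' η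
      have h2 : c⁻¹ * (c * σ) = σ := inv_mul_cancel_left₀ hc.ne' σ
      dsimp only [dilate]
      rw [h2]
      exact congrArg (fun e : TangentSpace (𝓡 n) x →L[ℝ] ℝ => ((σ, ⟨x, e⟩) : BCotangent n X))
        h1.symm
    · rintro p q r ⟨c, hc, h⟩ ⟨d, hd, h'⟩
      refine ⟨d * c, mul_pos hd hc, ?_⟩
      rw [h', h]
      obtain ⟨⟨σ, ⟨x, η⟩⟩, hp⟩ := p
      have h1 : d • c • η = (d * c) • η := smul_smul d c η
      dsimp only [dilate]
      rw [mul_assoc]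
      exact congrArg (fun e : TangentSpace (𝓡 n) x →L[ℝ] ℝ =>
        ((d * (c * σ), ⟨x, e⟩) : BCotangent n X)) h1

/-- The b-cosphere bundle `ᵇS*_XM = (ᵇT*_XM ∖ 0) / ℝ₊` over `X`, with the quotient topology. -/
def BSphere (n : ℕ) (X : Type*) [TopologicalSpace X]
    [ChartedSpace (EuclideanSpace ℝ (Fin n)) X] : Type _ := Quotient (raySetoid n X)

instance [IsManifold (𝓡 n) ∞ X] : TopologicalSpace (BSphere n X) :=
  TopologicalSpace.coinduced (Quotient.mk (raySetoid n X)) inferInstance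

/-- The projection `ᵇT*_XM ∖ 0 → ᵇS*_XM`. -/
def toSphere (p : Nonzero n X) : BSphere n X := Quotient.mk (raySetoid n X) p

/-- The conic preimage in `ᵇT*_XM ∖ 0` of a subset of `ᵇS*_XM`. -/
def cone (U : Set (BSphere n X)) : Set (BCotangent n X) :=
  {p | ∃ h : ¬(p.1 = 0 ∧ p.2.snd = 0), toSphere ⟨p, h⟩ ∈ U}

open Classical in
/-- The lift of a function on `ᵇS*_XM` to a homogeneous function of degree `0` on `ᵇT*_XM ∖ 0`
(extended by `0` to the zero section). A function on `ᵇS*_XM` is smooth where its lift is, and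
a vector field on `ᵇS*_XM` induced by one on `ᵇT*_XM ∖ 0` is applied to it by applying the latter
to its lift. -/
def lift (f : BSphere n X → ℝ) (p : BCotangent n X) : ℝ :=
  if h : ¬(p.1 = 0 ∧ p.2.snd = 0) then f (toSphere ⟨p, h⟩) else 0

/-- The Hessian of `f` at `p` in the canonical coordinates around `p`; it is independent of
coordinates where the differential of `f` vanishes. -/
def hessian [IsManifold (𝓡 n) ∞ X] (f : BCotangent n X → ℝ) (p : BCotangent n X)
    (v : TangentSpace (cotModel n) p) : ℝ :=
  iteratedFDeriv ℝ 2 (f ∘ (extChartAt (cotModel n) p).symm) (extChartAt (cotModel n) p p)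
    ![v, v]

/-- `ρ` is a nondegenerate quadratic defining function for `L` within `ᵇS*_XM`: near `L` it is
smooth and nonnegative, vanishes precisely at `L`, and its Hessian at points of `L` is positive in
all directions transversal to `L`. -/
def IsQuadraticDefiningFunction [IsManifold (𝓡 n) ∞ X] (L : Set (BSphere n X))
    (ρ : BSphere n X → ℝ) : Prop :=
  ∃ U : Set (BSphere n X), IsOpen U ∧ L ⊆ U ∧
    ContMDiffOn (cotModel n) 𝓘(ℝ) ∞ (lift ρ) (cone U) ∧
    (∀ z ∈ U, 0 ≤ ρ z ∧ (ρ z = 0 ↔ z ∈ L)) ∧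
    ∀ p ∈ cone L, ∀ v : TangentSpace (cotModel n) p,
      v ∉ tangentTo (cotModel n) (cone L) p → 0 < hessian (lift ρ) p v

end Cotangent

/-! ## The dual metric, the Hamilton vector field and its rescaling -/

namespace Setting

variable {n : ℕ} {M : Type*} [TopologicalSpace M] [ChartedSpace (EuclideanHalfSpace (n + 1)) M]
  [IsManifold (𝓡∂ (n + 1)) ∞ M]
  {X : Type*} [TopologicalSpace X] [ChartedSpace (EuclideanSpace ℝ (Fin n)) X]
  (S : Setting n M X)

/-- The metric `g` on `ᵇT_xM = ℝ τ∂_τ ⊕ T_xX`, for `x ∈ X`. -/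
def metric (x : X) :
    (ℝ × TangentSpace (𝓡 n) x) →L[ℝ] (ℝ × TangentSpace (𝓡 n) x) →L[ℝ] ℝ :=
  (ContinuousLinearMap.precomp ℝ (bVector S.isBoundaryDefining S.isBoundaryInclusion x)).comp
    ((S.g.form (S.ι x)).comp (bVector S.isBoundaryDefining S.isBoundaryInclusion x))

/-- The map `ϖ ↦ ϖ♯`, inverse to `v ↦ g(v, ·)`. -/
def sharp (x : X) :
    ((ℝ × TangentSpace (𝓡 n) x) →L[ℝ] ℝ) →L[ℝ] (ℝ × TangentSpace (𝓡 n) x) :=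
  (S.metric x).inverse

/-- The dual metric `g⁻¹` on `ᵇT*_xM`. -/
def dualMetric (x : X) (α β : (ℝ × TangentSpace (𝓡 n) x) →L[ℝ] ℝ) : ℝ := α (S.sharp x β)

/-- The quadratic form `G` on `ᵇT*_XM`. -/
def G (p : BCotangent n X) : ℝ := S.dualMetric (base p) (toForm p) (toForm p)

/-- `dτ/τ` is timelike on `X`. -/
def IsTimelike : Prop := ∀ x : X, 0 < S.dualMetric x (covector x 1 0) (covector x 1 0)

/-- The function `g⁻¹(-dτ/τ, ·)` on `ᵇT*_XM`. Since `-dτ/τ` is future-directed, its sign determines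
the time orientation of causal b-covectors. -/
def timeFunction (p : BCotangent n X) : ℝ :=
  S.dualMetric (base p) (-covector (base p) 1 0) (toForm p)

/-- For `s = ±1`, the set `Σ_±` of (nonzero) future/past-directed null b-covectors over `X`. -/
def lightCone (s : ℝ) : Set (BCotangent n X) :=
  {p | ¬(p.1 = 0 ∧ p.2.snd = 0) ∧ S.G p = 0 ∧ 0 < s * S.timeFunction p}

/-- The function `ρ̂ = |2 g⁻¹(-dτ/τ, ·)|⁻¹`, homogeneous of degree `-1`, defined where
`g⁻¹(dτ/τ, ·) ≠ 0`. -/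
def rhoHat (p : BCotangent n X) : ℝ := |2 * S.timeFunction p|⁻¹

/-- The Hamilton vector field of `G`, which in canonical coordinates `(τ, y, σ, η)` is
`(∂_σ G) τ∂_τ - (τ∂_τ G) ∂_σ + (∂_{η_i} G) ∂_{y^i} - (∂_{y^i} G) ∂_{η_i}`, restricted to
`ᵇT*_XM = {τ = 0}`, where it is the vector field
`(∂_{η_i} G) ∂_{y^i} - (∂_{y^i} G) ∂_{η_i}` tangent to `ᵇT*_XM`. The tangent space at `p` is
identified with the model space by the canonical coordinates `(σ, (y, η))` around `p`. -/
def hamilton [IsManifold (𝓡 n) ∞ X] (p : BCotangent n X) : TangentSpace (cotModel n) p :=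
  let D : (ℝ × (EuclideanSpace ℝ (Fin n) × (EuclideanSpace ℝ (Fin n) →L[ℝ] ℝ))) →L[ℝ] ℝ :=
    fderiv ℝ (S.G ∘ (extChartAt (cotModel n) p).symm) (extChartAt (cotModel n) p p)
  ((0, (WithLp.toLp 2 (fun i => D (0, (0, EuclideanSpace.proj i))),
    -(D.comp ((ContinuousLinearMap.inr ℝ ℝ _).comp (ContinuousLinearMap.inl ℝ _ _))))) :
    ℝ × (EuclideanSpace ℝ (Fin n) × (EuclideanSpace ℝ (Fin n) →L[ℝ] ℝ)))

/-- The vector field `ρ̂ H_G` on `ᵇT*_XM ∖ 0`; it is invariant under dilations. -/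
def rescaledHamilton [IsManifold (𝓡 n) ∞ X] (p : BCotangent n X) :
    TangentSpace (cotModel n) p :=
  S.rhoHat p • S.hamilton p

/-- The function `β = |H_G ρ̂|`. -/
def beta [IsManifold (𝓡 n) ∞ X] (p : BCotangent n X) : ℝ :=
  |diff (cotModel n) S.rhoHat p (S.hamilton p)|

/-- `γ` is on the interval `J` an integral curve of the vector field on `ᵇS*_XM` induced by
`d ρ̂ H_G`: it is there the projection of an integral curve of `d ρ̂ H_G` in `ᵇT*_XM ∖ 0`,
inside the domain of `ρ̂`. Here `d = 1` for the flow itself and `d = -1` for the reversed flow. -/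
def IsFlowLineOn [IsManifold (𝓡 n) ∞ X] (d : ℝ) (γ : ℝ → BSphere n X) (J : Set ℝ) : Prop :=
  ∃ c : ℝ → Nonzero n X, (∀ t ∈ J, γ t = toSphere (c t)) ∧
    (∀ t ∈ J, S.timeFunction (c t).1 ≠ 0) ∧
    IsMIntegralCurveOn (I := cotModel n) (fun t => (c t).1)
      (fun p => d • S.rescaledHamilton p) J

/-- `L` is invariant under the flow of `ρ̂ H_G` on `ᵇS*_XM`. -/
def IsInvariant [IsManifold (𝓡 n) ∞ X] (L : Set (BSphere n X)) : Prop :=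
  ∀ (γ : ℝ → BSphere n X) (J : Set ℝ), J.OrdConnected → 0 ∈ J → S.IsFlowLineOn 1 γ J →
    γ 0 ∈ L → ∀ t ∈ J, γ t ∈ L

/-- `L` is asymptotically stable for the flow of `d ρ̂ H_G` on `ᵇS*_XM`: the flow lines that start
in some neighbourhood of `L` exist for all positive times and converge to `L` uniformly, and those
that start close to `L` remain close to `L`. -/
def IsAttracting [IsManifold (𝓡 n) ∞ X] (d : ℝ) (L : Set (BSphere n X)) : Prop :=
  (∃ U : Set (BSphere n X), IsOpen U ∧ L ⊆ U ∧
    (∀ z ∈ U, ∃ γ : ℝ → BSphere n X, γ 0 = z ∧ S.IsFlowLineOn d γ (Ici 0)) ∧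
    ∀ N : Set (BSphere n X), IsOpen N → L ⊆ N → ∃ T : ℝ, 0 ≤ T ∧
      ∀ γ : ℝ → BSphere n X, S.IsFlowLineOn d γ (Ici 0) → γ 0 ∈ U → ∀ t, T ≤ t → γ t ∈ N) ∧
  ∀ N : Set (BSphere n X), IsOpen N → L ⊆ N → ∃ N' : Set (BSphere n X), IsOpen N' ∧ L ⊆ N' ∧
    ∀ (γ : ℝ → BSphere n X) (T : ℝ), S.IsFlowLineOn d γ (Icc 0 T) → γ 0 ∈ N' →
      ∀ t ∈ Icc 0 T, γ t ∈ N

/-- `L` is a sink for the flow of `ρ̂ H_G` within `ᵇS*_XM`. -/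
def IsSink [IsManifold (𝓡 n) ∞ X] (L : Set (BSphere n X)) : Prop := S.IsAttracting 1 L

/-- `L` is a source for the flow of `ρ̂ H_G` within `ᵇS*_XM`. -/
def IsSource [IsManifold (𝓡 n) ∞ X] (L : Set (BSphere n X)) : Prop := S.IsAttracting (-1) L

/-! ## b-horizons -/

/-- The function `μ = g(K, K)` on `X`, where `K = τ∂_τ + V` for a vector field `V` on `X`. -/
def mu (V : ∀ x : X, TangentSpace (𝓡 n) x) (x : X) : ℝ := S.metric x (1, V x) (1, V x)

/-- `H` is a compact connected component of `{μ = 0}`, and `dμ♯ = 2 κ K` on `H`. -/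
structure IsHorizonCore (V : ∀ x : X, TangentSpace (𝓡 n) x) (H : Set X) (κ : X → ℝ) : Prop where
  isCompact : IsCompact H
  component : ∃ x₀ ∈ {x | S.mu V x = 0}, H = connectedComponentIn {x | S.mu V x = 0} x₀
  surfaceGravity : ∀ x ∈ H,
    S.sharp x (covector x 0 (diff (𝓡 n) (S.mu V) x)) = (2 * κ x) • ((1, V x) : ℝ × _)

/-- `H` is a b-horizon (generated by `τ∂_τ`) with surface gravity `κ`
(only the values of `κ` on `H` matter). -/
def IsBHorizon (H : Set X) (κ : X → ℝ) : Prop := S.IsHorizonCore (fun _ => 0) H κ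

/-- `H` is a b-horizon generated by `K = τ∂_τ + V` with surface gravity `κ`
(only the values of `κ` on `H` matter). -/
structure IsBHorizonGeneratedBy [IsManifold (𝓡 n) ∞ X] (V : ∀ x : X, TangentSpace (𝓡 n) x)
    (H : Set X) (κ : X → ℝ) : Prop extends S.IsHorizonCore V H κ where
  smooth : ContMDiff (𝓡 n) (𝓡 n).tangent ∞ (fun x => (⟨x, V x⟩ : TangentBundle (𝓡 n) X))
  /-- `Vμ` vanishes quadratically along `H`. -/
  quadratic : ∀ x ∈ H, diff (𝓡 n) (S.mu V) x (V x) = 0 ∧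
    diff (𝓡 n) (fun y => diff (𝓡 n) (S.mu V) y (V y)) x = 0
  /-- `Vκ = 0` along `H`, computed with a smooth extension of `κ` from `H` to `X`. -/
  constant : ∃ k : X → ℝ, ContMDiff (𝓡 n) 𝓘(ℝ) ∞ k ∧ (∀ x ∈ H, k x = κ x) ∧
    ∀ x ∈ H, diff (𝓡 n) k x (V x) = 0
  /-- `V|_H` is Killing for some Riemannian metric on `H`, the latter given as the restriction to
  `H` of a Riemannian metric `ℓ` on `X`: the Lie derivative `ℒ_V ℓ` vanishes on `TH`. -/
  killing : ∃ ℓ : ContMDiffRiemannianMetric (𝓡 n) ∞ (EuclideanSpace ℝ (Fin n))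
      (fun x : X => TangentSpace (𝓡 n) x),
    ∀ x ∈ H, ∀ Y Z : ∀ x : X, TangentSpace (𝓡 n) x,
      ContMDiffAt (𝓡 n) (𝓡 n).tangent ∞ (fun x => (⟨x, Y x⟩ : TangentBundle (𝓡 n) X)) x →
      ContMDiffAt (𝓡 n) (𝓡 n).tangent ∞ (fun x => (⟨x, Z x⟩ : TangentBundle (𝓡 n) X)) x →
      Y x ∈ tangentTo (𝓡 n) H x → Z x ∈ tangentTo (𝓡 n) H x →
      diff (𝓡 n) (fun y => ℓ.inner y (Y y) (Z y)) x (V x)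
        - ℓ.inner x (VectorField.mlieBracket (𝓡 n) V Y x) (Z x)
        - ℓ.inner x (Y x) (VectorField.mlieBracket (𝓡 n) V Z x) = 0

/-- The b-conormal bundle `ᵇN*H`: the b-covectors over `H` annihilating all b-vectors
`a τ∂_τ + w` tangent to `H`. -/
def bConormal (H : Set X) : Set (BCotangent n X) :=
  {p | base p ∈ H ∧ ∀ (a : ℝ), ∀ w ∈ tangentTo (𝓡 n) H (base p), toForm p (a, w) = 0}

/-- For `s = ±1`, the future/past-directed half `ℛ_± ∖ 0` of `ᵇN*H`. -/
def halfConormal (H : Set X) (s : ℝ) : Set (BCotangent n X) := bConormal H ∩ S.lightCone s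

/-- For `s = ±1`, the image `L_±` of `ℛ_± ∖ 0` in `ᵇS*_XM`. -/
def L (H : Set X) (s : ℝ) : Set (BSphere n X) :=
  {z | ∃ p : Nonzero n X, p.1 ∈ S.halfConormal H s ∧ toSphere p = z}

end Setting

end BHorizon

/-!
The proof is a Lyapunov argument around the conormal set `ℛ_±`, whose points are the covectors
`a dμ` over `H` with `a` of one sign.

In canonical coordinates `(σ, (y, η))` of `ᵇT*_XM`, write `Y = ζ♯` for the b-vector dual to
`ζ = σ dτ/τ + η`. As the metric on `ᵇT_XM` does not depend on `τ`, the Hamilton vector field of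
`G` is `(0, (2 Y_X, v ↦ (∂_v g)(Y, Y)))`, where `Y_X` is the component of `Y` tangent to `X`. At
`ζ = a dμ` over `H` the surface gravity equation `dμ♯ = 2 κ K` gives `Y = 2 κ a K`, and computing
the derivative of `g⁻¹(-dτ/τ, ζ) = -Y_τ` one finds `H_G ρ̂ = ±κ` (`fderiv_tm_ham`, `fderiv_rh_ham`).
This gives `β = |κ|` on `ℛ_±`.

The conormal set is cut out, near each of its points, by the submersion
`ζ ↦ (ζ(K), u + G n₀)` (`surjective_fderiv_defn`, `eventually_conormal`), where `η = b dμ + ℓ(u, ·)`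
with `dμ(u) = 0`; here `ℓ` is the Riemannian metric for which `V` is Killing or, if `V = 0`, the
restriction of `-g` to the spacelike manifold `X`. With `Q = ℓ(u, u)`, the quadratic defining
function is

  `ρ = C ((ρ̂² G)² + (ρ̂ ζ(K))²) + ρ̂² Q`

for a large constant `C`. It is constant on the rays of `ᵇT*_XM`, and its growth along `ρ̂ H_G` comes
from the powers of `ρ̂`, provided that `G`, `ζ(K)` and `Q` are almost conserved. Indeed `H_G G = 0`.
The function `H_G(ζ(K))` vanishes to second order on the conormal set, because `Vμ` vanishes
quadratically and `V` preserves `dμ = 2 κ g(K, ·)` on `H` (`fderiv_nuDot`). The part of `H_G Q`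
quadratic in `u` is a multiple of the Lie derivative of `ℓ` along `V`, which vanishes on `H`, and the
remaining terms are bounded by a small multiple of `Q` plus a multiple of `G² + ζ(K)²`
(`exists_QDot_le`). Both facts are turned into estimates by the principle that a function vanishing
on the zero set of a submersion `f` is a linear function of `f` up to `o(f)`
(`isLittleO_of_vanishing`). Hence `±sgn κ · ρ̂ H_G ρ ≥ 2 (1 - δ) β ρ` near the conormal set
(`eventually_rho_ham`). All this is homogeneous under dilations, so by compactness of `H` the
constants are uniform on a conic neighbourhood of `ℛ_±` (`exists_isLyapunov`), and `ρ` descends to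
`ᵇS*_XM`.

The dynamical statements follow from the two-sided bounds for `ρ̂ H_G ρ`: invariance by Gronwall's
inequality (`IsLyapunov.isInvariant`); in the decaying direction, small sublevel sets of `ρ` near
`ℛ_±` are not left by the flow lines (`exists_isTrap`), which therefore exist for all positive times
(`exists_isMIntegralCurveOn_Ici`) and converge to `L_±` exponentially (`IsTrap.isAttracting`).

Finally, `dμ ≠ 0` on `H`, so that the component `H` of `{μ = 0}` is open in `{μ = 0}`
(`eventually_mem_component`); thus the b-vectors tangent to `H` over `X` are those annihilated by
`dμ`. The sign of `κ` is constant by connectedness (`exists_sign`).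
-/

namespace BHorizon

set_option maxSynthPendingDepth 3
set_option linter.unusedSectionVars false

/-! ### Functions vanishing on the zero set of a submersion -/

section Vanishing

variable {E F F' : Type*} [NormedAddCommGroup E] [NormedSpace ℝ E] [CompleteSpace E]
  [NormedAddCommGroup F] [NormedSpace ℝ F] [CompleteSpace F]
  [NormedAddCommGroup F'] [NormedSpace ℝ F']

/-- Metric regularity of a submersion: the distance to the zero set of `f` is bounded by a multiple
of `‖f‖`. -/
theorem exists_zero_near {f : E → F} {f' : E →L[ℝ] F} {z₀ : E} (hf : HasStrictFDerivAt f f' z₀)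
    (hsurj : Function.Surjective f') (h0 : f z₀ = 0) :
    ∃ C : ℝ, 0 < C ∧ ∀ᶠ z in 𝓝 z₀, ∃ z', f z' = 0 ∧ ‖z' - z‖ ≤ C * ‖f z‖ := by
  obtain ⟨s, hs⟩ := f'.exists_nonlinearRightInverse_of_surjective (LinearMap.range_eq_top.2 hsurj)
  have hN : (0 : ℝ) < s.nnnorm := hs
  set c : NNReal := s.nnnorm⁻¹ / 2 with hc
  have hcpos : 0 < c := by positivity
  have hcr : (c : ℝ) = (s.nnnorm : ℝ)⁻¹ / 2 := by rw [hc]; push_cast; rfl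
  obtain ⟨U, hU, hA⟩ := hf.approximates_deriv_on_nhds (c := c) (Or.inr hcpos)
  obtain ⟨r, hr, hrU⟩ := Metric.mem_nhds_iff.1 hU
  have hcr' : (0 : ℝ) < c := hcpos
  refine ⟨(c : ℝ)⁻¹, inv_pos.2 hcr', ?_⟩
  have hcont : ContinuousAt (fun z => (c : ℝ)⁻¹ * ‖f z‖) z₀ :=
    (hf.continuousAt.norm).const_mul _
  have h1 : ∀ᶠ z in 𝓝 z₀, (c : ℝ)⁻¹ * ‖f z‖ < r / 2 := by
    refine hcont.eventually_lt continuousAt_const ?_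
    simp [h0, hr]
  filter_upwards [h1, Metric.ball_mem_nhds z₀ (half_pos hr)] with z hz hzb
  have hε : 0 ≤ (c : ℝ)⁻¹ * ‖f z‖ := by positivity
  have hsub : Metric.closedBall z ((c : ℝ)⁻¹ * ‖f z‖) ⊆ U := by
    refine Subset.trans ?_ hrU
    intro w hw
    rw [Metric.mem_closedBall] at hw
    rw [Metric.mem_ball] at hzb ⊢
    calc dist w z₀ ≤ dist w z + dist z z₀ := dist_triangle _ _ _
      _ < r := by linarith
  have hsurjOn := hA.surjOn_closedBall_of_nonlinearRightInverse s hε hsub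
  have h0mem : (0 : F) ∈ Metric.closedBall (f z)
      (((s.nnnorm : ℝ)⁻¹ - c) * ((c : ℝ)⁻¹ * ‖f z‖)) := by
    rw [Metric.mem_closedBall, dist_zero_left]
    have : ((s.nnnorm : ℝ)⁻¹ - c) = c := by rw [hcr]; ring
    rw [this, ← mul_assoc, mul_inv_cancel₀ hcr'.ne', one_mul]
  obtain ⟨z', hz', hfz'⟩ := hsurjOn h0mem
  refine ⟨z', hfz', ?_⟩
  rwa [Metric.mem_closedBall, dist_eq_norm] at hz'

/-- If `r` vanishes on the zero set of the submersion `f`, then `r` equals a linear function of `f`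
up to an error `o(f)`. -/
theorem isLittleO_of_vanishing {f : E → F} {f' : E →L[ℝ] F} {r : E → F'} {r' : E →L[ℝ] F'} {z₀ : E}
    (hf : HasStrictFDerivAt f f' z₀) (hsurj : Function.Surjective f') (h0 : f z₀ = 0)
    (hr : HasStrictFDerivAt r r' z₀) (hv : ∀ᶠ z in 𝓝 z₀, f z = 0 → r z = 0)
    (A : F →L[ℝ] F') (hA : ∀ v, r' v = A (f' v)) :
    (fun z => r z - A (f z)) =o[𝓝 z₀] f := by
  obtain ⟨C, hC, hreg⟩ := exists_zero_near hf hsurj h0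
  obtain ⟨z', hz'⟩ := hreg.choice
  have hO : (fun z => z' z - z) =O[𝓝 z₀] f := Asymptotics.IsBigO.of_bound C (by
    filter_upwards [hz'] with z hz using hz.2)
  have hf0 : Filter.Tendsto f (𝓝 z₀) (𝓝 0) := by
    have := hf.continuousAt.tendsto; rwa [h0] at this
  have hlim0 : Filter.Tendsto (fun z => z' z - z) (𝓝 z₀) (𝓝 0) := hO.trans_tendsto hf0
  have hlim : Filter.Tendsto z' (𝓝 z₀) (𝓝 z₀) := by
    have := hlim0.add (Filter.tendsto_id (x := 𝓝 z₀))
    simpa using this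
  have hpair : Filter.Tendsto (fun z => (z, z' z)) (𝓝 z₀) (𝓝 (z₀, z₀)) :=
    Filter.tendsto_id.prodMk_nhds hlim
  have hO' : (fun z => z - z' z) =O[𝓝 z₀] f := by
    refine (hO.neg_left).congr_left fun z => by simp
  have e1 := (hr.isLittleO.comp_tendsto hpair).trans_isBigO hO'
  have e2 := (A.isBigO_comp (fun z => f z - f (z' z) - f' (z - z' z)) (𝓝 z₀)).trans_isLittleO
    ((hf.isLittleO.comp_tendsto hpair).trans_isBigO hO')
  refine (e1.sub e2).congr' ?_ Filter.EventuallyEq.rfl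
  filter_upwards [hz', hlim.eventually hv] with z hz hvz
  simp only [Function.comp_apply, hz.1, hvz hz.1, map_sub, hA, map_zero]
  abel

/-- Lagrange multipliers: the differential of a function vanishing on the zero set of a submersion
`f` annihilates the kernel of `df`. -/
theorem deriv_eq_zero_of_vanishing {f : E → F} {f' : E →L[ℝ] F} {r : E → F'} {r' : E →L[ℝ] F'}
    {z₀ : E} (hf : HasStrictFDerivAt f f' z₀) (hsurj : Function.Surjective f') (h0 : f z₀ = 0)
    (hr : HasStrictFDerivAt r r' z₀) (hv : ∀ᶠ z in 𝓝 z₀, f z = 0 → r z = 0)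
    {v : E} (hfv : f' v = 0) : r' v = 0 := by
  obtain ⟨C, hC, hreg⟩ := exists_zero_near hf hsurj h0
  obtain ⟨z', hz'⟩ := hreg.choice
  have hf0 : Filter.Tendsto f (𝓝 z₀) (𝓝 0) := by
    have := hf.continuousAt.tendsto; rwa [h0] at this
  have hO : (fun z => z - z' z) =O[𝓝 z₀] f := Asymptotics.IsBigO.of_bound C (by
    filter_upwards [hz'] with z hz
    rw [← norm_neg]; simpa using hz.2)
  have hlim : Filter.Tendsto z' (𝓝 z₀) (𝓝 z₀) := by
    have := (Filter.tendsto_id (x := 𝓝 z₀)).sub (hO.trans_tendsto hf0)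
    simpa using this
  have hpair : Filter.Tendsto (fun z => (z, z' z)) (𝓝 z₀) (𝓝 (z₀, z₀)) :=
    Filter.tendsto_id.prodMk_nhds hlim
  have e1 : r =O[𝓝 z₀] f := by
    refine ((hr.isBigO_sub.comp_tendsto hpair).trans hO).congr' ?_ Filter.EventuallyEq.rfl
    filter_upwards [hz', hlim.eventually hv] with z hz hvz
    simp [hvz hz.1]
  have hline : HasDerivAt (fun s : ℝ => z₀ + s • v) v 0 := by
    have := ((hasDerivAt_id (0 : ℝ)).smul_const v).const_add z₀
    simpa using this
  have hl0 : Filter.Tendsto (fun s : ℝ => z₀ + s • v) (𝓝 0) (𝓝 z₀) := by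
    have := hline.continuousAt.tendsto; simpa using this
  have hfl : HasDerivAt (fun s : ℝ => f (z₀ + s • v)) 0 0 := by
    have h := HasFDerivAt.comp_hasDerivAt (0 : ℝ) (f := fun s : ℝ => z₀ + s • v) (l := f)
      (l' := f') (by simpa using hf.hasFDerivAt) hline
    rw [hfv] at h; exact h
  have hrl : HasDerivAt (fun s : ℝ => r (z₀ + s • v)) (r' v) 0 :=
    HasFDerivAt.comp_hasDerivAt (0 : ℝ) (f := fun s : ℝ => z₀ + s • v) (l := r)
      (l' := r') (by simpa using hr.hasFDerivAt) hline
  have hfo : (fun s : ℝ => f (z₀ + s • v)) =o[𝓝 0] fun s : ℝ => s := by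
    have := hasDerivAt_iff_isLittleO.1 hfl
    simpa [h0] using this
  have hr0 : r z₀ = 0 := hv.self_of_nhds h0
  have hro : (fun s : ℝ => r (z₀ + s • v)) =o[𝓝 0] fun s : ℝ => s :=
    (e1.comp_tendsto hl0).trans_isLittleO hfo
  have : HasDerivAt (fun s : ℝ => r (z₀ + s • v)) 0 0 := by
    rw [hasDerivAt_iff_isLittleO]
    simpa [hr0] using hro
  exact hrl.unique this

/-- Existence of the linear function in `isLittleO_of_vanishing`. -/
theorem exists_isLittleO_of_vanishing [FiniteDimensional ℝ F] {f : E → F} {f' : E →L[ℝ] F}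
    {r : E → F'} {r' : E →L[ℝ] F'} {z₀ : E}
    (hf : HasStrictFDerivAt f f' z₀) (hsurj : Function.Surjective f') (h0 : f z₀ = 0)
    (hr : HasStrictFDerivAt r r' z₀) (hv : ∀ᶠ z in 𝓝 z₀, f z = 0 → r z = 0) :
    ∃ A : F →L[ℝ] F', (∀ v, r' v = A (f' v)) ∧ (fun z => r z - A (f z)) =o[𝓝 z₀] f := by
  obtain ⟨R, hR⟩ := LinearMap.exists_rightInverse_of_surjective f'.toLinearMap
    (LinearMap.range_eq_top.2 hsurj)
  have hR' : ∀ x, f' (R x) = x := fun x => congrArg (fun L : F →ₗ[ℝ] F => L x) hR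
  let A : F →L[ℝ] F' := r'.comp (LinearMap.toContinuousLinearMap R)
  have hA : ∀ v, r' v = A (f' v) := by
    intro v
    have : r' (v - R (f' v)) = 0 := deriv_eq_zero_of_vanishing hf hsurj h0 hr hv (by
      rw [map_sub, hR', sub_self])
    rw [map_sub, sub_eq_zero] at this
    exact this
  exact ⟨A, hA, isLittleO_of_vanishing hf hsurj h0 hr hv A hA⟩

end Vanishing

/-! ### Local coordinates: the metric, its Hamilton vector field and the horizon -/

/-- The linear form `(a, w) ↦ σ a + η(w)` attached to the point `(σ, (y, η))` of the coordinate
space of `ᵇT*_XM`. -/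
def covZ (E : Type*) [NormedAddCommGroup E] [NormedSpace ℝ E] :
    (ℝ × (E × (E →L[ℝ] ℝ))) →L[ℝ] ((ℝ × E) →L[ℝ] ℝ) :=
  (ContinuousLinearMap.toSpanSingleton ℝ (ContinuousLinearMap.fst ℝ ℝ E)).comp
      (ContinuousLinearMap.fst ℝ ℝ (E × (E →L[ℝ] ℝ)))
    + (ContinuousLinearMap.precomp ℝ (ContinuousLinearMap.snd ℝ ℝ E)).comp
      ((ContinuousLinearMap.snd ℝ E (E →L[ℝ] ℝ)).comp
        (ContinuousLinearMap.snd ℝ ℝ (E × (E →L[ℝ] ℝ))))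

/-- The coordinate expressions of a family of symmetric forms `g` on `ℝ ⊕ TX`, a vector field `V`,
an extension `k` of the surface gravity, and a Riemannian metric `ell`. -/
structure LocalData (E : Type*) [NormedAddCommGroup E] [NormedSpace ℝ E] where
  g : E → (ℝ × E) →L[ℝ] (ℝ × E) →L[ℝ] ℝ
  V : E → E
  k : E → ℝ
  ell : E → E →L[ℝ] E →L[ℝ] ℝ

namespace LocalData

variable {E : Type*} [NormedAddCommGroup E] [NormedSpace ℝ E]

@[simp] theorem covZ_apply (z : ℝ × (E × (E →L[ℝ] ℝ))) (u : ℝ × E) :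
    covZ E z u = z.1 * u.1 + z.2.2 u.2 := by
  simp [covZ]

variable (D : LocalData E)

/-- The vector field `K = τ∂_τ + V`. -/
def K (y : E) : ℝ × E := (1, D.V y)

@[simp] theorem K_fst (y : E) : (D.K y).1 = 1 := rfl

@[simp] theorem K_snd (y : E) : (D.K y).2 = D.V y := rfl

/-- The function `μ = g(K, K)`. -/
def mu (y : E) : ℝ := D.g y (D.K y) (D.K y)

/-- The differential `dμ`. -/
def dm (y : E) : E →L[ℝ] ℝ := fderiv ℝ D.mu y

/-- The b-vector `ζ♯` dual to the b-covector `ζ`. -/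
def Y (z : ℝ × (E × (E →L[ℝ] ℝ))) : ℝ × E := (D.g z.2.1).inverse (covZ E z)

/-- The dual metric function `G(ζ) = g⁻¹(ζ, ζ)`. -/
def G (z : ℝ × (E × (E →L[ℝ] ℝ))) : ℝ := covZ E z (D.Y z)

/-- The function `ζ ↦ ζ(K)`. -/
def nu (z : ℝ × (E × (E →L[ℝ] ℝ))) : ℝ := z.1 + z.2.2 (D.V z.2.1)

/-- The function `ζ ↦ g⁻¹(-dτ/τ, ζ)`. -/
def tm (z : ℝ × (E × (E →L[ℝ] ℝ))) : ℝ := -(D.Y z).1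

/-- The Hamilton vector field of `G`. -/
def ham (z : ℝ × (E × (E →L[ℝ] ℝ))) : ℝ × (E × (E →L[ℝ] ℝ)) :=
  (0, ((2 : ℝ) • (D.Y z).2, ((fderiv ℝ D.g z.2.1).flip (D.Y z)).flip (D.Y z)))

/-- The squared length of `dμ` for the metric dual to `ell`. -/
def mm (y : E) : ℝ := D.dm y ((D.ell y).inverse (D.dm y))

/-- The coefficient of `dμ` in the orthogonal decomposition `η = a dμ + ell(u, ·)`, `dμ(u) = 0`. -/
def co (z : ℝ × (E × (E →L[ℝ] ℝ))) : ℝ :=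
  D.dm z.2.1 ((D.ell z.2.1).inverse z.2.2) / D.mm z.2.1

/-- The vector `u` in the orthogonal decomposition `η = a dμ + ell(u, ·)`, `dμ(u) = 0`. -/
def uu (z : ℝ × (E × (E →L[ℝ] ℝ))) : E :=
  (D.ell z.2.1).inverse (z.2.2 - D.co z • D.dm z.2.1)

/-- The squared length of the restriction of `η` to the kernel of `dμ`. -/
def Q (z : ℝ × (E × (E →L[ℝ] ℝ))) : ℝ := z.2.2 (D.uu z)

/-- The family of symmetric forms is smooth and nondegenerate on the open set `Ω`. -/
structure IsMetricOn (Ω : Set E) : Prop where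
  isOpen : IsOpen Ω
  smooth_g : ContDiffOn ℝ ∞ D.g Ω
  symm : ∀ y ∈ Ω, ∀ u w, D.g y u w = D.g y w u
  invertible : ∀ y ∈ Ω, (D.g y).IsInvertible

/-- The properties of the coordinate data near a point `y₀` of the horizon, which is given on `Ω`
as `{μ = 0}`. -/
structure IsHorizonOn (Ω : Set E) (y₀ : E) : Prop extends D.IsMetricOn Ω where
  mem : y₀ ∈ Ω
  smooth_V : ContDiffOn ℝ ∞ D.V Ω
  smooth_k : ContDiffOn ℝ ∞ D.k Ω
  smooth_ell : ContDiffOn ℝ ∞ D.ell Ω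
  ell_symm : ∀ y ∈ Ω, ∀ u w, D.ell y u w = D.ell y w u
  ell_pos : ∀ y ∈ Ω, ∀ u, u ≠ 0 → 0 < D.ell y u u
  mu_eq_zero : D.mu y₀ = 0
  dm_ne_zero : ∀ y ∈ Ω, D.dm y ≠ 0
  k_ne_zero : ∀ y ∈ Ω, D.k y ≠ 0
  gravity : ∀ y ∈ Ω, D.mu y = 0 → ∀ w, D.dm y w.2 = 2 * D.k y * D.g y (D.K y) w
  quadratic : ∀ y ∈ Ω, D.mu y = 0 → fderiv ℝ (fun y => D.dm y (D.V y)) y = 0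
  constant : fderiv ℝ D.k y₀ (D.V y₀) = 0
  killing : ∀ v, D.dm y₀ v = 0 →
    fderiv ℝ D.ell y₀ (D.V y₀) v v + 2 * D.ell y₀ (fderiv ℝ D.V y₀ v) v = 0

end LocalData

namespace LocalData

variable {E : Type*} [NormedAddCommGroup E] [NormedSpace ℝ E]

theorem isInvertible_of_pos [FiniteDimensional ℝ E] (B : E →L[ℝ] E →L[ℝ] ℝ)
    (hB : ∀ u, u ≠ 0 → 0 < B u u) : B.IsInvertible := by
  have hinj : Function.Injective B := by
    rw [injective_iff_map_eq_zero]
    intro u hu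
    by_contra hne
    have := hB u hne
    rw [hu] at this
    simp at this
  have hfr : Module.finrank ℝ E = Module.finrank ℝ (E →L[ℝ] ℝ) := by
    rw [← (LinearMap.toContinuousLinearMap (𝕜 := ℝ) (E := E) (F' := ℝ)).finrank_eq]
    exact Subspace.dual_finrank_eq.symm
  let e : E ≃ₗ[ℝ] (E →L[ℝ] ℝ) := LinearEquiv.ofInjectiveOfFinrankEq B.toLinearMap hinj hfr
  exact ⟨e.toContinuousLinearEquiv, by ext; rfl⟩

variable {D : LocalData E} {Ω : Set E} {y₀ : E}

/-- A differentiable function which solves `A(z) f(z) = b(z)`, differentiated. -/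
theorem fderiv_clm_eq {E₁ F₁ F₂ : Type*} [NormedAddCommGroup E₁] [NormedSpace ℝ E₁]
    [NormedAddCommGroup F₁] [NormedSpace ℝ F₁] [NormedAddCommGroup F₂] [NormedSpace ℝ F₂]
    {A : E₁ → F₁ →L[ℝ] F₂} {f : E₁ → F₁} {b : E₁ → F₂} {z : E₁}
    (hA : DifferentiableAt ℝ A z) (hf : DifferentiableAt ℝ f z)
    (hb : (fun w => A w (f w)) =ᶠ[𝓝 z] b) (δ : E₁) :
    A z (fderiv ℝ f z δ) + fderiv ℝ A z δ (f z) = fderiv ℝ b z δ := by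
  rw [← hb.fderiv_eq, fderiv_clm_apply hA hf]
  simp

theorem contDiffAt_flip {E₁ F₁ F₂ F₃ : Type*} [NormedAddCommGroup E₁] [NormedSpace ℝ E₁]
    [NormedAddCommGroup F₁] [NormedSpace ℝ F₁] [NormedAddCommGroup F₂] [NormedSpace ℝ F₂]
    [NormedAddCommGroup F₃] [NormedSpace ℝ F₃] {A : E₁ → F₁ →L[ℝ] F₂ →L[ℝ] F₃} {z : E₁}
    (hA : ContDiffAt ℝ ∞ A z) : ContDiffAt ℝ ∞ (fun z => (A z).flip) z :=
  (ContinuousLinearMap.flipₗᵢ ℝ F₁ F₂ F₃).contDiff.contDiffAt.comp z hA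

theorem hasFDerivAt_comp_base {F₁ : Type*} [NormedAddCommGroup F₁] [NormedSpace ℝ F₁] {f : E → F₁}
    {z : ℝ × (E × (E →L[ℝ] ℝ))} (hf : DifferentiableAt ℝ f z.2.1) :
    HasFDerivAt (fun z : ℝ × (E × (E →L[ℝ] ℝ)) => f z.2.1)
      ((fderiv ℝ f z.2.1).comp ((ContinuousLinearMap.fst ℝ E (E →L[ℝ] ℝ)).comp
        (ContinuousLinearMap.snd ℝ ℝ (E × (E →L[ℝ] ℝ))))) z :=
  HasFDerivAt.comp (g := f) (f := fun z : ℝ × (E × (E →L[ℝ] ℝ)) => z.2.1) z hf.hasFDerivAt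
    ((ContinuousLinearMap.fst ℝ E (E →L[ℝ] ℝ)).comp
        (ContinuousLinearMap.snd ℝ ℝ (E × (E →L[ℝ] ℝ)))).hasFDerivAt

theorem hasFDerivAt_fibre (z : ℝ × (E × (E →L[ℝ] ℝ))) :
    HasFDerivAt (fun z : ℝ × (E × (E →L[ℝ] ℝ)) => z.2.2)
      ((ContinuousLinearMap.snd ℝ E (E →L[ℝ] ℝ)).comp
        (ContinuousLinearMap.snd ℝ ℝ (E × (E →L[ℝ] ℝ)))) z :=
  ((ContinuousLinearMap.snd ℝ E (E →L[ℝ] ℝ)).comp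
        (ContinuousLinearMap.snd ℝ ℝ (E × (E →L[ℝ] ℝ)))).hasFDerivAt

namespace IsMetricOn

variable (h : D.IsMetricOn Ω) {y : E} (hy : y ∈ Ω) {z : ℝ × (E × (E →L[ℝ] ℝ))} (hz : z.2.1 ∈ Ω)

include h

theorem preimage_mem_nhds {z : ℝ × (E × (E →L[ℝ] ℝ))} (hz : z.2.1 ∈ Ω) :
    ∀ᶠ w in 𝓝 z, w.2.1 ∈ Ω :=
  (continuous_fst.comp continuous_snd).continuousAt.eventually_mem (h.isOpen.mem_nhds hz)

include hy

theorem contDiffAt_g : ContDiffAt ℝ ∞ D.g y := h.smooth_g.contDiffAt (h.isOpen.mem_nhds hy)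

theorem Y_of_covZ_eq {z : ℝ × (E × (E →L[ℝ] ℝ))} (hz : z.2.1 = y) {w : ℝ × E}
    (hw : covZ E z = D.g y w) : D.Y z = w := by
  subst hz
  change (D.g z.2.1).inverse (covZ E z) = w
  rw [hw, (h.invertible _ hy).inverse_apply_self]

theorem fderiv_g_symm (v : E) (u w : ℝ × E) :
    fderiv ℝ D.g y v u w = fderiv ℝ D.g y v w u := by
  have hg := ((h.contDiffAt_g hy).differentiableAt (by simp)).hasFDerivAt
  have e1 : ∀ u w : ℝ × E, HasFDerivAt (fun y => D.g y u w)
      (((ContinuousLinearMap.apply ℝ ℝ w).comp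
        (ContinuousLinearMap.apply ℝ ((ℝ × E) →L[ℝ] ℝ) u)).comp (fderiv ℝ D.g y)) y :=
    fun u w => ((ContinuousLinearMap.apply ℝ ℝ w).comp
      (ContinuousLinearMap.apply ℝ ((ℝ × E) →L[ℝ] ℝ) u)).hasFDerivAt.comp y hg
  have e2 : (fun y => D.g y u w) =ᶠ[𝓝 y] fun y => D.g y w u := by
    filter_upwards [h.isOpen.mem_nhds hy] with y' hy' using h.symm y' hy' u w
  have := congrArg (fun L : E →L[ℝ] ℝ => L v) (((e1 u w).congr_of_eventuallyEq e2.symm).unique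
    (e1 w u))
  simpa using this

omit hy
include hz

theorem g_Y : D.g z.2.1 (D.Y z) = covZ E z := (h.invertible _ hz).self_apply_inverse _

theorem g_Y_symm (u : ℝ × E) : D.g z.2.1 u (D.Y z) = covZ E z u := by
  rw [h.symm _ hz, h.g_Y hz]

variable [FiniteDimensional ℝ E]

theorem contDiffAt_Y : ContDiffAt ℝ ∞ D.Y z := by
  have hfst : ContDiffAt ℝ ∞ (fun z : ℝ × (E × (E →L[ℝ] ℝ)) => z.2.1) z := by fun_prop
  have hg : ContDiffAt ℝ ∞ (fun z : ℝ × (E × (E →L[ℝ] ℝ)) => D.g z.2.1) z :=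
    (h.contDiffAt_g hz).comp z hfst
  obtain ⟨e, he⟩ := h.invertible _ hz
  have hi : ContDiffAt ℝ ∞ ContinuousLinearMap.inverse (D.g z.2.1) := by
    rw [← he]; exact contDiffAt_map_inverse e
  exact (hi.comp z hg).clm_apply (covZ E).contDiff.contDiffAt

theorem contDiffAt_G : ContDiffAt ℝ ∞ D.G z :=
  (covZ E).contDiff.contDiffAt.clm_apply (h.contDiffAt_Y hz)

theorem contDiffAt_tm : ContDiffAt ℝ ∞ D.tm z :=
  (contDiffAt_fst.comp z (h.contDiffAt_Y hz)).neg

theorem contDiffAt_ham : ContDiffAt ℝ ∞ D.ham z := by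
  have hfst : ContDiffAt ℝ ∞ (fun z : ℝ × (E × (E →L[ℝ] ℝ)) => z.2.1) z := by fun_prop
  have hY := h.contDiffAt_Y hz
  have hg : ContDiffAt ℝ ∞ (fun z : ℝ × (E × (E →L[ℝ] ℝ)) => fderiv ℝ D.g z.2.1) z :=
    ((h.contDiffAt_g hz).fderiv_right (m := ∞) (by simp)).comp z hfst
  refine contDiffAt_const.prodMk (ContDiffAt.prodMk ?_ ?_)
  · exact (contDiffAt_snd.comp z hY).const_smul _
  · exact ContDiffAt.clm_apply (contDiffAt_flip (ContDiffAt.clm_apply (contDiffAt_flip hg) hY)) hY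

theorem g_fderiv_Y (δ : ℝ × (E × (E →L[ℝ] ℝ))) :
    D.g z.2.1 (fderiv ℝ D.Y z δ) = covZ E δ - fderiv ℝ D.g z.2.1 δ.2.1 (D.Y z) := by
  have hgz : DifferentiableAt ℝ D.g z.2.1 := (h.contDiffAt_g hz).differentiableAt (by simp)
  have hd := hasFDerivAt_comp_base hgz
  have key := fderiv_clm_eq (A := fun z : ℝ × (E × (E →L[ℝ] ℝ)) => D.g z.2.1) (f := D.Y)
    (b := fun z => covZ E z) hd.differentiableAt
    ((h.contDiffAt_Y hz).differentiableAt (by simp))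
    (by filter_upwards [h.preimage_mem_nhds hz] with w hw using h.g_Y hw) δ
  rw [hd.fderiv, (covZ E).fderiv] at key
  rw [← key]
  simp

theorem g_Y_fderiv_Y (δ : ℝ × (E × (E →L[ℝ] ℝ))) :
    covZ E z (fderiv ℝ D.Y z δ) =
      covZ E δ (D.Y z) - fderiv ℝ D.g z.2.1 δ.2.1 (D.Y z) (D.Y z) := by
  rw [← h.g_Y hz, h.symm _ hz, h.g_fderiv_Y hz]; simp

theorem fderiv_G (δ : ℝ × (E × (E →L[ℝ] ℝ))) :
    fderiv ℝ D.G z δ = 2 * covZ E δ (D.Y z) - fderiv ℝ D.g z.2.1 δ.2.1 (D.Y z) (D.Y z) := by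
  have := fderiv_clm_apply (𝕜 := ℝ) (c := fun z => covZ E z) (u := D.Y)
    (covZ E).differentiableAt ((h.contDiffAt_Y hz).differentiableAt (by simp))
  have h2 : fderiv ℝ D.G z = _ := this
  rw [h2, (covZ E).fderiv]
  simp only [add_apply, ContinuousLinearMap.comp_apply,
    ContinuousLinearMap.flip_apply]
  rw [h.g_Y_fderiv_Y hz]; ring

/-- `G` is conserved by its Hamilton flow. -/
theorem fderiv_G_ham : fderiv ℝ D.G z (D.ham z) = 0 := by
  rw [h.fderiv_G hz]
  simp [ham]

theorem fderiv_tm (δ : ℝ × (E × (E →L[ℝ] ℝ))) :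
    fderiv ℝ D.tm z δ = -(fderiv ℝ D.Y z δ).1 := by
  have hY := ((h.contDiffAt_Y hz).differentiableAt (n := ∞) (by simp)).hasFDerivAt
  have h1 := (hY.fst).neg
  have h2 : fderiv ℝ D.tm z = _ := h1.fderiv
  rw [h2]; simp

end IsMetricOn

namespace IsHorizonOn

section Basic

variable (h : D.IsHorizonOn Ω y₀) {y : E} (hy : y ∈ Ω) {z : ℝ × (E × (E →L[ℝ] ℝ))}
  (hz : z.2.1 ∈ Ω)

include h

include hy

theorem contDiffAt_V : ContDiffAt ℝ ∞ D.V y := h.smooth_V.contDiffAt (h.isOpen.mem_nhds hy)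

theorem contDiffAt_k : ContDiffAt ℝ ∞ D.k y := h.smooth_k.contDiffAt (h.isOpen.mem_nhds hy)

theorem contDiffAt_ell : ContDiffAt ℝ ∞ D.ell y := h.smooth_ell.contDiffAt (h.isOpen.mem_nhds hy)

theorem contDiffAt_K : ContDiffAt ℝ ∞ D.K y := contDiffAt_const.prodMk (h.contDiffAt_V hy)

theorem contDiffAt_mu : ContDiffAt ℝ ∞ D.mu y :=
  ((h.contDiffAt_g hy).clm_apply (h.contDiffAt_K hy)).clm_apply (h.contDiffAt_K hy)

theorem contDiffAt_dm : ContDiffAt ℝ ∞ D.dm y :=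
  (h.contDiffAt_mu hy).fderiv_right (m := ∞) (by simp)

theorem symm_dm (v w : E) : fderiv ℝ D.dm y v w = fderiv ℝ D.dm y w v :=
  ((h.contDiffAt_mu hy).isSymmSndFDerivAt (by simpa using ENat.LEInfty.out)).eq v w

theorem hasFDerivAt_K : HasFDerivAt D.K ((0 : E →L[ℝ] ℝ).prod (fderiv ℝ D.V y)) y :=
  (hasFDerivAt_const _ _).prodMk ((h.contDiffAt_V hy).differentiableAt (by simp)).hasFDerivAt

theorem dm_apply (v : E) :
    D.dm y v = fderiv ℝ D.g y v (D.K y) (D.K y) + 2 * D.g y (D.K y) (0, fderiv ℝ D.V y v) := by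
  have hg := ((h.contDiffAt_g hy).differentiableAt (by simp)).hasFDerivAt
  have h1 := (hg.clm_apply (h.hasFDerivAt_K hy)).clm_apply (h.hasFDerivAt_K hy)
  have h2 : D.dm y = _ := h1.fderiv
  rw [h2]
  simp only [add_apply, ContinuousLinearMap.comp_apply,
    ContinuousLinearMap.flip_apply, ContinuousLinearMap.prod_apply, zero_apply]
  rw [h.symm y hy (0, _)]
  ring

theorem fderiv_dm_V (v : E) : fderiv ℝ (fun y => D.dm y (D.V y)) y v =
    fderiv ℝ D.dm y v (D.V y) + D.dm y (fderiv ℝ D.V y v) := by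
  rw [fderiv_clm_apply ((h.contDiffAt_dm hy).differentiableAt (by simp))
    ((h.contDiffAt_V hy).differentiableAt (by simp))]
  simp [add_comm]

/-- At points of the horizon, `V` is tangent to it. -/
theorem dm_V (hμ : D.mu y = 0) : D.dm y (D.V y) = 0 := by
  have := h.gravity y hy hμ (D.K y)
  have h2 : D.g y (D.K y) (D.K y) = 0 := hμ
  rw [h2, mul_zero] at this
  exact this

theorem ell_invertible [FiniteDimensional ℝ E] : (D.ell y).IsInvertible :=
  isInvertible_of_pos _ (h.ell_pos y hy)

theorem ell_inverse [FiniteDimensional ℝ E] (η : E →L[ℝ] ℝ) :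
    D.ell y ((D.ell y).inverse η) = η := (h.ell_invertible hy).self_apply_inverse η

theorem mm_pos [FiniteDimensional ℝ E] : 0 < D.mm y := by
  have h1 := h.ell_inverse hy (D.dm y)
  have hne : (D.ell y).inverse (D.dm y) ≠ 0 := by
    intro h0
    rw [h0, map_zero] at h1
    exact h.dm_ne_zero y hy h1.symm
  have h2 := h.ell_pos y hy _ hne
  rwa [h1] at h2

/-- Uniqueness of the decomposition `η = a dμ + ell(u, ·)` with `dμ(u) = 0`. -/
theorem decomposition_unique [FiniteDimensional ℝ E] {η : E →L[ℝ] ℝ} {σ a : ℝ} {v : E}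
    (hv : D.dm y v = 0) (hη : η = D.ell y v + a • D.dm y) :
    D.co (σ, (y, η)) = a ∧ D.uu (σ, (y, η)) = v := by
  have hinv := h.ell_invertible hy
  have hco : D.co (σ, (y, η)) = a := by
    change D.dm y ((D.ell y).inverse η) / D.mm y = a
    rw [div_eq_iff (h.mm_pos hy).ne', hη, map_add, map_smul, hinv.inverse_apply_self, map_add, hv,
      map_smul, smul_eq_mul, zero_add]
    rfl
  refine ⟨hco, ?_⟩
  change (D.ell y).inverse (η - D.co (σ, (y, η)) • D.dm y) = v
  rw [hco, hη, add_sub_cancel_right, hinv.inverse_apply_self]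

omit hy
include hz

theorem ell_uu [FiniteDimensional ℝ E] :
    D.ell z.2.1 (D.uu z) = z.2.2 - D.co z • D.dm z.2.1 := h.ell_inverse hz _

theorem dm_uu [FiniteDimensional ℝ E] : D.dm z.2.1 (D.uu z) = 0 := by
  have hm := (h.mm_pos hz).ne'
  change D.dm z.2.1 ((D.ell z.2.1).inverse (z.2.2 - D.co z • D.dm z.2.1)) = 0
  rw [map_sub, map_smul, map_sub, map_smul, smul_eq_mul]
  change _ - _ / _ * D.mm z.2.1 = 0
  rw [div_mul_cancel₀ _ hm, sub_self]

theorem Q_eq [FiniteDimensional ℝ E] : D.Q z = D.ell z.2.1 (D.uu z) (D.uu z) := by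
  rw [h.ell_uu hz]
  simp [Q, h.dm_uu hz]

variable [FiniteDimensional ℝ E]

omit [FiniteDimensional ℝ E] in
theorem contDiffAt_nu : ContDiffAt ℝ ∞ D.nu z := by
  have hfst : ContDiffAt ℝ ∞ (fun z : ℝ × (E × (E →L[ℝ] ℝ)) => z.2.1) z := by fun_prop
  have hV : ContDiffAt ℝ ∞ (fun z : ℝ × (E × (E →L[ℝ] ℝ)) => D.V z.2.1) z :=
    (h.contDiffAt_V hz).comp z hfst
  exact contDiffAt_fst.add ((contDiffAt_snd.comp z contDiffAt_snd).clm_apply hV)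

omit hz in
theorem contDiffAt_ell_inverse (hy : y ∈ Ω) :
    ContDiffAt ℝ ∞ (fun y => (D.ell y).inverse) y := by
  obtain ⟨e, he⟩ := h.ell_invertible hy
  have hi : ContDiffAt ℝ ∞ ContinuousLinearMap.inverse (D.ell y) := by
    rw [← he]; exact contDiffAt_map_inverse e
  exact hi.comp y (h.contDiffAt_ell hy)

theorem contDiffAt_co : ContDiffAt ℝ ∞ D.co z := by
  have hfst : ContDiffAt ℝ ∞ (fun z : ℝ × (E × (E →L[ℝ] ℝ)) => z.2.1) z := by fun_prop
  have hη : ContDiffAt ℝ ∞ (fun z : ℝ × (E × (E →L[ℝ] ℝ)) => z.2.2) z := by fun_prop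
  have hdm := (h.contDiffAt_dm hz).comp z hfst
  have hinv := (h.contDiffAt_ell_inverse hz).comp z hfst
  exact (hdm.clm_apply (hinv.clm_apply hη)).div (hdm.clm_apply (hinv.clm_apply hdm))
    (h.mm_pos hz).ne'

theorem contDiffAt_uu : ContDiffAt ℝ ∞ D.uu z := by
  have hfst : ContDiffAt ℝ ∞ (fun z : ℝ × (E × (E →L[ℝ] ℝ)) => z.2.1) z := by fun_prop
  have hη : ContDiffAt ℝ ∞ (fun z : ℝ × (E × (E →L[ℝ] ℝ)) => z.2.2) z := by fun_prop
  have hdm := (h.contDiffAt_dm hz).comp z hfst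
  have hinv := (h.contDiffAt_ell_inverse hz).comp z hfst
  exact hinv.clm_apply (hη.sub ((h.contDiffAt_co hz).smul hdm))

theorem contDiffAt_Q : ContDiffAt ℝ ∞ D.Q z := by
  have hη : ContDiffAt ℝ ∞ (fun z : ℝ × (E × (E →L[ℝ] ℝ)) => z.2.2) z := by fun_prop
  exact hη.clm_apply (h.contDiffAt_uu hz)

/-! ### First derivatives along the Hamilton vector field -/

omit [FiniteDimensional ℝ E] in
theorem fderiv_nu (δ : ℝ × (E × (E →L[ℝ] ℝ))) :
    fderiv ℝ D.nu z δ = δ.1 + δ.2.2 (D.V z.2.1) + z.2.2 (fderiv ℝ D.V z.2.1 δ.2.1) := by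
  have hV : DifferentiableAt ℝ D.V z.2.1 := (h.contDiffAt_V hz).differentiableAt (by simp)
  have hd := hasFDerivAt_comp_base hV
  have h2 := hasFDerivAt_fibre z
  have h3 := (hasFDerivAt_fst (𝕜 := ℝ) (p := z)).add (h2.clm_apply hd)
  have h4 : fderiv ℝ D.nu z = _ := h3.fderiv
  rw [h4]
  simp
  ring

/-- The derivative of `ζ(K)` along the Hamilton vector field. -/
def _root_.BHorizon.LocalData.nuDot (D : LocalData E) (z : ℝ × (E × (E →L[ℝ] ℝ))) : ℝ :=
  fderiv ℝ D.g z.2.1 (D.V z.2.1) (D.Y z) (D.Y z)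
    + 2 * z.2.2 (fderiv ℝ D.V z.2.1 (D.Y z).2)

omit [FiniteDimensional ℝ E] in
theorem fderiv_nu_ham : fderiv ℝ D.nu z (D.ham z) = D.nuDot z := by
  rw [h.fderiv_nu hz]
  simp [ham, nuDot]

theorem ell_fderiv_uu (δ : ℝ × (E × (E →L[ℝ] ℝ))) :
    D.ell z.2.1 (fderiv ℝ D.uu z δ) + fderiv ℝ D.ell z.2.1 δ.2.1 (D.uu z) =
      δ.2.2 - fderiv ℝ D.co z δ • D.dm z.2.1 - D.co z • fderiv ℝ D.dm z.2.1 δ.2.1 := by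
  have hell := hasFDerivAt_comp_base ((h.contDiffAt_ell hz).differentiableAt (by simp))
  have hdm := hasFDerivAt_comp_base ((h.contDiffAt_dm hz).differentiableAt (by simp))
  have hco := ((h.contDiffAt_co hz).differentiableAt (n := ∞) (by simp)).hasFDerivAt
  have h2 := hasFDerivAt_fibre z
  have key := fderiv_clm_eq (A := fun z : ℝ × (E × (E →L[ℝ] ℝ)) => D.ell z.2.1) (f := D.uu)
    (b := fun z => z.2.2 - D.co z • D.dm z.2.1) hell.differentiableAt
    ((h.contDiffAt_uu hz).differentiableAt (by simp))
    (by filter_upwards [h.preimage_mem_nhds hz] with w hw using h.ell_uu hw) δ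
  have hb : fderiv ℝ (fun z => z.2.2 - D.co z • D.dm z.2.1) z = _ :=
    (h2.sub (hco.smul hdm)).fderiv
  rw [hell.fderiv, hb] at key
  simp only [ContinuousLinearMap.comp_apply] at key
  change _ + fderiv ℝ D.ell z.2.1 δ.2.1 (D.uu z) = _ at key
  rw [key]
  simp
  abel

theorem dm_fderiv_uu (δ : ℝ × (E × (E →L[ℝ] ℝ))) :
    D.dm z.2.1 (fderiv ℝ D.uu z δ) + fderiv ℝ D.dm z.2.1 δ.2.1 (D.uu z) = 0 := by
  have hdm := hasFDerivAt_comp_base ((h.contDiffAt_dm hz).differentiableAt (by simp))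
  have key := fderiv_clm_eq (A := fun z : ℝ × (E × (E →L[ℝ] ℝ)) => D.dm z.2.1) (f := D.uu)
    (b := fun _ => (0 : ℝ)) hdm.differentiableAt
    ((h.contDiffAt_uu hz).differentiableAt (by simp))
    (by filter_upwards [h.preimage_mem_nhds hz] with w hw using h.dm_uu hw) δ
  rw [hdm.fderiv] at key
  simpa using key

theorem fderiv_Q (δ : ℝ × (E × (E →L[ℝ] ℝ))) :
    fderiv ℝ D.Q z δ = 2 * δ.2.2 (D.uu z) - 2 * D.co z * fderiv ℝ D.dm z.2.1 δ.2.1 (D.uu z)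
      - fderiv ℝ D.ell z.2.1 δ.2.1 (D.uu z) (D.uu z) := by
  have h2 := hasFDerivAt_fibre z
  have hu := ((h.contDiffAt_uu hz).differentiableAt (n := ∞) (by simp)).hasFDerivAt
  have h3 : fderiv ℝ D.Q z = _ := (h2.clm_apply hu).fderiv
  have h4 : fderiv ℝ D.Q z δ = z.2.2 (fderiv ℝ D.uu z δ) + δ.2.2 (D.uu z) := by rw [h3]; simp
  have e1 := congrArg (fun L : E →L[ℝ] ℝ => L (D.uu z)) (h.ell_fderiv_uu hz δ)
  have e2 := congrArg (fun L : E →L[ℝ] ℝ => L (fderiv ℝ D.uu z δ)) (h.ell_uu hz)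
  have e3 := h.dm_fderiv_uu hz δ
  have e4 := h.ell_symm _ hz (D.uu z) (fderiv ℝ D.uu z δ)
  have e5 := h.dm_uu hz
  simp only [add_apply, sub_apply,
    smul_apply, smul_eq_mul] at e1 e2
  rw [e5] at e1
  rw [h4]
  linear_combination (-1 : ℝ) * e2 + D.co z * e3 + e4 + e1

/-- The one-form which governs the derivative of `Q` along the Hamilton vector field. -/
def _root_.BHorizon.LocalData.Xi (D : LocalData E) (z : ℝ × (E × (E →L[ℝ] ℝ))) : E →L[ℝ] ℝ :=
  (2 * D.co z) • fderiv ℝ D.dm z.2.1 (D.Y z).2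
    - ((fderiv ℝ D.g z.2.1).flip (D.Y z)).flip (D.Y z)

theorem fderiv_Q_ham : fderiv ℝ D.Q z (D.ham z) =
    -2 * fderiv ℝ D.ell z.2.1 (D.Y z).2 (D.uu z) (D.uu z) - 2 * D.Xi z (D.uu z) := by
  rw [h.fderiv_Q hz]
  simp [ham, Xi]
  ring

end Basic

end IsHorizonOn

end LocalData

namespace LocalData

variable {E : Type*} [NormedAddCommGroup E] [NormedSpace ℝ E] [FiniteDimensional ℝ E]
  {D : LocalData E} {Ω : Set E} {y₀ : E}

namespace IsHorizonOn

/-! ### The conormal set of the horizon -/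

section Conormal

variable (h : D.IsHorizonOn Ω y₀) {y : E} (hy : y ∈ Ω) (hμ : D.mu y = 0)

include h hy

include hμ

theorem Y_conormal (a : ℝ) :
    D.Y (0, (y, a • D.dm y)) = (2 * D.k y * a) • D.K y := by
  refine h.Y_of_covZ_eq hy rfl ?_
  ext w
  · simp
    have := h.gravity y hy hμ (1, 0)
    simp only [map_zero] at this
    right
    have hk := h.k_ne_zero y hy
    have h2 : (2 * D.k y) ≠ 0 := by simpa using hk
    have h3 : D.g y (D.K y) (1, 0) = 0 := by
      rcases mul_eq_zero.1 this.symm with h4 | h4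
      · exact absurd h4 h2
      · exact h4
    exact h3
  · simp
    have := h.gravity y hy hμ (0, w)
    simp only at this
    rw [this]; ring

theorem co_conormal (σ a : ℝ) : D.co (σ, (y, a • D.dm y)) = a :=
  (h.decomposition_unique hy (η := a • D.dm y) (σ := σ) (a := a) (v := 0) (map_zero _)
    (by simp)).1

theorem uu_conormal (σ a : ℝ) : D.uu (σ, (y, a • D.dm y)) = 0 :=
  (h.decomposition_unique hy (η := a • D.dm y) (σ := σ) (a := a) (v := 0) (map_zero _)
    (by simp)).2

theorem G_conormal (a : ℝ) : D.G (0, (y, a • D.dm y)) = 0 := by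
  change covZ E _ (D.Y _) = 0
  rw [h.Y_conormal hy hμ]
  simp [K, h.dm_V hy hμ]

theorem nu_conormal (a : ℝ) : D.nu (0, (y, a • D.dm y)) = 0 := by
  simp [nu, h.dm_V hy hμ]

theorem nuDot_conormal (a : ℝ) : D.nuDot (0, (y, a • D.dm y)) = 0 := by
  have hY := h.Y_conormal hy hμ a
  have e1 := h.dm_apply hy (D.V y)
  rw [h.dm_V hy hμ] at e1
  have e2 := h.gravity y hy hμ (0, fderiv ℝ D.V y (D.V y))
  simp only at e2
  simp only [nuDot, hY]
  simp only [map_smul, smul_apply, smul_eq_mul, Prod.smul_snd, K_snd]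
  rw [e2]
  linear_combination (-(2 * D.k y * a) ^ 2) * e1

theorem Xi_conormal (σ a : ℝ) {v : E} (hv : D.dm y v = 0) (hY : D.Y (σ, (y, a • D.dm y)) =
    (2 * D.k y * a) • D.K y) :
    D.Xi (σ, (y, a • D.dm y)) v = 0 := by
  have e1 := h.dm_apply hy v
  rw [hv] at e1
  have e2 := h.gravity y hy hμ (0, fderiv ℝ D.V y v)
  have e3 := congrArg (fun L : E →L[ℝ] ℝ => L v) (h.quadratic y hy hμ)
  rw [h.fderiv_dm_V hy] at e3
  have e4 := h.symm_dm hy (D.V y) v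
  simp only [zero_apply] at e2 e3
  simp only [Xi, hY, h.co_conormal hy hμ]
  simp only [map_smul, smul_apply, smul_eq_mul, Prod.smul_snd, sub_apply, K_snd,
    ContinuousLinearMap.flip_apply]
  linear_combination ((2 * D.k y * a) ^ 2) * e1 + 4 * D.k y * a ^ 2 * e4
    + 4 * D.k y * a ^ 2 * e3 - 4 * D.k y * a ^ 2 * e2

/-- The derivative, in directions tangent to the horizon, of the identity `dμ = 2 k g(K, ·)`. -/
theorem fderiv_gravity {v : E} (hv : D.dm y v = 0) (w : ℝ × E) :
    fderiv ℝ D.dm y v w.2 = 2 * fderiv ℝ D.k y v * D.g y (D.K y) w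
      + 2 * D.k y * (fderiv ℝ D.g y v (D.K y) w + D.g y (0, fderiv ℝ D.V y v) w) := by
  let r : E → ℝ := fun y => D.dm y w.2 - 2 * D.k y * D.g y (D.K y) w
  have hg := ((h.contDiffAt_g hy).differentiableAt (by simp)).hasFDerivAt
  have hk := ((h.contDiffAt_k hy).differentiableAt (by simp)).hasFDerivAt
  have hdm := ((h.contDiffAt_dm hy).differentiableAt (by simp)).hasFDerivAt
  have hsm : ContDiffAt ℝ ∞ r y :=
    ((h.contDiffAt_dm hy).clm_apply contDiffAt_const).sub
      ((contDiffAt_const.mul (h.contDiffAt_k hy)).mul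
        (((h.contDiffAt_g hy).clm_apply (h.contDiffAt_K hy)).clm_apply contDiffAt_const))
  have hr : HasFDerivAt r _ y := (hdm.clm_apply (hasFDerivAt_const w.2 y)).sub
    ((hk.const_mul 2).mul ((hg.clm_apply (h.hasFDerivAt_K hy)).clm_apply (hasFDerivAt_const w y)))
  have hsurj : Function.Surjective (D.dm y) := by
    obtain ⟨n, hn⟩ : ∃ n, D.dm y n ≠ 0 := by
      by_contra hcon
      push Not at hcon
      exact h.dm_ne_zero y hy (ContinuousLinearMap.ext hcon)
    intro t
    exact ⟨(t / D.dm y n) • n, by rw [map_smul, smul_eq_mul, div_mul_cancel₀ _ hn]⟩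
  have key := deriv_eq_zero_of_vanishing (f := D.mu) (f' := D.dm y) (r := r)
    ((h.contDiffAt_mu hy).hasStrictFDerivAt (by simp)) hsurj hμ
    (hsm.hasStrictFDerivAt (by simp))
    (by
      filter_upwards [h.isOpen.mem_nhds hy] with y' hy' hμ'
      change D.dm y' w.2 - 2 * D.k y' * D.g y' (D.K y') w = 0
      rw [h.gravity y' hy' hμ' w, sub_self]) hv
  rw [hr.fderiv] at key
  simp at key
  linear_combination key

end Conormal

end IsHorizonOn

end LocalData

namespace LocalData

variable {E : Type*} [NormedAddCommGroup E] [NormedSpace ℝ E] [FiniteDimensional ℝ E]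
  {D : LocalData E} {Ω : Set E} {y₀ : E}

/-- The section `y ↦ c g(K, ·)` of the b-cotangent bundle. Over the horizon it takes values in the
conormal set. -/
def sec (D : LocalData E) (c : ℝ) (y : E) : ℝ × (E × (E →L[ℝ] ℝ)) :=
  (c * D.g y (D.K y) (1, 0), (y, c • (D.g y (D.K y)).comp (ContinuousLinearMap.inr ℝ ℝ E)))

theorem covZ_sec (c : ℝ) (y : E) : covZ E (D.sec c y) = c • D.g y (D.K y) := by
  ext w
  · have : ((0 : ℝ), (0 : E)) = 0 := rfl
    simp [sec, this]
  · simp [sec]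

/-- The derivative in a direction along which the base point is fixed. -/
theorem fderiv_eq_of_line {E₁ F₁ : Type*} [NormedAddCommGroup E₁] [NormedSpace ℝ E₁]
    [NormedAddCommGroup F₁] [NormedSpace ℝ F₁] {f : E₁ → F₁} {z δ : E₁} {b : F₁}
    (hf : DifferentiableAt ℝ f z) (hb : HasDerivAt (fun s : ℝ => f (z + s • δ)) b 0) :
    fderiv ℝ f z δ = b := by
  have hline : HasDerivAt (fun s : ℝ => z + s • δ) δ 0 := by
    simpa using ((hasDerivAt_id (0 : ℝ)).smul_const δ).const_add z
  have h1 : HasDerivAt (fun s : ℝ => f (z + s • δ)) (fderiv ℝ f z δ) 0 :=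
    HasFDerivAt.comp_hasDerivAt (0 : ℝ) (f := fun s : ℝ => z + s • δ) (l := f)
      (by simpa using hf.hasFDerivAt) hline
  exact h1.unique hb

namespace IsHorizonOn

section Section

variable (h : D.IsHorizonOn Ω y₀) {y : E} (hy : y ∈ Ω)

include h hy

theorem Y_sec (c : ℝ) : D.Y (D.sec c y) = c • D.K y :=
  h.Y_of_covZ_eq hy rfl (by rw [covZ_sec, map_smul])

theorem nu_sec (c : ℝ) : D.nu (D.sec c y) = c * D.mu y := by
  have := congrArg (fun L : (ℝ × E) →L[ℝ] ℝ => L (D.K y)) (covZ_sec (D := D) c y)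
  rw [covZ_apply] at this
  change (D.sec c y).1 + (D.sec c y).2.2 (D.V y) = _
  simpa [mu] using this

theorem G_sec (c : ℝ) : D.G (D.sec c y) = c ^ 2 * D.mu y := by
  change covZ E _ (D.Y _) = _
  rw [covZ_sec, h.Y_sec hy]
  simp [mu]; ring

theorem tm_sec (c : ℝ) : D.tm (D.sec c y) = -c := by
  simp [tm, h.Y_sec hy]

theorem nuDot_sec (c : ℝ) : D.nuDot (D.sec c y) = c ^ 2 * D.dm y (D.V y) := by
  rw [h.dm_apply hy, nuDot, h.Y_sec hy]
  simp [sec]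
  ring

theorem contDiffAt_sec (c : ℝ) : ContDiffAt ℝ ∞ (D.sec c) y := by
  have h1 : ContDiffAt ℝ ∞ (fun y => D.g y (D.K y)) y :=
    (h.contDiffAt_g hy).clm_apply (h.contDiffAt_K hy)
  refine (contDiffAt_const.mul (h1.clm_apply contDiffAt_const)).prodMk
    (contDiffAt_id.prodMk (ContDiffAt.const_smul _ ?_))
  exact h1.clm_comp contDiffAt_const

theorem hasFDerivAt_gK : HasFDerivAt (fun y => D.g y (D.K y))
    ((D.g y).comp ((0 : E →L[ℝ] ℝ).prod (fderiv ℝ D.V y)) + (fderiv ℝ D.g y).flip (D.K y)) y :=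
  ((h.contDiffAt_g hy).differentiableAt (by simp)).hasFDerivAt.clm_apply (h.hasFDerivAt_K hy)

theorem covZ_fderiv_sec (c : ℝ) (v : E) (w : ℝ × E) : covZ E (fderiv ℝ (D.sec c) y v) w =
    c * (fderiv ℝ D.g y v (D.K y) w + D.g y (0, fderiv ℝ D.V y v) w) := by
  have h1 : HasFDerivAt (fun y => covZ E (D.sec c y)) ((covZ E).comp (fderiv ℝ (D.sec c) y)) y :=
    (covZ E).hasFDerivAt.comp y
      ((h.contDiffAt_sec hy c).differentiableAt (by simp)).hasFDerivAt
  have h2 : (fun y => covZ E (D.sec c y)) = fun y => c • D.g y (D.K y) :=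
    funext fun y => covZ_sec c y
  rw [h2] at h1
  have h3 := h1.unique ((h.hasFDerivAt_gK hy).const_smul c)
  have := congrArg (fun L : E →L[ℝ] (ℝ × E) →L[ℝ] ℝ => L v w) h3
  simp only [ContinuousLinearMap.comp_apply] at this
  rw [this]
  simp
  ring

theorem fderiv_sec_base (c : ℝ) (v : E) : (fderiv ℝ (D.sec c) y v).2.1 = v := by
  have hd := ((h.contDiffAt_sec hy c).differentiableAt (n := ∞) (by simp)).hasFDerivAt
  have h1 : HasFDerivAt (fun y => (D.sec c y).2.1) _ y := hd.snd.fst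
  have h2 := h1.unique (hasFDerivAt_id y)
  exact congrArg (fun L : E →L[ℝ] E => L v) h2

theorem fderiv_comp_sec {F₁ : Type*} [NormedAddCommGroup F₁] [NormedSpace ℝ F₁] (c : ℝ)
    {f : ℝ × (E × (E →L[ℝ] ℝ)) → F₁}
    (hf : DifferentiableAt ℝ f (D.sec c y)) (v : E) :
    fderiv ℝ f (D.sec c y) (fderiv ℝ (D.sec c) y v) = fderiv ℝ (fun y => f (D.sec c y)) y v := by
  have hd := ((h.contDiffAt_sec hy c).differentiableAt (n := ∞) (by simp)).hasFDerivAt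
  have := hf.hasFDerivAt.comp y hd
  have h2 : fderiv ℝ (fun y => f (D.sec c y)) y = _ := this.fderiv
  rw [h2]; rfl

theorem sec_eq (hμ : D.mu y = 0) (a : ℝ) :
    D.sec (2 * D.k y * a) y = (0, (y, a • D.dm y)) := by
  have e1 := h.gravity y hy hμ (1, 0)
  simp only [map_zero] at e1
  refine Prod.ext ?_ (Prod.ext rfl ?_)
  · simp only [sec]; linear_combination -a * e1
  · ext w
    have e2 := h.gravity y hy hμ (0, w)
    simp [sec]
    simp only at e2
    linear_combination -a * e2

omit hy in
theorem Y_add_fibre {z δ : ℝ × (E × (E →L[ℝ] ℝ))} (hδ : δ.2.1 = 0) (s : ℝ) :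
    D.Y (z + s • δ) = D.Y z + s • (D.g z.2.1).inverse (covZ E δ) := by
  have : (z + s • δ).2.1 = z.2.1 := by simp [hδ]
  simp only [Y, this, map_add, map_smul]

end Section

/-! ### The linearization of the Hamilton flow at the conormal set -/

section Linearization

variable (h : D.IsHorizonOn Ω y₀) (a : ℝ)

include h

theorem exists_normal : ∃ n₀ : E, D.dm y₀ n₀ = 1 := by
  obtain ⟨n, hn⟩ : ∃ n, D.dm y₀ n ≠ 0 := by
    by_contra hcon
    push Not at hcon
    exact h.dm_ne_zero y₀ h.mem (ContinuousLinearMap.ext hcon)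
  exact ⟨(D.dm y₀ n)⁻¹ • n, by rw [map_smul, smul_eq_mul, inv_mul_cancel₀ hn]⟩

theorem sec_zero : D.sec (2 * D.k y₀ * a) y₀ = (0, (y₀, a • D.dm y₀)) :=
  h.sec_eq h.mem h.mu_eq_zero a

theorem contDiffAt_nuDot {z : ℝ × (E × (E →L[ℝ] ℝ))} (hz : z.2.1 ∈ Ω) :
    ContDiffAt ℝ ∞ D.nuDot z := by
  have hfst : ContDiffAt ℝ ∞ (fun z : ℝ × (E × (E →L[ℝ] ℝ)) => z.2.1) z := by fun_prop
  have hη : ContDiffAt ℝ ∞ (fun z : ℝ × (E × (E →L[ℝ] ℝ)) => z.2.2) z := by fun_prop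
  have hY := h.contDiffAt_Y hz
  have hg : ContDiffAt ℝ ∞ (fun z : ℝ × (E × (E →L[ℝ] ℝ)) => fderiv ℝ D.g z.2.1) z :=
    ((h.contDiffAt_g hz).fderiv_right (m := ∞) (by simp)).comp z hfst
  have hV := (h.contDiffAt_V hz).comp z hfst
  have hV' : ContDiffAt ℝ ∞ (fun z : ℝ × (E × (E →L[ℝ] ℝ)) => fderiv ℝ D.V z.2.1) z :=
    ((h.contDiffAt_V hz).fderiv_right (m := ∞) (by simp)).comp z hfst
  exact (((hg.clm_apply hV).clm_apply hY).clm_apply hY).add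
    (contDiffAt_const.mul (hη.clm_apply (hV'.clm_apply (contDiffAt_snd.comp z hY))))

/-- The derivative of `ζ(K)` along the Hamilton vector field vanishes quadratically at the conormal
set. In the base directions this is the quadratic vanishing of `Vμ`, in the fibre directions it
is the invariance of `dμ = 2 k g(K, ·)` under the flow of `V`. -/
theorem fderiv_nuDot (δ : ℝ × (E × (E →L[ℝ] ℝ))) :
    fderiv ℝ D.nuDot (0, (y₀, a • D.dm y₀)) δ = 0 := by
  have hy := h.mem
  have hμ := h.mu_eq_zero
  set z₀ : ℝ × (E × (E →L[ℝ] ℝ)) := (0, (y₀, a • D.dm y₀)) with hz₀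
  set c := 2 * D.k y₀ * a with hc
  have hsec : D.sec c y₀ = z₀ := h.sec_zero a
  have hdiff : DifferentiableAt ℝ D.nuDot z₀ :=
    (h.contDiffAt_nuDot (z := z₀) hy).differentiableAt (by simp)
  -- along the section, the function is `c² Vμ`
  have hbase : fderiv ℝ D.nuDot z₀ (fderiv ℝ (D.sec c) y₀ δ.2.1) = 0 := by
    have e := h.fderiv_comp_sec hy c (f := D.nuDot) (by rw [hsec]; exact hdiff) δ.2.1
    rw [hsec] at e
    have e2 : (fun y => D.nuDot (D.sec c y)) =ᶠ[𝓝 y₀] fun y => c ^ 2 * D.dm y (D.V y) := by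
      filter_upwards [h.isOpen.mem_nhds hy] with y hy using h.nuDot_sec hy c
    have hd : DifferentiableAt ℝ (fun y => D.dm y (D.V y)) y₀ :=
      ((h.contDiffAt_dm hy).clm_apply (h.contDiffAt_V hy)).differentiableAt (by simp)
    rw [e, e2.fderiv_eq, fderiv_const_mul hd, h.quadratic y₀ hy hμ]
    simp
  -- the remaining component is tangent to the fibre
  obtain ⟨ε, hε⟩ : ∃ ε, ε = δ - fderiv ℝ (D.sec c) y₀ δ.2.1 := ⟨_, rfl⟩
  have hε0 : ε.2.1 = 0 := by
    rw [hε]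
    have := h.fderiv_sec_base hy c δ.2.1
    simp [this]
  have hfib : fderiv ℝ D.nuDot z₀ ε = 0 := by
    refine fderiv_eq_of_line hdiff ?_
    set w := (D.g y₀).inverse (covZ E ε) with hw
    have hgw : ∀ u, D.g y₀ w u = covZ E ε u := fun u => by
      rw [hw, (h.invertible _ hy).self_apply_inverse]
    have hYl : ∀ s : ℝ, D.Y (z₀ + s • ε) = c • D.K y₀ + s • w := fun s => by
      rw [h.Y_add_fibre hε0, h.Y_conormal hy hμ]
    have hform : ∀ s : ℝ, D.nuDot (z₀ + s • ε) =
        fderiv ℝ D.g y₀ (D.V y₀) (c • D.K y₀ + s • w) (c • D.K y₀ + s • w)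
          + 2 * ((a • D.dm y₀ + s • ε.2.2) (fderiv ℝ D.V y₀ (c • D.V y₀ + s • w.2))) := by
      intro s
      simp only [nuDot, hYl]
      have : (z₀ + s • ε).2.1 = y₀ := by simp [hε0, hz₀]
      rw [this]
      rfl
    -- the coefficient of `s` in this polynomial of degree two
    have hpoly : ∀ s : ℝ, D.nuDot (z₀ + s • ε) = s * 0 + s ^ 2 *
        (fderiv ℝ D.g y₀ (D.V y₀) w w + 2 * ε.2.2 (fderiv ℝ D.V y₀ w.2)) := by
      intro s
      have e0 := h.nuDot_conormal hy hμ a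
      rw [← hz₀] at e0
      have e0' := hform 0
      simp only [zero_smul, add_zero, e0] at e0'
      have e1 := h.fderiv_gravity hy hμ (h.dm_V hy hμ) w
      rw [h.constant, h.symm _ hy, hgw] at e1
      simp only [← h.symm _ hy w, hgw] at e1
      have e2 := congrArg (fun L : E →L[ℝ] ℝ => L w.2) (h.quadratic y₀ hy hμ)
      rw [h.fderiv_dm_V hy] at e2
      have e3 := h.symm_dm hy (D.V y₀) w.2
      have e4 := h.fderiv_g_symm hy (D.V y₀) w (D.K y₀)
      rw [hform s]
      simp only [map_add, map_smul, add_apply, smul_apply, smul_eq_mul, covZ_apply, zero_apply,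
        hc, mul_zero, zero_mul, zero_add] at e0' e1 e2 e4 ⊢
      linear_combination (-1 : ℝ) * e0' - 2 * a * s * e1 + 2 * a * s * e2 +
        2 * D.k y₀ * a * s * e4 + 2 * a * s * e3
    simp only [hpoly]
    have := ((hasDerivAt_id (0 : ℝ)).mul_const 0).add (((hasDerivAt_id (0 : ℝ)).pow 2).mul_const
      (fderiv ℝ D.g y₀ (D.V y₀) w w + 2 * ε.2.2 (fderiv ℝ D.V y₀ w.2)))
    refine this.congr_deriv ?_
    simp
  have : δ = fderiv ℝ (D.sec c) y₀ δ.2.1 + ε := by rw [hε]; abel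
  rw [this, map_add, hbase, hfib, add_zero]

/-- The rate of change of `g⁻¹(-dτ/τ, ζ)` along the Hamilton flow in the conormal set. At
`c g(K, ·) = a dμ` the vector `H_G` is the image of `2 c V` under the differential of the section
`y ↦ c g(K, ·)`, on which `g⁻¹(-dτ/τ, ·)` is constant, plus the vector `c² dμ` in the fibre. -/
theorem fderiv_tm_ham :
    fderiv ℝ D.tm (0, (y₀, a • D.dm y₀)) (D.ham (0, (y₀, a • D.dm y₀))) =
      -2 * D.k y₀ * (2 * D.k y₀ * a) ^ 2 := by
  have hy := h.mem
  have hμ := h.mu_eq_zero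
  set z₀ : ℝ × (E × (E →L[ℝ] ℝ)) := (0, (y₀, a • D.dm y₀)) with hz₀
  set c := 2 * D.k y₀ * a with hc
  have hk := h.k_ne_zero y₀ hy
  have hsec : D.sec c y₀ = z₀ := h.sec_zero a
  have hY : D.Y z₀ = c • D.K y₀ := h.Y_conormal hy hμ a
  have hdiff : DifferentiableAt ℝ D.tm z₀ :=
    (h.contDiffAt_tm (z := z₀) hy).differentiableAt (by simp)
  have hbase : fderiv ℝ D.tm z₀ (fderiv ℝ (D.sec c) y₀ ((2 * c) • D.V y₀)) = 0 := by
    have e := h.fderiv_comp_sec hy c (f := D.tm) (by rw [hsec]; exact hdiff) ((2 * c) • D.V y₀)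
    rw [hsec] at e
    have e2 : (fun y => D.tm (D.sec c y)) =ᶠ[𝓝 y₀] fun _ => -c := by
      filter_upwards [h.isOpen.mem_nhds hy] with y hy using h.tm_sec hy c
    rw [e, e2.fderiv_eq]
    simp
  have hfib : fderiv ℝ D.tm z₀ (0, (0, c ^ 2 • D.dm y₀)) = -2 * D.k y₀ * c ^ 2 := by
    rw [h.fderiv_tm (z := z₀) hy]
    have e1 : fderiv ℝ D.Y z₀ (0, (0, c ^ 2 • D.dm y₀)) = (2 * D.k y₀ * c ^ 2) • D.K y₀ := by
      have e2 := h.g_fderiv_Y (z := z₀) hy (0, (0, c ^ 2 • D.dm y₀))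
      have e3 : D.g z₀.2.1 ((2 * D.k y₀ * c ^ 2) • D.K y₀) = covZ E (0, (0, c ^ 2 • D.dm y₀)) := by
        ext w
        · have := h.gravity y₀ hy hμ (1, 0)
          simp [hz₀] at this ⊢
          tauto
        · have := h.gravity y₀ hy hμ (0, w)
          simp only at this
          simp [hz₀]
          rw [this]
          ring
      apply (h.invertible _ hy).injective
      change D.g z₀.2.1 _ = D.g z₀.2.1 _
      rw [e2, e3]
      simp
    rw [e1]
    simp
  have hsplit : D.ham z₀ = fderiv ℝ (D.sec c) y₀ ((2 * c) • D.V y₀)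
      + (0, (0, c ^ 2 • D.dm y₀)) := by
    have hb := h.fderiv_sec_base hy c ((2 * c) • D.V y₀)
    have hcov : ∀ w, covZ E (fderiv ℝ (D.sec c) y₀ ((2 * c) • D.V y₀)) w = 2 * c ^ 2 *
        (fderiv ℝ D.g y₀ (D.V y₀) (D.K y₀) w
          + D.g y₀ (0, fderiv ℝ D.V y₀ (D.V y₀)) w) := by
      intro w
      rw [map_smul, map_smul, smul_apply, h.covZ_fderiv_sec hy c, smul_eq_mul]
      ring
    have e1 := h.fderiv_gravity hy hμ (h.dm_V hy hμ)
    have hk2 : 2 * D.k y₀ ≠ 0 := by simpa using hk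
    obtain ⟨S, hS⟩ : ∃ S, S = fderiv ℝ (D.sec c) y₀ ((2 * c) • D.V y₀) := ⟨_, rfl⟩
    rw [← hS] at hb hcov ⊢
    have hσ : S.1 = 0 := by
      have e3 := hcov (1, 0)
      have e4 := e1 (1, 0)
      rw [h.constant] at e4
      simp only [map_zero, covZ_apply, mul_one, add_zero, mul_zero, zero_mul, zero_add] at e3 e4
      have e7 := (mul_eq_zero.1 e4.symm).resolve_left hk2
      rw [e3, e7, mul_zero]
    have hη : ∀ w, S.2.2 w = fderiv ℝ D.g y₀ w (D.Y z₀) (D.Y z₀) - c ^ 2 * D.dm y₀ w := by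
      intro w
      have e3 := hcov (0, w)
      have e4 := e1 (0, w)
      have e5 := h.dm_apply hy w
      have e6 := congrArg (fun L : E →L[ℝ] ℝ => L w) (h.quadratic y₀ hy hμ)
      rw [h.fderiv_dm_V hy] at e6
      have e7 := h.symm_dm hy (D.V y₀) w
      have e8 := h.gravity y₀ hy hμ (0, fderiv ℝ D.V y₀ w)
      rw [h.constant] at e4
      rw [hY]
      simp only [covZ_apply, mul_zero, zero_add, zero_mul, map_smul, smul_apply, smul_eq_mul,
        zero_apply] at e3 e4 e6 e8 ⊢
      rw [e3, e5]
      refine mul_left_cancel₀ hk2 ?_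
      linear_combination (-2 * c ^ 2) * e4 + 2 * c ^ 2 * e7 + 2 * c ^ 2 * e6 - 2 * c ^ 2 * e8
    refine Prod.ext ?_ (Prod.ext ?_ ?_)
    · simp [ham, hσ]
    · simp [ham, hb, hY, smul_smul]
    · ext w
      have : (D.ham z₀).2.2 w = fderiv ℝ D.g y₀ w (D.Y z₀) (D.Y z₀) := rfl
      rw [this]
      simp [hη w]
  rw [hsplit, map_add, hbase, hfib, zero_add]

end Linearization

end IsHorizonOn

end LocalData

/-! ### The conormal set as the zero set of a submersion -/

namespace LocalData

variable {E : Type*} [NormedAddCommGroup E] [NormedSpace ℝ E] [FiniteDimensional ℝ E]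
  {D : LocalData E} {Ω : Set E} {y₀ : E}

/-- The submersion `ζ ↦ (ζ(K), u + G n₀)` whose zero set is the conormal set of the horizon; as
`dμ(u) = 0`, it vanishes precisely where `ζ(K)`, `G` and `u` do. -/
def defn (D : LocalData E) (n₀ : E) (z : ℝ × (E × (E →L[ℝ] ℝ))) : ℝ × E :=
  (D.nu z, D.uu z + D.G z • n₀)

namespace IsHorizonOn

section Submersion

variable (h : D.IsHorizonOn Ω y₀) {a : ℝ} (ha : a ≠ 0) {n₀ : E} (hn : D.dm y₀ n₀ = 1)

include h

theorem contDiffAt_defn (n₀ : E) {z : ℝ × (E × (E →L[ℝ] ℝ))} (hz : z.2.1 ∈ Ω) :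
    ContDiffAt ℝ ∞ (D.defn n₀) z :=
  (h.contDiffAt_nu hz).prodMk ((h.contDiffAt_uu hz).add
    ((h.contDiffAt_G hz).smul contDiffAt_const))

theorem fderiv_defn (n₀ : E) {z : ℝ × (E × (E →L[ℝ] ℝ))} (hz : z.2.1 ∈ Ω)
    (δ : ℝ × (E × (E →L[ℝ] ℝ))) :
    fderiv ℝ (D.defn n₀) z δ =
      (fderiv ℝ D.nu z δ, fderiv ℝ D.uu z δ + fderiv ℝ D.G z δ • n₀) := by
  have h1 := ((h.contDiffAt_nu hz).differentiableAt (n := ∞) (by simp)).hasFDerivAt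
  have h2 := ((h.contDiffAt_uu hz).differentiableAt (n := ∞) (by simp)).hasFDerivAt
  have h3 := ((h.contDiffAt_G hz).differentiableAt (n := ∞) (by simp)).hasFDerivAt
  have h4 : fderiv ℝ (D.defn n₀) z = _ := (h1.prodMk (h2.add (h3.smul_const n₀))).fderiv
  rw [h4]; simp

theorem dm_fderiv_uu_zero (δ : ℝ × (E × (E →L[ℝ] ℝ))) :
    D.dm y₀ (fderiv ℝ D.uu (0, (y₀, a • D.dm y₀)) δ) = 0 := by
  have := h.dm_fderiv_uu (z := (0, (y₀, a • D.dm y₀))) h.mem δ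
  rw [h.uu_conormal h.mem h.mu_eq_zero] at this
  simpa using this

/-- The derivative of the decomposition `η = a dμ + ell(u, ·)` in a fibre direction. -/
theorem fderiv_uu_fibre {v : E} (hv : D.dm y₀ v = 0) (σ : ℝ) :
    fderiv ℝ D.uu (0, (y₀, a • D.dm y₀)) (σ, (0, D.ell y₀ v)) = v := by
  have h1 := h.ell_fderiv_uu (z := (0, (y₀, a • D.dm y₀))) h.mem (σ, (0, D.ell y₀ v))
  have h2 := h.dm_fderiv_uu_zero (a := a) (σ, (0, D.ell y₀ v))
  rw [h.uu_conormal h.mem h.mu_eq_zero] at h1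
  simp only [map_zero, add_zero, smul_zero, sub_zero] at h1
  have h3 := h.decomposition_unique h.mem (η := D.ell y₀ v) (σ := σ) (a := 0) (v := v) hv (by simp)
  have h4 := h.decomposition_unique h.mem (η := D.ell y₀ v) (σ := σ) h2
    (a := fderiv ℝ D.co (0, (y₀, a • D.dm y₀)) (σ, (0, D.ell y₀ v))) (by
      rw [h1]; abel)
  exact h4.2.symm.trans h3.2

theorem fderiv_G_fibre (σ : ℝ) (η : E →L[ℝ] ℝ) :
    fderiv ℝ D.G (0, (y₀, a • D.dm y₀)) (σ, (0, η)) =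
      2 * (2 * D.k y₀ * a) * (σ + η (D.V y₀)) := by
  rw [h.fderiv_G (z := (0, (y₀, a • D.dm y₀))) h.mem, h.Y_conormal h.mem h.mu_eq_zero]
  simp
  ring

theorem fderiv_nu_fibre (σ : ℝ) (η : E →L[ℝ] ℝ) :
    fderiv ℝ D.nu (0, (y₀, a • D.dm y₀)) (σ, (0, η)) = σ + η (D.V y₀) := by
  rw [h.fderiv_nu (z := (0, (y₀, a • D.dm y₀))) h.mem]
  simp

theorem defn_zero (n₀ : E) : D.defn n₀ (0, (y₀, a • D.dm y₀)) = 0 := by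
  simp [defn, h.nu_conormal h.mem h.mu_eq_zero, h.uu_conormal h.mem h.mu_eq_zero,
    h.G_conormal h.mem h.mu_eq_zero]

include ha hn

/-- Along the section `y ↦ c g(K, ·)` one has `ζ(K) = c μ` and `G = c² μ`, whereas in the fibre the
differential of `G` at `c g(K, ·)` is `2 c` times that of `ζ(K)`. The two contributions to
`(ζ(K), G)` are independent, and the fibre directions take care of `u`. -/
theorem surjective_fderiv_defn :
    Function.Surjective (fderiv ℝ (D.defn n₀) (0, (y₀, a • D.dm y₀))) := by
  rintro ⟨α, e⟩
  have hy := h.mem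
  set z₀ : ℝ × (E × (E →L[ℝ] ℝ)) := (0, (y₀, a • D.dm y₀)) with hz₀
  set c := 2 * D.k y₀ * a with hc
  have hsec : D.sec c y₀ = z₀ := h.sec_zero a
  have hc0 : c ≠ 0 := by
    have := h.k_ne_zero y₀ hy
    rw [hc]; positivity
  set γ := D.dm y₀ e with hγ
  -- `b` and `t = α - c b` solve `c b + t = α`, `c² b + 2 c t = γ`
  set b := (2 * c * α - γ) / c ^ 2 with hb
  set S := fderiv ℝ (D.sec c) y₀ (b • n₀) with hS
  have hμd : HasFDerivAt D.mu (D.dm y₀) y₀ :=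
    ((h.contDiffAt_mu hy).differentiableAt (by simp)).hasFDerivAt
  have hνS : fderiv ℝ D.nu z₀ S = c * b := by
    have e1 := h.fderiv_comp_sec hy c (f := D.nu) (by
      rw [hsec]; exact (h.contDiffAt_nu (z := z₀) hy).differentiableAt (by simp)) (b • n₀)
    rw [hsec] at e1
    have e2 : (fun y => D.nu (D.sec c y)) =ᶠ[𝓝 y₀] fun y => c * D.mu y := by
      filter_upwards [h.isOpen.mem_nhds hy] with y hy using h.nu_sec hy c
    rw [hS, e1, e2.fderiv_eq, (hμd.const_mul c).fderiv]
    simp [hn, mul_comm]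
  have hGS : fderiv ℝ D.G z₀ S = c ^ 2 * b := by
    have e1 := h.fderiv_comp_sec hy c (f := D.G) (by
      rw [hsec]; exact (h.contDiffAt_G (z := z₀) hy).differentiableAt (by simp)) (b • n₀)
    rw [hsec] at e1
    have e2 : (fun y => D.G (D.sec c y)) =ᶠ[𝓝 y₀] fun y => c ^ 2 * D.mu y := by
      filter_upwards [h.isOpen.mem_nhds hy] with y hy using h.G_sec hy c
    rw [hS, e1, e2.fderiv_eq, (hμd.const_mul (c ^ 2)).fderiv]
    simp [hn, mul_comm]
  set v := e - γ • n₀ - fderiv ℝ D.uu z₀ S with hv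
  have hv0 : D.dm y₀ v = 0 := by
    rw [hv, map_sub, map_sub, map_smul, hn, h.dm_fderiv_uu_zero, ← hγ]; simp
  refine ⟨S + (α - c * b - D.ell y₀ v (D.V y₀), (0, D.ell y₀ v)), ?_⟩
  rw [h.fderiv_defn n₀ (z := z₀) hy, map_add, map_add, map_add, h.fderiv_uu_fibre hv0,
    h.fderiv_G_fibre, h.fderiv_nu_fibre, hνS, hGS, ← hc]
  refine Prod.ext ?_ ?_
  · simp
  · have : c ^ 2 * b + 2 * c * (α - c * b - D.ell y₀ v (D.V y₀) + D.ell y₀ v (D.V y₀)) = γ := by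
      rw [hb]; field_simp; ring
    simp only [this]
    rw [hv]
    abel

/-- Near `(0, a dμ)`, the zero set of the submersion `defn` is the conormal set of the horizon.
If `u` and `ζ(K)` vanish, then `ζ` is a multiple of `dμ - (Vμ) dτ/τ = 2 k g(K, ·) - θ`, where
`θ = O(μ)`, and `G` is the same multiple squared of `-4 k² μ + o(μ)`, so that `G = 0` forces
`μ = 0`. -/
theorem eventually_conormal : ∀ᶠ z in 𝓝 ((0, (y₀, a • D.dm y₀)) : ℝ × (E × (E →L[ℝ] ℝ))),
    D.uu z = 0 → D.G z = 0 → D.nu z = 0 →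
      z.1 = 0 ∧ D.mu z.2.1 = 0 ∧ z.2.2 = D.co z • D.dm z.2.1 := by
  have hy := h.mem
  -- the form `2 k g(K, ·) - (dμ - (Vμ) dτ/τ)` vanishes on the horizon
  let ζ : E → (ℝ × E) →L[ℝ] ℝ := fun y => covZ E (-D.dm y (D.V y), (y, D.dm y))
  let θ : E → (ℝ × E) →L[ℝ] ℝ := fun y => (2 * D.k y) • D.g y (D.K y) - ζ y
  have hθ : ContDiffAt ℝ ∞ θ y₀ := by
    refine ContDiffAt.sub ((contDiffAt_const.mul (h.contDiffAt_k hy)).smul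
      ((h.contDiffAt_g hy).clm_apply (h.contDiffAt_K hy))) ?_
    exact (covZ E).contDiff.contDiffAt.comp y₀
      ((((h.contDiffAt_dm hy).clm_apply (h.contDiffAt_V hy)).neg).prodMk
        (contDiffAt_id.prodMk (h.contDiffAt_dm hy)))
  have hθ0 : ∀ᶠ y in 𝓝 y₀, D.mu y = 0 → θ y = 0 := by
    filter_upwards [h.isOpen.mem_nhds hy] with y hy hμ
    refine ContinuousLinearMap.ext fun w => ?_
    have := h.gravity y hy hμ w
    change (2 * D.k y) * D.g y (D.K y) w - covZ E (-D.dm y (D.V y), (y, D.dm y)) w = 0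
    rw [← this, h.dm_V hy hμ]
    simp
  have hsurj : Function.Surjective (D.dm y₀) := fun t => ⟨t • n₀, by simp [hn]⟩
  have hO : θ =O[𝓝 y₀] D.mu := by
    obtain ⟨A, -, hA⟩ := exists_isLittleO_of_vanishing (f' := D.dm y₀)
      ((h.contDiffAt_mu hy).hasStrictFDerivAt (by simp)) hsurj h.mu_eq_zero
      (hθ.hasStrictFDerivAt (by simp)) hθ0
    have := hA.isBigO.add (A.isBigO_comp D.mu (𝓝 y₀))
    simpa using this
  have hinv : ContinuousAt (fun y => (D.g y).inverse) y₀ := by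
    obtain ⟨e, he⟩ := h.invertible _ hy
    have hi : ContDiffAt ℝ ∞ ContinuousLinearMap.inverse (D.g y₀) := by
      rw [← he]; exact contDiffAt_map_inverse e
    exact (hi.comp y₀ (h.contDiffAt_g hy)).continuousAt
  have hquad : (fun y => θ y ((D.g y).inverse (θ y))) =o[𝓝 y₀] D.mu := by
    have h0 : Filter.Tendsto (fun y => (D.g y).inverse (θ y)) (𝓝 y₀) (𝓝 0) := by
      have := hinv.clm_apply hθ.continuousAt
      have h1 : θ y₀ = 0 := hθ0.self_of_nhds h.mu_eq_zero
      have h2 := this.tendsto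
      simpa [h1] using h2
    refine Asymptotics.IsBigO.trans_isLittleO (g := fun y => ‖θ y‖ * ‖(D.g y).inverse (θ y)‖)
      (Asymptotics.IsBigO.of_bound 1 (Filter.Eventually.of_forall fun y => ?_)) ?_
    · rw [one_mul]
      refine ((θ y).le_opNorm _).trans (le_of_eq ?_)
      rw [Real.norm_of_nonneg (by positivity)]
    · have h3 : (fun y => ‖(D.g y).inverse (θ y)‖) =o[𝓝 y₀] fun _ => (1 : ℝ) :=
        (Asymptotics.isLittleO_one_iff ℝ).2 (by simpa using h0.norm)
      simpa using hO.norm_left.mul_isLittleO h3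
  have hkpos : 0 < (D.k y₀) ^ 2 := by have := h.k_ne_zero y₀ hy; positivity
  have hk2 : ∀ᶠ y in 𝓝 y₀, (D.k y₀) ^ 2 / 2 < D.k y ^ 2 :=
    (continuousAt_const (y := (D.k y₀) ^ 2 / 2)).eventually_lt
      ((h.contDiffAt_k hy).continuousAt.pow 2) (by linarith)
  have hΓ : ∀ᶠ y in 𝓝 y₀, ζ y ((D.g y).inverse (ζ y)) = 0 → D.mu y = 0 := by
    filter_upwards [hquad.bound (c := (D.k y₀) ^ 2) hkpos, hk2,
      h.isOpen.mem_nhds hy] with y hb hk hy h0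
    have hgi : ∀ φ, D.g y ((D.g y).inverse φ) = φ := (h.invertible y hy).self_apply_inverse
    have hζK : ζ y (D.K y) = 0 := by
      simp [ζ]
    have hζ : ζ y = (2 * D.k y) • D.g y (D.K y) - θ y := by simp [θ]
    have hθK : θ y (D.K y) = 2 * D.k y * D.mu y := by
      simp [θ, hζK, mu]
    have hi : (D.g y).inverse (ζ y) = (2 * D.k y) • D.K y - (D.g y).inverse (θ y) := by
      apply (h.invertible y hy).injective
      rw [hgi, map_sub, hgi, map_smul, ← hζ]
    have hsw : D.g y (D.K y) ((D.g y).inverse (θ y)) = θ y (D.K y) := by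
      rw [h.symm y hy, hgi]
    rw [hi, map_sub, map_smul, hζK, hζ] at h0
    simp only [sub_apply, smul_apply, smul_eq_mul, hsw, hθK] at h0
    have h1 : θ y ((D.g y).inverse (θ y)) = 4 * D.k y ^ 2 * D.mu y := by linear_combination h0
    rw [h1, Real.norm_eq_abs, Real.norm_eq_abs, abs_mul, abs_of_nonneg (by positivity)] at hb
    by_contra hne
    have := abs_pos.2 hne
    nlinarith
  have hπ : Filter.Tendsto (fun z : ℝ × (E × (E →L[ℝ] ℝ)) => z.2.1)
      (𝓝 (0, (y₀, a • D.dm y₀))) (𝓝 y₀) :=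
    (continuous_fst.comp continuous_snd).continuousAt.tendsto
  have hco : ∀ᶠ z in 𝓝 ((0, (y₀, a • D.dm y₀)) : ℝ × (E × (E →L[ℝ] ℝ))), D.co z ≠ 0 := by
    refine (h.contDiffAt_co (z := (0, (y₀, a • D.dm y₀))) hy).continuousAt.eventually_ne ?_
    rwa [h.co_conormal hy h.mu_eq_zero]
  filter_upwards [hπ.eventually hΓ, hco, h.preimage_mem_nhds (z := (0, (y₀, a • D.dm y₀))) hy]
    with z hΓ hco hz hu hG hν
  have hη : z.2.2 = D.co z • D.dm z.2.1 := by
    have := h.ell_uu hz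
    rw [hu, map_zero] at this
    exact (sub_eq_zero.1 this.symm)
  have hσ : z.1 = D.co z * (-D.dm z.2.1 (D.V z.2.1)) := by
    have h1 : z.1 + z.2.2 (D.V z.2.1) = 0 := hν
    rw [hη] at h1
    simp only [smul_apply, smul_eq_mul] at h1
    linear_combination h1
  have hcov : covZ E z = D.co z • ζ z.2.1 := by
    ext w
    · simp [ζ, hσ]
    · simp only [ζ, covZ_apply, smul_apply, smul_eq_mul, ContinuousLinearMap.comp_apply,
        ContinuousLinearMap.inr_apply, mul_zero, zero_add]
      rw [hη]; rfl
  have hμ : D.mu z.2.1 = 0 := by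
    apply hΓ
    have h1 : covZ E z ((D.g z.2.1).inverse (covZ E z)) = 0 := hG
    rw [hcov, map_smul] at h1
    simp only [smul_apply, map_smul, smul_eq_mul] at h1
    have h2 := (mul_eq_zero.1 h1).resolve_left hco
    exact (mul_eq_zero.1 h2).resolve_left hco
  exact ⟨by rw [hσ, h.dm_V hz hμ]; simp, hμ, hη⟩

/-- If `defn` vanishes near `(0, a dμ)`, then so do its constituents. -/
theorem eventually_defn_eq_zero :
    ∀ᶠ z in 𝓝 ((0, (y₀, a • D.dm y₀)) : ℝ × (E × (E →L[ℝ] ℝ))),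
      D.defn n₀ z = 0 → D.uu z = 0 ∧ D.G z = 0 ∧ D.nu z = 0 := by
  have hπ : Filter.Tendsto (fun z : ℝ × (E × (E →L[ℝ] ℝ)) => z.2.1)
      (𝓝 (0, (y₀, a • D.dm y₀))) (𝓝 y₀) :=
    (continuous_fst.comp continuous_snd).continuousAt.tendsto
  have hne : ∀ᶠ y in 𝓝 y₀, D.dm y n₀ ≠ 0 := by
    refine ((h.contDiffAt_dm h.mem).clm_apply
      (contDiffAt_const (c := n₀))).continuousAt.eventually_ne ?_
    rw [hn]; exact one_ne_zero
  filter_upwards [hπ.eventually hne, h.preimage_mem_nhds (z := (0, (y₀, a • D.dm y₀))) h.mem]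
    with z hne hz h0
  have h1 : D.nu z = 0 := congrArg Prod.fst h0
  have h2 : D.uu z + D.G z • n₀ = 0 := congrArg Prod.snd h0
  have h3 := congrArg (D.dm z.2.1) h2
  rw [map_add, h.dm_uu hz, map_smul, map_zero, zero_add, smul_eq_mul] at h3
  have h4 := (mul_eq_zero.1 h3).resolve_right hne
  rw [h4, zero_smul, add_zero] at h2
  exact ⟨h2, h4, h1⟩

/-- A function vanishing on the half of the conormal set which contains `(0, a dμ)` vanishes on the
zero set of `defn` near that point. -/
theorem eventually_defn_vanishing {F' : Type*} [NormedAddCommGroup F']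
    {r : ℝ × (E × (E →L[ℝ] ℝ)) → F'}
    (hr : ∀ y ∈ Ω, D.mu y = 0 → ∀ b : ℝ, 0 < b * a → r (0, (y, b • D.dm y)) = 0) :
    ∀ᶠ z in 𝓝 ((0, (y₀, a • D.dm y₀)) : ℝ × (E × (E →L[ℝ] ℝ))),
      D.defn n₀ z = 0 → r z = 0 := by
  have hco : ∀ᶠ z in 𝓝 ((0, (y₀, a • D.dm y₀)) : ℝ × (E × (E →L[ℝ] ℝ))), 0 < D.co z * a := by
    refine continuousAt_const.eventually_lt
      ((h.contDiffAt_co (z := (0, (y₀, a • D.dm y₀))) h.mem).continuousAt.mul_const a) ?_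
    rw [h.co_conormal h.mem h.mu_eq_zero]
    exact mul_self_pos.2 ha
  filter_upwards [h.eventually_defn_eq_zero ha hn, h.eventually_conormal ha hn, hco,
    h.preimage_mem_nhds (z := (0, (y₀, a • D.dm y₀))) h.mem] with z h1 h2 h3 hz h0
  obtain ⟨e1, e2, e3⟩ := h1 h0
  obtain ⟨f1, f2, f3⟩ := h2 e1 e2 e3
  have : z = (0, (z.2.1, D.co z • D.dm z.2.1)) := Prod.ext f1 (Prod.ext rfl f3)
  rw [this]
  exact hr _ hz f2 _ h3

end Submersion

end IsHorizonOn

end LocalData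

/-! ### Estimates along the Hamilton vector field -/

namespace LocalData

variable {E : Type*} [NormedAddCommGroup E] [NormedSpace ℝ E] [FiniteDimensional ℝ E]
  {D : LocalData E} {Ω : Set E} {y₀ : E}

theorem exists_coercive (B : E →L[ℝ] E →L[ℝ] ℝ) (hB : ∀ u, u ≠ 0 → 0 < B u u) :
    ∃ c : ℝ, 0 < c ∧ ∀ v, c * ‖v‖ ^ 2 ≤ B v v := by
  by_cases hE : (Metric.sphere (0 : E) 1).Nonempty
  · obtain ⟨u, hu, hmin⟩ := (isCompact_sphere (0 : E) 1).exists_isMinOn hE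
      (f := fun v => B v v) (by fun_prop)
    have hu0 : u ≠ 0 := by
      rintro rfl; simp at hu
    refine ⟨B u u, hB u hu0, fun v => ?_⟩
    rcases eq_or_ne v 0 with rfl | hv
    · simp
    have hv' : ‖v‖ ≠ 0 := norm_ne_zero_iff.2 hv
    have h1 : ‖v‖⁻¹ • v ∈ Metric.sphere (0 : E) 1 := by
      simp [norm_smul, hv']
    have h2 : B u u ≤ B (‖v‖⁻¹ • v) (‖v‖⁻¹ • v) := hmin h1
    simp only [map_smul, smul_apply, smul_eq_mul] at h2
    have h3 := mul_le_mul_of_nonneg_right h2 (sq_nonneg ‖v‖)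
    refine h3.trans (le_of_eq ?_)
    field_simp
  · refine ⟨1, one_pos, fun v => ?_⟩
    have hv : v = 0 := by
      by_contra hv
      exact hE ⟨‖v‖⁻¹ • v, by simp [norm_smul, hv]⟩
    simp [hv]

/-- If `T₀` vanishes on the diagonal of the kernel of `l₀`, then `T(u, u)` is small relative to
`‖u‖²` for `T` close to `T₀` and `u` in the kernel of a form `l` close to `l₀`. -/
theorem abs_apply_self_le {T T₀ : E →L[ℝ] E →L[ℝ] ℝ} {l l₀ : E →L[ℝ] ℝ} {n₀ u : E}
    (hT0 : ∀ v, l₀ v = 0 → T₀ v v = 0) (hn : l₀ n₀ = 1) (hu : l u = 0) :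
    |T u u| ≤ (‖T - T₀‖ + ‖l₀ - l‖ * (2 * ‖T₀‖ * ‖n₀‖)
      + ‖l₀ - l‖ ^ 2 * (‖T₀‖ * ‖n₀‖ ^ 2)) * ‖u‖ ^ 2 := by
  set t := l₀ u with ht
  have h1 : |t| ≤ ‖l₀ - l‖ * ‖u‖ := by
    have := (l₀ - l).le_opNorm u
    rw [sub_apply, hu, sub_zero] at this
    exact this
  have h2 := hT0 (u - t • n₀) (by rw [map_sub, map_smul, hn, ← ht]; simp)
  simp only [map_sub, map_smul, sub_apply, smul_apply, smul_eq_mul] at h2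
  have h3 : T u u = (T - T₀) u u + t * (T₀ u n₀ + T₀ n₀ u) - t ^ 2 * T₀ n₀ n₀ := by
    simp only [sub_apply]; linear_combination h2
  have b1 := (T - T₀).le_opNorm₂ u u
  have b2 := T₀.le_opNorm₂ u n₀
  have b3 := T₀.le_opNorm₂ n₀ u
  have b4 := T₀.le_opNorm₂ n₀ n₀
  rw [Real.norm_eq_abs] at b1 b2 b3 b4
  have b5 : |T₀ u n₀ + T₀ n₀ u| ≤ 2 * ‖T₀‖ * ‖n₀‖ * ‖u‖ :=
    (abs_add_le _ _).trans (by linarith)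
  have b6 : |t * (T₀ u n₀ + T₀ n₀ u)| ≤ (‖l₀ - l‖ * ‖u‖) * (2 * ‖T₀‖ * ‖n₀‖ * ‖u‖) := by
    rw [abs_mul]; gcongr
  have b7 : |t ^ 2 * T₀ n₀ n₀| ≤ (‖l₀ - l‖ * ‖u‖) ^ 2 * (‖T₀‖ * ‖n₀‖ * ‖n₀‖) := by
    rw [abs_mul, abs_of_nonneg (sq_nonneg t), ← sq_abs t]; gcongr
  rw [h3]
  calc _ ≤ |(T - T₀) u u| + |t * (T₀ u n₀ + T₀ n₀ u)| + |t ^ 2 * T₀ n₀ n₀| :=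
        (abs_sub _ _).trans (add_le_add (abs_add_le _ _) le_rfl)
    _ ≤ ‖T - T₀‖ * ‖u‖ * ‖u‖ + (‖l₀ - l‖ * ‖u‖) * (2 * ‖T₀‖ * ‖n₀‖ * ‖u‖)
        + (‖l₀ - l‖ * ‖u‖) ^ 2 * (‖T₀‖ * ‖n₀‖ * ‖n₀‖) := add_le_add (add_le_add b1 b6) b7
    _ = _ := by ring

/-- The terms linear in `x` are absorbed in `δ x²` by Young's inequality. -/
theorem absorb_le {δ A x N ν G : ℝ} (hδ : 0 < δ) (hA : 0 ≤ A) (hx : 0 ≤ x) (hN : 0 ≤ N) :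
    2 * (δ / 8 * x ^ 2) + 2 * (A * (|ν| + |G| * N) * x)
      + 2 * (δ / 8 * (x + (|ν| + |G| * N)) * x) ≤
    δ * x ^ 2 + 8 * (A + 1 + δ) ^ 2 / δ * (1 + N ^ 2) * (G ^ 2 + ν ^ 2) := by
  set q := |ν| + |G| * N with hq
  have hq0 : 0 ≤ q := by positivity
  set M := A + 1 + δ with hM
  have hMpos : 0 < M := by positivity
  have b5 : 2 * (δ / 8 * x ^ 2) + 2 * (A * q * x) + 2 * (δ / 8 * (x + q) * x) ≤
      δ / 2 * x ^ 2 + 2 * (M * q) * x := by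
    have h1 : 0 ≤ q * x := by positivity
    have h2 : 0 ≤ δ * (q * x) := by positivity
    rw [hM]
    linarith
  have b6 : 2 * (M * q) * x ≤ δ / 2 * x ^ 2 + 2 / δ * (M * q) ^ 2 := by
    have : 0 ≤ (δ / 2) * (x - 2 / δ * (M * q)) ^ 2 := by positivity
    have e5 : (δ / 2) * (x - 2 / δ * (M * q)) ^ 2 =
        δ / 2 * x ^ 2 - 2 * (M * q) * x + 2 / δ * (M * q) ^ 2 := by
      field_simp
      ring
    linarith
  have b7 : q ^ 2 ≤ 2 * ((1 + N ^ 2) * (G ^ 2 + ν ^ 2)) := by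
    have h1 : q ^ 2 ≤ 2 * (|ν| ^ 2 + (|G| * N) ^ 2) := by
      have := sq_nonneg (|ν| - |G| * N)
      have e : q ^ 2 = |ν| ^ 2 + 2 * (|ν| * (|G| * N)) + (|G| * N) ^ 2 := by rw [hq]; ring
      linarith
    rw [mul_pow, sq_abs, sq_abs] at h1
    have h2 : 0 ≤ N ^ 2 * ν ^ 2 := by positivity
    have h3 := sq_nonneg G
    linarith
  have b8 : 2 / δ * (M * q) ^ 2 ≤ 8 * M ^ 2 / δ * (1 + N ^ 2) * (G ^ 2 + ν ^ 2) := by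
    calc 2 / δ * (M * q) ^ 2 = 2 / δ * M ^ 2 * q ^ 2 := by ring
      _ ≤ 2 / δ * M ^ 2 * (2 * ((1 + N ^ 2) * (G ^ 2 + ν ^ 2))) := by gcongr
      _ = 4 * M ^ 2 / δ * (1 + N ^ 2) * (G ^ 2 + ν ^ 2) := by ring
      _ ≤ _ := by gcongr; norm_num
  linarith

namespace IsHorizonOn

section Estimates

variable (h : D.IsHorizonOn Ω y₀) {a : ℝ} (ha : a ≠ 0)

include h

theorem base_tendsto : Filter.Tendsto (fun z : ℝ × (E × (E →L[ℝ] ℝ)) => z.2.1)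
    (𝓝 (0, (y₀, a • D.dm y₀))) (𝓝 y₀) :=
  (continuous_fst.comp continuous_snd).continuousAt.tendsto

/-- `Q` controls the square of `u`. -/
theorem exists_le_Q : ∃ c : ℝ, 0 < c ∧
    ∀ᶠ z in 𝓝 ((0, (y₀, a • D.dm y₀)) : ℝ × (E × (E →L[ℝ] ℝ))), c * ‖D.uu z‖ ^ 2 ≤ D.Q z := by
  obtain ⟨c, hc, hB⟩ := exists_coercive (D.ell y₀) (h.ell_pos y₀ h.mem)
  refine ⟨c / 2, half_pos hc, ?_⟩
  have h1 : ∀ᶠ y in 𝓝 y₀, ‖D.ell y - D.ell y₀‖ < c / 2 := by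
    have := ((h.contDiffAt_ell h.mem).continuousAt.sub
      (continuousAt_const (y := D.ell y₀))).norm
    refine this.eventually_lt continuousAt_const ?_
    simpa using hc
  filter_upwards [(h.base_tendsto (a := a)).eventually h1,
    h.preimage_mem_nhds (z := (0, (y₀, a • D.dm y₀))) h.mem] with z h1 hz
  rw [h.Q_eq hz]
  have h2 := hB (D.uu z)
  have h3 := (D.ell z.2.1 - D.ell y₀).le_opNorm₂ (D.uu z) (D.uu z)
  have h4 := (abs_le.1 ((Real.norm_eq_abs _).symm.le.trans h3)).1
  simp only [sub_apply] at h4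
  nlinarith [norm_nonneg (D.uu z), sq_nonneg ‖D.uu z‖]

include ha

/-- The derivative of `ζ(K)` along the Hamilton vector field is small relative to `ζ(K)`, `G`
and `u`. -/
theorem eventually_nuDot_le {δ : ℝ} (hδ : 0 < δ) :
    ∀ᶠ z in 𝓝 ((0, (y₀, a • D.dm y₀)) : ℝ × (E × (E →L[ℝ] ℝ))),
      |D.nuDot z| ≤ δ * (|D.nu z| + |D.G z| + ‖D.uu z‖) := by
  obtain ⟨n₀, hn⟩ := h.exists_normal
  have hy := h.mem
  have hA := isLittleO_of_vanishing (f := D.defn n₀) (r := D.nuDot)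
    ((h.contDiffAt_defn n₀ (z := (0, (y₀, a • D.dm y₀))) hy).hasStrictFDerivAt (by simp))
    (h.surjective_fderiv_defn ha hn) (h.defn_zero n₀)
    ((h.contDiffAt_nuDot (z := (0, (y₀, a • D.dm y₀))) hy).hasStrictFDerivAt (by simp))
    (h.eventually_defn_vanishing ha hn fun y hy hμ b _ => h.nuDot_conormal hy hμ b) 0
    (fun v => by simp [h.fderiv_nuDot a v])
  have hpos : 0 < δ / (1 + ‖n₀‖) := by positivity
  filter_upwards [hA.bound hpos] with z hz
  simp only [zero_apply, sub_zero, Real.norm_eq_abs] at hz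
  refine hz.trans ?_
  have h1 : ‖D.defn n₀ z‖ ≤ (1 + ‖n₀‖) * (|D.nu z| + |D.G z| + ‖D.uu z‖) := by
    have e0 := abs_nonneg (D.nu z)
    have e1 := abs_nonneg (D.G z)
    have e2 := norm_nonneg (D.uu z)
    have e3 := norm_nonneg n₀
    refine max_le ?_ ?_
    · rw [Real.norm_eq_abs]
      change |D.nu z| ≤ _
      nlinarith [mul_nonneg e3 (add_nonneg (add_nonneg e0 e1) e2)]
    · refine (norm_add_le _ _).trans ?_
      rw [norm_smul, Real.norm_eq_abs]
      nlinarith [mul_nonneg e3 e0, mul_nonneg e3 e2]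
  calc δ / (1 + ‖n₀‖) * ‖D.defn n₀ z‖
      ≤ δ / (1 + ‖n₀‖) * ((1 + ‖n₀‖) * (|D.nu z| + |D.G z| + ‖D.uu z‖)) := by gcongr
    _ = δ * (|D.nu z| + |D.G z| + ‖D.uu z‖) := by
      rw [← mul_assoc, div_mul_cancel₀ _ (by positivity)]

omit ha in
theorem contDiffAt_Xi {z : ℝ × (E × (E →L[ℝ] ℝ))} (hz : z.2.1 ∈ Ω) : ContDiffAt ℝ ∞ D.Xi z := by
  have hfst : ContDiffAt ℝ ∞ (fun z : ℝ × (E × (E →L[ℝ] ℝ)) => z.2.1) z := by fun_prop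
  have hY := h.contDiffAt_Y hz
  have hg : ContDiffAt ℝ ∞ (fun z : ℝ × (E × (E →L[ℝ] ℝ)) => fderiv ℝ D.g z.2.1) z :=
    ((h.contDiffAt_g hz).fderiv_right (m := ∞) (by simp)).comp z hfst
  have hdm : ContDiffAt ℝ ∞ (fun z : ℝ × (E × (E →L[ℝ] ℝ)) => fderiv ℝ D.dm z.2.1) z :=
    ((h.contDiffAt_dm hz).fderiv_right (m := ∞) (by simp)).comp z hfst
  exact ((contDiffAt_const.mul (h.contDiffAt_co hz)).smul
    (hdm.clm_apply (contDiffAt_snd.comp z hY))).sub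
    (ContDiffAt.clm_apply (contDiffAt_flip (ContDiffAt.clm_apply (contDiffAt_flip hg) hY)) hY)

omit ha in
/-- The linearization of `Xi` at the conormal set in the fibre directions tangent to the level set
of `(ζ(K), G)`. -/
theorem fderiv_Xi_fibre {v w : E} (hv : D.dm y₀ v = 0) (hw : D.dm y₀ w = 0) :
    fderiv ℝ D.Xi (0, (y₀, a • D.dm y₀))
      (-(D.ell y₀ v (D.V y₀)), (0, D.ell y₀ v)) w =
      2 * (2 * D.k y₀ * a) * D.ell y₀ v (fderiv ℝ D.V y₀ w) := by
  have hy := h.mem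
  have hμ := h.mu_eq_zero
  set z₀ : ℝ × (E × (E →L[ℝ] ℝ)) := (0, (y₀, a • D.dm y₀)) with hz₀
  obtain ⟨ε, hε⟩ : ∃ ε : ℝ × (E × (E →L[ℝ] ℝ)), ε = (-(D.ell y₀ v (D.V y₀)), (0, D.ell y₀ v)) :=
    ⟨_, rfl⟩
  have hε0 : ε.2.1 = 0 := by rw [hε]
  have hdiff : DifferentiableAt ℝ D.Xi z₀ :=
    (h.contDiffAt_Xi (z := z₀) hy).differentiableAt (by simp)
  have hdiffw : DifferentiableAt ℝ (fun z => D.Xi z w) z₀ :=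
    hdiff.clm_apply (differentiableAt_const w)
  have happ : fderiv ℝ D.Xi z₀ ε w = fderiv ℝ (fun z => D.Xi z w) z₀ ε := by
    rw [fderiv_clm_apply hdiff (differentiableAt_const w)]; simp
  rw [← hε, happ]
  refine fderiv_eq_of_line hdiffw ?_
  set c := 2 * D.k y₀ * a with hc
  set ψ := (D.g y₀).inverse (covZ E ε) with hψ
  have hgψ : ∀ u, D.g y₀ ψ u = covZ E ε u := fun u => by
    rw [hψ, (h.invertible _ hy).self_apply_inverse]
  have hεK : covZ E ε (D.K y₀) = 0 := by rw [hε]; simp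
  have hYl : ∀ s : ℝ, D.Y (z₀ + s • ε) = c • D.K y₀ + s • ψ := fun s => by
    rw [h.Y_add_fibre hε0, h.Y_conormal hy hμ]
  have hcol : ∀ s : ℝ, D.co (z₀ + s • ε) = a := fun s => by
    have : z₀ + s • ε = (0 + s * -(D.ell y₀ v (D.V y₀)), (y₀, D.ell y₀ (s • v) + a • D.dm y₀)) := by
      rw [hz₀, hε]
      refine Prod.ext rfl (Prod.ext ?_ ?_)
      · simp
      · simp [add_comm]
    rw [this]
    exact (h.decomposition_unique hy (by rw [map_smul, hv, smul_zero]) rfl).1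
  have e0 := h.Xi_conormal hy hμ 0 a hw (h.Y_conormal hy hμ a)
  have e1 := h.fderiv_gravity hy hμ hw ψ
  have e2 := h.fderiv_g_symm hy w ψ (D.K y₀)
  have e3 := h.symm_dm hy w ψ.2
  rw [h.symm _ hy (D.K y₀), h.symm _ hy (0, _), hgψ, hgψ, hεK] at e1
  have e4 : covZ E ε (0, fderiv ℝ D.V y₀ w) = D.ell y₀ v (fderiv ℝ D.V y₀ w) := by
    rw [hε]; simp
  rw [e4] at e1
  have hform : ∀ s : ℝ, D.Xi (z₀ + s • ε) w =
      2 * a * fderiv ℝ D.dm y₀ (c • D.V y₀ + s • ψ.2) w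
        - fderiv ℝ D.g y₀ w (c • D.K y₀ + s • ψ) (c • D.K y₀ + s • ψ) := by
    intro s
    have : (z₀ + s • ε).2.1 = y₀ := by simp [hε0, hz₀]
    simp only [Xi, hYl, hcol, this]
    rfl
  have e0' := hform 0
  simp only [zero_smul, add_zero] at e0'
  rw [hz₀, e0] at e0'
  have hpoly : ∀ s : ℝ, D.Xi (z₀ + s • ε) w =
      s * (2 * c * D.ell y₀ v (fderiv ℝ D.V y₀ w)) + s ^ 2 * (-fderiv ℝ D.g y₀ w ψ ψ) := by
    intro s
    rw [hform s]
    simp only [map_add, map_smul, add_apply, smul_apply, smul_eq_mul, hc, mul_zero,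
      zero_add] at e0' e1 ⊢
    linear_combination (-1 : ℝ) * e0' + 2 * a * s * e1 - 2 * a * s * e3
      - 2 * D.k y₀ * a * s * e2
  simp only [hpoly]
  have := ((hasDerivAt_id (0 : ℝ)).mul_const (2 * c * D.ell y₀ v (fderiv ℝ D.V y₀ w))).add
    (((hasDerivAt_id (0 : ℝ)).pow 2).mul_const (-fderiv ℝ D.g y₀ w ψ ψ))
  refine this.congr_deriv ?_
  simp

set_option maxHeartbeats 1000000 in
/-- The derivative of `Q` along the Hamilton vector field is small relative to `Q`, up to multiples
of `G²` and `ζ(K)²`. The quadratic form in `u` which is left over at the conormal set is the Lie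
derivative of `ell` along `V`, which vanishes as `V` is Killing on the horizon. -/
theorem exists_QDot_le {δ : ℝ} (hδ : 0 < δ) : ∃ B : ℝ, 0 ≤ B ∧
    ∀ᶠ z in 𝓝 ((0, (y₀, a • D.dm y₀)) : ℝ × (E × (E →L[ℝ] ℝ))),
      |fderiv ℝ D.Q z (D.ham z)| ≤ δ * ‖D.uu z‖ ^ 2 + B * (D.G z ^ 2 + D.nu z ^ 2) := by
  obtain ⟨n₀, hn⟩ := h.exists_normal
  have hy := h.mem
  have hμ := h.mu_eq_zero
  set z₀ : ℝ × (E × (E →L[ℝ] ℝ)) := (0, (y₀, a • D.dm y₀)) with hz₀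
  set c := 2 * D.k y₀ * a with hc
  -- the restriction of `Xi` to the kernel of `dμ`, extended by `0` to `n₀`
  let r : ℝ × (E × (E →L[ℝ] ℝ)) → E →L[ℝ] ℝ := fun z =>
    D.Xi z - (D.Xi z n₀ / D.dm z.2.1 n₀) • D.dm z.2.1
  have hdmz : ContDiffAt ℝ ∞ (fun z : ℝ × (E × (E →L[ℝ] ℝ)) => D.dm z.2.1) z₀ := by
    have hfst : ContDiffAt ℝ ∞ (fun z : ℝ × (E × (E →L[ℝ] ℝ)) => z.2.1) z₀ := by fun_prop
    exact (h.contDiffAt_dm (y := z₀.2.1) hy).comp z₀ hfst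
  have hXi := h.contDiffAt_Xi (z := z₀) hy
  have hr : ContDiffAt ℝ ∞ r z₀ :=
    hXi.sub (((hXi.clm_apply contDiffAt_const).div (hdmz.clm_apply contDiffAt_const)
      (by simp [hz₀, hn])).smul hdmz)
  have hdm_ne : ∀ᶠ z in 𝓝 z₀, D.dm z.2.1 n₀ ≠ 0 :=
    (hdmz.clm_apply (contDiffAt_const (c := n₀))).continuousAt.eventually_ne (by simp [hz₀, hn])
  have hr0 : ∀ᶠ z in 𝓝 z₀, D.defn n₀ z = 0 → r z = 0 := by
    have hX : ∀ᶠ z in 𝓝 z₀, D.defn n₀ z = 0 → ∀ v, D.dm z.2.1 v = 0 → D.Xi z v = 0 := by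
      classical
      have hco : ∀ᶠ z in 𝓝 z₀, D.defn n₀ z = 0 →
          (if ∀ v, D.dm z.2.1 v = 0 → D.Xi z v = 0 then (0 : ℝ) else 1) = 0 :=
        h.eventually_defn_vanishing ha hn fun y hy hμ b _ => by
          rw [if_pos]
          intro v hv
          exact h.Xi_conormal hy hμ 0 b hv (h.Y_conormal hy hμ b)
      filter_upwards [hco] with z hz h0
      by_contra hcon
      have := hz h0
      rw [if_neg hcon] at this
      exact one_ne_zero this
    filter_upwards [hX, hdm_ne] with z hX hne h0
    refine ContinuousLinearMap.ext fun w => ?_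
    have h1 := hX h0 (w - (D.dm z.2.1 w / D.dm z.2.1 n₀) • n₀) (by
      rw [map_sub, map_smul, smul_eq_mul, div_mul_cancel₀ _ hne, sub_self])
    rw [map_sub, map_smul, smul_eq_mul] at h1
    change D.Xi z w - (D.Xi z n₀ / D.dm z.2.1 n₀) * D.dm z.2.1 w = 0
    rw [← h1]; ring
  -- `Xi` on `ker dμ` is a linear function of `(ζ(K), u + G n₀)` up to a small error
  obtain ⟨A, hA, hAo⟩ := exists_isLittleO_of_vanishing
    ((h.contDiffAt_defn n₀ (z := z₀) hy).hasStrictFDerivAt (by simp))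
    (h.surjective_fderiv_defn ha hn) (h.defn_zero n₀) (hr.hasStrictFDerivAt (by simp)) hr0
  -- the value of `A` on `0 ⊕ ker dμ`
  have hA0 : ∀ v w, D.dm y₀ v = 0 → D.dm y₀ w = 0 →
      A (0, v) w = 2 * c * D.ell y₀ v (fderiv ℝ D.V y₀ w) := by
    intro v w hv hw
    set ε : ℝ × (E × (E →L[ℝ] ℝ)) := (-(D.ell y₀ v (D.V y₀)), (0, D.ell y₀ v)) with hε
    have h1 : fderiv ℝ (D.defn n₀) z₀ ε = (0, v) := by
      rw [h.fderiv_defn n₀ (z := z₀) hy, hε, h.fderiv_nu_fibre, h.fderiv_uu_fibre hv,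
        h.fderiv_G_fibre]
      simp
    have h2 := hA ε
    rw [h1] at h2
    rw [← h2, ← h.fderiv_Xi_fibre hv hw]
    have hrd : DifferentiableAt ℝ r z₀ := hr.differentiableAt (by simp)
    have hXd : DifferentiableAt ℝ D.Xi z₀ := hXi.differentiableAt (by simp)
    have e1 : fderiv ℝ r z₀ ε w = fderiv ℝ (fun z => r z w) z₀ ε := by
      rw [fderiv_clm_apply hrd (differentiableAt_const w)]; simp
    have e2 : fderiv ℝ D.Xi z₀ ε w = fderiv ℝ (fun z => D.Xi z w) z₀ ε := by
      rw [fderiv_clm_apply hXd (differentiableAt_const w)]; simp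
    rw [e1, e2]
    refine fderiv_eq_of_line (hrd.clm_apply (differentiableAt_const w)) ?_
    have e3 : (fun s : ℝ => r (z₀ + s • ε) w) = fun s : ℝ => D.Xi (z₀ + s • ε) w := by
      funext s
      have : (z₀ + s • ε).2.1 = y₀ := by simp [hε, hz₀]
      change D.Xi _ w - (_ / _) * D.dm (z₀ + s • ε).2.1 w = _
      rw [this, hw, mul_zero, sub_zero]
    rw [e3]
    have hline : HasDerivAt (fun s : ℝ => z₀ + s • ε) ε 0 := by
      simpa using ((hasDerivAt_id (0 : ℝ)).smul_const ε).const_add z₀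
    exact HasFDerivAt.comp_hasDerivAt (0 : ℝ) (f := fun s : ℝ => z₀ + s • ε)
      (l := fun z => D.Xi z w)
      (by simpa using (hXd.clm_apply (differentiableAt_const w)).hasFDerivAt) hline
  -- the quadratic form in `u`
  let T : ℝ × (E × (E →L[ℝ] ℝ)) → E →L[ℝ] E →L[ℝ] ℝ := fun z =>
    fderiv ℝ D.ell z.2.1 (D.Y z).2 + A.comp (ContinuousLinearMap.inr ℝ ℝ E)
  have hT : ContinuousAt T z₀ := by
    have hfst : ContDiffAt ℝ ∞ (fun z : ℝ × (E × (E →L[ℝ] ℝ)) => z.2.1) z₀ := by fun_prop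
    have hell : ContDiffAt ℝ ∞ (fun z : ℝ × (E × (E →L[ℝ] ℝ)) => fderiv ℝ D.ell z.2.1) z₀ :=
      ((h.contDiffAt_ell (y := z₀.2.1) hy).fderiv_right (m := ∞) (by simp)).comp z₀ hfst
    exact ((hell.clm_apply (contDiffAt_snd.comp z₀ (h.contDiffAt_Y (z := z₀) hy))).add
      contDiffAt_const).continuousAt
  have hT0 : ∀ v, D.dm y₀ v = 0 → T z₀ v v = 0 := by
    intro v hv
    have h1 := h.killing v hv
    have h2 := hA0 v v hv hv
    rw [h.ell_symm _ hy] at h1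
    change fderiv ℝ D.ell y₀ (D.Y z₀).2 v v + A (0, v) v = 0
    rw [h2, h.Y_conormal hy hμ]
    simp only [Prod.smul_snd, K_snd, map_smul, smul_apply, smul_eq_mul]
    linear_combination c * h1
  let e : ℝ × (E × (E →L[ℝ] ℝ)) → ℝ := fun z => ‖T z - T z₀‖
    + ‖D.dm y₀ - D.dm z.2.1‖ * (2 * ‖T z₀‖ * ‖n₀‖)
    + ‖D.dm y₀ - D.dm z.2.1‖ ^ 2 * (‖T z₀‖ * ‖n₀‖ ^ 2)
  have he : ∀ᶠ z in 𝓝 z₀, e z < δ / 8 := by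
    have h1 : ContinuousAt e z₀ := by
      have h2 : ContinuousAt (fun z => ‖T z - T z₀‖) z₀ := (hT.sub continuousAt_const).norm
      have h3 : ContinuousAt (fun z : ℝ × (E × (E →L[ℝ] ℝ)) => ‖D.dm y₀ - D.dm z.2.1‖) z₀ :=
        (continuousAt_const.sub hdmz.continuousAt).norm
      exact (h2.add (h3.mul continuousAt_const)).add ((h3.pow 2).mul continuousAt_const)
    refine h1.eventually_lt continuousAt_const ?_
    simp [e, hz₀]
    positivity
  have hTu : ∀ z, D.dm z.2.1 (D.uu z) = 0 → |T z (D.uu z) (D.uu z)| ≤ e z * ‖D.uu z‖ ^ 2 := by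
    intro z hz
    exact abs_apply_self_le hT0 hn hz
  set N := ‖n₀‖ with hN
  set M := ‖A‖ + 1 + δ with hM
  have hMpos : 0 < M := by positivity
  refine ⟨8 * M ^ 2 / δ * (1 + N ^ 2), by positivity, ?_⟩
  have hδ8 : 0 < δ / 8 := by positivity
  filter_upwards [he, hAo.bound hδ8, h.preimage_mem_nhds (z := z₀) hy] with z he hb hz
  have hdmu := h.dm_uu hz
  have hTz := hTu z hdmu
  rw [h.fderiv_Q_ham hz]
  set u := D.uu z with hu
  have e1 : D.Xi z u = r z u := by
    change _ = D.Xi z u - _ * D.dm z.2.1 u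
    rw [hdmu, mul_zero, sub_zero]
  have e2 : D.defn n₀ z = (0, u) + (D.nu z, D.G z • n₀) := by
    simp [defn, hu]
  set q := |D.nu z| + |D.G z| * N with hq
  have hq0 : 0 ≤ q := by positivity
  have hf : ‖D.defn n₀ z‖ ≤ ‖u‖ + q := by
    rw [e2]
    refine (norm_add_le _ _).trans (add_le_add ?_ ?_)
    · simp [Prod.norm_def]
    · refine max_le ?_ ?_
      · rw [Real.norm_eq_abs]
        have : 0 ≤ |D.G z| * N := by positivity
        simp only [hq]; linarith
      · rw [norm_smul, Real.norm_eq_abs]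
        simp [hq, hN]
  have e3 : -2 * fderiv ℝ D.ell z.2.1 (D.Y z).2 u u - 2 * D.Xi z u =
      -2 * T z u u - 2 * A (D.nu z, D.G z • n₀) u - 2 * (r z - A (D.defn n₀ z)) u := by
    have e4 : T z u u = fderiv ℝ D.ell z.2.1 (D.Y z).2 u u + A (0, u) u := rfl
    rw [e1, e4, e2, map_add]
    simp only [sub_apply, add_apply]
    ring
  rw [e3]
  have b1 : |A (D.nu z, D.G z • n₀) u| ≤ ‖A‖ * q * ‖u‖ := by
    refine (A.le_opNorm₂ _ _).trans ?_
    gcongr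
    refine max_le ?_ ?_
    · rw [Real.norm_eq_abs]
      have : 0 ≤ |D.G z| * N := by positivity
      simp only [hq]; linarith
    · rw [norm_smul, Real.norm_eq_abs]
      simp [hq, hN]
  have b2 : |(r z - A (D.defn n₀ z)) u| ≤ δ / 8 * (‖u‖ + q) * ‖u‖ := by
    refine ((r z - A (D.defn n₀ z)).le_opNorm u).trans ?_
    gcongr
    exact hb.trans (by gcongr)
  have b3 : |T z u u| ≤ δ / 8 * ‖u‖ ^ 2 := hTz.trans (by gcongr)
  have b4 : |-2 * T z u u - 2 * A (D.nu z, D.G z • n₀) u - 2 * (r z - A (D.defn n₀ z)) u| ≤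
      2 * (δ / 8 * ‖u‖ ^ 2) + 2 * (‖A‖ * q * ‖u‖) + 2 * (δ / 8 * (‖u‖ + q) * ‖u‖) := by
    rw [abs_le] at b1 b2 b3 ⊢
    constructor <;> linarith [b1.1, b1.2, b2.1, b2.2, b3.1, b3.2]
  exact b4.trans (absorb_le hδ (norm_nonneg _) (norm_nonneg _) (norm_nonneg _))

end Estimates

end IsHorizonOn

end LocalData

/-! ### The quadratic defining function in local coordinates -/

/-- The Hessian of `B(u, u)` at a zero of `u`. -/
theorem iteratedFDeriv_two_quadratic {E F : Type*} [NormedAddCommGroup E] [NormedSpace ℝ E]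
    [NormedAddCommGroup F] [NormedSpace ℝ F] {B : E → F →L[ℝ] F →L[ℝ] ℝ} {u : E → F} {z₀ : E}
    (hB : ContDiffAt ℝ ∞ B z₀) (hu : ContDiffAt ℝ ∞ u z₀) (h0 : u z₀ = 0) (v : E) :
    iteratedFDeriv ℝ 2 (fun z => B z (u z) (u z)) z₀ ![v, v] =
      2 * B z₀ (fderiv ℝ u z₀ v) (fderiv ℝ u z₀ v) := by
  have hev : ∀ᶠ z in 𝓝 z₀, DifferentiableAt ℝ B z ∧ DifferentiableAt ℝ u z := by
    filter_upwards [(hB.of_le (m := 1) (by simp)).eventually (by simp),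
      (hu.of_le (m := 1) (by simp)).eventually (by simp)] with z h1 h2
    exact ⟨h1.differentiableAt (by simp), h2.differentiableAt (by simp)⟩
  let l : E → F →L[ℝ] ℝ := fun z => B z (fderiv ℝ u z v) + (B z).flip (fderiv ℝ u z v)
    + (fderiv ℝ B z v).flip (u z)
  have hfu : DifferentiableAt ℝ (fun z => fderiv ℝ u z v) z₀ :=
    ((hu.fderiv_right (m := ∞) (by simp)).differentiableAt (by simp)).clm_apply
      (differentiableAt_const v)
  have hfB : ContDiffAt ℝ ∞ (fun z => fderiv ℝ B z v) z₀ :=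
    (hB.fderiv_right (m := ∞) (by simp)).clm_apply contDiffAt_const
  have hBd := hB.differentiableAt (n := ∞) (by simp)
  have hud := hu.differentiableAt (n := ∞) (by simp)
  have hl : DifferentiableAt ℝ l z₀ :=
    ((hBd.clm_apply hfu).add (((LocalData.contDiffAt_flip hB).differentiableAt (by simp)).clm_apply hfu)).add
      (((LocalData.contDiffAt_flip hfB).differentiableAt (by simp)).clm_apply hud)
  have h1 : (fun z => fderiv ℝ (fun z => B z (u z) (u z)) z v) =ᶠ[𝓝 z₀] fun z => l z (u z) := by
    filter_upwards [hev] with z hz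
    have h2 := ((hz.1.hasFDerivAt.clm_apply hz.2.hasFDerivAt).clm_apply hz.2.hasFDerivAt).fderiv
    rw [h2]
    simp [l]
    ring
  have hsm : ContDiffAt ℝ ∞ (fun z => B z (u z) (u z)) z₀ := (hB.clm_apply hu).clm_apply hu
  have hd : DifferentiableAt ℝ (fderiv ℝ (fun z => B z (u z) (u z))) z₀ :=
    (hsm.fderiv_right (m := ∞) (by simp)).differentiableAt (by simp)
  have h3 : fderiv ℝ (fun z => fderiv ℝ (fun z => B z (u z) (u z)) z v) z₀ v =
      fderiv ℝ (fderiv ℝ (fun z => B z (u z) (u z))) z₀ v v := by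
    rw [fderiv_clm_apply hd (differentiableAt_const v)]; simp
  rw [iteratedFDeriv_two_apply]
  simp only [Matrix.cons_val_zero, Matrix.cons_val_one]
  rw [← h3, h1.fderiv_eq, fderiv_clm_apply hl hud]
  simp [h0, l]
  ring

/-- The arithmetic behind the growth estimate: the error terms are absorbed by the
quadratic form `C (g² + v²) + q`. -/
theorem abs_error_le {δ B C r G ν Q N Q' : ℝ} (hδ : 0 < δ) (hC : 0 < C)
    (hBC : 4 * B ≤ δ * C) (hr1 : 1 / 2 ≤ r) (hr2 : r ≤ 2) (hQ : 0 ≤ Q)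
    (hN : |N| ≤ δ / (16 * (1 + C)) * (|ν| + |G| + Real.sqrt Q))
    (hQ' : |Q'| ≤ δ / 4 * Q + B * (G ^ 2 + ν ^ 2)) (hB : 0 ≤ B) :
    |2 * C * (r * ν) * (r ^ 2 * N) + r ^ 3 * Q'| ≤
      δ * (C * ((r ^ 2 * G) ^ 2 + (r * ν) ^ 2) + r ^ 2 * Q) := by
  have hr0 : 0 < r := by linarith
  set w := Real.sqrt Q with hw
  have hw0 : 0 ≤ w := Real.sqrt_nonneg _
  have hwQ : w ^ 2 = Q := Real.sq_sqrt hQ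
  set d := δ / (16 * (1 + C)) with hd
  have hd0 : 0 < d := by positivity
  have hdC : d * (16 * (1 + C)) = δ := div_mul_cancel₀ _ (by positivity)
  -- in terms of the rescaled quantities
  set g := r ^ 2 * |G| with hg
  set v := r * |ν| with hv
  set q := r * w with hq
  have hg0 : 0 ≤ g := by positivity
  have hv0 : 0 ≤ v := by positivity
  have hq0 : 0 ≤ q := by positivity
  have e1 : (r ^ 2 * G) ^ 2 = g ^ 2 := by rw [hg, mul_pow, mul_pow, sq_abs]
  have e2 : (r * ν) ^ 2 = v ^ 2 := by rw [hv, mul_pow, mul_pow, sq_abs]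
  have e3 : r ^ 2 * Q = q ^ 2 := by rw [hq, mul_pow, hwQ]
  have b1 : |r ^ 2 * N| ≤ d * (2 * v + g + 2 * q) := by
    rw [abs_mul, abs_of_nonneg (sq_nonneg r)]
    calc r ^ 2 * |N| ≤ r ^ 2 * (d * (|ν| + |G| + w)) := by gcongr
      _ = d * (r * v + g + r * q) := by rw [hv, hg, hq]; ring
      _ ≤ d * (2 * v + g + 2 * q) := by gcongr
  have b2 : |2 * C * (r * ν) * (r ^ 2 * N)| ≤ 2 * C * v * (d * (2 * v + g + 2 * q)) := by
    rw [abs_mul, abs_mul, abs_mul, abs_mul, abs_of_pos hr0, abs_of_pos hC, abs_two]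
    gcongr
  have b3 : 2 * C * v * (d * (2 * v + g + 2 * q)) ≤ δ / 2 * (C * (g ^ 2 + v ^ 2) + q ^ 2) := by
    have h1 : v * (2 * v + g + 2 * q) ≤ 4 * v ^ 2 + g ^ 2 + q ^ 2 := by
      linarith [sq_nonneg (v - q), sq_nonneg (v - g), sq_nonneg g, sq_nonneg v]
    have h2 : 2 * C * v * (d * (2 * v + g + 2 * q)) ≤ 2 * C * d * (4 * v ^ 2 + g ^ 2 + q ^ 2) := by
      calc _ = 2 * C * d * (v * (2 * v + g + 2 * q)) := by ring
        _ ≤ _ := by gcongr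
    have h3 : 2 * C * d * (4 * v ^ 2 + g ^ 2 + q ^ 2) ≤
        δ / 2 * (C * (g ^ 2 + v ^ 2) + q ^ 2) := by
      rw [← hdC]
      have p1 : 0 ≤ d * C * v ^ 2 := by positivity
      have p2 : 0 ≤ d * C * g ^ 2 := by positivity
      have p3 : 0 ≤ d * C * q ^ 2 := by positivity
      have p4 : 0 ≤ d * C ^ 2 * v ^ 2 := by positivity
      have p5 : 0 ≤ d * C ^ 2 * g ^ 2 := by positivity
      have p6 : 0 ≤ d * q ^ 2 := by positivity
      linarith
    exact h2.trans h3
  have b4 : |r ^ 3 * Q'| ≤ δ / 2 * (C * (g ^ 2 + v ^ 2) + q ^ 2) := by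
    rw [abs_mul, abs_of_pos (by positivity : 0 < r ^ 3)]
    have h1 : r ^ 3 * G ^ 2 ≤ 2 * g ^ 2 := by
      rw [← e1, mul_pow]
      have : r ^ 3 ≤ 2 * (r ^ 2) ^ 2 := by
        have : 0 ≤ r ^ 3 * (2 * r - 1) := mul_nonneg (by positivity) (by linarith)
        linarith
      linarith [mul_le_mul_of_nonneg_right this (sq_nonneg G)]
    have h2 : r ^ 3 * ν ^ 2 ≤ 2 * v ^ 2 := by
      rw [← e2, mul_pow]
      have : r ^ 3 ≤ 2 * r ^ 2 := by
        have : 0 ≤ r ^ 2 * (2 - r) := mul_nonneg (by positivity) (by linarith)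
        linarith
      linarith [mul_le_mul_of_nonneg_right this (sq_nonneg ν)]
    have h3 : r ^ 3 * Q ≤ 2 * q ^ 2 := by
      rw [← e3]
      have : r ^ 3 ≤ 2 * r ^ 2 := by
        have : 0 ≤ r ^ 2 * (2 - r) := mul_nonneg (by positivity) (by linarith)
        linarith
      linarith [mul_le_mul_of_nonneg_right this hQ]
    calc r ^ 3 * |Q'| ≤ r ^ 3 * (δ / 4 * Q + B * (G ^ 2 + ν ^ 2)) := by gcongr
      _ = δ / 4 * (r ^ 3 * Q) + B * (r ^ 3 * G ^ 2 + r ^ 3 * ν ^ 2) := by ring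
      _ ≤ δ / 4 * (2 * q ^ 2) + B * (2 * g ^ 2 + 2 * v ^ 2) := by gcongr
      _ = δ / 2 * q ^ 2 + (4 * B) / 2 * (g ^ 2 + v ^ 2) := by ring
      _ ≤ δ / 2 * q ^ 2 + (δ * C) / 2 * (g ^ 2 + v ^ 2) := by gcongr
      _ = _ := by ring
  rw [e1, e2, e3]
  calc _ ≤ |2 * C * (r * ν) * (r ^ 2 * N)| + |r ^ 3 * Q'| := abs_add_le _ _
    _ ≤ _ := by linarith

namespace LocalData

variable {E : Type*} [NormedAddCommGroup E] [NormedSpace ℝ E] [FiniteDimensional ℝ E]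
  {D : LocalData E} {Ω : Set E} {y₀ : E}

/-- The function `ρ̂ = |2 g⁻¹(-dτ/τ, ·)|⁻¹`. -/
def rh (D : LocalData E) (z : ℝ × (E × (E →L[ℝ] ℝ))) : ℝ := |2 * D.tm z|⁻¹

/-- The quadratic defining function `C ((ρ̂² G)² + (ρ̂ ζ(K))²) + ρ̂² Q`. -/
def rho (D : LocalData E) (C : ℝ) (z : ℝ × (E × (E →L[ℝ] ℝ))) : ℝ :=
  C * ((D.rh z ^ 2 * D.G z) ^ 2 + (D.rh z * D.nu z) ^ 2) + D.rh z ^ 2 * D.Q z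

theorem rh_pos {z : ℝ × (E × (E →L[ℝ] ℝ))} (ht : D.tm z ≠ 0) : 0 < D.rh z := by
  unfold rh; positivity

theorem IsMetricOn.contDiffAt_rh (h : D.IsMetricOn Ω) {z : ℝ × (E × (E →L[ℝ] ℝ))}
    (hz : z.2.1 ∈ Ω) (ht : D.tm z ≠ 0) : ContDiffAt ℝ ∞ D.rh z :=
  ContDiffAt.inv (f := fun z => |2 * D.tm z|)
    (ContDiffAt.comp (g := fun t : ℝ => |t|) z (contDiffAt_abs (mul_ne_zero two_ne_zero ht))
      (contDiffAt_const.mul (h.contDiffAt_tm hz))) (abs_ne_zero.2 (mul_ne_zero two_ne_zero ht))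

namespace IsHorizonOn

section Rho

variable (h : D.IsHorizonOn Ω y₀)

include h

theorem Q_nonneg {z : ℝ × (E × (E →L[ℝ] ℝ))} (hz : z.2.1 ∈ Ω) : 0 ≤ D.Q z := by
  rw [h.Q_eq hz]
  rcases eq_or_ne (D.uu z) 0 with h0 | h0
  · simp [h0]
  · exact (h.ell_pos _ hz _ h0).le

theorem rho_nonneg {C : ℝ} (hC : 0 < C) {z : ℝ × (E × (E →L[ℝ] ℝ))} (hz : z.2.1 ∈ Ω) :
    0 ≤ D.rho C z := by
  have := h.Q_nonneg hz
  unfold rho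
  positivity

theorem contDiffAt_rho (C : ℝ) {z : ℝ × (E × (E →L[ℝ] ℝ))} (hz : z.2.1 ∈ Ω) (ht : D.tm z ≠ 0) :
    ContDiffAt ℝ ∞ (D.rho C) z := by
  have h1 := h.contDiffAt_rh hz ht
  exact (contDiffAt_const.mul ((((h1.pow 2).mul (h.contDiffAt_G hz)).pow 2).add
    ((h1.mul (h.contDiffAt_nu hz)).pow 2))).add ((h1.pow 2).mul (h.contDiffAt_Q hz))

theorem fderiv_rho_ham (C : ℝ) {z : ℝ × (E × (E →L[ℝ] ℝ))} (hz : z.2.1 ∈ Ω) (ht : D.tm z ≠ 0) :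
    fderiv ℝ (D.rho C) z (D.rh z • D.ham z) =
      2 * fderiv ℝ D.rh z (D.ham z) * (D.rho C z + C * (D.rh z ^ 2 * D.G z) ^ 2)
      + (2 * C * (D.rh z * D.nu z) * (D.rh z ^ 2 * D.nuDot z)
        + D.rh z ^ 3 * fderiv ℝ D.Q z (D.ham z)) := by
  have h1 := ((h.contDiffAt_rh hz ht).differentiableAt (n := ∞) (by simp)).hasFDerivAt
  have h2 := ((h.contDiffAt_G hz).differentiableAt (n := ∞) (by simp)).hasFDerivAt
  have h3 := ((h.contDiffAt_nu hz).differentiableAt (n := ∞) (by simp)).hasFDerivAt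
  have h4 := ((h.contDiffAt_Q hz).differentiableAt (n := ∞) (by simp)).hasFDerivAt
  have h5 := ((((h1.pow 2).mul h2).pow 2).add ((h1.mul h3).pow 2)).const_mul C |>.add
    ((h1.pow 2).mul h4)
  have h6 : fderiv ℝ (D.rho C) z = _ := h5.fderiv
  have e1 := h.fderiv_G_ham hz
  have e2 := h.fderiv_nu_ham hz
  rw [h6, map_smul]
  simp only [add_apply, smul_apply, smul_eq_mul, e1, e2, rho]
  simp
  ring

theorem tm_conormal {y : E} (hy : y ∈ Ω) (hμ : D.mu y = 0) (a : ℝ) :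
    D.tm (0, (y, a • D.dm y)) = -(2 * D.k y * a) := by
  simp [tm, h.Y_conormal hy hμ]

theorem rho_conormal (C : ℝ) {y : E} (hy : y ∈ Ω) (hμ : D.mu y = 0) (a : ℝ) :
    D.rho C (0, (y, a • D.dm y)) = 0 := by
  simp [rho, h.G_conormal hy hμ, h.nu_conormal hy hμ, Q, h.uu_conormal hy hμ]

variable {a : ℝ} (ha : a ≠ 0)

include ha

theorem tm_ne_zero : D.tm (0, (y₀, a • D.dm y₀)) ≠ 0 := by
  rw [h.tm_conormal h.mem h.mu_eq_zero]
  exact neg_ne_zero.2 (mul_ne_zero (mul_ne_zero two_ne_zero (h.k_ne_zero _ h.mem)) ha)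

/-- At the conormal set, `H_G ρ̂` is the surface gravity, up to the sign of the time function. -/
theorem fderiv_rh_ham {s : ℝ} (hs : s = 1 ∨ s = -1) (hst : 0 < s * D.tm (0, (y₀, a • D.dm y₀))) :
    fderiv ℝ D.rh (0, (y₀, a • D.dm y₀)) (D.ham (0, (y₀, a • D.dm y₀))) = s * D.k y₀ := by
  have hy := h.mem
  have hd := fderiv_tm_ham h a
  have ht := h.tm_conormal h.mem h.mu_eq_zero a
  set z₀ : ℝ × (E × (E →L[ℝ] ℝ)) := (0, (y₀, a • D.dm y₀)) with hz₀
  have hne : D.tm z₀ ≠ 0 := h.tm_ne_zero ha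
  have h1 := ((h.contDiffAt_tm (z := z₀) hy).differentiableAt (n := ∞) (by simp)).hasFDerivAt
  have hs2 : s * s = 1 := by rcases hs with rfl | rfl <;> norm_num
  have hev : D.rh =ᶠ[𝓝 z₀] fun z => (2 * s * D.tm z)⁻¹ := by
    filter_upwards [continuousAt_const.eventually_lt
      (continuousAt_const.mul (h.contDiffAt_tm (z := z₀) hy).continuousAt) hst] with z hz
    have : |2 * D.tm z| = 2 * s * D.tm z := by
      rw [abs_mul, abs_two, mul_assoc]
      congr 1
      rcases hs with rfl | rfl
      · rw [one_mul, abs_of_pos (by simpa using hz)]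
      · rw [neg_one_mul, abs_of_neg (by simpa using hz)]
    rw [rh, this]
  have hs0 : s ≠ 0 := by rintro rfl; simp at hs2
  have h2 : HasFDerivAt (fun z => (2 * s * D.tm z)⁻¹)
      ((-((2 * s * D.tm z₀) ^ 2)⁻¹) • ((2 * s) • fderiv ℝ D.tm z₀)) z₀ :=
    HasDerivAt.comp_hasFDerivAt z₀ (hasDerivAt_inv (mul_ne_zero (mul_ne_zero two_ne_zero hs0) hne))
      (h1.const_mul (2 * s))
  rw [hev.fderiv_eq, h2.fderiv]
  simp only [smul_apply, smul_eq_mul]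
  rw [hd]
  have e1 : (2 * D.k y₀ * a) ^ 2 = D.tm z₀ ^ 2 := by rw [ht]; ring
  rw [e1, mul_pow, mul_pow, pow_two s, hs2]
  field_simp

/-- The exponential growth or decay of the quadratic defining function along the rescaled Hamilton
flow. With `b = H_G ρ̂`, the weights `ρ̂², ρ̂, ρ̂` of `G`, `ζ(K)`, `√Q` contribute `2 b ρ` and a
further `2 b C (ρ̂² G)²`, which has the same sign; the terms with the derivatives of `ζ(K)` and `Q`
are errors. -/
theorem eventually_rho_ham {s e δ δ' B C : ℝ} (hs : s = 1 ∨ s = -1)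
    (hst : 0 < s * D.tm (0, (y₀, a • D.dm y₀))) (hrh : D.rh (0, (y₀, a • D.dm y₀)) = 1)
    (he : e = 1 ∨ e = -1) (hek : 0 < e * (s * D.k y₀)) (hδ' : 0 < δ') (hδ : δ' ≤ δ * |D.k y₀|)
    (hB : 0 ≤ B) (hC : 0 < C) (hBC : 4 * B ≤ δ' * C)
    (hQ : ∀ᶠ z in 𝓝 ((0, (y₀, a • D.dm y₀)) : ℝ × (E × (E →L[ℝ] ℝ))),
      |fderiv ℝ D.Q z (D.ham z)| ≤ δ' / 4 * D.Q z + B * (D.G z ^ 2 + D.nu z ^ 2)) :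
    ∀ᶠ z in 𝓝 ((0, (y₀, a • D.dm y₀)) : ℝ × (E × (E →L[ℝ] ℝ))),
      |D.k y₀| / 2 ≤ |fderiv ℝ D.rh z (D.ham z)| ∧
      2 * (1 - δ) * |fderiv ℝ D.rh z (D.ham z)| * D.rho C z ≤
        e * fderiv ℝ (D.rho C) z (D.rh z • D.ham z) ∧
      |fderiv ℝ (D.rho C) z (D.rh z • D.ham z)| ≤ (8 * |D.k y₀| + δ') * D.rho C z := by
  have hy := h.mem
  have hb := h.fderiv_rh_ham ha hs hst
  have hk := h.k_ne_zero _ h.mem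
  have hne := h.tm_ne_zero ha
  obtain ⟨c, hc, hcQ⟩ := h.exists_le_Q (a := a)
  have hN := h.eventually_nuDot_le ha
    -- the factor `(1 + C)⁻¹` compensates the weight `C` of `ζ(K)²` in `ρ`
    (δ := δ' / (16 * (1 + C)) * min 1 (Real.sqrt c)) (by positivity)
  set z₀ : ℝ × (E × (E →L[ℝ] ℝ)) := (0, (y₀, a • D.dm y₀)) with hz₀
  have hrc := h.contDiffAt_rh (z := z₀) hy hne
  have hbc : ContinuousAt (fun z => fderiv ℝ D.rh z (D.ham z)) z₀ :=
    ((hrc.fderiv_right (m := ∞) (by simp)).clm_apply (h.contDiffAt_ham (z := z₀) hy)).continuousAt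
  have hebc : ContinuousAt (fun z => e * fderiv ℝ D.rh z (D.ham z)) z₀ :=
    continuousAt_const.mul hbc
  have he1 : |e| = 1 := by rcases he with rfl | rfl <;> simp
  have hebk : e * (s * D.k y₀) = |D.k y₀| := by
    have : |e * (s * D.k y₀)| = |D.k y₀| := by
      rcases hs with rfl | rfl <;> rcases he with rfl | rfl <;> simp
    rwa [abs_of_pos hek] at this
  have hkpos : 0 < |D.k y₀| := abs_pos.2 hk
  have hb1 : ∀ᶠ z in 𝓝 z₀, |D.k y₀| / 2 < e * fderiv ℝ D.rh z (D.ham z) := by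
    refine continuousAt_const.eventually_lt hebc ?_
    rw [hb, hebk]; linarith
  have hb2 : ∀ᶠ z in 𝓝 z₀, e * fderiv ℝ D.rh z (D.ham z) < 2 * |D.k y₀| := by
    refine hebc.eventually_lt continuousAt_const ?_
    rw [hb, hebk]; linarith
  have hr1 : ∀ᶠ z in 𝓝 z₀, 1 / 2 < D.rh z :=
    continuousAt_const.eventually_lt hrc.continuousAt (by rw [hrh]; norm_num)
  have hr2 : ∀ᶠ z in 𝓝 z₀, D.rh z < 2 :=
    hrc.continuousAt.eventually_lt continuousAt_const (by rw [hrh]; norm_num)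
  filter_upwards [h.preimage_mem_nhds (z := z₀) hy, hQ, hN, hcQ, hb1, hb2, hr1, hr2,
    (h.contDiffAt_tm (z := z₀) hy).continuousAt.eventually_ne hne]
    with z hz hQ hN hcQ hb1 hb2 hr1 hr2 ht
  have hQ0 := h.Q_nonneg hz
  have hρ := h.rho_nonneg hC hz
  have hu : Real.sqrt c * ‖D.uu z‖ ≤ Real.sqrt (D.Q z) := by
    rw [← Real.sqrt_sq (norm_nonneg (D.uu z)), ← Real.sqrt_mul hc.le]
    exact Real.sqrt_le_sqrt hcQ
  have hN' : |D.nuDot z| ≤ δ' / (16 * (1 + C)) * (|D.nu z| + |D.G z| + Real.sqrt (D.Q z)) := by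
    refine hN.trans ?_
    rw [mul_assoc]
    gcongr
    have m1 := min_le_left 1 (Real.sqrt c)
    have m2 := min_le_right 1 (Real.sqrt c)
    have p1 := abs_nonneg (D.nu z)
    have p2 := abs_nonneg (D.G z)
    have p3 := norm_nonneg (D.uu z)
    linarith [mul_le_mul_of_nonneg_right m1 p1, mul_le_mul_of_nonneg_right m1 p2,
      mul_le_mul_of_nonneg_right m2 p3]
  have herr := abs_error_le hδ' hC hBC hr1.le hr2.le hQ0 hN' hQ hB
  have hf := h.fderiv_rho_ham C hz ht
  set R := 2 * C * (D.rh z * D.nu z) * (D.rh z ^ 2 * D.nuDot z)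
    + D.rh z ^ 3 * fderiv ℝ D.Q z (D.ham z) with hR
  change |R| ≤ δ' * D.rho C z at herr
  set b := fderiv ℝ D.rh z (D.ham z) with hb'
  set f := C * (D.rh z ^ 2 * D.G z) ^ 2 with hf'
  have hf0 : 0 ≤ f := by positivity
  have hfρ : f ≤ D.rho C z := by
    have : 0 ≤ C * (D.rh z * D.nu z) ^ 2 + D.rh z ^ 2 * D.Q z := by positivity
    rw [rho]; linarith
  have heb : e * b = |b| := by
    have h1 : |e * b| = |b| := by rw [abs_mul, he1, one_mul]
    rwa [abs_of_pos (by linarith : 0 < e * b)] at h1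
  have heR : |e * R| = |R| := by rw [abs_mul, he1, one_mul]
  rw [hf]
  have e0 : e * (2 * b * (D.rho C z + f) + R) = 2 * |b| * (D.rho C z + f) + e * R := by
    rw [← heb]; ring
  have eabs : |2 * b * (D.rho C z + f) + R| = |e * (2 * b * (D.rho C z + f) + R)| := by
    rw [abs_mul, he1, one_mul]
  rw [heb] at hb1 hb2
  have l1 := (abs_le.1 (heR.le.trans herr))
  refine ⟨hb1.le, ?_, ?_⟩
  · rw [e0]
    have l2 : δ' * D.rho C z ≤ 2 * δ * |b| * D.rho C z := by
      gcongr
      have hδ0 : 0 < δ := by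
        by_contra hneg
        exact absurd (hδ'.trans_le hδ)
          (not_lt.2 (mul_nonpos_of_nonpos_of_nonneg (not_lt.1 hneg) hkpos.le))
      calc δ' ≤ δ * |D.k y₀| := hδ
        _ ≤ δ * (2 * |b|) := by gcongr; linarith
        _ = 2 * δ * |b| := by ring
    have l3 : 0 ≤ |b| * f := by positivity
    linarith [l1.1]
  · rw [eabs, e0]
    refine (abs_add_le _ _).trans ?_
    rw [heR, abs_of_nonneg (by positivity)]
    have l4 : 2 * |b| * (D.rho C z + f) ≤ 2 * (2 * |D.k y₀|) * (D.rho C z + D.rho C z) := by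
      gcongr
    linarith

/-- Near the conormal set, the quadratic defining function vanishes only on it. -/
theorem eventually_rho_eq_zero {C : ℝ} (hC : 0 < C) :
    ∀ᶠ z in 𝓝 ((0, (y₀, a • D.dm y₀)) : ℝ × (E × (E →L[ℝ] ℝ))),
      D.rho C z = 0 → z.1 = 0 ∧ D.mu z.2.1 = 0 ∧ z.2.2 = D.co z • D.dm z.2.1 := by
  obtain ⟨n₀, hn⟩ := h.exists_normal
  filter_upwards [h.eventually_conormal ha hn,
    h.preimage_mem_nhds (z := (0, (y₀, a • D.dm y₀))) h.mem,
    (h.contDiffAt_tm (z := (0, (y₀, a • D.dm y₀))) h.mem).continuousAt.eventually_ne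
      (h.tm_ne_zero ha)] with z h1 hz ht h0
  have hr := (rh_pos ht).ne'
  have hQ := h.Q_nonneg hz
  have p1 : 0 ≤ C * (D.rh z ^ 2 * D.G z) ^ 2 := by positivity
  have p2 : 0 ≤ C * (D.rh z * D.nu z) ^ 2 := by positivity
  have p3 : 0 ≤ D.rh z ^ 2 * D.Q z := by positivity
  rw [rho] at h0
  have q1 : C * (D.rh z ^ 2 * D.G z) ^ 2 = 0 := by linarith
  have q2 : C * (D.rh z * D.nu z) ^ 2 = 0 := by linarith
  have q3 : D.rh z ^ 2 * D.Q z = 0 := by linarith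
  have hG : D.G z = 0 := by simpa [hC.ne', hr] using q1
  have hν : D.nu z = 0 := by simpa [hC.ne', hr] using q2
  have hQ0 : D.Q z = 0 := by simpa [hr] using q3
  refine h1 ?_ hG hν
  by_contra hu
  have := h.ell_pos _ hz _ hu
  rw [← h.Q_eq hz, hQ0] at this
  exact lt_irrefl _ this

/-- The differential at `(0, a dμ)` of a function vanishing on the conormal set annihilates the
kernel of the differential of `defn`. -/
theorem fderiv_eq_zero_of_vanishing {n₀ : E} (hn : D.dm y₀ n₀ = 1)
    {r : ℝ × (E × (E →L[ℝ] ℝ)) → ℝ}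
    (hrd : ContDiffAt ℝ ∞ r (0, (y₀, a • D.dm y₀)))
    (hr : ∀ y ∈ Ω, D.mu y = 0 → ∀ b : ℝ, 0 < b * a → r (0, (y, b • D.dm y)) = 0)
    {v : ℝ × (E × (E →L[ℝ] ℝ))} (hv : fderiv ℝ (D.defn n₀) (0, (y₀, a • D.dm y₀)) v = 0) :
    fderiv ℝ r (0, (y₀, a • D.dm y₀)) v = 0 :=
  deriv_eq_zero_of_vanishing
    ((h.contDiffAt_defn n₀ (z := (0, (y₀, a • D.dm y₀))) h.mem).hasStrictFDerivAt (by simp))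
    (h.surjective_fderiv_defn ha hn) (h.defn_zero n₀) (hrd.hasStrictFDerivAt (by simp))
    (h.eventually_defn_vanishing ha hn hr) hv

/-- The Hessian of the quadratic defining function is positive in the directions transversal to the
conormal set: `ρ` is a sum of positive quadratic forms in `G`, `ζ(K)` and `u`, whose differentials
do not vanish simultaneously on such a direction. -/
theorem hessian_rho_pos {C : ℝ} (hC : 0 < C) {n₀ : E}
    {v : ℝ × (E × (E →L[ℝ] ℝ))} (hv : fderiv ℝ (D.defn n₀) (0, (y₀, a • D.dm y₀)) v ≠ 0) :
    0 < iteratedFDeriv ℝ 2 (D.rho C) (0, (y₀, a • D.dm y₀)) ![v, v] := by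
  have hy := h.mem
  have hG0 := h.G_conormal hy h.mu_eq_zero a
  have hν0 := h.nu_conormal hy h.mu_eq_zero a
  have hu0 := h.uu_conormal hy h.mu_eq_zero 0 a
  have ht := h.tm_ne_zero ha
  rw [h.fderiv_defn n₀ (z := (0, (y₀, a • D.dm y₀))) hy] at hv
  set z₀ : ℝ × (E × (E →L[ℝ] ℝ)) := (0, (y₀, a • D.dm y₀)) with hz₀
  have hr := h.contDiffAt_rh (z := z₀) hy ht
  have hG := h.contDiffAt_G (z := z₀) hy
  have hν := h.contDiffAt_nu (z := z₀) hy
  have hu := h.contDiffAt_uu (z := z₀) hy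
  have hfst : ContDiffAt ℝ ∞ (fun z : ℝ × (E × (E →L[ℝ] ℝ)) => z.2.1) z₀ := by fun_prop
  have hell : ContDiffAt ℝ ∞ (fun z : ℝ × (E × (E →L[ℝ] ℝ)) => D.ell z.2.1) z₀ :=
    (h.contDiffAt_ell (y := z₀.2.1) hy).comp z₀ hfst
  let B₁ : ℝ × (E × (E →L[ℝ] ℝ)) → ℝ →L[ℝ] ℝ →L[ℝ] ℝ := fun z =>
    (C * D.rh z ^ 4) • ContinuousLinearMap.mul ℝ ℝ
  let B₂ : ℝ × (E × (E →L[ℝ] ℝ)) → ℝ →L[ℝ] ℝ →L[ℝ] ℝ := fun z =>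
    (C * D.rh z ^ 2) • ContinuousLinearMap.mul ℝ ℝ
  let B₃ : ℝ × (E × (E →L[ℝ] ℝ)) → E →L[ℝ] E →L[ℝ] ℝ := fun z => D.rh z ^ 2 • D.ell z.2.1
  have hB₁ : ContDiffAt ℝ ∞ B₁ z₀ := (contDiffAt_const.mul (hr.pow 4)).smul contDiffAt_const
  have hB₂ : ContDiffAt ℝ ∞ B₂ z₀ := (contDiffAt_const.mul (hr.pow 2)).smul contDiffAt_const
  have hB₃ : ContDiffAt ℝ ∞ B₃ z₀ := (hr.pow 2).smul hell
  have hev : D.rho C =ᶠ[𝓝 z₀] (fun z => B₁ z (D.G z) (D.G z))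
      + (fun z => B₂ z (D.nu z) (D.nu z)) + fun z => B₃ z (D.uu z) (D.uu z) := by
    filter_upwards [h.preimage_mem_nhds (z := z₀) hy] with z hz
    simp only [B₁, B₂, B₃, Pi.add_apply, smul_apply, smul_eq_mul, ContinuousLinearMap.mul_apply',
      ← h.Q_eq hz, rho]
    ring
  have c1 : ContDiffAt ℝ 2 (fun z => B₁ z (D.G z) (D.G z)) z₀ :=
    ((hB₁.clm_apply hG).clm_apply hG).of_le (by simpa using ENat.LEInfty.out)
  have c2 : ContDiffAt ℝ 2 (fun z => B₂ z (D.nu z) (D.nu z)) z₀ :=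
    ((hB₂.clm_apply hν).clm_apply hν).of_le (by simpa using ENat.LEInfty.out)
  have c3 : ContDiffAt ℝ 2 (fun z => B₃ z (D.uu z) (D.uu z)) z₀ :=
    ((hB₃.clm_apply hu).clm_apply hu).of_le (by simpa using ENat.LEInfty.out)
  have c12 : ContDiffAt ℝ 2 ((fun z => B₁ z (D.G z) (D.G z))
      + fun z => B₂ z (D.nu z) (D.nu z)) z₀ := c1.add c2
  rw [(hev.iteratedFDeriv ℝ 2).eq_of_nhds, iteratedFDeriv_add_apply c12 c3,
    iteratedFDeriv_add_apply c1 c2]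
  simp only [add_apply]
  rw [iteratedFDeriv_two_quadratic hB₁ hG hG0, iteratedFDeriv_two_quadratic hB₂ hν hν0,
    iteratedFDeriv_two_quadratic hB₃ hu hu0]
  simp only [B₁, B₂, B₃, smul_apply, smul_eq_mul, ContinuousLinearMap.mul_apply']
  set g := fderiv ℝ D.G z₀ v
  set ν := fderiv ℝ D.nu z₀ v
  set u := fderiv ℝ D.uu z₀ v
  have hrp := rh_pos ht
  have hCp : 0 < C * D.rh z₀ ^ 4 := by positivity
  have hCp2 : 0 < C * D.rh z₀ ^ 2 := by positivity
  have hrp2 : 0 < D.rh z₀ ^ 2 := by positivity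
  have hu0' : 0 ≤ D.ell z₀.2.1 u u := by
    rcases eq_or_ne u 0 with h0 | h0
    · simp [h0]
    · exact (h.ell_pos _ hy _ h0).le
  have p1 := mul_nonneg hCp.le (mul_self_nonneg g)
  have p2 := mul_nonneg hCp2.le (mul_self_nonneg ν)
  have p3 := mul_nonneg hrp2.le hu0'
  by_contra hcon
  have q1 : C * D.rh z₀ ^ 4 * (g * g) = 0 := by linarith
  have q2 : C * D.rh z₀ ^ 2 * (ν * ν) = 0 := by linarith
  have q3 : D.rh z₀ ^ 2 * D.ell z₀.2.1 u u = 0 := by linarith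
  have hg : g = 0 := mul_self_eq_zero.1 ((mul_eq_zero.1 q1).resolve_left hCp.ne')
  have hν' : ν = 0 := mul_self_eq_zero.1 ((mul_eq_zero.1 q2).resolve_left hCp2.ne')
  have hu' : u = 0 := by
    by_contra hne
    exact (mul_pos hrp2 (h.ell_pos _ hy _ hne)).ne' q3
  exact hv (by rw [hg, hν', hu']; simp)

end Rho

end IsHorizonOn

end LocalData

/-! ### Invariance of the Hamilton vector field under changes of coordinates -/

namespace LocalData

variable {E : Type*} [NormedAddCommGroup E] [NormedSpace ℝ E] [FiniteDimensional ℝ E]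

/-- The change of coordinates of the b-cotangent bundle induced by a change of coordinates `ψ` of
the base, where `θ` is the inverse of `ψ`. -/
def cotChange (ψ θ : E → E) (z : ℝ × (E × (E →L[ℝ] ℝ))) : ℝ × (E × (E →L[ℝ] ℝ)) :=
  (z.1, (ψ z.2.1, z.2.2.comp (fderiv ℝ θ (ψ z.2.1))))

/-- The Hamilton vector field is invariant under changes of coordinates of the base. -/
theorem IsMetricOn.fderiv_cotChange_ham {D₀ D₁ : LocalData E} {Ω₀ Ω₁ : Set E}
    (h₀ : D₀.IsMetricOn Ω₀) (h₁ : D₁.IsMetricOn Ω₁) {ψ θ : E → E} {z : ℝ × (E × (E →L[ℝ] ℝ))}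
    (hz : z.2.1 ∈ Ω₁) (hψz : ψ z.2.1 ∈ Ω₀) (hψ : ContDiffAt ℝ ∞ ψ z.2.1)
    (hθ : ContDiffAt ℝ ∞ θ (ψ z.2.1)) (hθψ : ∀ᶠ y in 𝓝 z.2.1, θ (ψ y) = y)
    (hg : ∀ᶠ y in 𝓝 (ψ z.2.1), ∀ u w, D₀.g y u w =
      D₁.g (θ y) (u.1, fderiv ℝ θ y u.2) (w.1, fderiv ℝ θ y w.2)) :
    fderiv ℝ (cotChange ψ θ) z (D₁.ham z) = D₀.ham (cotChange ψ θ z) := by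
  obtain ⟨σ, y₁, η⟩ := z
  simp only at hz hψz hψ hθ hθψ hg
  set y₀ := ψ y₁ with hy₀
  have hθy : θ y₀ = y₁ := hθψ.self_of_nhds
  set A := fderiv ℝ θ y₀ with hA
  set P := fderiv ℝ ψ y₁ with hP
  have hψd : HasFDerivAt ψ P y₁ := (hψ.differentiableAt (by simp)).hasFDerivAt
  have hθd : HasFDerivAt θ A y₀ := (hθ.differentiableAt (by simp)).hasFDerivAt
  have hAP : ∀ v, A (P v) = v := by
    have h1 : HasFDerivAt (θ ∘ ψ) (A.comp P) y₁ := hθd.comp y₁ hψd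
    have h2 : HasFDerivAt (θ ∘ ψ) (ContinuousLinearMap.id ℝ E) y₁ :=
      (hasFDerivAt_id y₁).congr_of_eventuallyEq (by filter_upwards [hθψ] with y hy using hy)
    exact fun v => congrArg (fun L : E →L[ℝ] E => L v) (h1.unique h2)
  set z : ℝ × (E × (E →L[ℝ] ℝ)) := (σ, (y₁, η)) with hz'
  have hY : D₀.Y (cotChange ψ θ z) = ((D₁.Y z).1, P (D₁.Y z).2) := by
    refine h₀.Y_of_covZ_eq hψz rfl (ContinuousLinearMap.ext fun w => ?_)
    rw [hg.self_of_nhds, hθy, ← hA]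
    simp only
    rw [hAP]
    have := congrArg (fun L : (ℝ × E) →L[ℝ] ℝ => L (w.1, A w.2)) (h₁.g_Y (z := z) hz)
    simp only [covZ_apply] at this
    rw [covZ_apply]
    exact this.symm
  -- the derivative of the change of coordinates
  have hθ2 : HasFDerivAt (fderiv ℝ θ) (fderiv ℝ (fderiv ℝ θ) y₀) y₀ :=
    ((hθ.fderiv_right (m := ∞) (by simp)).differentiableAt (by simp)).hasFDerivAt
  set θ2 := fderiv ℝ (fderiv ℝ θ) y₀ with hθ2'
  have hsymm : ∀ v w, θ2 v w = θ2 w v := fun v w =>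
    (hθ.isSymmSndFDerivAt (by simpa using ENat.LEInfty.out)).eq v w
  have e1 : HasFDerivAt (fun z : ℝ × (E × (E →L[ℝ] ℝ)) => ψ z.2.1) _ z :=
    hasFDerivAt_comp_base (z := z) hψd.differentiableAt
  have e2 : HasFDerivAt (fun z : ℝ × (E × (E →L[ℝ] ℝ)) => fderiv ℝ θ (ψ z.2.1)) _ z :=
    HasFDerivAt.comp (g := fderiv ℝ θ) (f := fun z : ℝ × (E × (E →L[ℝ] ℝ)) => ψ z.2.1) z hθ2 e1
  have e3 := (hasFDerivAt_fst (𝕜 := ℝ) (p := z)).prodMk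
    (e1.prodMk ((hasFDerivAt_fibre z).clm_comp e2))
  have e4 : fderiv ℝ (cotChange ψ θ) z = _ := e3.fderiv
  -- the derivative of the metric
  have key : ∀ w, fderiv ℝ D₀.g y₀ w (D₀.Y (cotChange ψ θ z)) (D₀.Y (cotChange ψ θ z)) =
      fderiv ℝ D₁.g y₁ (A w) (D₁.Y z) (D₁.Y z)
        + 2 * η (θ2 w (P (D₁.Y z).2)) := by
    intro w
    set u := D₀.Y (cotChange ψ θ z) with hu
    have f1 : HasFDerivAt (fun y => D₀.g y u u) _ y₀ :=
      ((((h₀.contDiffAt_g hψz).differentiableAt (by simp)).hasFDerivAt.clm_apply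
        (hasFDerivAt_const u y₀)).clm_apply (hasFDerivAt_const u y₀))
    have hg₁ : HasFDerivAt D₁.g (fderiv ℝ D₁.g y₁) (θ y₀) := by
      rw [hθy]; exact ((h₁.contDiffAt_g hz).differentiableAt (by simp)).hasFDerivAt
    have f2 : HasFDerivAt (fun y => ((u.1, fderiv ℝ θ y u.2) : ℝ × E)) _ y₀ :=
      (hasFDerivAt_const u.1 y₀).prodMk (hθ2.clm_apply (hasFDerivAt_const u.2 y₀))
    have f3 : HasFDerivAt (fun y => D₁.g (θ y) (u.1, fderiv ℝ θ y u.2) (u.1, fderiv ℝ θ y u.2))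
        _ y₀ := ((hg₁.comp y₀ hθd).clm_apply f2).clm_apply f2
    have f4 : (fun y => D₀.g y u u) =ᶠ[𝓝 y₀]
        fun y => D₁.g (θ y) (u.1, fderiv ℝ θ y u.2) (u.1, fderiv ℝ θ y u.2) := by
      filter_upwards [hg] with y hy using hy u u
    have f5 := congrArg (fun L : E →L[ℝ] ℝ => L w) (f1.unique (f3.congr_of_eventuallyEq f4))
    have f6 : ((u.1, A u.2) : ℝ × E) = D₁.Y z := by
      rw [hY]; simp only; rw [hAP]
    have f7 : u.2 = P (D₁.Y z).2 := by rw [hY]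
    have f8 := h₁.g_Y_symm (z := z) hz (0, θ2 w u.2)
    have f9 := congrArg (fun L : (ℝ × E) →L[ℝ] ℝ => L (0, θ2 w u.2)) (h₁.g_Y (z := z) hz)
    simp only [covZ_apply, mul_zero, zero_add] at f8 f9
    simp only [Function.comp_apply, ← hA, f6, hθy] at f5
    simp at f5
    rw [f5, ← f7]
    linear_combination f8 + f9
  rw [e4]
  refine Prod.ext ?_ (Prod.ext ?_ ?_)
  · simp [ham]
  · change P ((2 : ℝ) • (D₁.Y z).2) = (2 : ℝ) • (D₀.Y (cotChange ψ θ z)).2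
    rw [hY, map_smul]
  · refine ContinuousLinearMap.ext fun w => ?_
    change _ = fderiv ℝ D₀.g y₀ w (D₀.Y (cotChange ψ θ z)) (D₀.Y (cotChange ψ θ z))
    rw [key]
    simp [ham]
    rw [hsymm]
    simp [z, ← hP, ← hA, ← hy₀]
    ring

/-- The Hamilton vector field in terms of the differential of `G`. -/
theorem IsMetricOn.ham_eq {n : ℕ} {D : LocalData (EuclideanSpace ℝ (Fin n))}
    {Ω : Set (EuclideanSpace ℝ (Fin n))} (h : D.IsMetricOn Ω)
    {z : ℝ × (EuclideanSpace ℝ (Fin n) × (EuclideanSpace ℝ (Fin n) →L[ℝ] ℝ))} (hz : z.2.1 ∈ Ω) :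
    D.ham z = (0, (WithLp.toLp 2 (fun i => fderiv ℝ D.G z (0, (0, EuclideanSpace.proj i))),
      -((fderiv ℝ D.G z).comp ((ContinuousLinearMap.inr ℝ ℝ _).comp
        (ContinuousLinearMap.inl ℝ _ _))))) := by
  refine Prod.ext rfl (Prod.ext ?_ ?_)
  · ext i
    simp only
    rw [h.fderiv_G hz]
    simp [ham]
  · refine ContinuousLinearMap.ext fun w => ?_
    simp only [neg_apply, ContinuousLinearMap.comp_apply]
    rw [h.fderiv_G hz]
    simp [ham]

end LocalData

/-! ### Canonical coordinates of the b-cotangent bundle -/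

section Charts

variable {n : ℕ} {X : Type*} [TopologicalSpace X] [ChartedSpace (EuclideanSpace ℝ (Fin n)) X]
  [IsManifold (𝓡 n) ∞ X]

/-- The components of tangent vectors at `x` in the coordinates around `x₀`. -/
def toCoord (x₀ x : X) : TangentSpace (𝓡 n) x →L[ℝ] EuclideanSpace ℝ (Fin n) :=
  (trivializationAt (EuclideanSpace ℝ (Fin n)) (TangentSpace (𝓡 n)) x₀).continuousLinearMapAt ℝ x

/-- The tangent vector at `x` with given components in the coordinates around `x₀`. -/
def ofCoord (x₀ x : X) : EuclideanSpace ℝ (Fin n) →L[ℝ] TangentSpace (𝓡 n) x :=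
  (trivializationAt (EuclideanSpace ℝ (Fin n)) (TangentSpace (𝓡 n)) x₀).symmL ℝ x

variable {x₀ x : X}

theorem toCoord_ofCoord (hx : x ∈ (chartAt (EuclideanSpace ℝ (Fin n)) x₀).source)
    (v : EuclideanSpace ℝ (Fin n)) : toCoord x₀ x (ofCoord x₀ x v) = v :=
  (trivializationAt (EuclideanSpace ℝ (Fin n))
    (TangentSpace (𝓡 n)) x₀).continuousLinearMapAt_symmL (R := ℝ) hx v

theorem ofCoord_toCoord (hx : x ∈ (chartAt (EuclideanSpace ℝ (Fin n)) x₀).source)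
    (v : TangentSpace (𝓡 n) x) : ofCoord x₀ x (toCoord x₀ x v) = v :=
  (trivializationAt (EuclideanSpace ℝ (Fin n))
    (TangentSpace (𝓡 n)) x₀).symmL_continuousLinearMapAt (R := ℝ) hx v

theorem toCoord_eq_mfderiv (hx : x ∈ (chartAt (EuclideanSpace ℝ (Fin n)) x₀).source)
    (v : TangentSpace (𝓡 n) x) :
    toCoord x₀ x v = mfderiv (𝓡 n) 𝓘(ℝ, EuclideanSpace ℝ (Fin n)) (extChartAt (𝓡 n) x₀) x v := by
  have := TangentBundle.continuousLinearMapAt_trivializationAt (I := 𝓡 n) hx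
  exact congrArg (fun L => L v) this

theorem ofCoord_eq_mfderiv (hx : x ∈ (chartAt (EuclideanSpace ℝ (Fin n)) x₀).source)
    (v : EuclideanSpace ℝ (Fin n)) :
    ofCoord x₀ x v = mfderiv 𝓘(ℝ, EuclideanSpace ℝ (Fin n)) (𝓡 n) (extChartAt (𝓡 n) x₀).symm
      (extChartAt (𝓡 n) x₀ x) v := by
  have := TangentBundle.symmL_trivializationAt (I := 𝓡 n) hx
  rw [ModelWithCorners.range_eq_univ, mfderivWithin_univ] at this
  exact congrArg (fun L => L v) this

theorem chart_symm_mem {y : EuclideanSpace ℝ (Fin n)} (hy : y ∈ (extChartAt (𝓡 n) x₀).target) :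
    (extChartAt (𝓡 n) x₀).symm y ∈ (chartAt (EuclideanSpace ℝ (Fin n)) x₀).source := by
  rw [← extChartAt_source (𝓡 n)]
  exact (extChartAt (𝓡 n) x₀).map_target hy

theorem contMDiffAt_chart_symm {y : EuclideanSpace ℝ (Fin n)}
    (hy : y ∈ (extChartAt (𝓡 n) x₀).target) :
    ContMDiffAt 𝓘(ℝ, EuclideanSpace ℝ (Fin n)) (𝓡 n) ∞ (extChartAt (𝓡 n) x₀).symm y :=
  (contMDiffOn_extChartAt_symm x₀).contMDiffAt ((isOpen_extChartAt_target x₀).mem_nhds hy)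

/-- The differential of a function in coordinates. -/
theorem fderiv_comp_chart_symm {y : EuclideanSpace ℝ (Fin n)}
    (hy : y ∈ (extChartAt (𝓡 n) x₀).target)
    {f : X → ℝ} (hf : MDifferentiableAt (𝓡 n) 𝓘(ℝ) f ((extChartAt (𝓡 n) x₀).symm y))
    (v : EuclideanSpace ℝ (Fin n)) :
    fderiv ℝ (f ∘ (extChartAt (𝓡 n) x₀).symm) y v =
      diff (𝓡 n) f ((extChartAt (𝓡 n) x₀).symm y) (ofCoord x₀ ((extChartAt (𝓡 n) x₀).symm y) v) := by
  rw [ofCoord_eq_mfderiv (chart_symm_mem hy), (extChartAt (𝓡 n) x₀).right_inv hy]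
  have h1 := mfderiv_comp y hf ((contMDiffAt_chart_symm hy).mdifferentiableAt (by simp))
  rw [mfderiv_eq_fderiv] at h1
  exact congrArg (fun L => L v) h1

/-- The extended chart of `ᵇT*_XM` around `p`. -/
theorem extChartAt_cot (p q : BCotangent n X) :
    extChartAt (cotModel n) p q =
      (q.1, (extChartAt (𝓡 n) (base p) (base q), q.2.snd.comp (ofCoord (base p) (base q)))) := by
  rw [extChartAt_prod]
  refine Prod.ext rfl ?_
  change extChartAt ((𝓡 n).prod 𝓘(ℝ, EuclideanSpace ℝ (Fin n) →L[ℝ] ℝ)) p.2 q.2 = _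
  rw [FiberBundle.extChartAt]
  refine Prod.ext rfl ?_
  refine ContinuousLinearMap.ext fun v => ?_
  change (trivializationAt ℝ (Bundle.Trivial X ℝ) p.2.proj).continuousLinearMapAt ℝ q.2.proj
    (q.2.snd (ofCoord p.2.proj q.2.proj v)) = _
  simp
  rfl

theorem mem_extChartAt_cot_source (p q : BCotangent n X) :
    q ∈ (extChartAt (cotModel n) p).source ↔
      base q ∈ (chartAt (EuclideanSpace ℝ (Fin n)) (base p)).source := by
  rw [extChartAt_prod]
  simp [FiberBundle.chartedSpace_chartAt, base, hom_trivializationAt_apply]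
  exact fun _ => by rw [chartAt_self_eq]; trivial

theorem mem_extChartAt_cot_target (p : BCotangent n X)
    (z : ℝ × (EuclideanSpace ℝ (Fin n) × (EuclideanSpace ℝ (Fin n) →L[ℝ] ℝ))) :
    z ∈ (extChartAt (cotModel n) p).target ↔ z.2.1 ∈ (extChartAt (𝓡 n) (base p)).target := by
  rw [extChartAt_prod, PartialEquiv.prod_target, FiberBundle.extChartAt_target]
  simp only [PartialEquiv.refl_target, mem_prod, extChartAt_model_space_eq_id, mem_univ, true_and,
    and_true, mem_inter_iff, mem_preimage]
  refine ⟨fun h => h.1, fun h => ⟨h, ?_⟩⟩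
  rw [hom_trivializationAt_baseSet]
  exact ⟨chart_symm_mem h, mem_univ _⟩

theorem extChartAt_cot_symm (p : BCotangent n X)
    {z : ℝ × (EuclideanSpace ℝ (Fin n) × (EuclideanSpace ℝ (Fin n) →L[ℝ] ℝ))}
    (hz : z.2.1 ∈ (extChartAt (𝓡 n) (base p)).target) :
    (extChartAt (cotModel n) p).symm z =
      (z.1, ⟨(extChartAt (𝓡 n) (base p)).symm z.2.1,
        z.2.2.comp (toCoord (base p) ((extChartAt (𝓡 n) (base p)).symm z.2.1))⟩) := by
  have hz' := (mem_extChartAt_cot_target p z).2 hz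
  refine (((extChartAt (cotModel n) p).eq_symm_apply ?_ hz').2 ?_).symm
  · rw [mem_extChartAt_cot_source]
    exact chart_symm_mem hz
  · rw [extChartAt_cot]
    refine Prod.ext rfl (Prod.ext ((extChartAt (𝓡 n) (base p)).right_inv hz) ?_)
    refine ContinuousLinearMap.ext fun v => ?_
    exact congrArg z.2.2 (toCoord_ofCoord (chart_symm_mem hz) v)

end Charts

/-! ### The metric in canonical coordinates -/

section Forms

variable {E : Type*} [NormedAddCommGroup E] [NormedSpace ℝ E]
  {E' H' N : Type*} [NormedAddCommGroup E'] [NormedSpace ℝ E'] [TopologicalSpace H']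
  {I' : ModelWithCorners ℝ E' H'} [TopologicalSpace N] [ChartedSpace H' N] [IsManifold I' ∞ N]

theorem contMDiffOn_mfderiv_const {f : E → N} {s : Set E} (hs : IsOpen s)
    (hf : ContMDiffOn 𝓘(ℝ, E) I' ∞ f s) (v : E) :
    ContMDiffOn 𝓘(ℝ, E) I'.tangent ∞
      (fun y => (⟨f y, mfderiv 𝓘(ℝ, E) I' f y v⟩ : TangentBundle I' N)) s := by
  have h1 := hf.contMDiffOn_tangentMapWithin (m := ∞) (by simp) hs.uniqueMDiffOn
  have h2 : ContMDiff 𝓘(ℝ, E) 𝓘(ℝ, E).tangent ∞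
      (fun y => (⟨y, v⟩ : TangentBundle 𝓘(ℝ, E) E)) := fun y =>
    contMDiffAt_vectorSpace_iff_contDiffAt.2 contDiffAt_const
  have h3 := h1.comp h2.contMDiffOn (s := s) (fun y hy => hy)
  refine h3.congr fun y hy => ?_
  simp only [Function.comp_apply, tangentMapWithin]
  rw [mfderivWithin_of_isOpen hs hy]

theorem contDiffOn_form₁ {f : E → N} {s : Set E} (hs : IsOpen s)
    (hf : ContMDiffOn 𝓘(ℝ, E) I' ∞ f s) {b : ∀ q : N, TangentSpace I' q →L[ℝ] ℝ}
    (hb : ContMDiff I' (I'.prod 𝓘(ℝ, E' →L[ℝ] ℝ)) ∞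
      (fun q => TotalSpace.mk' (E' →L[ℝ] ℝ) (E := fun q : N => TangentSpace I' q →L[ℝ] ℝ) q (b q)))
    (v : E) : ContDiffOn ℝ ∞ (fun y => b (f y) (mfderiv 𝓘(ℝ, E) I' f y v)) s := by
  rw [← contMDiffOn_iff_contDiffOn]
  have h1 := ContMDiffOn.clm_bundle_apply (F₁ := E') (F₂ := ℝ) (E₂ := Bundle.Trivial N ℝ)
    (ϕ := fun y => b (f y))
    (hb.comp_contMDiffOn hf) (contMDiffOn_mfderiv_const hs hf v)
  intro y hy
  have h2 := (contMDiffWithinAt_totalSpace.1 (h1 y hy)).2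
  exact h2

theorem contDiffOn_form₂ {f : E → N} {s : Set E} (hs : IsOpen s)
    (hf : ContMDiffOn 𝓘(ℝ, E) I' ∞ f s)
    {c : ∀ q : N, TangentSpace I' q →L[ℝ] TangentSpace I' q →L[ℝ] ℝ}
    (hc : ContMDiff I' (I'.prod 𝓘(ℝ, E' →L[ℝ] E' →L[ℝ] ℝ)) ∞
      (fun q => TotalSpace.mk' (E' →L[ℝ] E' →L[ℝ] ℝ)
        (E := fun q : N => TangentSpace I' q →L[ℝ] TangentSpace I' q →L[ℝ] ℝ) q (c q)))
    (v w : E) : ContDiffOn ℝ ∞ (fun y => c (f y) (mfderiv 𝓘(ℝ, E) I' f y v)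
      (mfderiv 𝓘(ℝ, E) I' f y w)) s := by
  rw [← contMDiffOn_iff_contDiffOn]
  have h1 := ContMDiffOn.clm_bundle_apply₂ (F₁ := E') (F₂ := E') (F₃ := ℝ)
    (E₃ := Bundle.Trivial N ℝ) (ψ := fun y => c (f y))
    (hc.comp_contMDiffOn hf) (contMDiffOn_mfderiv_const hs hf v)
    (contMDiffOn_mfderiv_const hs hf w)
  intro y hy
  have h2 := (contMDiffWithinAt_totalSpace.1 (h1 y hy)).2
  exact h2

end Forms

/-- The bilinear form `(v, w) ↦ B(Lv, Lw)`. -/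
def pullForm {F F' : Type*} [AddCommGroup F] [Module ℝ F] [TopologicalSpace F]
    [AddCommGroup F'] [Module ℝ F'] [TopologicalSpace F']
    (B : F' →L[ℝ] F' →L[ℝ] ℝ) (L : F →L[ℝ] F') : F →L[ℝ] F →L[ℝ] ℝ :=
  (ContinuousLinearMap.precomp ℝ L).comp (B.comp L)

namespace Setting

variable {n : ℕ} {M : Type*} [TopologicalSpace M] [ChartedSpace (EuclideanHalfSpace (n + 1)) M]
  [IsManifold (𝓡∂ (n + 1)) ∞ M]
  {X : Type*} [TopologicalSpace X] [ChartedSpace (EuclideanSpace ℝ (Fin n)) X]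
  (S : Setting n M X)

/-! ### Linear algebra of the metric -/

theorem metric_apply (x : X) (u w : ℝ × TangentSpace (𝓡 n) x) :
    S.metric x u w = S.g.form (S.ι x) (bVector S.isBoundaryDefining S.isBoundaryInclusion x u)
      (bVector S.isBoundaryDefining S.isBoundaryInclusion x w) := rfl

theorem metric_symm (x : X) (u w : ℝ × TangentSpace (𝓡 n) x) :
    S.metric x u w = S.metric x w u := S.g.symm _ _ _

theorem bVector_injective (x : X) :
    Function.Injective (bVector S.isBoundaryDefining S.isBoundaryInclusion x) := by
  intro u w h
  have h1 := congrArg Subtype.val h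
  have h2 : mfderiv (𝓡 n) (𝓡∂ (n + 1)) S.ι x u.2 = mfderiv (𝓡 n) (𝓡∂ (n + 1)) S.ι x w.2 :=
    congrArg Prod.fst h1
  exact Prod.ext (congrArg Prod.snd h1) (S.isBoundaryInclusion.injective_mfderiv x h2)

theorem finrank_bTangentSpace (x : X) :
    Module.finrank ℝ (bTangentSpace n S.τ (S.ι x)) = n + 1 := by
  have hq : S.ι x ∈ (𝓡∂ (n + 1)).boundary M :=
    S.isBoundaryInclusion.range_eq ▸ mem_range_self x
  have hne := S.isBoundaryDefining.mfderiv_ne_zero _ hq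
  let l : (EuclideanSpace ℝ (Fin (n + 1)) × ℝ) →ₗ[ℝ] ℝ :=
    ((diff (𝓡∂ (n + 1)) S.τ (S.ι x)).comp (ContinuousLinearMap.fst ℝ _ ℝ)
      - S.τ (S.ι x) • ContinuousLinearMap.snd ℝ (TangentSpace (𝓡∂ (n + 1)) (S.ι x)) ℝ).toLinearMap
  have hl : Function.Surjective l := by
    refine LinearMap.surjective fun h0 => hne ?_
    refine ContinuousLinearMap.ext fun v => ?_
    have h1 : l (v, 0) = 0 := by rw [h0]; rfl
    have h2 : l (v, 0) = diff (𝓡∂ (n + 1)) S.τ (S.ι x) v - S.τ (S.ι x) * 0 := rfl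
    rw [h2, mul_zero, sub_zero] at h1
    exact h1
  have h1 := LinearMap.finrank_range_add_finrank_ker l
  rw [LinearMap.range_eq_top.2 hl, finrank_top] at h1
  simp at h1
  have h2 : Module.finrank ℝ (bTangentSpace n S.τ (S.ι x)) = Module.finrank ℝ (LinearMap.ker l) :=
    rfl
  omega

theorem bVector_surjective (x : X) :
    Function.Surjective (bVector S.isBoundaryDefining S.isBoundaryInclusion x) := by
  let L : (ℝ × EuclideanSpace ℝ (Fin n)) →ₗ[ℝ] bTangentSpace n S.τ (S.ι x) :=
    (bVector S.isBoundaryDefining S.isBoundaryInclusion x).toLinearMap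
  have hpos : 0 < Module.finrank ℝ (bTangentSpace n S.τ (S.ι x)) := by
    rw [S.finrank_bTangentSpace]; omega
  have := Module.finite_of_finrank_pos hpos
  have h1 : Module.finrank ℝ (ℝ × EuclideanSpace ℝ (Fin n)) =
      Module.finrank ℝ (bTangentSpace n S.τ (S.ι x)) := by
    rw [S.finrank_bTangentSpace]; simp [add_comm]
  have h2 : Function.Injective L := S.bVector_injective x
  exact (LinearMap.injective_iff_surjective_of_finrank_eq_finrank h1).1 h2

/-- The metric on `ℝ τ∂_τ ⊕ T_xX` has signature `(1, n)`. -/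
theorem metric_signature (x : X) : ∃ u, 0 < S.metric x u u ∧
    ∀ w, S.metric x u w = 0 → w ≠ 0 → S.metric x w w < 0 := by
  obtain ⟨u', hu, hw⟩ := S.g.signature (S.ι x)
  obtain ⟨u, rfl⟩ := S.bVector_surjective x u'
  have h0 : bVector S.isBoundaryDefining S.isBoundaryInclusion x 0 = 0 :=
    (bVector S.isBoundaryDefining S.isBoundaryInclusion x).map_zero
  exact ⟨u, hu, fun w h1 hne => hw _ h1 fun h => hne (S.bVector_injective x (h.trans h0.symm))⟩

theorem metric_nondegenerate (x : X) {u : ℝ × TangentSpace (𝓡 n) x}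
    (hu : ∀ w, S.metric x u w = 0) : u = 0 := by
  obtain ⟨u₀, -, hw⟩ := S.metric_signature x
  by_contra hne
  have := hw u (by rw [S.metric_symm]; exact hu _) hne
  rw [hu] at this
  exact lt_irrefl _ this

/-- The orthogonal complement of a timelike vector is spacelike. -/
theorem metric_neg_of_orthogonal (x : X) {t w : ℝ × TangentSpace (𝓡 n) x}
    (ht : 0 < S.metric x t t) (htw : S.metric x t w = 0) (hw : w ≠ 0) : S.metric x w w < 0 := by
  obtain ⟨u, -, hu⟩ := S.metric_signature x
  by_contra hcon
  rw [not_lt] at hcon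
  by_cases h0 : S.metric x u t = 0
  · have hne : t ≠ 0 := by rintro rfl; simp at ht
    exact absurd (hu t h0 hne) (not_lt.2 ht.le)
  · -- a combination of `t` and `w` orthogonal to `u`
    set v := S.metric x u w • t - S.metric x u t • w with hv
    have h1 : S.metric x u v = 0 := by
      rw [hv, map_sub, map_smul, map_smul, smul_eq_mul, smul_eq_mul]; ring
    have h2 : S.metric x v v =
        S.metric x u w ^ 2 * S.metric x t t + S.metric x u t ^ 2 * S.metric x w w := by
      simp only [hv, map_sub, map_smul, sub_apply, smul_apply, smul_eq_mul, htw,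
        S.metric_symm x w t]
      ring
    have h3 : v ≠ 0 := by
      intro hv0
      have h4 : S.metric x w v = 0 := by rw [hv0, map_zero]
      have h5 : S.metric x t v = 0 := by rw [hv0, map_zero]
      simp only [hv, map_sub, map_smul, smul_eq_mul, htw, mul_zero, sub_zero] at h5
      have h6 : S.metric x u w = 0 := (mul_eq_zero.1 h5).resolve_right ht.ne'
      have h7 : S.metric x u t • w = 0 := by
        rw [hv, h6, zero_smul, zero_sub, neg_eq_zero] at hv0; exact hv0
      exact hw ((smul_eq_zero.1 h7).resolve_left h0)
    have h4 := hu v h1 h3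
    rw [h2] at h4
    have p1 : 0 ≤ S.metric x u w ^ 2 * S.metric x t t := by positivity
    have p2 : 0 ≤ S.metric x u t ^ 2 * S.metric x w w := mul_nonneg (sq_nonneg _) hcon
    linarith

theorem metric_isInvertible (x : X) : (S.metric x).IsInvertible := by
  let L : (ℝ × EuclideanSpace ℝ (Fin n)) →L[ℝ] ((ℝ × EuclideanSpace ℝ (Fin n)) →L[ℝ] ℝ) :=
    S.metric x
  have hinj : Function.Injective L := by
    rw [injective_iff_map_eq_zero]
    intro u hu
    exact S.metric_nondegenerate x (u := u) fun w =>
      congrArg (fun l : (ℝ × EuclideanSpace ℝ (Fin n)) →L[ℝ] ℝ => l w) hu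
  have hd : Module.finrank ℝ (ℝ × EuclideanSpace ℝ (Fin n)) =
      Module.finrank ℝ ((ℝ × EuclideanSpace ℝ (Fin n)) →L[ℝ] ℝ) := by
    rw [← (LinearMap.toContinuousLinearMap (𝕜 := ℝ) (E := ℝ × EuclideanSpace ℝ (Fin n))
      (F' := ℝ)).finrank_eq]
    exact (Subspace.dual_finrank_eq).symm
  let e := LinearEquiv.ofInjectiveOfFinrankEq L.toLinearMap hinj hd
  exact ⟨e.toContinuousLinearEquiv, rfl⟩

theorem metric_sharp (x : X) (α : (ℝ × TangentSpace (𝓡 n) x) →L[ℝ] ℝ) :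
    S.metric x (S.sharp x α) = α := (S.metric_isInvertible x).self_apply_inverse α

theorem sharp_eq_iff (x : X) {α : (ℝ × TangentSpace (𝓡 n) x) →L[ℝ] ℝ}
    {u : ℝ × TangentSpace (𝓡 n) x} : S.sharp x α = u ↔ S.metric x u = α :=
  ⟨fun h => h ▸ S.metric_sharp x α, fun h => h ▸ (S.metric_isInvertible x).inverse_apply_self u⟩

/-- As `dτ/τ` is timelike, `X` is spacelike. -/
theorem metric_tangent_neg (hS : S.IsTimelike) (x : X) {v : TangentSpace (𝓡 n) x} (hv : v ≠ 0) :
    S.metric x (0, v) (0, v) < 0 := by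
  have h1 := hS x
  set t := S.sharp x (covector x 1 0) with ht
  have h2 : S.metric x t = covector x 1 0 := S.metric_sharp x _
  refine S.metric_neg_of_orthogonal x (t := t) ?_ ?_ (fun h => hv (congrArg Prod.snd h))
  · rw [h2]; exact h1
  · rw [h2]; simp [covector]

/-! ### The data in coordinates -/

section Local

variable [IsManifold (𝓡 n) ∞ X] (V : ∀ x : X, TangentSpace (𝓡 n) x) (k : X → ℝ)
  (ℓ : ∀ x : X, TangentSpace (𝓡 n) x →L[ℝ] TangentSpace (𝓡 n) x →L[ℝ] ℝ) (x₀ : X)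

/-- The metric on `ᵇTM`, the vector field `V`, the function `k` and the form `ℓ` on `TX` in the
coordinates around `x₀`. -/
def localData : LocalData (EuclideanSpace ℝ (Fin n)) where
  g y := pullForm (S.metric ((extChartAt (𝓡 n) x₀).symm y))
    ((ContinuousLinearMap.id ℝ ℝ).prodMap (ofCoord x₀ ((extChartAt (𝓡 n) x₀).symm y)))
  V y := toCoord x₀ ((extChartAt (𝓡 n) x₀).symm y) (V ((extChartAt (𝓡 n) x₀).symm y))
  k y := k ((extChartAt (𝓡 n) x₀).symm y)
  ell y := pullForm (ℓ ((extChartAt (𝓡 n) x₀).symm y)) (ofCoord x₀ ((extChartAt (𝓡 n) x₀).symm y))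

theorem localData_g_apply (y : EuclideanSpace ℝ (Fin n)) (u w : ℝ × EuclideanSpace ℝ (Fin n)) :
    (S.localData V k ℓ x₀).g y u w = S.metric ((extChartAt (𝓡 n) x₀).symm y)
      (u.1, ofCoord x₀ ((extChartAt (𝓡 n) x₀).symm y) u.2)
      (w.1, ofCoord x₀ ((extChartAt (𝓡 n) x₀).symm y) w.2) := rfl

theorem localData_ell_apply (y : EuclideanSpace ℝ (Fin n)) (u w : EuclideanSpace ℝ (Fin n)) :
    (S.localData V k ℓ x₀).ell y u w = ℓ ((extChartAt (𝓡 n) x₀).symm y)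
      (ofCoord x₀ ((extChartAt (𝓡 n) x₀).symm y) u)
      (ofCoord x₀ ((extChartAt (𝓡 n) x₀).symm y) w) := rfl

theorem contDiffOn_localData_g :
    ContDiffOn ℝ ∞ (S.localData V k ℓ x₀).g (extChartAt (𝓡 n) x₀).target := by
  obtain ⟨a, b, c, ha, hb, hc, -, hform⟩ := S.g.smooth
  rw [contDiffOn_clm_apply]
  intro u
  rw [contDiffOn_clm_apply]
  intro w
  have hs := isOpen_extChartAt_target (I := 𝓡 n) x₀
  have hf : ContMDiffOn 𝓘(ℝ, EuclideanSpace ℝ (Fin n)) (𝓡∂ (n + 1)) ∞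
      (S.ι ∘ (extChartAt (𝓡 n) x₀).symm) (extChartAt (𝓡 n) x₀).target :=
    S.isBoundaryInclusion.smooth.comp_contMDiffOn (contMDiffOn_extChartAt_symm x₀)
  have ha' : ContDiffOn ℝ ∞ (fun y => a (S.ι ((extChartAt (𝓡 n) x₀).symm y)))
      (extChartAt (𝓡 n) x₀).target :=
    contMDiffOn_iff_contDiffOn.1 (ha.comp_contMDiffOn hf)
  have hb' := fun v => contDiffOn_form₁ hs hf hb v
  have hc' := contDiffOn_form₂ hs hf hc u.2 w.2
  refine (((ha'.mul (contDiffOn_const (c := u.1))).mul (contDiffOn_const (c := w.1))).add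
    (((contDiffOn_const (c := u.1)).mul (hb' w.2)).add
      ((contDiffOn_const (c := w.1)).mul (hb' u.2)))).add hc' |>.congr fun y hy => ?_
  have hd : ∀ v, mfderiv (𝓡 n) (𝓡∂ (n + 1)) S.ι ((extChartAt (𝓡 n) x₀).symm y)
      (ofCoord x₀ ((extChartAt (𝓡 n) x₀).symm y) v) =
      mfderiv 𝓘(ℝ, EuclideanSpace ℝ (Fin n)) (𝓡∂ (n + 1))
        (S.ι ∘ (extChartAt (𝓡 n) x₀).symm) y v := by
    intro v
    rw [ofCoord_eq_mfderiv (chart_symm_mem hy), (extChartAt (𝓡 n) x₀).right_inv hy]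
    have h1 := mfderiv_comp y ((S.isBoundaryInclusion.smooth _).mdifferentiableAt (by simp))
      ((contMDiffAt_chart_symm hy).mdifferentiableAt (by simp))
    exact (congrArg (fun L => L v) h1).symm
  rw [localData_g_apply, metric_apply, hform]
  simp only [← hd]
  rfl

theorem isMetricOn_localData :
    (S.localData V k ℓ x₀).IsMetricOn (extChartAt (𝓡 n) x₀).target where
  isOpen := isOpen_extChartAt_target x₀
  smooth_g := S.contDiffOn_localData_g V k ℓ x₀
  symm y _ u w := S.metric_symm _ _ _
  invertible y hy := by
    have hx := chart_symm_mem hy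
    set x := (extChartAt (𝓡 n) x₀).symm y
    have h1 := S.metric_isInvertible x
    have hinj : Function.Injective ((S.localData V k ℓ x₀).g y) := by
      rw [injective_iff_map_eq_zero]
      intro u hu
      have : ((u.1, ofCoord x₀ x u.2) : ℝ × TangentSpace (𝓡 n) x) = 0 := by
        refine S.metric_nondegenerate x fun w => ?_
        have h2 := congrArg (fun l : (ℝ × EuclideanSpace ℝ (Fin n)) →L[ℝ] ℝ =>
          l (w.1, toCoord x₀ x w.2)) hu
        simp only [localData_g_apply] at h2
        rw [ofCoord_toCoord hx] at h2
        exact h2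
      have h3 : ofCoord x₀ x u.2 = 0 := congrArg Prod.snd this
      have h4 : u.1 = 0 := congrArg Prod.fst this
      refine Prod.ext h4 ?_
      rw [← toCoord_ofCoord hx u.2]
      exact (congrArg (toCoord x₀ x) h3).trans (map_zero _)
    have hd : Module.finrank ℝ (ℝ × EuclideanSpace ℝ (Fin n)) =
        Module.finrank ℝ ((ℝ × EuclideanSpace ℝ (Fin n)) →L[ℝ] ℝ) := by
      rw [← (LinearMap.toContinuousLinearMap (𝕜 := ℝ) (E := ℝ × EuclideanSpace ℝ (Fin n))
        (F' := ℝ)).finrank_eq]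
      exact (Subspace.dual_finrank_eq).symm
    let e := LinearEquiv.ofInjectiveOfFinrankEq ((S.localData V k ℓ x₀).g y).toLinearMap hinj hd
    exact ⟨e.toContinuousLinearEquiv, rfl⟩

end Local

end Setting

namespace Setting

variable {n : ℕ} {M : Type*} [TopologicalSpace M] [ChartedSpace (EuclideanHalfSpace (n + 1)) M]
  [IsManifold (𝓡∂ (n + 1)) ∞ M]
  {X : Type*} [TopologicalSpace X] [ChartedSpace (EuclideanSpace ℝ (Fin n)) X]
  [IsManifold (𝓡 n) ∞ X] (S : Setting n M X)

/-! ### The data of a horizon -/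

/-- The squared length, for the metric dual to the inner product `ell`, of the component of the
linear form `η` orthogonal to `m`. -/
def _root_.BHorizon.orthogonalLengthSq {F : Type*} [AddCommGroup F] [Module ℝ F]
    [TopologicalSpace F] [IsTopologicalAddGroup F] [ContinuousSMul ℝ F]
    (m : F →L[ℝ] ℝ) (ell : F →L[ℝ] F →L[ℝ] ℝ) (η : F →L[ℝ] ℝ) : ℝ :=
  η (ell.inverse (η - (m (ell.inverse η) / m (ell.inverse m)) • m))

theorem _root_.BHorizon.orthogonalLengthSq_pull {F F' : Type*} [AddCommGroup F] [Module ℝ F]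
    [TopologicalSpace F] [IsTopologicalAddGroup F] [ContinuousSMul ℝ F]
    [AddCommGroup F'] [Module ℝ F']
    [TopologicalSpace F'] [IsTopologicalAddGroup F'] [ContinuousSMul ℝ F']
    (m : F →L[ℝ] ℝ) {ell : F →L[ℝ] F →L[ℝ] ℝ} (hell : ell.IsInvertible) (η : F →L[ℝ] ℝ)
    {A : F →L[ℝ] F'} {B : F' →L[ℝ] F} (hBA : ∀ v, B (A v) = v)
    (hp : (pullForm ell B).IsInvertible) :
    orthogonalLengthSq (m.comp B) (pullForm ell B) (η.comp B) = orthogonalLengthSq m ell η := by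
  have key : ∀ θ : F →L[ℝ] ℝ, (pullForm ell B).inverse (θ.comp B) = A (ell.inverse θ) := by
    intro θ
    have h1 : pullForm ell B (A (ell.inverse θ)) = θ.comp B := by
      refine ContinuousLinearMap.ext fun w => ?_
      change ell (B (A (ell.inverse θ))) (B w) = θ (B w)
      rw [hBA, hell.self_apply_inverse]
    rw [← h1, hp.inverse_apply_self]
  have h2 : ∀ c : ℝ, η.comp B - c • m.comp B = (η - c • m).comp B := fun c => by
    refine ContinuousLinearMap.ext fun w => rfl
  simp only [orthogonalLengthSq, h2, key, ContinuousLinearMap.comp_apply, hBA]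

/-- The differentials and tensors which enter the local analysis of a horizon `H`, at which `k` is
the surface gravity: `ℓ` is a Riemannian metric for which `V` is a Killing vector field on `H`. -/
structure HorizonData (V : ∀ x : X, TangentSpace (𝓡 n) x) (k : X → ℝ)
    (ℓ : ∀ x : X, TangentSpace (𝓡 n) x →L[ℝ] TangentSpace (𝓡 n) x →L[ℝ] ℝ) (H : Set X) : Prop where
  isCompact : IsCompact H
  mu_eq_zero : ∀ x ∈ H, S.mu V x = 0
  isolated : ∀ x ∈ H, ∀ᶠ y in 𝓝 x, S.mu V y = 0 → y ∈ H
  smooth_V : ∀ x₀, ContDiffOn ℝ ∞ (S.localData V k ℓ x₀).V (extChartAt (𝓡 n) x₀).target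
  smooth_k : ∀ x₀, ContDiffOn ℝ ∞ (S.localData V k ℓ x₀).k (extChartAt (𝓡 n) x₀).target
  smooth_ell : ∀ x₀, ContDiffOn ℝ ∞ (S.localData V k ℓ x₀).ell (extChartAt (𝓡 n) x₀).target
  ell_symm : ∀ x v w, ℓ x v w = ℓ x w v
  ell_pos : ∀ x v, v ≠ 0 → 0 < ℓ x v v
  k_ne_zero : ∀ x ∈ H, k x ≠ 0
  gravity : ∀ x ∈ H, ∀ w : ℝ × TangentSpace (𝓡 n) x,
    diff (𝓡 n) (S.mu V) x w.2 = 2 * k x * S.metric x (1, V x) w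
  quadratic : ∀ x ∈ H, diff (𝓡 n) (fun y => diff (𝓡 n) (S.mu V) y (V y)) x = 0
  constant : ∀ x ∈ H, diff (𝓡 n) k x (V x) = 0
  killing : ∀ x ∈ H, ∀ v, (S.localData V k ℓ x).dm (extChartAt (𝓡 n) x x) v = 0 →
    fderiv ℝ (S.localData V k ℓ x).ell (extChartAt (𝓡 n) x x)
        ((S.localData V k ℓ x).V (extChartAt (𝓡 n) x x)) v v
      + 2 * (S.localData V k ℓ x).ell (extChartAt (𝓡 n) x x)
        (fderiv ℝ (S.localData V k ℓ x).V (extChartAt (𝓡 n) x x) v) v = 0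

theorem _root_.BHorizon.contMDiffAt_of_chart {f : X → ℝ} {x₀ x : X}
    (hx : x ∈ (chartAt (EuclideanSpace ℝ (Fin n)) x₀).source)
    (hf : ContDiffAt ℝ ∞ (f ∘ (extChartAt (𝓡 n) x₀).symm) (extChartAt (𝓡 n) x₀ x)) :
    ContMDiffAt (𝓡 n) 𝓘(ℝ) ∞ f x := by
  have h1 : ContMDiffAt (𝓡 n) 𝓘(ℝ, EuclideanSpace ℝ (Fin n)) ∞ (extChartAt (𝓡 n) x₀) x :=
    contMDiffAt_extChartAt' hx
  refine (hf.contMDiffAt.comp x h1).congr_of_eventuallyEq ?_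
  filter_upwards [(chartAt (EuclideanSpace ℝ (Fin n)) x₀).open_source.mem_nhds hx] with y hy
  simp only [Function.comp_apply]
  rw [(extChartAt (𝓡 n) x₀).left_inv (by rwa [extChartAt_source])]

/-- The components of `df` are those of the differential of the coordinate expression of `f`. -/
theorem _root_.BHorizon.diff_eq_fderiv_chart {f : X → ℝ} {x₀ x : X}
    (hx : x ∈ (chartAt (EuclideanSpace ℝ (Fin n)) x₀).source)
    (hf : MDifferentiableAt (𝓡 n) 𝓘(ℝ) f x) (v : TangentSpace (𝓡 n) x) :
    fderiv ℝ (f ∘ (extChartAt (𝓡 n) x₀).symm) (extChartAt (𝓡 n) x₀ x) (toCoord x₀ x v) =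
      diff (𝓡 n) f x v := by
  obtain ⟨y, hy, rfl⟩ : ∃ y ∈ (extChartAt (𝓡 n) x₀).target, (extChartAt (𝓡 n) x₀).symm y = x :=
    ⟨_, (extChartAt (𝓡 n) x₀).map_source (by rwa [extChartAt_source]),
      (extChartAt (𝓡 n) x₀).left_inv (by rwa [extChartAt_source])⟩
  rw [(extChartAt (𝓡 n) x₀).right_inv hy, fderiv_comp_chart_symm hy hf, ofCoord_toCoord hx]

theorem _root_.BHorizon.contDiffOn_chart {f : X → ℝ} (hf : ContMDiff (𝓡 n) 𝓘(ℝ) ∞ f) (x₀ : X) :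
    ContDiffOn ℝ ∞ (f ∘ (extChartAt (𝓡 n) x₀).symm) (extChartAt (𝓡 n) x₀).target :=
  contMDiffOn_iff_contDiffOn.1 (hf.comp_contMDiffOn (contMDiffOn_extChartAt_symm x₀))

section Pointwise

variable {S} {V : ∀ x : X, TangentSpace (𝓡 n) x} {k : X → ℝ}
  {ℓ : ∀ x : X, TangentSpace (𝓡 n) x →L[ℝ] TangentSpace (𝓡 n) x →L[ℝ] ℝ}

theorem ofCoord_localData_V {x₀ : X} {y : EuclideanSpace ℝ (Fin n)}
    (hy : y ∈ (extChartAt (𝓡 n) x₀).target) :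
    ofCoord x₀ ((extChartAt (𝓡 n) x₀).symm y) ((S.localData V k ℓ x₀).V y) =
      V ((extChartAt (𝓡 n) x₀).symm y) :=
  ofCoord_toCoord (chart_symm_mem hy) _

theorem localData_mu {x₀ : X} {y : EuclideanSpace ℝ (Fin n)}
    (hy : y ∈ (extChartAt (𝓡 n) x₀).target) :
    (S.localData V k ℓ x₀).mu y = S.mu V ((extChartAt (𝓡 n) x₀).symm y) := by
  rw [LocalData.mu, localData_g_apply, LocalData.K_snd, ofCoord_localData_V hy]
  rfl

theorem diff_mu_ne_zero_of_gravity {x : X} {κ : ℝ} (hκ : κ ≠ 0)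
    (hg : ∀ w : ℝ × TangentSpace (𝓡 n) x,
      diff (𝓡 n) (S.mu V) x w.2 = 2 * κ * S.metric x (1, V x) w) :
    diff (𝓡 n) (S.mu V) x ≠ 0 := by
  intro h0
  have h1 : ∀ w, S.metric x (1, V x) w = 0 := fun w => by
    have h2 := hg w
    rw [h0] at h2
    exact (mul_eq_zero.1 h2.symm).resolve_left (mul_ne_zero two_ne_zero hκ)
  have h3 := S.metric_nondegenerate x h1
  exact one_ne_zero (congrArg Prod.fst h3)

variable (hV : ∀ x₀, ContDiffOn ℝ ∞ (S.localData V k ℓ x₀).V (extChartAt (𝓡 n) x₀).target)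

include hV

theorem contDiffOn_localData_mu (x₀ : X) :
    ContDiffOn ℝ ∞ (S.localData V k ℓ x₀).mu (extChartAt (𝓡 n) x₀).target := by
  have hK : ContDiffOn ℝ ∞ (S.localData V k ℓ x₀).K (extChartAt (𝓡 n) x₀).target :=
    contDiffOn_const.prodMk (hV x₀)
  exact ((S.contDiffOn_localData_g V k ℓ x₀).clm_apply hK).clm_apply hK

theorem contDiffOn_localData_dm (x₀ : X) :
    ContDiffOn ℝ ∞ (S.localData V k ℓ x₀).dm (extChartAt (𝓡 n) x₀).target :=
  (contDiffOn_localData_mu hV x₀).fderiv_of_isOpen (isOpen_extChartAt_target x₀) (by simp)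

theorem contMDiff_mu : ContMDiff (𝓡 n) 𝓘(ℝ) ∞ (S.mu V) := fun x => by
  refine contMDiffAt_of_chart (x₀ := x) (mem_chart_source _ x) ?_
  have hx := mem_extChartAt_target (I := 𝓡 n) x
  refine ((contDiffOn_localData_mu hV x).contDiffAt
    ((isOpen_extChartAt_target x).mem_nhds hx)).congr_of_eventuallyEq ?_
  filter_upwards [(isOpen_extChartAt_target x).mem_nhds hx] with y hy
  rw [localData_mu hy]
  rfl

theorem localData_dm {x₀ : X} {y : EuclideanSpace ℝ (Fin n)}
    (hy : y ∈ (extChartAt (𝓡 n) x₀).target) (v : EuclideanSpace ℝ (Fin n)) :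
    (S.localData V k ℓ x₀).dm y v = diff (𝓡 n) (S.mu V) ((extChartAt (𝓡 n) x₀).symm y)
      (ofCoord x₀ ((extChartAt (𝓡 n) x₀).symm y) v) := by
  rw [← fderiv_comp_chart_symm hy ((contMDiff_mu hV _).mdifferentiableAt (by simp))]
  rw [LocalData.dm]
  congr 1
  refine Filter.EventuallyEq.fderiv_eq ?_
  filter_upwards [(isOpen_extChartAt_target x₀).mem_nhds hy] with y hy
  rw [localData_mu hy]
  rfl

theorem localData_dm_toCoord {x₀ x : X} (hx : x ∈ (chartAt (EuclideanSpace ℝ (Fin n)) x₀).source)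
    (v : TangentSpace (𝓡 n) x) :
    (S.localData V k ℓ x₀).dm (extChartAt (𝓡 n) x₀ x) (toCoord x₀ x v) =
      diff (𝓡 n) (S.mu V) x v := by
  rw [← diff_eq_fderiv_chart hx ((contMDiff_mu hV _).mdifferentiableAt (by simp)), LocalData.dm]
  congr 1
  refine Filter.EventuallyEq.fderiv_eq ?_
  filter_upwards [(isOpen_extChartAt_target x₀).mem_nhds
    ((extChartAt (𝓡 n) x₀).map_source (by rwa [extChartAt_source]))] with y hy
  rw [localData_mu hy]
  rfl

theorem localData_dm_ne_zero {x₀ : X} (h : diff (𝓡 n) (S.mu V) x₀ ≠ 0) :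
    (S.localData V k ℓ x₀).dm (extChartAt (𝓡 n) x₀ x₀) ≠ 0 := by
  intro h0
  refine h (ContinuousLinearMap.ext fun w => ?_)
  rw [← localData_dm_toCoord hV (mem_chart_source _ x₀), h0]
  rfl

theorem localData_dm_V {x₀ : X} {y : EuclideanSpace ℝ (Fin n)}
    (hy : y ∈ (extChartAt (𝓡 n) x₀).target) :
    (S.localData V k ℓ x₀).dm y ((S.localData V k ℓ x₀).V y) =
      diff (𝓡 n) (S.mu V) ((extChartAt (𝓡 n) x₀).symm y) (V ((extChartAt (𝓡 n) x₀).symm y)) := by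
  rw [localData_dm hV hy, ofCoord_localData_V hy]

theorem contMDiff_diff_mu_V :
    ContMDiff (𝓡 n) 𝓘(ℝ) ∞ (fun y => diff (𝓡 n) (S.mu V) y (V y)) := fun x => by
  refine contMDiffAt_of_chart (x₀ := x) (mem_chart_source _ x) ?_
  have hx := mem_extChartAt_target (I := 𝓡 n) x
  refine (((contDiffOn_localData_dm hV x).clm_apply (hV x)).contDiffAt
    ((isOpen_extChartAt_target x).mem_nhds hx)).congr_of_eventuallyEq ?_
  filter_upwards [(isOpen_extChartAt_target x).mem_nhds hx] with y hy
  rw [localData_dm_V hV hy]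
  rfl

end Pointwise

namespace HorizonData

variable {S} {V : ∀ x : X, TangentSpace (𝓡 n) x} {k : X → ℝ}
  {ℓ : ∀ x : X, TangentSpace (𝓡 n) x →L[ℝ] TangentSpace (𝓡 n) x →L[ℝ] ℝ} {H : Set X}
  (hd : S.HorizonData V k ℓ H)

include hd

theorem localData_ell_pos {x₀ : X} {y : EuclideanSpace ℝ (Fin n)}
    (hy : y ∈ (extChartAt (𝓡 n) x₀).target) (u : EuclideanSpace ℝ (Fin n)) (hu : u ≠ 0) :
    0 < (S.localData V k ℓ x₀).ell y u u := by
  refine hd.ell_pos _ _ fun h => hu ?_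
  rw [← toCoord_ofCoord (chart_symm_mem hy) u]
  exact (congrArg _ h).trans (map_zero _)

theorem diff_mu_ne_zero {x : X} (hx : x ∈ H) : diff (𝓡 n) (S.mu V) x ≠ 0 :=
  diff_mu_ne_zero_of_gravity (hd.k_ne_zero x hx) (hd.gravity x hx)

/-- In coordinates around a point of the horizon, the local analysis applies. -/
theorem exists_isHorizonOn {x₀ : X} (hx₀ : x₀ ∈ H) : ∃ Ω ⊆ (extChartAt (𝓡 n) x₀).target,
    (S.localData V k ℓ x₀).IsHorizonOn Ω (extChartAt (𝓡 n) x₀ x₀) ∧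
    (∀ y ∈ Ω, (S.localData V k ℓ x₀).mu y = 0 → (extChartAt (𝓡 n) x₀).symm y ∈ H) := by
  set D := S.localData V k ℓ x₀ with hD
  set φ := extChartAt (𝓡 n) x₀ with hφ
  have hy₀ : φ x₀ ∈ φ.target := mem_extChartAt_target x₀
  have hopen : IsOpen φ.target := isOpen_extChartAt_target x₀
  have hsymm : φ.symm (φ x₀) = x₀ := φ.left_inv (mem_extChartAt_source x₀)
  have hmu : D.mu (φ x₀) = 0 := by
    rw [hD, localData_mu hy₀, ← hφ, hsymm]; exact hd.mu_eq_zero _ hx₀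
  have hdm := contDiffOn_localData_dm hd.smooth_V x₀
  have hk := hd.smooth_k x₀
  have hO : ∀ᶠ y in 𝓝 (φ x₀), S.mu V (φ.symm y) = 0 → φ.symm y ∈ H := by
    have h1 : ContinuousAt φ.symm (φ x₀) := (contMDiffAt_chart_symm hy₀).continuousAt
    have h2 := hd.isolated x₀ hx₀
    rw [ContinuousAt, hsymm] at h1
    exact h1.eventually h2
  have hdm0 : D.dm (φ x₀) ≠ 0 := localData_dm_ne_zero hd.smooth_V (hd.diff_mu_ne_zero hx₀)
  have hk0 : D.k (φ x₀) ≠ 0 := by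
    change k (φ.symm (φ x₀)) ≠ 0
    rw [hsymm]
    exact hd.k_ne_zero _ hx₀
  obtain ⟨O, hO1, hO2, hO3⟩ := eventually_nhds_iff.1 (hO.and
    (((hdm.continuousOn.continuousAt (hopen.mem_nhds hy₀)).eventually_ne hdm0).and
    ((hk.continuousOn.continuousAt (hopen.mem_nhds hy₀)).eventually_ne hk0)))
  have hiso : ∀ y ∈ φ.target ∩ O, D.mu y = 0 → φ.symm y ∈ H := by
    intro y hy h0
    rw [hD, localData_mu hy.1] at h0
    exact (hO1 y hy.2).1 h0
  refine ⟨φ.target ∩ O, inter_subset_left, ?_, hiso⟩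
  have hm := S.isMetricOn_localData V k ℓ x₀
  refine { isOpen := hopen.inter hO2, smooth_g := hm.smooth_g.mono inter_subset_left,
           symm := fun y hy => hm.symm y hy.1, invertible := fun y hy => hm.invertible y hy.1,
           mem := ⟨hy₀, hO3⟩, smooth_V := (hd.smooth_V x₀).mono inter_subset_left,
           smooth_k := hk.mono inter_subset_left,
           smooth_ell := (hd.smooth_ell x₀).mono inter_subset_left,
           ell_symm := fun y _ u w => hd.ell_symm _ _ _,
           ell_pos := fun y hy => hd.localData_ell_pos hy.1,
           mu_eq_zero := hmu, dm_ne_zero := fun y hy => (hO1 y hy.2).2.1,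
           k_ne_zero := fun y hy => (hO1 y hy.2).2.2, gravity := ?_, quadratic := ?_,
           constant := ?_, killing := ?_ }
  · intro y hy h0 w
    have h1 := hd.gravity _ (hiso y hy h0) (w.1, ofCoord x₀ (φ.symm y) w.2)
    rw [localData_dm hd.smooth_V hy.1, localData_g_apply, LocalData.K_snd, ofCoord_localData_V hy.1]
    exact h1
  · intro y hy h0
    refine ContinuousLinearMap.ext fun v => ?_
    have h1 := hd.quadratic _ (hiso y hy h0)
    have h2 := fderiv_comp_chart_symm hy.1
      ((contMDiff_diff_mu_V hd.smooth_V _).mdifferentiableAt (by simp)) v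
    rw [← hφ, h1] at h2
    refine Eq.trans ?_ h2
    congr 1
    refine Filter.EventuallyEq.fderiv_eq ?_
    filter_upwards [hopen.mem_nhds hy.1] with y hy
    rw [localData_dm_V hd.smooth_V hy]
    rfl
  · have hkd : MDifferentiableAt (𝓡 n) 𝓘(ℝ) k (φ.symm (φ x₀)) := by
      refine (contMDiffAt_of_chart (x₀ := x₀) (chart_symm_mem hy₀) ?_).mdifferentiableAt
        (n := ∞) (by simp)
      rw [← hφ, hsymm]
      exact hk.contDiffAt (hopen.mem_nhds hy₀)
    have h1 := fderiv_comp_chart_symm hy₀ hkd (D.V (φ x₀))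
    rw [ofCoord_localData_V hy₀, ← hφ] at h1
    refine Eq.trans h1 ?_
    have h2 : ∀ x, x ∈ H → diff (𝓡 n) k x (V x) = 0 := hd.constant
    exact h2 _ (by rwa [hsymm])
  · exact hd.killing x₀ hx₀

end HorizonData

end Setting

/-! ### The horizon as a component of the zero set -/

/-- The zero set of a submersion is locally connected. -/
theorem exists_nhds_isPreconnected_zero {E : Type*} [NormedAddCommGroup E] [NormedSpace ℝ E]
    [FiniteDimensional ℝ E] {f : E → ℝ} {f' : E →L[ℝ] ℝ} {y₀ : E}
    (hf : HasStrictFDerivAt f f' y₀) (hf' : f' ≠ 0) (h0 : f y₀ = 0) {U : Set E} (hU : U ∈ 𝓝 y₀) :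
    ∃ W ∈ 𝓝 y₀, W ⊆ U ∧ IsPreconnected (W ∩ {y | f y = 0}) := by
  have := FiniteDimensional.complete ℝ E
  have hr : f'.range = ⊤ := LinearMap.range_eq_top.2 (LinearMap.surjective (f := f'.toLinearMap)
    fun h => hf' (ContinuousLinearMap.coe_injective h))
  set e := hf.implicitToOpenPartialHomeomorph f f' hr with he
  have hs : y₀ ∈ e.source := hf.mem_implicitToOpenPartialHomeomorph_source hr
  have hfst : ∀ y, (e y).1 = f y := fun y => hf.implicitToOpenPartialHomeomorph_fst hr y
  have hself : e y₀ = (0, 0) := by rw [he, hf.implicitToOpenPartialHomeomorph_self hr, h0]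
  have hmem : e.target ∩ e.symm ⁻¹' U ∈ 𝓝 ((0, 0) : ℝ × f'.ker) := by
    rw [← hself]
    refine Filter.inter_mem (e.open_target.mem_nhds (e.map_source hs)) ?_
    refine (e.continuousAt_symm (e.map_source hs)).preimage_mem_nhds ?_
    rwa [e.left_inv hs]
  obtain ⟨r, hr0, hball⟩ := Metric.mem_nhds_iff.1 hmem
  have hball' : Metric.ball ((0, 0) : ℝ × f'.ker) r = Metric.ball 0 r ×ˢ Metric.ball 0 r :=
    (ball_prod_same _ _ _).symm
  refine ⟨e.source ∩ e ⁻¹' Metric.ball (0, 0) r, ?_, ?_, ?_⟩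
  · refine Filter.inter_mem (e.open_source.mem_nhds hs) ?_
    refine (e.continuousAt hs).preimage_mem_nhds ?_
    rw [hself]
    exact Metric.ball_mem_nhds _ hr0
  · rintro y ⟨hy, hyb⟩
    have := (hball hyb).2
    rwa [mem_preimage, e.left_inv hy] at this
  · have h1 : e.source ∩ e ⁻¹' Metric.ball (0, 0) r ∩ {y | f y = 0} =
        e.symm '' (({0} : Set ℝ) ×ˢ Metric.ball (0 : f'.ker) r) := by
      ext y
      constructor
      · rintro ⟨⟨hy, hyb⟩, hy0⟩
        refine ⟨e y, ⟨?_, ?_⟩, e.left_inv hy⟩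
        · rw [hfst]; exact hy0
        · rw [hball'] at hyb; exact hyb.2
      · rintro ⟨w, ⟨hw1, hw2⟩, rfl⟩
        have hwb : w ∈ Metric.ball ((0, 0) : ℝ × f'.ker) r := by
          rw [hball', mem_prod, mem_singleton_iff.1 hw1]
          exact ⟨Metric.mem_ball_self hr0, hw2⟩
        have hwt := (hball hwb).1
        refine ⟨⟨e.map_target hwt, ?_⟩, ?_⟩
        · rwa [mem_preimage, e.right_inv hwt]
        · rw [mem_ofPred_eq, ← hfst, e.right_inv hwt]; exact hw1
    rw [h1]
    refine (isPreconnected_singleton.prod (convex_ball _ _).isPreconnected).image _ ?_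
    refine e.continuousOn_symm.mono fun w hw => (hball ?_).1
    rw [hball', mem_prod, mem_singleton_iff.1 hw.1]
    exact ⟨Metric.mem_ball_self hr0, hw.2⟩

namespace Setting

variable {n : ℕ} {M : Type*} [TopologicalSpace M] [ChartedSpace (EuclideanHalfSpace (n + 1)) M]
  [IsManifold (𝓡∂ (n + 1)) ∞ M]
  {X : Type*} [TopologicalSpace X] [ChartedSpace (EuclideanSpace ℝ (Fin n)) X]
  [IsManifold (𝓡 n) ∞ X] {S : Setting n M X}

section Component

variable {V : ∀ x : X, TangentSpace (𝓡 n) x} {k : X → ℝ}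
  {ℓ : ∀ x : X, TangentSpace (𝓡 n) x →L[ℝ] TangentSpace (𝓡 n) x →L[ℝ] ℝ} {H : Set X}
  (hV : ∀ x₀, ContDiffOn ℝ ∞ (S.localData V k ℓ x₀).V (extChartAt (𝓡 n) x₀).target)

include hV

/-- A component of `{μ = 0}` on which `dμ ≠ 0` is open in `{μ = 0}`. -/
theorem eventually_mem_component {x₁ x : X}
    (hx : x ∈ connectedComponentIn {x | S.mu V x = 0} x₁) (hne : diff (𝓡 n) (S.mu V) x ≠ 0) :
    ∀ᶠ y in 𝓝 x, S.mu V y = 0 → y ∈ connectedComponentIn {x | S.mu V x = 0} x₁ := by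
  set φ := extChartAt (𝓡 n) x with hφ
  have hy₀ : φ x ∈ φ.target := mem_extChartAt_target x
  have hsymm : φ.symm (φ x) = x := φ.left_inv (mem_extChartAt_source x)
  have hxF : S.mu V x = 0 := (connectedComponentIn_subset {x | S.mu V x = 0} x₁) hx
  have hsm := (contDiffOn_localData_mu hV x).contDiffAt ((isOpen_extChartAt_target x).mem_nhds hy₀)
  obtain ⟨W, hW, hWU, hWc⟩ := exists_nhds_isPreconnected_zero
    (hsm.hasStrictFDerivAt (by simp)) (localData_dm_ne_zero hV hne)
    (by rw [localData_mu hy₀, ← hφ, hsymm, hxF])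
    ((isOpen_extChartAt_target x).mem_nhds hy₀)
  have hsub : φ.symm '' (W ∩ {y | (S.localData V k ℓ x).mu y = 0}) ⊆
      connectedComponentIn {x | S.mu V x = 0} x₁ := by
    rw [connectedComponentIn_eq hx]
    refine IsPreconnected.subset_connectedComponentIn (hWc.image _ ?_) ?_ ?_
    · exact (continuousOn_extChartAt_symm x).mono fun y hy => hWU hy.1
    · refine ⟨φ x, ⟨mem_of_mem_nhds hW, ?_⟩, hsymm⟩
      rw [mem_ofPred_eq, localData_mu hy₀, ← hφ, hsymm, hxF]
    · rintro _ ⟨y, ⟨hy, hy0⟩, rfl⟩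
      rw [mem_ofPred_eq, localData_mu (hWU hy)] at hy0
      exact hy0
  filter_upwards [(continuousAt_extChartAt (I := 𝓡 n) x).preimage_mem_nhds hW,
    extChartAt_source_mem_nhds (I := 𝓡 n) x] with y hyW hys hy0
  refine hsub ⟨φ y, ⟨hyW, ?_⟩, φ.left_inv hys⟩
  rw [mem_ofPred_eq, localData_mu (hWU hyW), ← hφ, φ.left_inv hys, hy0]

/-- The tangent space of the horizon is the kernel of `dμ`. -/
theorem mem_tangentTo_iff (hmu : ∀ x ∈ H, S.mu V x = 0)
    (hiso : ∀ x ∈ H, ∀ᶠ y in 𝓝 x, S.mu V y = 0 → y ∈ H) {x : X} (hx : x ∈ H)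
    (hne : diff (𝓡 n) (S.mu V) x ≠ 0) {v : TangentSpace (𝓡 n) x} :
    v ∈ tangentTo (𝓡 n) H x ↔ diff (𝓡 n) (S.mu V) x v = 0 := by
  refine ⟨fun h => h _ (contMDiff_mu hV) hmu, fun hv f hf hf0 => ?_⟩
  set φ := extChartAt (𝓡 n) x with hφ
  have hy₀ : φ x ∈ φ.target := mem_extChartAt_target x
  have hsymm : φ.symm (φ x) = x := φ.left_inv (mem_extChartAt_source x)
  have hsm := (contDiffOn_localData_mu hV x).contDiffAt ((isOpen_extChartAt_target x).mem_nhds hy₀)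
  have hfm := (contDiffOn_chart hf x).contDiffAt ((isOpen_extChartAt_target x).mem_nhds hy₀)
  rw [← diff_eq_fderiv_chart (mem_chart_source _ x) ((hf x).mdifferentiableAt (by simp))]
  refine deriv_eq_zero_of_vanishing (hsm.hasStrictFDerivAt (by simp))
    (LinearMap.surjective (f := ((S.localData V k ℓ x).dm (φ x)).toLinearMap) fun h =>
      localData_dm_ne_zero hV hne (ContinuousLinearMap.coe_injective h))
    (by rw [localData_mu hy₀, ← hφ, hsymm, hmu x hx]) (hfm.hasStrictFDerivAt (by simp)) ?_ ?_
  · have h1 : ContinuousAt φ.symm (φ x) := (contMDiffAt_chart_symm hy₀).continuousAt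
    have h2 := hiso x hx
    rw [ContinuousAt, hsymm] at h1
    filter_upwards [h1.eventually h2, (isOpen_extChartAt_target x).mem_nhds hy₀] with y hy hyt hy0
    rw [localData_mu hyt] at hy0
    exact hf0 _ (hy hy0)
  · exact (localData_dm_toCoord hV (mem_chart_source _ x) v).trans hv

end Component

/-! ### Vector fields in coordinates -/

section Fields

variable {V : ∀ x : X, TangentSpace (𝓡 n) x} {k : X → ℝ}
  {ℓ : ∀ x : X, TangentSpace (𝓡 n) x →L[ℝ] TangentSpace (𝓡 n) x →L[ℝ] ℝ}

theorem contDiffOn_localData_V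
    (hV : ContMDiff (𝓡 n) (𝓡 n).tangent ∞ (fun x => (⟨x, V x⟩ : TangentBundle (𝓡 n) X))) (x₀ : X) :
    ContDiffOn ℝ ∞ (S.localData V k ℓ x₀).V (extChartAt (𝓡 n) x₀).target := by
  rw [← contMDiffOn_iff_contDiffOn]
  have h1 := ((trivializationAt (EuclideanSpace ℝ (Fin n)) (TangentSpace (𝓡 n))
    x₀).contMDiffOn_section_baseSet_iff (IB := 𝓡 n) (n := ∞)).1 hV.contMDiffOn
  refine (h1.comp (contMDiffOn_extChartAt_symm x₀) fun y hy => chart_symm_mem hy).congr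
    fun y hy => ?_
  change (trivializationAt (EuclideanSpace ℝ (Fin n)) (TangentSpace (𝓡 n))
    x₀).continuousLinearMapAt ℝ _ _ = _
  rw [Trivialization.continuousLinearMapAt_apply, Trivialization.linearMapAt_apply,
    if_pos (by exact chart_symm_mem hy)]
  rfl

theorem contMDiffAt_ofCoord (x : X) (v : EuclideanSpace ℝ (Fin n)) :
    ContMDiffAt (𝓡 n) (𝓡 n).tangent ∞
      (fun y => (⟨y, ofCoord x y v⟩ : TangentBundle (𝓡 n) X)) x := by
  rw [contMDiffAt_section]
  refine contMDiffAt_const (c := v) |>.congr_of_eventuallyEq ?_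
  filter_upwards [(chartAt (EuclideanSpace ℝ (Fin n)) x).open_source.mem_nhds
    (mem_chart_source _ x)] with y hy
  have h1 := toCoord_ofCoord hy v
  rw [toCoord, Trivialization.continuousLinearMapAt_apply, Trivialization.linearMapAt_apply,
    if_pos (by exact hy)] at h1
  exact h1

theorem inverse_eq_toCoord {x₀ x : X} (hx : x ∈ (chartAt (EuclideanSpace ℝ (Fin n)) x₀).source)
    {A : EuclideanSpace ℝ (Fin n) →L[ℝ] TangentSpace (𝓡 n) x} (hA : ∀ v, A v = ofCoord x₀ x v) :
    A.inverse = toCoord x₀ x := by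
  obtain rfl : A = ofCoord x₀ x := ContinuousLinearMap.ext hA
  exact ContinuousLinearMap.inverse_eq (ContinuousLinearMap.ext (ofCoord_toCoord hx))
    (ContinuousLinearMap.ext (toCoord_ofCoord hx))

theorem _root_.BHorizon.lieBracket_const {E : Type*} [NormedAddCommGroup E] [NormedSpace ℝ E]
    {A A' B : E → E} {y v : E} (hA : A =ᶠ[𝓝 y] A') (hB : B =ᶠ[𝓝 y] fun _ => v) :
    VectorField.lieBracket ℝ A B y = -fderiv ℝ A' y v := by
  rw [VectorField.lieBracket, hA.fderiv_eq, hB.fderiv_eq, hB.eq_of_nhds]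
  simp

theorem mlieBracket_ofCoord (V : ∀ x : X, TangentSpace (𝓡 n) x) (x : X)
    (v : EuclideanSpace ℝ (Fin n)) :
    VectorField.mlieBracket (𝓡 n) V (fun y => ofCoord x y v) x =
      -ofCoord x x (fderiv ℝ (S.localData V k ℓ x).V (extChartAt (𝓡 n) x x) v) := by
  have hinv : (mfderiv (𝓡 n) 𝓘(ℝ, EuclideanSpace ℝ (Fin n)) (extChartAt (𝓡 n) x) x).inverse =
      ofCoord x x := by
    have h1 : mfderiv (𝓡 n) 𝓘(ℝ, EuclideanSpace ℝ (Fin n)) (extChartAt (𝓡 n) x) x = toCoord x x :=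
      ContinuousLinearMap.ext fun w => (toCoord_eq_mfderiv (mem_chart_source _ x) w).symm
    rw [h1]
    exact ContinuousLinearMap.inverse_eq
      (ContinuousLinearMap.ext (toCoord_ofCoord (mem_chart_source _ x)))
      (ContinuousLinearMap.ext (ofCoord_toCoord (mem_chart_source _ x)))
  have hpull : ∀ W : ∀ x : X, TangentSpace (𝓡 n) x,
      VectorField.mpullbackWithin 𝓘(ℝ, EuclideanSpace ℝ (Fin n)) (𝓡 n) (extChartAt (𝓡 n) x).symm W
        (range (𝓡 n)) =ᶠ[𝓝 (extChartAt (𝓡 n) x x)]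
      fun y => toCoord x ((extChartAt (𝓡 n) x).symm y) (W ((extChartAt (𝓡 n) x).symm y)) := by
    intro W
    filter_upwards [(isOpen_extChartAt_target x).mem_nhds (mem_extChartAt_target x)] with y hy
    rw [VectorField.mpullbackWithin_apply]
    congr 1
    rw [ModelWithCorners.range_eq_univ, mfderivWithin_univ]
    refine inverse_eq_toCoord (chart_symm_mem hy) fun w => ?_
    rw [ofCoord_eq_mfderiv (chart_symm_mem hy), (extChartAt (𝓡 n) x).right_inv hy]
    rfl
  have hconst : VectorField.mpullbackWithin 𝓘(ℝ, EuclideanSpace ℝ (Fin n)) (𝓡 n)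
      (extChartAt (𝓡 n) x).symm (fun y => ofCoord x y v) (range (𝓡 n))
      =ᶠ[𝓝 (extChartAt (𝓡 n) x x)] fun _ => v := by
    filter_upwards [hpull (fun y => ofCoord x y v),
      (isOpen_extChartAt_target x).mem_nhds (mem_extChartAt_target x)] with y hy hyt
    rw [hy, toCoord_ofCoord (chart_symm_mem hyt)]
  rw [VectorField.mlieBracket, VectorField.mlieBracketWithin_apply, hinv]
  refine (congrArg (ofCoord x x) ?_).trans (map_neg _ _)
  rw [preimage_univ, univ_inter]
  rw [ModelWithCorners.range_eq_univ] at hpull hconst ⊢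
  refine (congrFun (VectorField.lieBracketWithin_univ) _).trans ?_
  exact lieBracket_const (hpull V) hconst

end Fields

theorem gravity_of_core {V : ∀ x : X, TangentSpace (𝓡 n) x} {H : Set X} {κ : X → ℝ}
    (h : S.IsHorizonCore V H κ) {x : X} (hx : x ∈ H) (w : ℝ × TangentSpace (𝓡 n) x) :
    diff (𝓡 n) (S.mu V) x w.2 = 2 * κ x * S.metric x (1, V x) w := by
  have h1 := (S.sharp_eq_iff x).1 (h.surfaceGravity x hx)
  have h2 := congrArg (fun l => l w) h1
  rw [map_smul] at h2
  have h3 : covector x 0 (diff (𝓡 n) (S.mu V) x) w = diff (𝓡 n) (S.mu V) x w.2 := by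
    simp [covector]
  rw [← h3, ← h2]
  rfl

/-- A horizon generated by `τ∂_τ + V`, with `V` Killing, satisfies the local assumptions. -/
theorem horizonData_of_generatedBy {V : ∀ x : X, TangentSpace (𝓡 n) x} {H : Set X} {κ : X → ℝ}
    (h : S.IsBHorizonGeneratedBy V H κ) (hκ : ∀ x ∈ H, κ x ≠ 0) :
    ∃ k ℓ, S.HorizonData V k ℓ H ∧ ∀ x ∈ H, k x = κ x := by
  obtain ⟨k, hk, hkκ, hkV⟩ := h.constant
  obtain ⟨ℓ, hℓ⟩ := h.killing
  have hV := fun x₀ => contDiffOn_localData_V (S := S) (k := k) (ℓ := ℓ.inner) h.smooth x₀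
  have hne : ∀ x ∈ H, diff (𝓡 n) (S.mu V) x ≠ 0 := fun x hx =>
    diff_mu_ne_zero_of_gravity (hκ x hx) (gravity_of_core h.toIsHorizonCore hx)
  obtain ⟨x₁, hx₁, hH⟩ := h.component
  have hmu : ∀ x ∈ H, S.mu V x = 0 := by
    rw [hH]; exact connectedComponentIn_subset {x | S.mu V x = 0} x₁
  have hiso : ∀ x ∈ H, ∀ᶠ y in 𝓝 x, S.mu V y = 0 → y ∈ H := by
    intro x hx
    have h1 := eventually_mem_component hV (x₁ := x₁) (hH ▸ hx) (hne x hx)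
    rwa [← hH] at h1
  have hell : ∀ x₀, ContDiffOn ℝ ∞ (S.localData V k ℓ.inner x₀).ell
      (extChartAt (𝓡 n) x₀).target := by
    intro x₀
    rw [contDiffOn_clm_apply]
    intro v
    rw [contDiffOn_clm_apply]
    intro w
    refine (contDiffOn_form₂ (isOpen_extChartAt_target x₀) (contMDiffOn_extChartAt_symm x₀)
      ℓ.contMDiff v w).congr fun y hy => ?_
    rw [localData_ell_apply, ofCoord_eq_mfderiv (chart_symm_mem hy),
      ofCoord_eq_mfderiv (chart_symm_mem hy), (extChartAt (𝓡 n) x₀).right_inv hy]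
  refine ⟨k, ℓ.inner, ⟨h.isCompact, hmu, hiso, hV, fun x₀ => contDiffOn_chart hk x₀, hell,
    ℓ.symm, ℓ.pos, fun x hx => by rw [hkκ x hx]; exact hκ x hx, fun x hx w => by
      rw [hkκ x hx]; exact gravity_of_core h.toIsHorizonCore hx w,
    fun x hx => (h.quadratic x hx).2, hkV, ?_⟩, hkκ⟩
  intro x hx v hv
  have hy₀ := mem_extChartAt_target (I := 𝓡 n) x
  have hc := mem_chart_source (EuclideanSpace ℝ (Fin n)) x
  set D := S.localData V k ℓ.inner x with hD
  -- the Killing equation for a vector field with constant components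
  have htan : ofCoord x x v ∈ tangentTo (𝓡 n) H x := by
    rw [mem_tangentTo_iff hV hmu hiso hx (hne x hx), ← localData_dm_toCoord hV hc,
      toCoord_ofCoord hc]
    exact hv
  have h1 := hℓ x hx (fun y => ofCoord x y v) (fun y => ofCoord x y v)
    (contMDiffAt_ofCoord x v) (contMDiffAt_ofCoord x v) htan htan
  rw [mlieBracket_ofCoord (S := S) (k := k) (ℓ := ℓ.inner)] at h1
  have hellx := (hell x).contDiffAt ((isOpen_extChartAt_target x).mem_nhds hy₀)
  have hsm : ContDiffAt ℝ ∞ (fun y => D.ell y v v) (extChartAt (𝓡 n) x x) :=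
    (hellx.clm_apply contDiffAt_const).clm_apply contDiffAt_const
  have h2 : diff (𝓡 n) (fun y => ℓ.inner y (ofCoord x y v) (ofCoord x y v)) x (V x) =
      fderiv ℝ D.ell (extChartAt (𝓡 n) x x) (D.V (extChartAt (𝓡 n) x x)) v v := by
    rw [← diff_eq_fderiv_chart hc]
    · have h3 : HasFDerivAt (fun y => D.ell y v v) _ (extChartAt (𝓡 n) x x) :=
        (((hellx.differentiableAt (by simp)).hasFDerivAt.clm_apply
          (hasFDerivAt_const v _)).clm_apply (hasFDerivAt_const v _))
      have h4 : D.V (extChartAt (𝓡 n) x x) = toCoord x x (V x) := by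
        change toCoord x ((extChartAt (𝓡 n) x).symm (extChartAt (𝓡 n) x x)) (V _) = _
        rw [(extChartAt (𝓡 n) x).left_inv (mem_extChartAt_source x)]
      rw [h4]
      refine (congrArg (fun L => L (toCoord x x (V x))) h3.fderiv).trans ?_
      simp only [add_apply, ContinuousLinearMap.flip_apply, zero_apply, map_zero,
        zero_add, ContinuousLinearMap.comp_apply]
      rfl
    · exact (contMDiffAt_of_chart (x₀ := x)
        (f := fun y => ℓ.inner y (ofCoord x y v) (ofCoord x y v)) hc hsm).mdifferentiableAt
        (by simp)
  have h5 : D.ell (extChartAt (𝓡 n) x x) (fderiv ℝ D.V (extChartAt (𝓡 n) x x) v) v =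
      ℓ.inner x (ofCoord x x (fderiv ℝ D.V (extChartAt (𝓡 n) x x) v)) (ofCoord x x v) := by
    rw [hD, localData_ell_apply, (extChartAt (𝓡 n) x).left_inv (mem_extChartAt_source x)]
  rw [h2, map_neg, map_neg, neg_apply, ℓ.symm x (ofCoord x x v), ← hD, ← h5] at h1
  linarith

/-- A horizon generated by `τ∂_τ` satisfies the local assumptions: the restriction of `-g` to the
spacelike boundary is a Riemannian metric. -/
theorem horizonData_of_bHorizon (hS : S.IsTimelike) {H : Set X} {κ : X → ℝ}
    (h : S.IsBHorizon H κ) (hκ : ∀ x ∈ H, κ x ≠ 0) :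
    ∃ k ℓ, S.HorizonData (fun _ => 0) k ℓ H ∧ ∀ x ∈ H, k x = κ x := by
  set V : ∀ x : X, TangentSpace (𝓡 n) x := fun _ => 0 with hVdef
  set ℓ : ∀ x : X, TangentSpace (𝓡 n) x →L[ℝ] TangentSpace (𝓡 n) x →L[ℝ] ℝ := fun x =>
    -pullForm (S.metric x) (ContinuousLinearMap.inr ℝ ℝ (TangentSpace (𝓡 n) x)) with hℓ
  -- as `dμ♯ = 2 κ (τ∂_τ + V)` on `H`, half the first component of `dμ♯` extends `κ`
  set k : X → ℝ := fun x => (1 / 2) * (S.sharp x (covector x 0 (diff (𝓡 n) (S.mu V) x))).1 with hk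
  have hV0 : ∀ x₀, (S.localData V k ℓ x₀).V = fun _ => 0 := fun x₀ => funext fun y =>
    map_zero _
  have hV : ∀ x₀, ContDiffOn ℝ ∞ (S.localData V k ℓ x₀).V (extChartAt (𝓡 n) x₀).target :=
    fun x₀ => by rw [hV0]; exact contDiffOn_const
  have hkκ : ∀ x ∈ H, k x = κ x := fun x hx => by
    rw [hk]
    simp only
    rw [h.surfaceGravity x hx, Prod.smul_fst, smul_eq_mul]
    ring
  have hne : ∀ x ∈ H, diff (𝓡 n) (S.mu V) x ≠ 0 := fun x hx =>
    diff_mu_ne_zero_of_gravity (hκ x hx) (gravity_of_core h hx)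
  obtain ⟨x₁, hx₁, hH⟩ := h.component
  have hmu : ∀ x ∈ H, S.mu V x = 0 := by
    rw [hH]; exact connectedComponentIn_subset {x | S.mu V x = 0} x₁
  have hiso : ∀ x ∈ H, ∀ᶠ y in 𝓝 x, S.mu V y = 0 → y ∈ H := by
    intro x hx
    have h1 := eventually_mem_component hV (x₁ := x₁) (hH ▸ hx) (hne x hx)
    rwa [← hH] at h1
  have hzero : ∀ x, diff (𝓡 n) (fun y => diff (𝓡 n) (S.mu V) y (V y)) x = 0 := by
    intro x
    have h1 : (fun y => diff (𝓡 n) (S.mu V) y (V y)) = fun _ => (0 : ℝ) :=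
      funext fun y => map_zero _
    rw [h1]
    exact mfderiv_const
  have hell : ∀ x₀, ContDiffOn ℝ ∞ (S.localData V k ℓ x₀).ell (extChartAt (𝓡 n) x₀).target := by
    intro x₀
    rw [contDiffOn_clm_apply]
    intro v
    rw [contDiffOn_clm_apply]
    intro w
    refine (((S.contDiffOn_localData_g V k ℓ x₀).clm_apply
      (contDiffOn_const (c := ((0, v) : ℝ × EuclideanSpace ℝ (Fin n))))).clm_apply
      (contDiffOn_const (c := ((0, w) : ℝ × EuclideanSpace ℝ (Fin n))))).neg.congr fun y hy => ?_
    rw [localData_ell_apply, localData_g_apply]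
    rfl
  have hksm : ∀ x₀, ContDiffOn ℝ ∞ (S.localData V k ℓ x₀).k (extChartAt (𝓡 n) x₀).target := by
    intro x₀
    have hm := S.isMetricOn_localData V k ℓ x₀
    have h1 : ContDiffOn ℝ ∞ (fun y => (S.localData V k ℓ x₀).Y
        (0, (y, (S.localData V k ℓ x₀).dm y))) (extChartAt (𝓡 n) x₀).target := by
      intro y hy
      have h2 := (contDiffOn_localData_dm hV x₀).contDiffAt (hm.isOpen.mem_nhds hy)
      have h3 : ContDiffAt ℝ ∞ (fun y => ((0, (y, (S.localData V k ℓ x₀).dm y)) :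
          ℝ × (EuclideanSpace ℝ (Fin n) × (EuclideanSpace ℝ (Fin n) →L[ℝ] ℝ)))) y :=
        contDiffAt_const.prodMk (contDiffAt_id.prodMk h2)
      exact (ContDiffAt.comp y (hm.contDiffAt_Y (z := (0, (y, (S.localData V k ℓ x₀).dm y)))
        hy) h3).contDiffWithinAt
    refine ((contDiffOn_const (c := (1 / 2 : ℝ))).mul (contDiff_fst.comp_contDiffOn h1)).congr
      fun y hy => ?_
    change (1 / 2) * (S.sharp ((extChartAt (𝓡 n) x₀).symm y) (covector _ 0 _)).1 = (1 / 2) * _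
    congr 1
    set x := (extChartAt (𝓡 n) x₀).symm y with hx
    set u := S.sharp x (covector x 0 (diff (𝓡 n) (S.mu V) x)) with hu
    have h2 : (S.localData V k ℓ x₀).Y (0, (y, (S.localData V k ℓ x₀).dm y)) =
        (u.1, toCoord x₀ x u.2) := by
      refine hm.Y_of_covZ_eq hy rfl (ContinuousLinearMap.ext fun w => ?_)
      rw [LocalData.covZ_apply, localData_g_apply, ← hx, ofCoord_toCoord (chart_symm_mem hy)]
      refine Eq.trans ?_ (congrArg (fun l => l (w.1, ofCoord x₀ x w.2))
        (S.metric_sharp x (covector x 0 (diff (𝓡 n) (S.mu V) x)))).symm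
      simp only [zero_mul, zero_add]
      rw [localData_dm hV hy]
      simp only [covector, zero_smul, zero_add]
      rfl
    rw [Function.comp_apply, h2]
  refine ⟨k, ℓ, ⟨h.isCompact, hmu, hiso, hV, hksm, hell, ?_, ?_, fun x hx => by
      rw [hkκ x hx]; exact hκ x hx, fun x hx w => by
      rw [hkκ x hx]; exact gravity_of_core h hx w,
    fun x _ => hzero x, fun x _ => map_zero _, ?_⟩, hkκ⟩
  · intro x v w
    exact congrArg Neg.neg (S.metric_symm x (0, v) (0, w))
  · intro x v hv
    exact neg_pos.2 (S.metric_tangent_neg hS x hv)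
  · intro x hx v hv
    rw [hV0]
    simp

theorem HorizonData.continuous_k {V : ∀ x : X, TangentSpace (𝓡 n) x} {k : X → ℝ}
    {ℓ : ∀ x : X, TangentSpace (𝓡 n) x →L[ℝ] TangentSpace (𝓡 n) x →L[ℝ] ℝ} {H : Set X}
    (hd : S.HorizonData V k ℓ H) : Continuous k := continuous_iff_continuousAt.2 fun x => by
  refine (contMDiffAt_of_chart (n := n) (x₀ := x) (mem_chart_source _ x) ?_).continuousAt
  exact (hd.smooth_k x).contDiffAt ((isOpen_extChartAt_target x).mem_nhds
    (mem_extChartAt_target x))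

/-- The surface gravity has constant sign on the connected set `H`. -/
theorem HorizonData.exists_sign {V : ∀ x : X, TangentSpace (𝓡 n) x} {k : X → ℝ}
    {ℓ : ∀ x : X, TangentSpace (𝓡 n) x →L[ℝ] TangentSpace (𝓡 n) x →L[ℝ] ℝ} {H : Set X}
    (hd : S.HorizonData V k ℓ H) (hH : IsPreconnected H) :
    ∃ ε : ℝ, (ε = 1 ∨ ε = -1) ∧ ∀ x ∈ H, 0 < ε * k x := by
  by_cases hpos : ∃ x ∈ H, 0 < k x
  · obtain ⟨x, hx, hkx⟩ := hpos
    refine ⟨1, Or.inl rfl, fun y hy => ?_⟩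
    rw [one_mul]
    by_contra hneg
    obtain ⟨z, hz, hz0⟩ := hH.intermediate_value hy hx hd.continuous_k.continuousOn
      ⟨not_lt.1 hneg, hkx.le⟩
    exact hd.k_ne_zero z hz hz0
  · push Not at hpos
    refine ⟨-1, Or.inr rfl, fun y hy => ?_⟩
    have := lt_of_le_of_ne (hpos y hy) (hd.k_ne_zero y hy)
    linarith

end Setting

namespace Setting

variable {n : ℕ} {M : Type*} [TopologicalSpace M] [ChartedSpace (EuclideanHalfSpace (n + 1)) M]
  [IsManifold (𝓡∂ (n + 1)) ∞ M]
  {X : Type*} [TopologicalSpace X] [ChartedSpace (EuclideanSpace ℝ (Fin n)) X]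
  [IsManifold (𝓡 n) ∞ X] (S : Setting n M X)

/-! ### Functions on the b-cotangent bundle in coordinates -/

/-- The function `ζ ↦ ζ(K)` for `K = τ∂_τ + V`. -/
def pairing (V : ∀ x : X, TangentSpace (𝓡 n) x) (p : BCotangent n X) : ℝ :=
  p.1 + p.2.snd (V p.2.proj)

/-- The squared length, with respect to `ℓ`, of the component of a b-covector orthogonal to `dμ`. -/
def transverseSq (V : ∀ x : X, TangentSpace (𝓡 n) x)
    (ℓ : ∀ x : X, TangentSpace (𝓡 n) x →L[ℝ] TangentSpace (𝓡 n) x →L[ℝ] ℝ)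
    (p : BCotangent n X) : ℝ :=
  orthogonalLengthSq (diff (𝓡 n) (S.mu V) p.2.proj) (ℓ p.2.proj) p.2.snd

/-- The quadratic defining function `C ((ρ̂² G)² + (ρ̂ ζ(K))²) + ρ̂² Q` of the conormal set, where
`Q` is the squared length of the component orthogonal to `dμ`. -/
def conormalDefining (V : ∀ x : X, TangentSpace (𝓡 n) x)
    (ℓ : ∀ x : X, TangentSpace (𝓡 n) x →L[ℝ] TangentSpace (𝓡 n) x →L[ℝ] ℝ) (C : ℝ)
    (p : BCotangent n X) : ℝ :=
  C * ((S.rhoHat p ^ 2 * S.G p) ^ 2 + (S.rhoHat p * pairing V p) ^ 2)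
    + S.rhoHat p ^ 2 * S.transverseSq V ℓ p

section Transfer

variable {S} {V : ∀ x : X, TangentSpace (𝓡 n) x} {k : X → ℝ}
  {ℓ : ∀ x : X, TangentSpace (𝓡 n) x →L[ℝ] TangentSpace (𝓡 n) x →L[ℝ] ℝ}
  {p₀ : BCotangent n X}
  {z : ℝ × (EuclideanSpace ℝ (Fin n) × (EuclideanSpace ℝ (Fin n) →L[ℝ] ℝ))}
  (hz : z.2.1 ∈ (extChartAt (𝓡 n) (base p₀)).target)

include hz

theorem localData_Y : (S.localData V k ℓ (base p₀)).Y z =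
    ((S.sharp ((extChartAt (𝓡 n) (base p₀)).symm z.2.1) (covector _ z.1
        (z.2.2.comp (toCoord (base p₀) ((extChartAt (𝓡 n) (base p₀)).symm z.2.1))))).1,
      toCoord (base p₀) ((extChartAt (𝓡 n) (base p₀)).symm z.2.1)
      (S.sharp ((extChartAt (𝓡 n) (base p₀)).symm z.2.1) (covector _ z.1
        (z.2.2.comp (toCoord (base p₀) ((extChartAt (𝓡 n) (base p₀)).symm z.2.1))))).2) := by
  set x := (extChartAt (𝓡 n) (base p₀)).symm z.2.1 with hx
  have hc : x ∈ (chartAt (EuclideanSpace ℝ (Fin n)) (base p₀)).source := chart_symm_mem hz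
  set α := covector x z.1 (z.2.2.comp (toCoord (base p₀) x)) with hα
  refine (S.isMetricOn_localData V k ℓ (base p₀)).Y_of_covZ_eq hz rfl
    (ContinuousLinearMap.ext fun w => ?_)
  rw [LocalData.covZ_apply, localData_g_apply, ← hx, ofCoord_toCoord hc]
  refine Eq.trans ?_ (congrArg (fun l => l (w.1, ofCoord (base p₀) x w.2))
    (S.metric_sharp x α)).symm
  have h1 : toCoord (base p₀) x (ofCoord (base p₀) x w.2) = w.2 := toCoord_ofCoord hc w.2
  have h2 : α (w.1, ofCoord (base p₀) x w.2) =
      z.1 * w.1 + z.2.2 (toCoord (base p₀) x (ofCoord (base p₀) x w.2)) := rfl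
  rw [h1] at h2
  exact h2.symm

theorem localData_G : (S.localData V k ℓ (base p₀)).G z =
    S.G ((extChartAt (cotModel n) p₀).symm z) := by
  rw [extChartAt_cot_symm p₀ hz, LocalData.G, localData_Y hz, LocalData.covZ_apply]
  rfl

theorem localData_tm : (S.localData V k ℓ (base p₀)).tm z =
    S.timeFunction ((extChartAt (cotModel n) p₀).symm z) := by
  rw [extChartAt_cot_symm p₀ hz, LocalData.tm, localData_Y hz]
  set x := (extChartAt (𝓡 n) (base p₀)).symm z.2.1 with hx
  change -(S.sharp x _).1 = (-covector x 1 0) (S.sharp x _)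
  rw [neg_apply]
  congr 1
  change _ = 1 * (S.sharp x _).1 + 0
  rw [one_mul, add_zero]
  rfl

theorem localData_rh : (S.localData V k ℓ (base p₀)).rh z =
    S.rhoHat ((extChartAt (cotModel n) p₀).symm z) := by
  rw [LocalData.rh, localData_tm hz]; rfl

theorem localData_nu : (S.localData V k ℓ (base p₀)).nu z =
    pairing V ((extChartAt (cotModel n) p₀).symm z) := by
  rw [extChartAt_cot_symm p₀ hz]
  rfl

variable {H : Set X} (hd : S.HorizonData V k ℓ H)

include hd

theorem HorizonData.localData_Q : (S.localData V k ℓ (base p₀)).Q z =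
    S.transverseSq V ℓ ((extChartAt (cotModel n) p₀).symm z) := by
  have hQ : (S.localData V k ℓ (base p₀)).Q z = orthogonalLengthSq
      ((S.localData V k ℓ (base p₀)).dm z.2.1) ((S.localData V k ℓ (base p₀)).ell z.2.1) z.2.2 := rfl
  rw [hQ, extChartAt_cot_symm p₀ hz]
  set x := (extChartAt (𝓡 n) (base p₀)).symm z.2.1 with hx
  have hc : x ∈ (chartAt (EuclideanSpace ℝ (Fin n)) (base p₀)).source := chart_symm_mem hz
  have h1 : (S.localData V k ℓ (base p₀)).dm z.2.1 =
      (diff (𝓡 n) (S.mu V) x).comp (ofCoord (base p₀) x) :=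
    ContinuousLinearMap.ext fun w => localData_dm hd.smooth_V hz w
  have h2 : z.2.2 = (z.2.2.comp (toCoord (base p₀) x)).comp (ofCoord (base p₀) x) :=
    ContinuousLinearMap.ext fun w => (congrArg z.2.2 (toCoord_ofCoord hc w)).symm
  have h3 : (ℓ x).IsInvertible :=
    LocalData.isInvertible_of_pos (E := EuclideanSpace ℝ (Fin n)) (ℓ x) (hd.ell_pos x)
  have h4 : (pullForm (ℓ x) (ofCoord (base p₀) x)).IsInvertible :=
    LocalData.isInvertible_of_pos _ (hd.localData_ell_pos hz)
  rw [h1]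
  refine (congrArg (orthogonalLengthSq _ _) h2).trans ?_
  exact orthogonalLengthSq_pull (diff (𝓡 n) (S.mu V) x) h3 (z.2.2.comp (toCoord (base p₀) x))
    (A := toCoord (base p₀) x) (ofCoord_toCoord hc) h4

theorem HorizonData.localData_rho (C : ℝ) : (S.localData V k ℓ (base p₀)).rho C z =
    S.conormalDefining V ℓ C ((extChartAt (cotModel n) p₀).symm z) := by
  rw [LocalData.rho, localData_rh hz, localData_G hz, localData_nu hz, hd.localData_Q hz]
  rfl

end Transfer

/-! ### The Hamilton vector field in coordinates -/

section Hamilton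

variable {S} (V : ∀ x : X, TangentSpace (𝓡 n) x) (k : X → ℝ)
  (ℓ : ∀ x : X, TangentSpace (𝓡 n) x →L[ℝ] TangentSpace (𝓡 n) x →L[ℝ] ℝ)
  {p₀ p : BCotangent n X}

theorem extChartAt_cot_mem (hp : base p ∈ (chartAt (EuclideanSpace ℝ (Fin n)) (base p₀)).source) :
    (extChartAt (cotModel n) p₀ p).2.1 ∈ (extChartAt (𝓡 n) (base p₀)).target := by
  rw [extChartAt_cot]
  exact (extChartAt (𝓡 n) (base p₀)).map_source (by rwa [extChartAt_source])

theorem extChartAt_cot_left_inv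
    (hp : base p ∈ (chartAt (EuclideanSpace ℝ (Fin n)) (base p₀)).source) :
    (extChartAt (cotModel n) p₀).symm (extChartAt (cotModel n) p₀ p) = p :=
  (extChartAt (cotModel n) p₀).left_inv ((mem_extChartAt_cot_source p₀ p).2 hp)

theorem eventually_base_mem
    (hp : base p ∈ (chartAt (EuclideanSpace ℝ (Fin n)) (base p₀)).source) :
    ∀ᶠ q in 𝓝 p, base q ∈ (chartAt (EuclideanSpace ℝ (Fin n)) (base p₀)).source := by
  filter_upwards [(isOpen_extChartAt_source (I := cotModel n) p₀).mem_nhds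
    ((mem_extChartAt_cot_source p₀ p).2 hp)] with q hq
  exact (mem_extChartAt_cot_source p₀ q).1 hq

theorem hamilton_eq_ham (p : BCotangent n X) :
    S.hamilton p = (S.localData V k ℓ (base p)).ham (extChartAt (cotModel n) p p) := by
  have hc : base p ∈ (chartAt (EuclideanSpace ℝ (Fin n)) (base p)).source := mem_chart_source _ _
  have hm := extChartAt_cot_mem hc
  rw [(S.isMetricOn_localData V k ℓ (base p)).ham_eq hm]
  have h1 : fderiv ℝ (S.localData V k ℓ (base p)).G (extChartAt (cotModel n) p p) =
      fderiv ℝ (S.G ∘ (extChartAt (cotModel n) p).symm) (extChartAt (cotModel n) p p) := by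
    refine Filter.EventuallyEq.fderiv_eq ?_
    have h2 : ContinuousAt (fun z : ℝ × (EuclideanSpace ℝ (Fin n) ×
      (EuclideanSpace ℝ (Fin n) →L[ℝ] ℝ)) => z.2.1) (extChartAt (cotModel n) p p) := by fun_prop
    filter_upwards [h2.preimage_mem_nhds ((isOpen_extChartAt_target (base p)).mem_nhds hm)]
      with z hz
    exact localData_G hz
  rw [h1]
  rfl

/-- The differential of a change of coordinates. -/
theorem _root_.BHorizon.fderiv_transition {x₀ x₁ : X} {y : EuclideanSpace ℝ (Fin n)}
    (hy : y ∈ (extChartAt (𝓡 n) x₀).target)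
    (hx : (extChartAt (𝓡 n) x₀).symm y ∈ (chartAt (EuclideanSpace ℝ (Fin n)) x₁).source)
    (v : EuclideanSpace ℝ (Fin n)) :
    fderiv ℝ (extChartAt (𝓡 n) x₁ ∘ (extChartAt (𝓡 n) x₀).symm) y v =
      toCoord x₁ ((extChartAt (𝓡 n) x₀).symm y) (ofCoord x₀ ((extChartAt (𝓡 n) x₀).symm y) v) := by
  rw [toCoord_eq_mfderiv hx, ofCoord_eq_mfderiv (chart_symm_mem hy),
    (extChartAt (𝓡 n) x₀).right_inv hy]
  have h4 := mfderiv_comp (I := 𝓘(ℝ, EuclideanSpace ℝ (Fin n))) (I' := 𝓡 n)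
    (I'' := 𝓘(ℝ, EuclideanSpace ℝ (Fin n))) y
    (g := extChartAt (𝓡 n) x₁) (f := (extChartAt (𝓡 n) x₀).symm)
    ((contMDiffAt_extChartAt' (n := ∞) hx).mdifferentiableAt (by simp))
    ((contMDiffAt_chart_symm hy).mdifferentiableAt (by simp))
  rw [mfderiv_eq_fderiv] at h4
  exact congrArg (fun L => L v) h4

theorem cot_chart_change (hp : base p ∈ (chartAt (EuclideanSpace ℝ (Fin n)) (base p₀)).source) :
    extChartAt (cotModel n) p₀ ∘ (extChartAt (cotModel n) p).symm
      =ᶠ[𝓝 (extChartAt (cotModel n) p p)]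
    LocalData.cotChange (extChartAt (𝓡 n) (base p₀) ∘ (extChartAt (𝓡 n) (base p)).symm)
      (extChartAt (𝓡 n) (base p) ∘ (extChartAt (𝓡 n) (base p₀)).symm) := by
  have hc : base p ∈ (chartAt (EuclideanSpace ℝ (Fin n)) (base p)).source := mem_chart_source _ _
  have hm := extChartAt_cot_mem hc
  have h2 : ContinuousAt (fun z : ℝ × (EuclideanSpace ℝ (Fin n) ×
    (EuclideanSpace ℝ (Fin n) →L[ℝ] ℝ)) => z.2.1) (extChartAt (cotModel n) p p) := by fun_prop
  have hyp : (extChartAt (cotModel n) p p).2.1 = extChartAt (𝓡 n) (base p) (base p) := by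
    rw [extChartAt_cot]
  have h3 : ∀ᶠ y in 𝓝 (extChartAt (cotModel n) p p).2.1, (extChartAt (𝓡 n) (base p)).symm y ∈
      (chartAt (EuclideanSpace ℝ (Fin n)) (base p₀)).source := by
    refine (contMDiffAt_chart_symm hm).continuousAt.preimage_mem_nhds ?_
    rw [hyp, (extChartAt (𝓡 n) (base p)).left_inv (mem_extChartAt_source _)]
    exact (chartAt _ (base p₀)).open_source.mem_nhds hp
  filter_upwards [h2.preimage_mem_nhds ((isOpen_extChartAt_target (base p)).mem_nhds hm),
    h2.eventually h3] with z hz hz0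
  rw [Function.comp_apply, extChartAt_cot_symm p hz, extChartAt_cot]
  set x := (extChartAt (𝓡 n) (base p)).symm z.2.1 with hx
  have hcx : x ∈ (chartAt (EuclideanSpace ℝ (Fin n)) (base p)).source := chart_symm_mem hz
  have hy0 : extChartAt (𝓡 n) (base p₀) x ∈ (extChartAt (𝓡 n) (base p₀)).target :=
    (extChartAt (𝓡 n) (base p₀)).map_source (by rwa [extChartAt_source])
  have hsx : (extChartAt (𝓡 n) (base p₀)).symm (extChartAt (𝓡 n) (base p₀) x) = x :=
    (extChartAt (𝓡 n) (base p₀)).left_inv (by rwa [extChartAt_source])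
  refine Prod.ext rfl (Prod.ext rfl ?_)
  change (z.2.2.comp (toCoord (base p) x)).comp (ofCoord (base p₀) x) =
    z.2.2.comp (fderiv ℝ (extChartAt (𝓡 n) (base p) ∘ (extChartAt (𝓡 n) (base p₀)).symm)
      (extChartAt (𝓡 n) (base p₀) x))
  refine ContinuousLinearMap.ext fun v => congrArg z.2.2 ?_
  have h4 := fderiv_transition hy0 (x₁ := base p) (by rw [hsx]; exact hcx) v
  rw [hsx] at h4
  exact h4.symm

/-- The coordinate expression of the Hamilton vector field, in the charts around arbitrary points;
the definition uses the chart around the point in question, so this is the invariance of `H_G`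
under changes of coordinates. -/
theorem mfderiv_chart_hamilton
    (hp : base p ∈ (chartAt (EuclideanSpace ℝ (Fin n)) (base p₀)).source) :
    mfderiv (cotModel n) 𝓘(ℝ, ℝ × (EuclideanSpace ℝ (Fin n) × (EuclideanSpace ℝ (Fin n) →L[ℝ] ℝ)))
      (extChartAt (cotModel n) p₀) p (S.hamilton p) =
    (S.localData V k ℓ (base p₀)).ham (extChartAt (cotModel n) p₀ p) := by
  have hmd : MDifferentiableAt (cotModel n)
      𝓘(ℝ, ℝ × (EuclideanSpace ℝ (Fin n) × (EuclideanSpace ℝ (Fin n) →L[ℝ] ℝ)))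
      (extChartAt (cotModel n) p₀) p :=
    (contMDiffAt_extChartAt' (n := ∞) (by
      rw [← extChartAt_source (cotModel n)]
      exact (mem_extChartAt_cot_source p₀ p).2 hp)).mdifferentiableAt (by simp)
  have hc : base p ∈ (chartAt (EuclideanSpace ℝ (Fin n)) (base p)).source := mem_chart_source _ _
  have hm := extChartAt_cot_mem hc
  have hyp : (extChartAt (cotModel n) p p).2.1 = extChartAt (𝓡 n) (base p) (base p) := by
    rw [extChartAt_cot]
  have hsp : (extChartAt (𝓡 n) (base p)).symm (extChartAt (𝓡 n) (base p) (base p)) = base p :=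
    (extChartAt (𝓡 n) (base p)).left_inv (mem_extChartAt_source _)
  have hy₀ : extChartAt (𝓡 n) (base p₀) (base p) ∈ (extChartAt (𝓡 n) (base p₀)).target :=
    (extChartAt (𝓡 n) (base p₀)).map_source (by rwa [extChartAt_source])
  have hs₀ : (extChartAt (𝓡 n) (base p₀)).symm (extChartAt (𝓡 n) (base p₀) (base p)) = base p :=
    (extChartAt (𝓡 n) (base p₀)).left_inv (by rwa [extChartAt_source])
  have h1 : mfderiv (cotModel n)
      𝓘(ℝ, ℝ × (EuclideanSpace ℝ (Fin n) × (EuclideanSpace ℝ (Fin n) →L[ℝ] ℝ)))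
      (extChartAt (cotModel n) p₀) p =
      fderiv ℝ (extChartAt (cotModel n) p₀ ∘ (extChartAt (cotModel n) p).symm)
        (extChartAt (cotModel n) p p) := by
    rw [hmd.mfderiv, writtenInExtChartAt, ModelWithCorners.range_eq_univ, fderivWithin_univ]
    rfl
  rw [h1, hamilton_eq_ham V k ℓ p]
  rw [(cot_chart_change hp).fderiv_eq]
  have hψy : (extChartAt (𝓡 n) (base p₀) ∘ (extChartAt (𝓡 n) (base p)).symm)
      (extChartAt (cotModel n) p p).2.1 = extChartAt (𝓡 n) (base p₀) (base p) := by
    rw [hyp, Function.comp_apply, hsp]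
  have hθ : ContDiffAt ℝ ∞ (extChartAt (𝓡 n) (base p) ∘ (extChartAt (𝓡 n) (base p₀)).symm)
      (extChartAt (𝓡 n) (base p₀) (base p)) := by
    rw [← contMDiffAt_iff_contDiffAt]
    refine ContMDiffAt.comp (I' := 𝓡 n) _ ?_ (contMDiffAt_chart_symm hy₀)
    rw [hs₀]
    exact contMDiffAt_extChartAt
  have hevθ : ∀ᶠ y in 𝓝 (extChartAt (𝓡 n) (base p₀) (base p)),
      y ∈ (extChartAt (𝓡 n) (base p₀)).target ∧ (extChartAt (𝓡 n) (base p₀)).symm y ∈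
        (chartAt (EuclideanSpace ℝ (Fin n)) (base p)).source := by
    refine ((isOpen_extChartAt_target (base p₀)).eventually_mem hy₀).and ?_
    refine (contMDiffAt_chart_symm hy₀).continuousAt.preimage_mem_nhds ?_
    rw [hs₀]
    exact (chartAt _ (base p)).open_source.mem_nhds hc
  refine ((S.isMetricOn_localData V k ℓ (base p₀)).fderiv_cotChange_ham
    (S.isMetricOn_localData V k ℓ (base p)) hm ?_ ?_ ?_ ?_ ?_).trans ?_
  · rw [hψy]; exact hy₀
  · rw [hyp, ← contMDiffAt_iff_contDiffAt]
    refine ContMDiffAt.comp (I' := 𝓡 n) _ ?_ (contMDiffAt_chart_symm (mem_extChartAt_target _))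
    rw [hsp]
    exact contMDiffAt_extChartAt' hp
  · rw [hψy]; exact hθ
  · rw [hyp]
    have h5 : ∀ᶠ y in 𝓝 (extChartAt (𝓡 n) (base p) (base p)),
        (extChartAt (𝓡 n) (base p)).symm y ∈
          (chartAt (EuclideanSpace ℝ (Fin n)) (base p₀)).source := by
      refine (contMDiffAt_chart_symm (mem_extChartAt_target _)).continuousAt.preimage_mem_nhds ?_
      rw [hsp]
      exact (chartAt _ (base p₀)).open_source.mem_nhds hp
    filter_upwards [h5, (isOpen_extChartAt_target (base p)).mem_nhds
      (mem_extChartAt_target (I := 𝓡 n) (base p))] with y hy hyt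
    simp only [Function.comp_apply]
    rw [(extChartAt (𝓡 n) (base p₀)).left_inv (by rwa [extChartAt_source]),
      (extChartAt (𝓡 n) (base p)).right_inv hyt]
  · rw [hψy]
    filter_upwards [hevθ] with y hy u w
    have hd : ∀ v, ofCoord (base p) ((extChartAt (𝓡 n) (base p₀)).symm y)
        (fderiv ℝ (extChartAt (𝓡 n) (base p) ∘ (extChartAt (𝓡 n) (base p₀)).symm) y v) =
        ofCoord (base p₀) ((extChartAt (𝓡 n) (base p₀)).symm y) v := by
      intro v
      rw [fderiv_transition hy.1 hy.2, ofCoord_toCoord hy.2]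
    have hbase : (extChartAt (𝓡 n) (base p)).symm ((extChartAt (𝓡 n) (base p) ∘
        (extChartAt (𝓡 n) (base p₀)).symm) y) = (extChartAt (𝓡 n) (base p₀)).symm y :=
      (extChartAt (𝓡 n) (base p)).left_inv (by rw [extChartAt_source]; exact hy.2)
    rw [localData_g_apply, localData_g_apply, hbase, hd, hd]
  · rw [← (cot_chart_change hp).eq_of_nhds, Function.comp_apply,
      (extChartAt (cotModel n) p).left_inv (mem_extChartAt_source _)]

/-- The derivative along the Hamilton vector field, in coordinates. -/
theorem diff_hamilton (hp : base p ∈ (chartAt (EuclideanSpace ℝ (Fin n)) (base p₀)).source)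
    {f : BCotangent n X → ℝ}
    {F : ℝ × (EuclideanSpace ℝ (Fin n) × (EuclideanSpace ℝ (Fin n) →L[ℝ] ℝ)) → ℝ}
    (hF : DifferentiableAt ℝ F (extChartAt (cotModel n) p₀ p))
    (hf : f =ᶠ[𝓝 p] F ∘ extChartAt (cotModel n) p₀) :
    diff (cotModel n) f p (S.hamilton p) = fderiv ℝ F (extChartAt (cotModel n) p₀ p)
      ((S.localData V k ℓ (base p₀)).ham (extChartAt (cotModel n) p₀ p)) := by
  have hmd : MDifferentiableAt (cotModel n)
      𝓘(ℝ, ℝ × (EuclideanSpace ℝ (Fin n) × (EuclideanSpace ℝ (Fin n) →L[ℝ] ℝ)))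
      (extChartAt (cotModel n) p₀) p :=
    (contMDiffAt_extChartAt' (n := ∞) (by
      rw [← extChartAt_source (cotModel n)]
      exact (mem_extChartAt_cot_source p₀ p).2 hp)).mdifferentiableAt (by simp)
  rw [diff, hf.mfderiv_eq, mfderiv_comp p hF.mdifferentiableAt hmd, mfderiv_eq_fderiv,
    ← mfderiv_chart_hamilton V k ℓ hp]
  rfl

end Hamilton

end Setting

/-! ### Dilations -/

section
variable (n : ℕ) (X : Type*) [TopologicalSpace X] [ChartedSpace (EuclideanSpace ℝ (Fin n)) X]
  [IsManifold (𝓡 n) ∞ X]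

/-- The topology of the b-cotangent bundle, recorded to shorten instance searches. -/
abbrev cotTopology : TopologicalSpace (BCotangent n X) := inferInstance

attribute [local instance] cotTopology

theorem cot_isManifold : IsManifold (cotModel n) ∞ (BCotangent n X) := inferInstance
end

attribute [local instance] cotTopology cot_isManifold

/-- Dilation by `c` in the fibres, in coordinates. -/
def scaleZ {E : Type*} [NormedAddCommGroup E] [NormedSpace ℝ E] (c : ℝ) :
    (ℝ × (E × (E →L[ℝ] ℝ))) →L[ℝ] (ℝ × (E × (E →L[ℝ] ℝ))) :=
  (c • ContinuousLinearMap.id ℝ ℝ).prodMap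
    ((ContinuousLinearMap.id ℝ E).prodMap (c • ContinuousLinearMap.id ℝ (E →L[ℝ] ℝ)))

theorem scaleZ_apply {E : Type*} [NormedAddCommGroup E] [NormedSpace ℝ E] (c : ℝ)
    (z : ℝ × (E × (E →L[ℝ] ℝ))) : scaleZ c z = (c * z.1, (z.2.1, c • z.2.2)) := rfl

theorem LocalData.ham_scaleZ {E : Type*} [NormedAddCommGroup E] [NormedSpace ℝ E]
    (D : LocalData E) (c : ℝ) (z : ℝ × (E × (E →L[ℝ] ℝ))) :
    D.ham (scaleZ c z) = c • scaleZ c (D.ham z) := by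
  have hY : D.Y (scaleZ c z) = c • D.Y z := by
    have h1 : covZ E (scaleZ c z) = c • covZ E z := by
      refine ContinuousLinearMap.ext fun u => ?_
      simp only [LocalData.covZ_apply, scaleZ_apply, smul_apply, smul_eq_mul]
      ring
    rw [LocalData.Y, h1, map_smul]
    rfl
  rw [LocalData.ham, hY, LocalData.ham]
  refine Prod.ext ?_ (Prod.ext ?_ ?_)
  · simp [scaleZ_apply]
  · simp [scaleZ_apply, smul_smul, mul_comm]
  · refine ContinuousLinearMap.ext fun w => ?_
    simp [scaleZ_apply]

section Cotangent

variable {n : ℕ} {X : Type*} [TopologicalSpace X] [ChartedSpace (EuclideanSpace ℝ (Fin n)) X]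

/-- A set of b-covectors invariant under positive dilations. -/
def IsConic (O : Set (BCotangent n X)) : Prop := ∀ p ∈ O, ∀ c : ℝ, 0 < c → dilate c p ∈ O

/-- The image in `ᵇS*_XM` of a set of b-covectors. -/
def sphereSet (O : Set (BCotangent n X)) : Set (BSphere n X) :=
  {z | ∃ p : Nonzero n X, p.1 ∈ O ∧ toSphere p = z}

theorem dilate_dilate (a b : ℝ) (p : BCotangent n X) :
    dilate a (dilate b p) = dilate (a * b) p := by
  refine Prod.ext (mul_assoc a b p.1).symm ?_
  exact congrArg (TotalSpace.mk p.2.proj) (smul_smul a b p.2.snd)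

theorem dilate_one (p : BCotangent n X) : dilate 1 p = p := by
  refine Prod.ext (one_mul p.1) ?_
  exact congrArg (TotalSpace.mk p.2.proj) (one_smul ℝ p.2.snd)

theorem toSphere_eq_iff {p q : Nonzero n X} :
    toSphere p = toSphere q ↔ ∃ c : ℝ, 0 < c ∧ q.1 = dilate c p.1 := Quotient.eq

theorem toSphere_mem_sphereSet {O : Set (BCotangent n X)} (hO : IsConic O) {p : Nonzero n X} :
    toSphere p ∈ sphereSet O ↔ p.1 ∈ O := by
  refine ⟨fun ⟨q, hq, hqp⟩ => ?_, fun h => ⟨p, h, rfl⟩⟩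
  obtain ⟨c, hc, h⟩ := toSphere_eq_iff.1 hqp
  rw [h]
  exact hO _ hq c hc

theorem mem_cone_sphereSet {O : Set (BCotangent n X)} (hO : IsConic O) {p : BCotangent n X} :
    p ∈ cone (sphereSet O) ↔ ¬(p.1 = 0 ∧ p.2.snd = 0) ∧ p ∈ O :=
  ⟨fun ⟨h, h'⟩ => ⟨h, (toSphere_mem_sphereSet hO).1 h'⟩,
    fun ⟨h, h'⟩ => ⟨h, (toSphere_mem_sphereSet hO).2 h'⟩⟩

theorem dilate_nonzero {c : ℝ} (hc : c ≠ 0) {p : BCotangent n X}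
    (hp : ¬(p.1 = 0 ∧ p.2.snd = 0)) :
    ¬((dilate c p).1 = 0 ∧ (dilate c p).2.snd = 0) := by
  rintro ⟨h1, h2⟩
  exact hp ⟨(mul_eq_zero.1 h1).resolve_left hc, (smul_eq_zero.1 h2).resolve_left hc⟩

theorem isConic_cone (U : Set (BSphere n X)) : IsConic (cone U) := by
  rintro p ⟨hp, hU⟩ c hc
  refine ⟨dilate_nonzero hc.ne' hp, ?_⟩
  have : toSphere ⟨p, hp⟩ = toSphere ⟨dilate c p, dilate_nonzero hc.ne' hp⟩ :=
    toSphere_eq_iff.2 ⟨c, hc, rfl⟩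
  rwa [← this]

variable [IsManifold (𝓡 n) ∞ X]

theorem isOpen_sphereSet {O : Set (BCotangent n X)} (hO : IsConic O) (hOo : IsOpen O) :
    IsOpen (sphereSet O) := by
  have h1 : IsOpen ((Quotient.mk (raySetoid n X)) ⁻¹' (sphereSet O)) := by
    have h2 : (Quotient.mk (raySetoid n X)) ⁻¹' (sphereSet O) = Subtype.val ⁻¹' O := by
      ext p
      exact toSphere_mem_sphereSet hO
    rw [h2]
    exact hOo.preimage continuous_subtype_val
  exact isOpen_coinduced.2 h1

theorem continuous_base : Continuous (base : BCotangent n X → X) :=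
  (FiberBundle.continuous_proj _ _).comp continuous_snd

theorem extChartAt_cot_dilate (p₀ : BCotangent n X) (c : ℝ) (p : BCotangent n X) :
    extChartAt (cotModel n) p₀ (dilate c p) = scaleZ c (extChartAt (cotModel n) p₀ p) := by
  rw [extChartAt_cot, extChartAt_cot]
  rfl

theorem isOpen_nonzero : IsOpen {p : BCotangent n X | ¬(p.1 = 0 ∧ p.2.snd = 0)} := by
  rw [isOpen_iff_mem_nhds]
  intro p hp
  have hm : base p ∈ (chartAt (EuclideanSpace ℝ (Fin n)) (base p)).source := mem_chart_source _ _
  have hc : ContinuousAt (extChartAt (cotModel n) p) p := continuousAt_extChartAt p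
  have key : ∀ q : BCotangent n X,
      base q ∈ (chartAt (EuclideanSpace ℝ (Fin n)) (base p)).source →
      (q.1 = 0 ∧ q.2.snd = 0 ↔ ((extChartAt (cotModel n) p q).1,
        (extChartAt (cotModel n) p q).2.2) = (0, 0)) := by
    intro q hq
    rw [extChartAt_cot, Prod.mk.injEq]
    refine and_congr Iff.rfl ⟨fun h => ?_, fun h => ?_⟩
    · refine ContinuousLinearMap.ext fun v => ?_
      exact congrArg (fun L => L (ofCoord (base p) (base q) v)) h
    · refine ContinuousLinearMap.ext fun v => ?_
      have h1 := congrArg (fun L => L (toCoord (base p) (base q) v)) h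
      exact (congrArg q.2.snd (ofCoord_toCoord hq v)).symm.trans h1
  have h1 : ContinuousAt (fun q => ((extChartAt (cotModel n) p q).1,
      (extChartAt (cotModel n) p q).2.2)) p :=
    hc.fst.prodMk hc.snd.snd
  have h2 : ∀ᶠ q in 𝓝 p, base q ∈ (chartAt (EuclideanSpace ℝ (Fin n)) (base p)).source :=
    continuous_base.continuousAt.eventually ((chartAt _ (base p)).open_source.mem_nhds hm)
  filter_upwards [h1.eventually_ne fun h => hp ((key p hm).2 h), h2] with q hq hqm h
  exact hq ((key q hqm).1 h)

theorem isOpen_cone {U : Set (BSphere n X)} (hU : IsOpen U) : IsOpen (cone U) := by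
  have h1 : IsOpen ((Quotient.mk (raySetoid n X)) ⁻¹' U) := isOpen_coinduced.1 hU
  have h2 : cone U = Subtype.val '' ((Quotient.mk (raySetoid n X)) ⁻¹' U) := by
    ext p
    exact ⟨fun ⟨h, h'⟩ => ⟨⟨p, h⟩, h', rfl⟩, fun ⟨q, hq, hqp⟩ => hqp ▸ ⟨q.2, hq⟩⟩
  rw [h2]
  exact isOpen_nonzero.isOpenMap_subtype_val _ h1

theorem t2Space_bCotangent [T2Space X] : T2Space (BCotangent n X) := by
  refine ⟨fun p q hne => ?_⟩
  by_cases hb : base p = base q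
  · have hp : p ∈ (extChartAt (cotModel n) p).source := mem_extChartAt_source p
    have hq : q ∈ (extChartAt (cotModel n) p).source := by
      rw [mem_extChartAt_cot_source, ← hb]
      exact mem_chart_source _ _
    have hne' : extChartAt (cotModel n) p p ≠ extChartAt (cotModel n) p q := fun h =>
      hne ((extChartAt (cotModel n) p).injOn hp hq h)
    obtain ⟨U, V, hU, hV, hpU, hqV, hUV⟩ := t2_separation hne'
    refine ⟨_, _, (continuousOn_extChartAt p).isOpen_inter_preimage (isOpen_extChartAt_source p) hU,
      (continuousOn_extChartAt p).isOpen_inter_preimage (isOpen_extChartAt_source p) hV,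
      ⟨hp, hpU⟩, ⟨hq, hqV⟩, ?_⟩
    exact (hUV.preimage _).mono inter_subset_right inter_subset_right
  · obtain ⟨U, V, hU, hV, hpU, hqV, hUV⟩ := t2_separation hb
    exact ⟨_, _, hU.preimage continuous_base, hV.preimage continuous_base, hpU, hqV,
      hUV.preimage _⟩

theorem dilate_eq_chart (p₀ : BCotangent n X) (c : ℝ) {q : BCotangent n X}
    (hq : base q ∈ (chartAt (EuclideanSpace ℝ (Fin n)) (base p₀)).source) :
    dilate c q = (extChartAt (cotModel n) p₀).symm (scaleZ c (extChartAt (cotModel n) p₀ q)) := by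
  rw [← extChartAt_cot_dilate, (extChartAt (cotModel n) p₀).left_inv]
  exact (mem_extChartAt_cot_source p₀ _).2 hq

theorem continuous_dilate :
    Continuous fun x : ℝ × BCotangent n X => dilate x.1 x.2 := by
  rw [continuous_iff_continuousAt]
  rintro ⟨c, p⟩
  have hm : base p ∈ (chartAt (EuclideanSpace ℝ (Fin n)) (base p)).source := mem_chart_source _ _
  have h2 : ∀ᶠ x in 𝓝 (c, p),
      base x.2 ∈ (chartAt (EuclideanSpace ℝ (Fin n)) (base p)).source :=
    (continuous_base.comp continuous_snd).continuousAt.eventually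
      ((chartAt _ (base p)).open_source.mem_nhds hm)
  have h3 : ContinuousAt (fun x : ℝ × BCotangent n X => scaleZ x.1 (extChartAt (cotModel n) p x.2))
      (c, p) := by
    have hc : ContinuousAt (fun x : ℝ × BCotangent n X => extChartAt (cotModel n) p x.2) (c, p) :=
      ContinuousAt.comp (f := Prod.snd) (x := (c, p)) (continuousAt_extChartAt p) continuousAt_snd
    exact (continuousAt_fst.mul hc.fst).prodMk (hc.snd.fst.prodMk (continuousAt_fst.smul hc.snd.snd))
  have h4 : ContinuousAt (extChartAt (cotModel n) p).symm
      (scaleZ c (extChartAt (cotModel n) p p)) := by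
    rw [← extChartAt_cot_dilate]
    exact continuousAt_extChartAt_symm' ((mem_extChartAt_cot_source p _).2 hm)
  refine (ContinuousAt.comp (f := fun x : ℝ × BCotangent n X =>
    scaleZ x.1 (extChartAt (cotModel n) p x.2)) (x := (c, p)) h4 h3).congr ?_
  filter_upwards [h2] with x hx
  exact (dilate_eq_chart p x.1 hx).symm

theorem contMDiff_dilate (c : ℝ) :
    ContMDiff (cotModel n) (cotModel n) ∞ (dilate c : BCotangent n X → BCotangent n X) := by
  intro p
  have hm : base p ∈ (chartAt (EuclideanSpace ℝ (Fin n)) (base p)).source := mem_chart_source _ _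
  have h1 : ContMDiffAt (cotModel n)
      𝓘(ℝ, ℝ × (EuclideanSpace ℝ (Fin n) × (EuclideanSpace ℝ (Fin n) →L[ℝ] ℝ))) ∞
      (fun q => scaleZ c (extChartAt (cotModel n) p q)) p :=
    (scaleZ (E := EuclideanSpace ℝ (Fin n)) c).contMDiff.contMDiffAt.comp p
      (contMDiffAt_extChartAt (I := cotModel n))
  have h2 : ContMDiffAt
      𝓘(ℝ, ℝ × (EuclideanSpace ℝ (Fin n) × (EuclideanSpace ℝ (Fin n) →L[ℝ] ℝ))) (cotModel n) ∞
      (extChartAt (cotModel n) p).symm (scaleZ c (extChartAt (cotModel n) p p)) := by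
    refine (contMDiffOn_extChartAt_symm p).contMDiffAt
      ((isOpen_extChartAt_target (I := cotModel n) p).mem_nhds ?_)
    rw [← extChartAt_cot_dilate]
    exact (extChartAt (cotModel n) p).map_source ((mem_extChartAt_cot_source p _).2 hm)
  refine (h2.comp p h1).congr_of_eventuallyEq ?_
  filter_upwards [continuous_base.continuousAt.eventually
    ((chartAt _ (base p)).open_source.mem_nhds hm)] with q hq
  exact dilate_eq_chart p c hq

end Cotangent

namespace Setting

variable {n : ℕ} {M : Type*} [TopologicalSpace M] [ChartedSpace (EuclideanHalfSpace (n + 1)) M]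
  [IsManifold (𝓡∂ (n + 1)) ∞ M]
  {X : Type*} [TopologicalSpace X] [ChartedSpace (EuclideanSpace ℝ (Fin n)) X]
  [IsManifold (𝓡 n) ∞ X] (S : Setting n M X)

theorem toForm_dilate (c : ℝ) (p : BCotangent n X) :
    toForm (dilate c p) = c • toForm p := by
  refine ContinuousLinearMap.ext fun w => ?_
  change c * p.1 * w.1 + c * p.2.snd w.2 = c * (p.1 * w.1 + p.2.snd w.2)
  ring

theorem timeFunction_dilate (c : ℝ) (p : BCotangent n X) :
    S.timeFunction (dilate c p) = c * S.timeFunction p := by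
  rw [timeFunction, dualMetric, toForm_dilate]
  change (-covector (base p) 1 0) (S.sharp (base p) (c • toForm p)) = _
  rw [map_smul, map_smul]
  rfl

theorem G_dilate (c : ℝ) (p : BCotangent n X) : S.G (dilate c p) = c ^ 2 * S.G p := by
  rw [G, dualMetric, toForm_dilate]
  change (c • toForm p) (S.sharp (base p) (c • toForm p)) = c ^ 2 * (toForm p) (S.sharp _ _)
  rw [map_smul, map_smul, smul_apply, smul_eq_mul, smul_eq_mul]
  ring

theorem rhoHat_dilate {c : ℝ} (hc : 0 < c) (p : BCotangent n X) :
    S.rhoHat (dilate c p) = c⁻¹ * S.rhoHat p := by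
  rw [rhoHat, rhoHat, timeFunction_dilate, show 2 * (c * S.timeFunction p) =
    c * (2 * S.timeFunction p) by ring, abs_mul, abs_of_pos hc, mul_inv]

theorem rhoHat_pos {p : BCotangent n X} (hp : S.timeFunction p ≠ 0) : 0 < S.rhoHat p := by
  unfold rhoHat; positivity

theorem transverseSq_dilate (V : ∀ x : X, TangentSpace (𝓡 n) x)
    (ℓ : ∀ x : X, TangentSpace (𝓡 n) x →L[ℝ] TangentSpace (𝓡 n) x →L[ℝ] ℝ) (c : ℝ)
    (p : BCotangent n X) : S.transverseSq V ℓ (dilate c p) = c ^ 2 * S.transverseSq V ℓ p := by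
  set m := diff (𝓡 n) (S.mu V) p.2.proj with hm
  set N := (ℓ p.2.proj).inverse with hN
  change (c • p.2.snd) (N (c • p.2.snd - (m (N (c • p.2.snd)) / m (N m)) • m)) =
    c ^ 2 * p.2.snd (N (p.2.snd - (m (N p.2.snd) / m (N m)) • m))
  rw [map_smul, map_smul, smul_eq_mul, mul_div_assoc, mul_smul, ← smul_sub, map_smul, map_smul,
    smul_apply, smul_eq_mul, smul_eq_mul]
  ring

theorem conormalDefining_dilate (V : ∀ x : X, TangentSpace (𝓡 n) x)
    (ℓ : ∀ x : X, TangentSpace (𝓡 n) x →L[ℝ] TangentSpace (𝓡 n) x →L[ℝ] ℝ) (C : ℝ) {c : ℝ}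
    (hc : 0 < c) (p : BCotangent n X) :
    S.conormalDefining V ℓ C (dilate c p) = S.conormalDefining V ℓ C p := by
  have h1 : pairing V (dilate c p) = c * pairing V p := by
    change c * p.1 + c * p.2.snd (V p.2.proj) = c * (p.1 + p.2.snd (V p.2.proj))
    ring
  rw [conormalDefining, conormalDefining, S.rhoHat_dilate hc, G_dilate, h1, transverseSq_dilate]
  field_simp

variable {S} {p₀ p : BCotangent n X}

theorem contMDiffAt_of_chart
    (hp : base p ∈ (chartAt (EuclideanSpace ℝ (Fin n)) (base p₀)).source)
    {f : BCotangent n X → ℝ}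
    {F : ℝ × (EuclideanSpace ℝ (Fin n) × (EuclideanSpace ℝ (Fin n) →L[ℝ] ℝ)) → ℝ}
    (hF : ContDiffAt ℝ ∞ F (extChartAt (cotModel n) p₀ p))
    (hf : f =ᶠ[𝓝 p] F ∘ extChartAt (cotModel n) p₀) :
    ContMDiffAt (cotModel n) 𝓘(ℝ) ∞ f p := by
  have h1 : ContMDiffAt (cotModel n)
      𝓘(ℝ, ℝ × (EuclideanSpace ℝ (Fin n) × (EuclideanSpace ℝ (Fin n) →L[ℝ] ℝ))) ∞
      (extChartAt (cotModel n) p₀) p :=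
    contMDiffAt_extChartAt' (n := ∞) (by
      rw [← extChartAt_source (cotModel n)]
      exact (mem_extChartAt_cot_source p₀ p).2 hp)
  exact (hF.contMDiffAt.comp p h1).congr_of_eventuallyEq hf

section

variable (V : ∀ x : X, TangentSpace (𝓡 n) x) (k : X → ℝ)
  (ℓ : ∀ x : X, TangentSpace (𝓡 n) x →L[ℝ] TangentSpace (𝓡 n) x →L[ℝ] ℝ)
  (hp : base p ∈ (chartAt (EuclideanSpace ℝ (Fin n)) (base p₀)).source)

include hp

theorem tm_chart : (S.localData V k ℓ (base p₀)).tm (extChartAt (cotModel n) p₀ p) =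
    S.timeFunction p := by
  rw [localData_tm (extChartAt_cot_mem hp), extChartAt_cot_left_inv hp]

theorem rh_chart : (S.localData V k ℓ (base p₀)).rh (extChartAt (cotModel n) p₀ p) =
    S.rhoHat p := by
  rw [localData_rh (extChartAt_cot_mem hp), extChartAt_cot_left_inv hp]

theorem G_chart : (S.localData V k ℓ (base p₀)).G (extChartAt (cotModel n) p₀ p) = S.G p := by
  rw [localData_G (extChartAt_cot_mem hp), extChartAt_cot_left_inv hp]

theorem nu_chart : (S.localData V k ℓ (base p₀)).nu (extChartAt (cotModel n) p₀ p) =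
    pairing V p := by
  rw [localData_nu (extChartAt_cot_mem hp), extChartAt_cot_left_inv hp]

omit hp in
theorem eventually_rh_chart (hp : base p ∈ (chartAt (EuclideanSpace ℝ (Fin n)) (base p₀)).source) :
    S.rhoHat =ᶠ[𝓝 p] (S.localData V k ℓ (base p₀)).rh ∘ extChartAt (cotModel n) p₀ := by
  filter_upwards [eventually_base_mem hp] with q hq
  exact (rh_chart V k ℓ hq).symm

end

theorem contMDiff_timeFunction : ContMDiff (cotModel n) 𝓘(ℝ) ∞ S.timeFunction := fun p => by
  have hm : base p ∈ (chartAt (EuclideanSpace ℝ (Fin n)) (base p)).source := mem_chart_source _ _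
  refine contMDiffAt_of_chart hm ((S.isMetricOn_localData (fun _ => 0) 0 (fun _ => 0)
    (base p)).contDiffAt_tm (extChartAt_cot_mem hm)) ?_
  filter_upwards [eventually_base_mem hm] with q hq
  exact (tm_chart _ _ _ hq).symm

theorem contMDiffAt_rhoHat (hp : S.timeFunction p ≠ 0) :
    ContMDiffAt (cotModel n) 𝓘(ℝ) ∞ S.rhoHat p := by
  have hm : base p ∈ (chartAt (EuclideanSpace ℝ (Fin n)) (base p)).source := mem_chart_source _ _
  refine contMDiffAt_of_chart hm ((S.isMetricOn_localData (fun _ => 0) 0 (fun _ => 0)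
    (base p)).contDiffAt_rh (extChartAt_cot_mem hm) ?_) (eventually_rh_chart _ _ _ hm)
  rwa [tm_chart _ _ _ hm]

/-- The Hamilton vector field is the image under the inverse chart of its coordinate expression. -/
theorem mfderiv_chart_symm_ham (V : ∀ x : X, TangentSpace (𝓡 n) x) (k : X → ℝ)
    (ℓ : ∀ x : X, TangentSpace (𝓡 n) x →L[ℝ] TangentSpace (𝓡 n) x →L[ℝ] ℝ)
    {z : ℝ × (EuclideanSpace ℝ (Fin n) × (EuclideanSpace ℝ (Fin n) →L[ℝ] ℝ))}
    (hz : z.2.1 ∈ (extChartAt (𝓡 n) (base p₀)).target) :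
    mfderiv 𝓘(ℝ, ℝ × (EuclideanSpace ℝ (Fin n) × (EuclideanSpace ℝ (Fin n) →L[ℝ] ℝ)))
      (cotModel n) (extChartAt (cotModel n) p₀).symm z
      ((S.localData V k ℓ (base p₀)).ham z) = S.hamilton ((extChartAt (cotModel n) p₀).symm z) := by
  have hzt := (mem_extChartAt_cot_target p₀ z).2 hz
  have hp : base ((extChartAt (cotModel n) p₀).symm z) ∈
      (chartAt (EuclideanSpace ℝ (Fin n)) (base p₀)).source :=
    (mem_extChartAt_cot_source p₀ _).1 ((extChartAt (cotModel n) p₀).map_target hzt)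
  have h1 := mfderiv_chart_hamilton (S := S) V k ℓ hp
  rw [(extChartAt (cotModel n) p₀).right_inv hzt] at h1
  rw [← h1]
  have h2 := mfderivWithin_extChartAt_symm_comp_mfderiv_extChartAt (I := cotModel n) hzt
  rw [ModelWithCorners.range_eq_univ, mfderivWithin_univ] at h2
  exact congrArg (fun L => L (S.hamilton ((extChartAt (cotModel n) p₀).symm z))) h2

/-- The Hamilton vector field is homogeneous of degree `1`. -/
theorem mfderiv_dilate_hamilton {c : ℝ} (hc : c ≠ 0) (p : BCotangent n X) :
    mfderiv (cotModel n) (cotModel n) (dilate c) p (S.hamilton p) =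
      c⁻¹ • S.hamilton (dilate c p) := by
  have hm : base p ∈ (chartAt (EuclideanSpace ℝ (Fin n)) (base p)).source := mem_chart_source _ _
  set V : ∀ x : X, TangentSpace (𝓡 n) x := fun _ => 0
  set ℓ : ∀ x : X, TangentSpace (𝓡 n) x →L[ℝ] TangentSpace (𝓡 n) x →L[ℝ] ℝ := fun _ => 0
  have hΦ : MDifferentiableAt (cotModel n)
      𝓘(ℝ, ℝ × (EuclideanSpace ℝ (Fin n) × (EuclideanSpace ℝ (Fin n) →L[ℝ] ℝ)))
      (extChartAt (cotModel n) p) p :=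
    (contMDiffAt_extChartAt (n := ∞)).mdifferentiableAt (by simp)
  have hzs : (scaleZ c (extChartAt (cotModel n) p p)).2.1 ∈ (extChartAt (𝓡 n) (base p)).target := by
    rw [← extChartAt_cot_dilate]
    exact extChartAt_cot_mem (p := dilate c p) hm
  have h2 : MDifferentiableAt
      𝓘(ℝ, ℝ × (EuclideanSpace ℝ (Fin n) × (EuclideanSpace ℝ (Fin n) →L[ℝ] ℝ))) (cotModel n)
      (extChartAt (cotModel n) p).symm (scaleZ c (extChartAt (cotModel n) p p)) :=
    ((contMDiffOn_extChartAt_symm (n := ∞) p).contMDiffAt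
      ((isOpen_extChartAt_target (I := cotModel n) p).mem_nhds
        ((mem_extChartAt_cot_target p _).2 hzs))).mdifferentiableAt (by simp)
  have h3 : (dilate c : BCotangent n X → BCotangent n X) =ᶠ[𝓝 p]
      (extChartAt (cotModel n) p).symm ∘ (scaleZ c ∘ extChartAt (cotModel n) p) := by
    filter_upwards [eventually_base_mem hm] with q hq
    exact dilate_eq_chart p c hq
  have h4 : mfderiv (cotModel n) (cotModel n) (dilate c) p (S.hamilton p) =
      mfderiv 𝓘(ℝ, ℝ × (EuclideanSpace ℝ (Fin n) × (EuclideanSpace ℝ (Fin n) →L[ℝ] ℝ)))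
        (cotModel n) (extChartAt (cotModel n) p).symm (scaleZ c (extChartAt (cotModel n) p p))
        (scaleZ c ((S.localData V 0 ℓ (base p)).ham (extChartAt (cotModel n) p p))) := by
    have hd : HasMFDerivAt (cotModel n)
        𝓘(ℝ, ℝ × (EuclideanSpace ℝ (Fin n) × (EuclideanSpace ℝ (Fin n) →L[ℝ] ℝ)))
        (scaleZ c ∘ extChartAt (cotModel n) p) p _ :=
      (ContinuousLinearMap.hasMFDerivAt (scaleZ (E := EuclideanSpace ℝ (Fin n)) c)).comp p
        hΦ.hasMFDerivAt
    have hd2 := (HasMFDerivAt.comp (f := scaleZ c ∘ extChartAt (cotModel n) p) p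
      h2.hasMFDerivAt hd).congr_of_eventuallyEq h3
    rw [← mfderiv_chart_hamilton V 0 ℓ hm]
    exact congrArg (fun L => L (S.hamilton p)) hd2.mfderiv
  have h5 := mfderiv_chart_symm_ham (S := S) V 0 ℓ hzs
  rw [LocalData.ham_scaleZ, ← dilate_eq_chart p c hm] at h5
  have key : ∀ (L : (ℝ × (EuclideanSpace ℝ (Fin n) × (EuclideanSpace ℝ (Fin n) →L[ℝ] ℝ))) →L[ℝ]
      (ℝ × (EuclideanSpace ℝ (Fin n) × (EuclideanSpace ℝ (Fin n) →L[ℝ] ℝ)))) (w),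
      L w = c⁻¹ • L (c • w) := fun L w => by rw [map_smul, inv_smul_smul₀ hc]
  rw [h4, ← h5]
  exact key _ _

theorem mfderiv_dilate_rescaledHamilton {c : ℝ} (hc : 0 < c) (p : BCotangent n X) :
    mfderiv (cotModel n) (cotModel n) (dilate c) p (S.rescaledHamilton p) =
      S.rescaledHamilton (dilate c p) := by
  rw [rescaledHamilton, rescaledHamilton, S.rhoHat_dilate hc]
  refine (ContinuousLinearMap.map_smul _ _ _).trans ?_
  rw [mfderiv_dilate_hamilton hc.ne', smul_smul, mul_comm]

/-- The derivative along `ρ̂ H_G` of a function invariant under dilations is invariant. -/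
theorem diff_rescaledHamilton_dilate {f : BCotangent n X → ℝ} {c : ℝ} (hc : 0 < c)
    (hf : f ∘ dilate c = f)
    (hfd : MDifferentiableAt (cotModel n) 𝓘(ℝ) f (dilate c p)) :
    diff (cotModel n) f (dilate c p) (S.rescaledHamilton (dilate c p)) =
      diff (cotModel n) f p (S.rescaledHamilton p) := by
  have h1 := mfderiv_comp p hfd ((contMDiff_dilate c p).mdifferentiableAt (by simp))
  rw [hf] at h1
  rw [diff, diff, h1, ← mfderiv_dilate_rescaledHamilton hc]
  rfl

theorem beta_dilate {c : ℝ} (hc : 0 < c) (hp : S.timeFunction p ≠ 0) :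
    S.beta (dilate c p) = S.beta p := by
  have hcp : S.timeFunction (dilate c p) ≠ 0 := by
    rw [timeFunction_dilate]; exact mul_ne_zero hc.ne' hp
  have h1 := mfderiv_comp p ((contMDiffAt_rhoHat hcp).mdifferentiableAt (by simp))
    ((contMDiff_dilate c p).mdifferentiableAt (by simp))
  have h2 : S.rhoHat ∘ dilate c = c⁻¹ • S.rhoHat := funext fun q => S.rhoHat_dilate hc q
  rw [h2, const_smul_mfderiv ((contMDiffAt_rhoHat hp).mdifferentiableAt (by simp))] at h1
  have h3 := congrArg (fun L => L (S.hamilton p)) h1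
  have h4 : c⁻¹ * diff (cotModel n) S.rhoHat p (S.hamilton p) =
      diff (cotModel n) S.rhoHat (dilate c p)
        (mfderiv (cotModel n) (cotModel n) (dilate c) p (S.hamilton p)) := h3
  rw [mfderiv_dilate_hamilton hc.ne'] at h4
  replace h4 := h4.trans (ContinuousLinearMap.map_smul _ _ _)
  rw [beta, beta, mul_left_cancel₀ (inv_ne_zero hc.ne') h4]

end Setting

namespace Setting

variable {n : ℕ} {M : Type*} [TopologicalSpace M] [ChartedSpace (EuclideanHalfSpace (n + 1)) M]
  [IsManifold (𝓡∂ (n + 1)) ∞ M]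
  {X : Type*} [TopologicalSpace X] [ChartedSpace (EuclideanSpace ℝ (Fin n)) X]
  [IsManifold (𝓡 n) ∞ X] {S : Setting n M X}

/-! ### The conormal set in the b-cotangent bundle -/

namespace HorizonData

variable {V : ∀ x : X, TangentSpace (𝓡 n) x} {k : X → ℝ}
  {ℓ : ∀ x : X, TangentSpace (𝓡 n) x →L[ℝ] TangentSpace (𝓡 n) x →L[ℝ] ℝ} {H : Set X}
  (hd : S.HorizonData V k ℓ H)

include hd

theorem covector_conormal {x : X} (hx : x ∈ H) (a : ℝ) :
    covector x 0 (a • diff (𝓡 n) (S.mu V) x) =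
      S.metric x ((a * (2 * k x)) • ((1, V x) : ℝ × TangentSpace (𝓡 n) x)) := by
  refine ContinuousLinearMap.ext fun w => ?_
  have h1 : covector x 0 (a • diff (𝓡 n) (S.mu V) x) w =
      0 * w.1 + a * diff (𝓡 n) (S.mu V) x w.2 := rfl
  rw [h1, hd.gravity x hx w, map_smul, smul_apply, smul_eq_mul]
  ring

theorem sharp_conormal {x : X} (hx : x ∈ H) (a : ℝ) :
    S.sharp x (covector x 0 (a • diff (𝓡 n) (S.mu V) x)) =
      (a * (2 * k x)) • ((1, V x) : ℝ × TangentSpace (𝓡 n) x) :=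
  (S.sharp_eq_iff x).2 (hd.covector_conormal hx a).symm

/-- The multiple `a dμ` of `dμ` at a point of the horizon has the time function `-2ka`. -/
theorem timeFunction_conormal {x : X} (hx : x ∈ H) (a : ℝ) :
    S.timeFunction ((0, ⟨x, a • diff (𝓡 n) (S.mu V) x⟩) : BCotangent n X) = -(2 * k x * a) := by
  change (-covector x 1 0) (S.sharp x (covector x 0 (a • diff (𝓡 n) (S.mu V) x))) = _
  rw [hd.sharp_conormal hx]
  change -(1 * ((a * (2 * k x)) * 1) + 0) = _
  ring

theorem G_conormal {x : X} (hx : x ∈ H) (a : ℝ) :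
    S.G ((0, ⟨x, a • diff (𝓡 n) (S.mu V) x⟩) : BCotangent n X) = 0 := by
  have hmu : S.metric x (1, V x) (1, V x) = 0 := hd.mu_eq_zero x hx
  change covector x 0 (a • diff (𝓡 n) (S.mu V) x)
    (S.sharp x (covector x 0 (a • diff (𝓡 n) (S.mu V) x))) = 0
  rw [hd.sharp_conormal hx, hd.covector_conormal hx, map_smul, map_smul, smul_apply, hmu,
    smul_zero, smul_zero]

theorem mem_tangentTo_iff {x : X} (hx : x ∈ H) {v : TangentSpace (𝓡 n) x} :
    v ∈ tangentTo (𝓡 n) H x ↔ diff (𝓡 n) (S.mu V) x v = 0 :=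
  Setting.mem_tangentTo_iff hd.smooth_V hd.mu_eq_zero hd.isolated hx (hd.diff_mu_ne_zero hx)

/-- The conormal set consists of the multiples of `dμ` over the horizon. -/
theorem mem_halfConormal_iff {s : ℝ} {p : BCotangent n X} :
    p ∈ S.halfConormal H s ↔ ∃ x ∈ H, ∃ a : ℝ,
      p = (0, ⟨x, a • diff (𝓡 n) (S.mu V) x⟩) ∧ 0 < s * -(2 * k x * a) := by
  constructor
  · rintro ⟨⟨hx, hann⟩, hne, hG, ht⟩
    obtain ⟨σ, ⟨x, η⟩⟩ := p
    change x ∈ H at hx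
    have hσ : σ = 0 := by
      have h1 := hann 1 0 (fun f _ _ => map_zero _)
      have h2 : σ * 1 + η 0 = 0 := h1
      rw [map_zero, mul_one, add_zero] at h2
      exact h2
    have hη : ∀ v, diff (𝓡 n) (S.mu V) x v = 0 → η v = 0 := by
      intro v hv
      have h1 := hann 0 v ((hd.mem_tangentTo_iff hx).2 hv)
      have h2 : σ * 0 + η v = 0 := h1
      rwa [mul_zero, zero_add] at h2
    obtain ⟨v₀, hv₀⟩ : ∃ v₀, diff (𝓡 n) (S.mu V) x v₀ ≠ 0 := by
      by_contra hcon
      push Not at hcon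
      exact hd.diff_mu_ne_zero hx (ContinuousLinearMap.ext hcon)
    have hηa : η = (η v₀ / diff (𝓡 n) (S.mu V) x v₀) • diff (𝓡 n) (S.mu V) x := by
      refine ContinuousLinearMap.ext fun v => ?_
      have h1 := hη (v - (diff (𝓡 n) (S.mu V) x v / diff (𝓡 n) (S.mu V) x v₀) • v₀) (by
        rw [map_sub, map_smul, smul_eq_mul, div_mul_cancel₀ _ hv₀, sub_self])
      rw [map_sub, map_smul, smul_eq_mul, sub_eq_zero] at h1
      rw [h1, smul_apply, smul_eq_mul]
      ring
    subst hσ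
    refine ⟨x, hx, η v₀ / diff (𝓡 n) (S.mu V) x v₀, ?_, ?_⟩
    · exact congrArg (fun θ => ((0, ⟨x, θ⟩) : BCotangent n X)) hηa
    · rw [← hd.timeFunction_conormal hx]
      rw [hηa] at ht
      exact ht
  · rintro ⟨x, hx, a, rfl, ht⟩
    refine ⟨⟨hx, fun b w hw => ?_⟩, ?_, hd.G_conormal hx a, ?_⟩
    · change 0 * b + a * diff (𝓡 n) (S.mu V) x w = 0
      rw [(hd.mem_tangentTo_iff hx).1 hw]
      ring
    · rintro ⟨-, h2⟩
      have ha : a ≠ 0 := by rintro rfl; simp at ht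
      exact hd.diff_mu_ne_zero hx ((smul_eq_zero.1 h2).resolve_left ha)
    · rw [hd.timeFunction_conormal hx]; exact ht

theorem isConic_halfConormal (s : ℝ) : IsConic (S.halfConormal H s) := by
  intro p hp c hc
  obtain ⟨x, hx, a, rfl, ht⟩ := hd.mem_halfConormal_iff.1 hp
  refine hd.mem_halfConormal_iff.2 ⟨x, hx, c * a, ?_, ?_⟩
  · refine Prod.ext (mul_zero c) ?_
    exact congrArg (TotalSpace.mk x) (smul_smul c a (diff (𝓡 n) (S.mu V) x))
  · have := mul_pos hc ht
    linarith

omit hd in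
theorem timeFunction_ne_zero {s : ℝ} {p : BCotangent n X} (hp : p ∈ S.halfConormal H s) :
    S.timeFunction p ≠ 0 := by
  intro h
  have := hp.2.2.2
  rw [h, mul_zero] at this
  exact lt_irrefl _ this

theorem chart_conormal {p₀ : BCotangent n X} {x : X}
    (hx : x ∈ (chartAt (EuclideanSpace ℝ (Fin n)) (base p₀)).source) (a : ℝ) :
    extChartAt (cotModel n) p₀ ((0, ⟨x, a • diff (𝓡 n) (S.mu V) x⟩) : BCotangent n X) =
      (0, (extChartAt (𝓡 n) (base p₀) x,
        a • (S.localData V k ℓ (base p₀)).dm (extChartAt (𝓡 n) (base p₀) x))) := by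
  rw [extChartAt_cot]
  refine Prod.ext rfl (Prod.ext rfl (ContinuousLinearMap.ext fun v => ?_))
  have h1 := localData_dm_toCoord hd.smooth_V hx (ofCoord (base p₀) x v)
  rw [toCoord_ofCoord hx] at h1
  exact congrArg (fun t => a * t) h1.symm

theorem Q_chart {p₀ p : BCotangent n X}
    (hp : base p ∈ (chartAt (EuclideanSpace ℝ (Fin n)) (base p₀)).source) :
    (S.localData V k ℓ (base p₀)).Q (extChartAt (cotModel n) p₀ p) = S.transverseSq V ℓ p := by
  rw [hd.localData_Q (extChartAt_cot_mem hp), extChartAt_cot_left_inv hp]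

theorem rho_chart {p₀ p : BCotangent n X} (C : ℝ)
    (hp : base p ∈ (chartAt (EuclideanSpace ℝ (Fin n)) (base p₀)).source) :
    (S.localData V k ℓ (base p₀)).rho C (extChartAt (cotModel n) p₀ p) =
      S.conormalDefining V ℓ C p := by
  rw [hd.localData_rho (extChartAt_cot_mem hp), extChartAt_cot_left_inv hp]

theorem eventually_rho_chart {p₀ p : BCotangent n X} (C : ℝ)
    (hp : base p ∈ (chartAt (EuclideanSpace ℝ (Fin n)) (base p₀)).source) :
    S.conormalDefining V ℓ C =ᶠ[𝓝 p]
      (S.localData V k ℓ (base p₀)).rho C ∘ extChartAt (cotModel n) p₀ := by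
  filter_upwards [eventually_base_mem hp] with q hq
  exact (hd.rho_chart C hq).symm

theorem conormalDefining_eq_zero (C : ℝ) {s : ℝ} {p : BCotangent n X}
    (hp : p ∈ S.halfConormal H s) : S.conormalDefining V ℓ C p = 0 := by
  obtain ⟨x, hx, a, rfl, ht⟩ := hd.mem_halfConormal_iff.1 hp
  obtain ⟨Ω, hΩ, h, -⟩ := hd.exists_isHorizonOn hx
  set p : BCotangent n X := (0, ⟨x, a • diff (𝓡 n) (S.mu V) x⟩) with hpdef
  have hc : base p ∈ (chartAt (EuclideanSpace ℝ (Fin n)) (base p)).source := mem_chart_source _ _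
  rw [← hd.rho_chart C hc]
  refine (congrArg ((S.localData V k ℓ (base p)).rho C) (hd.chart_conormal hc a)).trans ?_
  exact h.rho_conormal C h.mem h.mu_eq_zero a

/-- `H_G ρ̂` equals the surface gravity on the conormal set, up to the sign of the time function. -/
theorem beta_conormal {s : ℝ} (hs : s = 1 ∨ s = -1) {p : BCotangent n X}
    (hp : p ∈ S.halfConormal H s) : S.beta p = |k (base p)| := by
  have htp := hp.2.2.2
  have htne := timeFunction_ne_zero hp
  obtain ⟨x, hx, a, rfl, ht⟩ := hd.mem_halfConormal_iff.1 hp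
  set p : BCotangent n X := (0, ⟨x, a • diff (𝓡 n) (S.mu V) x⟩) with hpdef
  obtain ⟨Ω, hΩ, h, -⟩ := hd.exists_isHorizonOn hx
  have hc : base p ∈ (chartAt (EuclideanSpace ℝ (Fin n)) (base p)).source := mem_chart_source _ _
  have ha : a ≠ 0 := by rintro rfl; simp at ht
  have hz : extChartAt (cotModel n) p p = _ := hd.chart_conormal (p₀ := p) hc a
  have htm := tm_chart (S := S) V k ℓ hc
  have h1 := diff_hamilton (S := S) V k ℓ hc (((S.isMetricOn_localData V k ℓ (base p)).contDiffAt_rh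
    (extChartAt_cot_mem hc) (by rw [htm]; exact htne)).differentiableAt (n := ∞) (by simp))
    (eventually_rh_chart V k ℓ hc)
  rw [beta, h1, hz]
  rw [hz] at htm
  refine (congrArg abs (h.fderiv_rh_ham ha hs (by exact htm.symm ▸ htp))).trans ?_
  have hk : (S.localData V k ℓ x).k (extChartAt (𝓡 n) x x) = k x :=
    congrArg k ((extChartAt (𝓡 n) x).left_inv (mem_extChartAt_source x))
  rw [hk, abs_mul]
  rcases hs with rfl | rfl <;> simp [hpdef, base]

end HorizonData

end Setting

namespace Setting

variable {n : ℕ} {M : Type*} [TopologicalSpace M] [ChartedSpace (EuclideanHalfSpace (n + 1)) M]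
  [IsManifold (𝓡∂ (n + 1)) ∞ M]
  {X : Type*} [TopologicalSpace X] [ChartedSpace (EuclideanSpace ℝ (Fin n)) X]
  [IsManifold (𝓡 n) ∞ X]

/-! ### Estimates near the conormal set -/

/-- On the conic neighbourhood `W` of the conormal set `ℛ_±`, the dilation invariant function `ρ`
is a quadratic defining function of `ℛ_±` which grows exponentially along the flow of
`e ρ̂ H_G`, where `e = ±1`. -/
structure IsLyapunov (S : Setting n M X) (H : Set X) (s e δ b L : ℝ) (ρ : BCotangent n X → ℝ)
    (W : Set (BCotangent n X)) : Prop where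
  isOpen : IsOpen W
  isConic : IsConic W
  subset : S.halfConormal H s ⊆ W
  timeFunction_ne_zero : ∀ p ∈ W, S.timeFunction p ≠ 0
  smooth : ∀ p ∈ W, ContMDiffAt (cotModel n) 𝓘(ℝ) ∞ ρ p
  nonneg : ∀ p ∈ W, 0 ≤ ρ p
  eq_zero_iff : ∀ p ∈ W, ρ p = 0 ↔ p ∈ S.halfConormal H s
  dilate : ∀ c : ℝ, 0 < c → ∀ p, ρ (dilate c p) = ρ p
  le_beta : ∀ p ∈ W, b ≤ S.beta p
  le_diff : ∀ p ∈ W, 2 * (1 - δ) * S.beta p * ρ p ≤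
    e * diff (cotModel n) ρ p (S.rescaledHamilton p)
  abs_diff_le : ∀ p ∈ W, |diff (cotModel n) ρ p (S.rescaledHamilton p)| ≤ L * ρ p

variable {S : Setting n M X}

theorem diff_rescaledHamilton {V : ∀ x : X, TangentSpace (𝓡 n) x} {k : X → ℝ}
    {ℓ : ∀ x : X, TangentSpace (𝓡 n) x →L[ℝ] TangentSpace (𝓡 n) x →L[ℝ] ℝ} {p₀ p : BCotangent n X}
    (hp : base p ∈ (chartAt (EuclideanSpace ℝ (Fin n)) (base p₀)).source)
    {f : BCotangent n X → ℝ}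
    {F : ℝ × (EuclideanSpace ℝ (Fin n) × (EuclideanSpace ℝ (Fin n) →L[ℝ] ℝ)) → ℝ}
    (hF : DifferentiableAt ℝ F (extChartAt (cotModel n) p₀ p))
    (hf : f =ᶠ[𝓝 p] F ∘ extChartAt (cotModel n) p₀) :
    diff (cotModel n) f p (S.rescaledHamilton p) = fderiv ℝ F (extChartAt (cotModel n) p₀ p)
      ((S.localData V k ℓ (base p₀)).rh (extChartAt (cotModel n) p₀ p) •
        (S.localData V k ℓ (base p₀)).ham (extChartAt (cotModel n) p₀ p)) := by
  rw [map_smul, ← diff_hamilton V k ℓ hp hF hf, rh_chart V k ℓ hp, rescaledHamilton]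
  exact ContinuousLinearMap.map_smul _ _ _

namespace HorizonData

variable {V : ∀ x : X, TangentSpace (𝓡 n) x} {k : X → ℝ}
  {ℓ : ∀ x : X, TangentSpace (𝓡 n) x →L[ℝ] TangentSpace (𝓡 n) x →L[ℝ] ℝ} {H : Set X}
  (hd : S.HorizonData V k ℓ H)

include hd

/-- The part of the conormal set with `ρ̂ = 1` is compact, as the image of `H` under a section. -/
theorem isCompact_slice {s : ℝ} (hs : s = 1 ∨ s = -1) :
    IsCompact {p | p ∈ S.halfConormal H s ∧ S.rhoHat p = 1} := by
  -- `ρ̂(a dμ) = |4 k a|⁻¹`, and the sign of the time function `-2 k a` is `s`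
  set c : X → BCotangent n X := fun x =>
    (0, ⟨x, (-s / (4 * k x)) • diff (𝓡 n) (S.mu V) x⟩) with hc
  have hs2 : s * s = 1 := by rcases hs with rfl | rfl <;> norm_num
  have htime : ∀ x ∈ H, -(2 * k x * (-s / (4 * k x))) = s / 2 := by
    intro x hx
    have := hd.k_ne_zero x hx
    field_simp
    ring
  have himage : {p | p ∈ S.halfConormal H s ∧ S.rhoHat p = 1} = c '' H := by
    ext p
    constructor
    · rintro ⟨hp, h1⟩
      obtain ⟨x, hx, a, rfl, ht⟩ := hd.mem_halfConormal_iff.1 hp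
      refine ⟨x, hx, ?_⟩
      have hk := hd.k_ne_zero x hx
      rw [rhoHat, hd.timeFunction_conormal hx, inv_eq_one] at h1
      have h2 : 2 * -(2 * k x * a) = s := by
        have h3 : |2 * -(2 * k x * a)| = s * (2 * -(2 * k x * a)) := by
          rw [← abs_of_pos (show 0 < s * (2 * -(2 * k x * a)) by linarith), abs_mul]
          rcases hs with rfl | rfl <;> simp
        rw [h3] at h1
        calc 2 * -(2 * k x * a) = s * s * (2 * -(2 * k x * a)) := by rw [hs2, one_mul]
          _ = s := by rw [mul_assoc, h1, mul_one]
      have h3 : a = -s / (4 * k x) := by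
        rw [← h2]; field_simp; ring
      rw [h3]
    · rintro ⟨x, hx, rfl⟩
      refine ⟨hd.mem_halfConormal_iff.2 ⟨x, hx, _, rfl, ?_⟩, ?_⟩
      · rw [htime x hx]
        linarith
      · rw [rhoHat, hd.timeFunction_conormal hx, htime x hx, mul_div_cancel₀ _ two_ne_zero]
        rcases hs with rfl | rfl <;> simp
  rw [himage]
  refine hd.isCompact.image_of_continuousOn fun x hx => ContinuousAt.continuousWithinAt ?_
  have hcs : base (c x) ∈ (chartAt (EuclideanSpace ℝ (Fin n)) (base (c x))).source :=
    mem_chart_source _ _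
  have h1 : ContinuousAt (fun x' => ((0, (extChartAt (𝓡 n) x x', (-s / (4 * k x')) •
      (S.localData V k ℓ x).dm (extChartAt (𝓡 n) x x'))) :
      ℝ × (EuclideanSpace ℝ (Fin n) × (EuclideanSpace ℝ (Fin n) →L[ℝ] ℝ)))) x := by
    have h2 : ContinuousAt (extChartAt (𝓡 n) x) x := continuousAt_extChartAt x
    have h3 : ContinuousAt (S.localData V k ℓ x).dm (extChartAt (𝓡 n) x x) :=
      (contDiffOn_localData_dm hd.smooth_V x).continuousOn.continuousAt
        ((isOpen_extChartAt_target x).mem_nhds (mem_extChartAt_target x))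
    have h4 : ContinuousAt (fun x' => -s / (4 * k x')) x :=
      continuousAt_const.div (continuousAt_const.mul hd.continuous_k.continuousAt)
        (mul_ne_zero four_ne_zero (hd.k_ne_zero x hx))
    exact continuousAt_const.prodMk (h2.prodMk (h4.smul (ContinuousAt.comp
      (f := extChartAt (𝓡 n) x) h3 h2)))
  have h5 : ∀ x' ∈ (chartAt (EuclideanSpace ℝ (Fin n)) x).source,
      extChartAt (cotModel n) (c x) (c x') = (0, (extChartAt (𝓡 n) x x', (-s / (4 * k x')) •
      (S.localData V k ℓ x).dm (extChartAt (𝓡 n) x x'))) := fun x' hx' =>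
    hd.chart_conormal (p₀ := c x) hx' _
  have h6 : ContinuousAt (extChartAt (cotModel n) (c x)).symm
      ((0, (extChartAt (𝓡 n) x x, (-s / (4 * k x)) •
      (S.localData V k ℓ x).dm (extChartAt (𝓡 n) x x))) :
      ℝ × (EuclideanSpace ℝ (Fin n) × (EuclideanSpace ℝ (Fin n) →L[ℝ] ℝ))) := by
    rw [← h5 x (mem_chart_source _ x)]
    exact continuousAt_extChartAt_symm (c x)
  refine (ContinuousAt.comp (x := x) (f := fun x' => ((0, (extChartAt (𝓡 n) x x',
    (-s / (4 * k x')) • (S.localData V k ℓ x).dm (extChartAt (𝓡 n) x x'))) :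
      ℝ × (EuclideanSpace ℝ (Fin n) × (EuclideanSpace ℝ (Fin n) →L[ℝ] ℝ)))) h6 h1).congr ?_
  filter_upwards [(chartAt (EuclideanSpace ℝ (Fin n)) x).open_source.mem_nhds
    (mem_chart_source _ x)] with x' hx'
  rw [Function.comp_apply, ← h5 x' hx']
  exact extChartAt_cot_left_inv (p₀ := c x) (p := c x') hx'

/-- The derivative of the squared transverse length along the Hamilton vector field, near a point
of the conormal set. -/
theorem exists_abs_diff_transverseSq_le {s : ℝ} {p₀ : BCotangent n X}
    (hp₀ : p₀ ∈ S.halfConormal H s) {η : ℝ} (hη : 0 < η) : ∃ B : ℝ, 0 ≤ B ∧ ∀ᶠ p in 𝓝 p₀,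
      |diff (cotModel n) (S.transverseSq V ℓ) p (S.hamilton p)| ≤
        η * S.transverseSq V ℓ p + B * (S.G p ^ 2 + pairing V p ^ 2) := by
  obtain ⟨x, hx, a, hpe, ht⟩ := hd.mem_halfConormal_iff.1 hp₀
  obtain ⟨Ω, hΩ, h, -⟩ := hd.exists_isHorizonOn hx
  have ha : a ≠ 0 := by rintro rfl; simp at ht
  have hbx : base p₀ = x := by rw [hpe]; rfl
  have hc : base p₀ ∈ (chartAt (EuclideanSpace ℝ (Fin n)) (base p₀)).source := mem_chart_source _ _
  subst hbx
  have hz : extChartAt (cotModel n) p₀ p₀ = (0, (extChartAt (𝓡 n) (base p₀) (base p₀),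
      a • (S.localData V k ℓ (base p₀)).dm (extChartAt (𝓡 n) (base p₀) (base p₀)))) := by
    have h1 := hd.chart_conormal hc a
    rwa [← hpe] at h1
  have hΦ : Filter.Tendsto (extChartAt (cotModel n) p₀) (𝓝 p₀) (𝓝 _) :=
    continuousAt_extChartAt (I := cotModel n) p₀
  rw [hz] at hΦ
  obtain ⟨c, hc0, hcQ⟩ := h.exists_le_Q (a := a)
  obtain ⟨B, hB, hBQ⟩ := h.exists_QDot_le ha (mul_pos hη hc0)
  refine ⟨B, hB, ?_⟩
  filter_upwards [hΦ.eventually hcQ, hΦ.eventually hBQ, eventually_base_mem hc,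
    hΦ.eventually (h.preimage_mem_nhds (z := (0, (extChartAt (𝓡 n) (base p₀) (base p₀),
      a • (S.localData V k ℓ (base p₀)).dm (extChartAt (𝓡 n) (base p₀) (base p₀))))) h.mem)]
    with p h1 h2 hp hpΩ
  have h3 := diff_hamilton (S := S) V k ℓ hp
    ((h.contDiffAt_Q hpΩ).differentiableAt (n := ∞) (by simp)) (f := S.transverseSq V ℓ) (by
      filter_upwards [eventually_base_mem hp] with q hq
      exact (hd.Q_chart hq).symm)
  rw [h3, ← hd.Q_chart hp, ← G_chart (S := S) V k ℓ hp,
    ← nu_chart (S := S) V k ℓ hp]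
  have h4 := mul_le_mul_of_nonneg_left h1 hη.le
  linarith

/-- A uniform form of the estimate of the derivative of the squared transverse length. -/
theorem exists_uniform_abs_diff_transverseSq_le {s : ℝ} (hs : s = 1 ∨ s = -1) {η : ℝ}
    (hη : 0 < η) : ∃ B : ℝ, 0 ≤ B ∧ ∀ p₀ ∈ S.halfConormal H s, S.rhoHat p₀ = 1 → ∀ᶠ p in 𝓝 p₀,
      |diff (cotModel n) (S.transverseSq V ℓ) p (S.hamilton p)| ≤
        η * S.transverseSq V ℓ p + B * (S.G p ^ 2 + pairing V p ^ 2) := by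
  have hK := hd.isCompact_slice hs
  have key : ∃ B : ℝ, 0 ≤ B ∧ ∀ p₀ ∈ {p | p ∈ S.halfConormal H s ∧ S.rhoHat p = 1},
      ∀ᶠ p in 𝓝 p₀, |diff (cotModel n) (S.transverseSq V ℓ) p (S.hamilton p)| ≤
        η * S.transverseSq V ℓ p + B * (S.G p ^ 2 + pairing V p ^ 2) := by
    refine hK.induction_on (p := fun A => ∃ B : ℝ, 0 ≤ B ∧ ∀ p₀ ∈ A, ∀ᶠ p in 𝓝 p₀,
      |diff (cotModel n) (S.transverseSq V ℓ) p (S.hamilton p)| ≤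
        η * S.transverseSq V ℓ p + B * (S.G p ^ 2 + pairing V p ^ 2)) ?_ ?_ ?_ ?_
    · exact ⟨0, le_rfl, fun p hp => hp.elim⟩
    · rintro A A' hAA' ⟨B, hB, h⟩
      exact ⟨B, hB, fun p hp => h p (hAA' hp)⟩
    · rintro A A' ⟨B, hB, h⟩ ⟨B', hB', h'⟩
      have mono : ∀ {B₁ B₂ : ℝ}, B₁ ≤ B₂ → ∀ p : BCotangent n X,
          η * S.transverseSq V ℓ p + B₁ * (S.G p ^ 2 + pairing V p ^ 2) ≤
            η * S.transverseSq V ℓ p + B₂ * (S.G p ^ 2 + pairing V p ^ 2) := by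
        intro B₁ B₂ h12 p
        have := mul_le_mul_of_nonneg_right h12
          (show 0 ≤ S.G p ^ 2 + pairing V p ^ 2 by positivity)
        linarith
      refine ⟨max B B', le_max_of_le_left hB, ?_⟩
      rintro p (hp | hp)
      · filter_upwards [h p hp] with q hq
        exact hq.trans (mono (le_max_left _ _) q)
      · filter_upwards [h' p hp] with q hq
        exact hq.trans (mono (le_max_right _ _) q)
    · intro p hp
      obtain ⟨B, hB, h⟩ := hd.exists_abs_diff_transverseSq_le hp.1 hη
      exact ⟨_, mem_nhdsWithin_of_mem_nhds h.eventually_nhds, B, hB, fun q hq => hq⟩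
  obtain ⟨B, hB, h⟩ := key
  exact ⟨B, hB, fun p hp hp1 => h p ⟨hp, hp1⟩⟩

/-- The properties of the quadratic defining function near a point of the conormal set at which
`ρ̂ = 1`. -/
theorem eventually_conormalDefining {s ε δ δ' B C : ℝ} (hs : s = 1 ∨ s = -1)
    (hε : ε = 1 ∨ ε = -1) (hεk : ∀ x ∈ H, 0 < ε * k x) (hδ' : 0 < δ')
    (hδ : ∀ x ∈ H, δ' ≤ δ * |k x|) (hB : 0 ≤ B) (hC : 0 < C) (hBC : 4 * B ≤ δ' * C)
    {p₀ : BCotangent n X} (hp₀ : p₀ ∈ S.halfConormal H s) (hρ : S.rhoHat p₀ = 1)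
    (hQ : ∀ᶠ p in 𝓝 p₀, |diff (cotModel n) (S.transverseSq V ℓ) p (S.hamilton p)| ≤
        δ' / 4 * S.transverseSq V ℓ p + B * (S.G p ^ 2 + pairing V p ^ 2)) :
    ∀ᶠ p in 𝓝 p₀, S.timeFunction p ≠ 0 ∧
      ContMDiffAt (cotModel n) 𝓘(ℝ) ∞ (S.conormalDefining V ℓ C) p ∧
      0 ≤ S.conormalDefining V ℓ C p ∧
      (S.conormalDefining V ℓ C p = 0 → p ∈ S.halfConormal H s) ∧
      |k (base p₀)| / 2 ≤ S.beta p ∧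
      2 * (1 - δ) * S.beta p * S.conormalDefining V ℓ C p ≤
        s * ε * diff (cotModel n) (S.conormalDefining V ℓ C) p (S.rescaledHamilton p) ∧
      |diff (cotModel n) (S.conormalDefining V ℓ C) p (S.rescaledHamilton p)| ≤
        (8 * |k (base p₀)| + δ') * S.conormalDefining V ℓ C p := by
  have htp := hp₀.2.2.2
  obtain ⟨x, hx, a, hpe, ht⟩ := hd.mem_halfConormal_iff.1 hp₀
  obtain ⟨Ω, hΩ, h, hiso⟩ := hd.exists_isHorizonOn hx
  have ha : a ≠ 0 := by rintro rfl; simp at ht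
  have hbx : base p₀ = x := by rw [hpe]; rfl
  have hc : base p₀ ∈ (chartAt (EuclideanSpace ℝ (Fin n)) (base p₀)).source := mem_chart_source _ _
  subst hbx
  set D := S.localData V k ℓ (base p₀) with hD
  set y₀ := extChartAt (𝓡 n) (base p₀) (base p₀) with hy₀
  have hz : extChartAt (cotModel n) p₀ p₀ = (0, (y₀, a • D.dm y₀)) := by
    have h1 := hd.chart_conormal hc a
    rwa [← hpe] at h1
  have hΦc : ContinuousAt (extChartAt (cotModel n) p₀) p₀ := continuousAt_extChartAt p₀
  have hΦ : Filter.Tendsto (extChartAt (cotModel n) p₀) (𝓝 p₀) (𝓝 (0, (y₀, a • D.dm y₀))) := by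
    rw [← hz]; exact hΦc
  have hk : D.k y₀ = k (base p₀) :=
    congrArg k ((extChartAt (𝓡 n) (base p₀)).left_inv (mem_extChartAt_source _))
  have htm : D.tm (0, (y₀, a • D.dm y₀)) = S.timeFunction p₀ := by
    rw [← hz]; exact tm_chart V k ℓ hc
  have hrh : D.rh (0, (y₀, a • D.dm y₀)) = 1 := by
    rw [← hz, ← hρ]; exact rh_chart V k ℓ hc
  have hs2 : s * s = 1 := by rcases hs with rfl | rfl <;> norm_num
  have hΩ' := h.preimage_mem_nhds (z := (0, (y₀, a • D.dm y₀))) h.mem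
  -- the hypothesis on the transverse part, in coordinates
  have hQ' : ∀ᶠ z in 𝓝 ((0, (y₀, a • D.dm y₀)) :
      ℝ × (EuclideanSpace ℝ (Fin n) × (EuclideanSpace ℝ (Fin n) →L[ℝ] ℝ))),
      |fderiv ℝ D.Q z (D.ham z)| ≤ δ' / 4 * D.Q z + B * (D.G z ^ 2 + D.nu z ^ 2) := by
    have hsc : ContinuousAt (extChartAt (cotModel n) p₀).symm (0, (y₀, a • D.dm y₀)) := by
      rw [← hz]; exact continuousAt_extChartAt_symm p₀
    have hst : Filter.Tendsto (extChartAt (cotModel n) p₀).symm (𝓝 (0, (y₀, a • D.dm y₀)))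
        (𝓝 p₀) := by
      have h1 := hsc
      rwa [ContinuousAt, ← hz, extChartAt_cot_left_inv hc, hz] at h1
    filter_upwards [hst.eventually hQ, hΩ'] with z hz1 hzΩ
    have hzt : z.2.1 ∈ (extChartAt (𝓡 n) (base p₀)).target := hΩ hzΩ
    have hzT := (mem_extChartAt_cot_target p₀ z).2 hzt
    have hp : base ((extChartAt (cotModel n) p₀).symm z) ∈
        (chartAt (EuclideanSpace ℝ (Fin n)) (base p₀)).source :=
      (mem_extChartAt_cot_source p₀ _).1 ((extChartAt (cotModel n) p₀).map_target hzT)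
    have hr := (extChartAt (cotModel n) p₀).right_inv hzT
    have h3 := diff_hamilton (S := S) V k ℓ hp (F := D.Q) (by
        rw [hr]; exact (h.contDiffAt_Q hzΩ).differentiableAt (n := ∞) (by simp))
      (f := S.transverseSq V ℓ) (by
        filter_upwards [eventually_base_mem hp] with q hq
        exact (hd.Q_chart hq).symm)
    rw [hr] at h3
    rwa [h3, ← hd.localData_Q hzt, ← localData_G (k := k) (V := V) (ℓ := ℓ) hzt,
      ← localData_nu (S := S) (k := k) (ℓ := ℓ) hzt] at hz1
  have hmain := h.eventually_rho_ham ha (e := s * ε) hs (by rw [htm]; exact htp) hrh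
    (by rcases hs with rfl | rfl <;> rcases hε with rfl | rfl <;> simp)
    (by
      rw [hk]
      have := hεk _ hx
      calc (0 : ℝ) < ε * k (base p₀) := this
        _ = s * s * (ε * k (base p₀)) := by rw [hs2, one_mul]
        _ = s * ε * (s * k (base p₀)) := by ring)
    hδ' (by rw [hk]; exact hδ _ hx) hB hC hBC hQ'
  have hsT : ∀ᶠ p in 𝓝 p₀, 0 < s * S.timeFunction p :=
    (continuousAt_const.mul (contMDiff_timeFunction (S := S)).continuous.continuousAt).eventually
      (lt_mem_nhds htp)
  filter_upwards [hΦ.eventually hmain, hΦ.eventually (h.eventually_rho_eq_zero ha hC), hsT,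
    eventually_base_mem hc, hΦ.eventually hΩ'] with p h1 h2 hpt hp hpΩ
  have htne : S.timeFunction p ≠ 0 := fun h0 => by simp [h0] at hpt
  have htne' : D.tm (extChartAt (cotModel n) p₀ p) ≠ 0 := by
    rw [hD, tm_chart V k ℓ hp]; exact htne
  have hρs := h.contDiffAt_rho C hpΩ htne'
  have hrs := h.contDiffAt_rh hpΩ htne'
  have hβ := diff_hamilton (S := S) V k ℓ hp (hrs.differentiableAt (n := ∞) (by simp))
    (eventually_rh_chart V k ℓ hp)
  have hρd := diff_rescaledHamilton (S := S) (V := V) (k := k) (ℓ := ℓ) hp (hρs.differentiableAt (n := ∞) (by simp))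
    (hd.eventually_rho_chart C hp)
  rw [← hD] at hβ hρd
  refine ⟨htne, contMDiffAt_of_chart hp hρs (hd.eventually_rho_chart C hp), ?_, ?_, ?_, ?_, ?_⟩
  · rw [← hd.rho_chart C hp]; exact h.rho_nonneg hC hpΩ
  · intro h0
    rw [← hd.rho_chart C hp] at h0
    obtain ⟨q1, q2, q3⟩ := h2 h0
    have hbH : base p ∈ H := by
      have h4 := hiso _ hpΩ q2
      have h5 : (extChartAt (cotModel n) p₀ p).2.1 = extChartAt (𝓡 n) (base p₀) (base p) := by
        rw [extChartAt_cot]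
      rwa [h5, (extChartAt (𝓡 n) (base p₀)).left_inv (by rwa [extChartAt_source])] at h4
    have h5 : (extChartAt (cotModel n) p₀ p).2.1 = extChartAt (𝓡 n) (base p₀) (base p) := by
      rw [extChartAt_cot]
    have h6 : p = (0, ⟨base p, D.co (extChartAt (cotModel n) p₀ p) •
        diff (𝓡 n) (S.mu V) (base p)⟩) := by
      refine (extChartAt (cotModel n) p₀).injOn ((mem_extChartAt_cot_source p₀ _).2 hp)
        ((mem_extChartAt_cot_source p₀ _).2 hp) ?_
      rw [hd.chart_conormal hp]
      refine Prod.ext q1 (Prod.ext h5 ?_)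
      rw [q3, h5]
    refine hd.mem_halfConormal_iff.2 ⟨base p, hbH, _, h6, ?_⟩
    rw [← hd.timeFunction_conormal hbH, ← h6]
    exact hpt
  · rw [beta, hβ, ← hk]; exact h1.1
  · rw [beta, hβ, hρd, ← hd.rho_chart C hp]; exact h1.2.1
  · rw [hρd, ← hd.rho_chart C hp, ← hk]; exact h1.2.2

/-- Quadratic defining functions of the conormal set with the growth rate `2 (1 - δ) β`. The
estimates hold near the points of the compact set where `ρ̂ = 1`, with uniform constants, and
therefore on the union of the rays through a neighbourhood of it. -/
theorem exists_isLyapunov {s ε δ : ℝ} (hs : s = 1 ∨ s = -1)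
    (hε : ε = 1 ∨ ε = -1) (hεk : ∀ x ∈ H, 0 < ε * k x) (hδ : 0 < δ) :
    ∃ b L C : ℝ, 0 < b ∧ 0 < C ∧
      ∃ W, S.IsLyapunov H s (s * ε) δ b L (S.conormalDefining V ℓ C) W := by
  obtain ⟨b, hb, hbk⟩ := hd.isCompact.exists_forall_le' (f := fun x => |k x|)
    (hd.continuous_k.abs.continuousOn) (a := 0) fun x hx => abs_pos.2 (hd.k_ne_zero x hx)
  obtain ⟨L, hL⟩ := hd.isCompact.exists_bound_of_continuousOn hd.continuous_k.continuousOn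
  obtain ⟨B, hB, hBQ⟩ := hd.exists_uniform_abs_diff_transverseSq_le hs
    (show 0 < δ * b / 4 by positivity)
  have hδb : 0 < δ * b := mul_pos hδ hb
  obtain ⟨C, hC, hBC⟩ : ∃ C : ℝ, 0 < C ∧ 4 * B ≤ δ * b * C := by
    refine ⟨4 * B / (δ * b) + 1, by positivity, ?_⟩
    rw [mul_add, mul_div_cancel₀ _ hδb.ne']
    linarith
  set ρ := S.conormalDefining V ℓ C with hρ
  set A : Set (BCotangent n X) := {p | S.timeFunction p ≠ 0 ∧
      ContMDiffAt (cotModel n) 𝓘(ℝ) ∞ ρ p ∧ 0 ≤ ρ p ∧ (ρ p = 0 → p ∈ S.halfConormal H s) ∧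
      b / 2 ≤ S.beta p ∧
      2 * (1 - δ) * S.beta p * ρ p ≤
        s * ε * diff (cotModel n) ρ p (S.rescaledHamilton p) ∧
      |diff (cotModel n) ρ p (S.rescaledHamilton p)| ≤ (8 * L + δ * b) * ρ p} with hA
  have hAn : ∀ p₀ ∈ S.halfConormal H s, S.rhoHat p₀ = 1 → A ∈ 𝓝 p₀ := by
    intro p₀ hp₀ hp1
    have hbH : base p₀ ∈ H := hp₀.1.1
    filter_upwards [hd.eventually_conormalDefining (δ := δ) hs hε hεk hδb
      (fun x hx => mul_le_mul_of_nonneg_left (hbk x hx) hδ.le) hB hC hBC hp₀ hp1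
      (hBQ p₀ hp₀ hp1)] with p hp
    obtain ⟨q1, q2, q3, q4, q5, q6, q7⟩ := hp
    refine ⟨q1, q2, q3, q4, ?_, q6, q7.trans ?_⟩
    · have := hbk _ hbH
      linarith
    · refine mul_le_mul_of_nonneg_right ?_ q3
      have := hL _ hbH
      rw [Real.norm_eq_abs] at this
      linarith
  have hdil : ∀ c : ℝ, 0 < c → ∀ p, ρ (dilate c p) = ρ p := fun c hc p =>
    S.conormalDefining_dilate V ℓ C hc p
  have hopen : ∀ c : ℝ, IsOpen (dilate c ⁻¹' interior A) := fun c =>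
    isOpen_interior.preimage (continuous_dilate.comp (continuous_const.prodMk continuous_id))
  refine ⟨b / 2, 8 * L + δ * b, C, half_pos hb, hC,
    {p | ∃ c : ℝ, 0 < c ∧ dilate c p ∈ interior A}, ?_⟩
  have hWA : ∀ p, (∃ c : ℝ, 0 < c ∧ dilate c p ∈ interior A) → p ∈ A := by
    rintro p ⟨c, hc, hcA⟩
    obtain ⟨q1, q2, q3, q4, q5, q6, q7⟩ := interior_subset hcA
    rw [timeFunction_dilate] at q1
    have q1' : S.timeFunction p ≠ 0 := right_ne_zero_of_mul q1
    have hρc : ρ ∘ dilate c = ρ := funext (hdil c hc)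
    rw [hdil c hc] at q3 q4 q6 q7
    rw [beta_dilate hc q1'] at q5 q6
    rw [diff_rescaledHamilton_dilate hc hρc (q2.mdifferentiableAt (by simp))] at q6 q7
    refine ⟨q1', ?_, q3, fun h0 => ?_, q5, q6, q7⟩
    · have h1 := q2.comp p (contMDiff_dilate c p)
      rwa [hρc] at h1
    · have h1 := hd.isConic_halfConormal s _ (q4 h0) c⁻¹ (inv_pos.2 hc)
      rwa [dilate_dilate, inv_mul_cancel₀ hc.ne', dilate_one] at h1
  refine { isOpen := ?_, isConic := ?_, subset := ?_,
           timeFunction_ne_zero := fun p hp => (hWA p hp).1,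
           smooth := fun p hp => (hWA p hp).2.1, nonneg := fun p hp => (hWA p hp).2.2.1,
           eq_zero_iff := fun p hp => ⟨(hWA p hp).2.2.2.1, hd.conormalDefining_eq_zero C⟩,
           dilate := hdil, le_beta := fun p hp => (hWA p hp).2.2.2.2.1,
           le_diff := fun p hp => (hWA p hp).2.2.2.2.2.1,
           abs_diff_le := fun p hp => (hWA p hp).2.2.2.2.2.2 }
  · have h1 : {p | ∃ c : ℝ, 0 < c ∧ dilate c p ∈ interior A} =
        ⋃ c ∈ Ioi (0 : ℝ), dilate c ⁻¹' interior A := by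
      ext p; simp
    rw [h1]
    exact isOpen_biUnion fun c _ => hopen c
  · rintro p ⟨c, hc, hcA⟩ c' hc'
    refine ⟨c * c'⁻¹, by positivity, ?_⟩
    rwa [dilate_dilate, mul_assoc, inv_mul_cancel₀ hc'.ne', mul_one]
  · intro p hp
    have hr := S.rhoHat_pos (timeFunction_ne_zero hp)
    refine ⟨S.rhoHat p, hr, mem_interior_iff_mem_nhds.2 (hAn _
      (hd.isConic_halfConormal s p hp _ hr) ?_)⟩
    rw [S.rhoHat_dilate hr, inv_mul_cancel₀ hr.ne']

end HorizonData

end Setting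

section Sphere

variable {n : ℕ} {X : Type*} [TopologicalSpace X] [ChartedSpace (EuclideanSpace ℝ (Fin n)) X]

/-- The function on the b-cosphere bundle induced by a function which is constant on rays. -/
def sphereFun (f : BCotangent n X → ℝ) (z : BSphere n X) : ℝ := f (Quotient.out z).1

theorem sphereFun_toSphere {f : BCotangent n X → ℝ}
    (hf : ∀ c : ℝ, 0 < c → ∀ p, f (dilate c p) = f p)
    (p : Nonzero n X) : sphereFun f (toSphere p) = f p.1 := by
  obtain ⟨c, hc, h⟩ := Quotient.mk_out (s := raySetoid n X) p
  rw [h, hf c hc]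
  rfl

theorem lift_sphereFun {f : BCotangent n X → ℝ} (hf : ∀ c : ℝ, 0 < c → ∀ p, f (dilate c p) = f p)
    {p : BCotangent n X} (hp : ¬(p.1 = 0 ∧ p.2.snd = 0)) : lift (sphereFun f) p = f p := by
  rw [lift, dif_pos hp, sphereFun_toSphere hf]

end Sphere

namespace Setting

variable {n : ℕ} {M : Type*} [TopologicalSpace M] [ChartedSpace (EuclideanHalfSpace (n + 1)) M]
  [IsManifold (𝓡∂ (n + 1)) ∞ M]
  {X : Type*} [TopologicalSpace X] [ChartedSpace (EuclideanSpace ℝ (Fin n)) X]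
  [IsManifold (𝓡 n) ∞ X] {S : Setting n M X}

/-! ### Quadratic defining functions on the b-cosphere bundle -/

theorem nonzero_of_timeFunction_ne_zero {p : BCotangent n X} (hp : S.timeFunction p ≠ 0) :
    ¬(p.1 = 0 ∧ p.2.snd = 0) := by
  rintro ⟨h1, h2⟩
  obtain ⟨σ, ⟨x, η⟩⟩ := p
  change σ = 0 at h1
  change η = 0 at h2
  subst h1 h2
  refine hp ?_
  have h := S.timeFunction_dilate 0 ((0, ⟨x, 0⟩) : BCotangent n X)
  rw [zero_mul] at h
  have h3 : dilate 0 ((0, ⟨x, 0⟩) : BCotangent n X) = (0, ⟨x, 0⟩) := by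
    have h4 : (0 : ℝ) • (0 : TangentSpace (𝓡 n) x →L[ℝ] ℝ) = 0 := smul_zero _
    dsimp only [dilate]
    rw [zero_mul]
    exact congrArg (fun e : TangentSpace (𝓡 n) x →L[ℝ] ℝ => ((0, ⟨x, e⟩) : BCotangent n X)) h4
  rwa [h3] at h

theorem cone_L {H : Set X} {s : ℝ} (hc : IsConic (S.halfConormal H s)) :
    cone (S.L H s) = S.halfConormal H s := by
  ext p
  exact (mem_cone_sphereSet hc).trans ⟨fun h => h.2, fun h => ⟨h.2.1, h⟩⟩

namespace IsLyapunov

variable {H : Set X} {s e δ b L : ℝ} {ρ : BCotangent n X → ℝ} {W : Set (BCotangent n X)}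
  (hW : S.IsLyapunov H s e δ b L ρ W)

include hW

theorem cone_sphereSet : cone (sphereSet W) = W := by
  ext p
  exact (mem_cone_sphereSet hW.isConic).trans ⟨fun h => h.2, fun h =>
    ⟨nonzero_of_timeFunction_ne_zero (hW.timeFunction_ne_zero p h), h⟩⟩

theorem lift_eq {p : BCotangent n X} (hp : p ∈ W) : lift (sphereFun ρ) p = ρ p :=
  lift_sphereFun hW.dilate (nonzero_of_timeFunction_ne_zero (hW.timeFunction_ne_zero p hp))

theorem lift_eventuallyEq {p : BCotangent n X} (hp : p ∈ W) : lift (sphereFun ρ) =ᶠ[𝓝 p] ρ := by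
  filter_upwards [hW.isOpen.mem_nhds hp] with q hq
  exact hW.lift_eq hq

theorem exists_le_diff_lift (hb : 0 < b) : ∃ U : Set (BSphere n X), IsOpen U ∧ S.L H s ⊆ U ∧
    ∀ p ∈ cone U, S.timeFunction p ≠ 0 ∧ 0 < S.beta p ∧
      2 * (1 - δ) * S.beta p * lift (sphereFun ρ) p ≤
        e * diff (cotModel n) (lift (sphereFun ρ)) p (S.rescaledHamilton p) := by
  refine ⟨sphereSet W, isOpen_sphereSet hW.isConic hW.isOpen, ?_, ?_⟩
  · rintro z ⟨p, hp, rfl⟩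
    exact ⟨p, hW.subset hp, rfl⟩
  · rw [hW.cone_sphereSet]
    intro p hp
    refine ⟨hW.timeFunction_ne_zero p hp, hb.trans_le (hW.le_beta p hp), ?_⟩
    have h1 : mfderiv (cotModel n) 𝓘(ℝ) (lift (sphereFun ρ)) p =
        mfderiv (cotModel n) 𝓘(ℝ) ρ p := (hW.lift_eventuallyEq hp).mfderiv_eq
    have h2 : diff (cotModel n) (lift (sphereFun ρ)) p (S.rescaledHamilton p) =
        diff (cotModel n) ρ p (S.rescaledHamilton p) := DFunLike.congr_fun h1 _
    rw [h2, hW.lift_eq hp]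
    exact hW.le_diff p hp

end IsLyapunov

namespace HorizonData

variable {V : ∀ x : X, TangentSpace (𝓡 n) x} {k : X → ℝ}
  {ℓ : ∀ x : X, TangentSpace (𝓡 n) x →L[ℝ] TangentSpace (𝓡 n) x →L[ℝ] ℝ} {H : Set X}
  (hd : S.HorizonData V k ℓ H)

include hd

/-- The Hessian of the quadratic defining function is positive in the directions transversal to
the conormal set: a vector on which it is not positive is annihilated by a submersion defining
the conormal set, hence by all functions vanishing there. -/
theorem hessian_conormalDefining_pos {s ε C : ℝ} (hεk : ∀ x ∈ H, 0 < ε * k x) (hC : 0 < C)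
    {p : BCotangent n X} (hp : p ∈ S.halfConormal H s) {v : TangentSpace (cotModel n) p}
    (hv : v ∉ tangentTo (cotModel n) (S.halfConormal H s) p) :
    0 < hessian (S.conormalDefining V ℓ C) p v := by
  obtain ⟨x, hx, a, hpe, ht⟩ := hd.mem_halfConormal_iff.1 hp
  obtain ⟨Ω, hΩ, h, hiso⟩ := hd.exists_isHorizonOn hx
  have ha : a ≠ 0 := by rintro rfl; simp at ht
  have hbx : base p = x := by rw [hpe]; rfl
  have hc : base p ∈ (chartAt (EuclideanSpace ℝ (Fin n)) (base p)).source := mem_chart_source _ _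
  subst hbx
  obtain ⟨n₀, hn₀⟩ := h.exists_normal
  have hz : extChartAt (cotModel n) p p = (0, (extChartAt (𝓡 n) (base p) (base p),
      a • (S.localData V k ℓ (base p)).dm (extChartAt (𝓡 n) (base p) (base p)))) := by
    have h1 := hd.chart_conormal hc a
    rwa [← hpe] at h1
  have hsymm : Filter.Tendsto (extChartAt (cotModel n) p).symm
      (𝓝 (extChartAt (cotModel n) p p)) (𝓝 p) := by
    have h1 := continuousAt_extChartAt_symm (I := cotModel n) p
    rwa [ContinuousAt, extChartAt_cot_left_inv hc] at h1
  have hrho : S.conormalDefining V ℓ C ∘ (extChartAt (cotModel n) p).symm =ᶠ[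
      𝓝 (extChartAt (cotModel n) p p)] (S.localData V k ℓ (base p)).rho C := by
    filter_upwards [hsymm.eventually (eventually_base_mem hc),
      (isOpen_extChartAt_target (I := cotModel n) p).mem_nhds (mem_extChartAt_target p)]
      with z hz1 hz2
    rw [Function.comp_apply, ← hd.rho_chart C hz1, (extChartAt (cotModel n) p).right_inv hz2]
  rw [hessian, (hrho.iteratedFDeriv ℝ 2).eq_of_nhds, hz]
  refine h.hessian_rho_pos ha hC (n₀ := n₀) fun h0 => hv ?_
  intro f hf hfv
  have hfd : MDifferentiableAt (cotModel n) 𝓘(ℝ) f p := (hf p).mdifferentiableAt (by simp)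
  have hdf : diff (cotModel n) f p v =
      fderiv ℝ (f ∘ (extChartAt (cotModel n) p).symm) (extChartAt (cotModel n) p p) v := by
    have h1 : mfderiv (cotModel n) 𝓘(ℝ) f p = fderivWithin ℝ
        (f ∘ (extChartAt (cotModel n) p).symm) (range (cotModel n)) (extChartAt (cotModel n) p p) :=
      hfd.mfderiv
    rw [(cotModel n).range_eq_univ, fderivWithin_univ] at h1
    exact DFunLike.congr_fun h1 v
  rw [hdf, hz]
  refine h.fderiv_eq_zero_of_vanishing ha hn₀ ?_ ?_ h0
  · rw [← hz, ← contMDiffAt_iff_contDiffAt]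
    have h1 : ContMDiffAt 𝓘(ℝ, ℝ × (EuclideanSpace ℝ (Fin n) × (EuclideanSpace ℝ (Fin n) →L[ℝ] ℝ)))
        (cotModel n) ∞ (extChartAt (cotModel n) p).symm (extChartAt (cotModel n) p p) :=
      (contMDiffOn_extChartAt_symm p).contMDiffAt
        ((isOpen_extChartAt_target (I := cotModel n) p).mem_nhds (mem_extChartAt_target p))
    exact (hf _).comp _ h1
  · intro y hy hmu b hb
    have hyH := hiso y hy hmu
    have hyt := hΩ hy
    refine hfv _ ?_
    have hys : (extChartAt (𝓡 n) (base p)).symm y ∈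
        (chartAt (EuclideanSpace ℝ (Fin n)) (base p)).source := chart_symm_mem hyt
    have h1 := hd.chart_conormal (p₀ := p) hys b
    rw [(extChartAt (𝓡 n) (base p)).right_inv hyt] at h1
    rw [← h1, extChartAt_cot_left_inv hys]
    refine hd.mem_halfConormal_iff.2 ⟨_, hyH, b, rfl, ?_⟩
    set k' := k ((extChartAt (𝓡 n) (base p)).symm y) with hk'
    have hkk : 0 < k' * k (base p) := by
      have h2 := mul_pos (hεk _ hyH) (hεk _ hx)
      have h3 : ε * k' * (ε * k (base p)) = ε ^ 2 * (k' * k (base p)) := by ring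
      rw [h3] at h2
      exact pos_of_mul_pos_right h2 (sq_nonneg _)
    have h4 : 0 < s * -(2 * k' * b) * (a * k (base p)) ^ 2 := by
      have := mul_pos ht (mul_pos hb hkk)
      calc 0 < _ := this
        _ = _ := by ring
    exact pos_of_mul_pos_left h4 (sq_nonneg _)

theorem isQuadraticDefiningFunction {s ε e δ b L C : ℝ} (hεk : ∀ x ∈ H, 0 < ε * k x) (hC : 0 < C)
    {W : Set (BCotangent n X)} (hW : S.IsLyapunov H s e δ b L (S.conormalDefining V ℓ C) W) :
    IsQuadraticDefiningFunction (S.L H s) (sphereFun (S.conormalDefining V ℓ C)) := by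
  have hΛ := hd.isConic_halfConormal s
  refine ⟨sphereSet W, isOpen_sphereSet hW.isConic hW.isOpen, ?_, ?_, ?_, ?_⟩
  · rintro z ⟨p, hp, rfl⟩
    exact ⟨p, hW.subset hp, rfl⟩
  · rw [hW.cone_sphereSet]
    exact fun p hp => ((hW.smooth p hp).congr_of_eventuallyEq
      (hW.lift_eventuallyEq hp)).contMDiffWithinAt
  · rintro z ⟨p, hp, rfl⟩
    rw [sphereFun_toSphere hW.dilate]
    exact ⟨hW.nonneg _ hp, (hW.eq_zero_iff _ hp).trans (toSphere_mem_sphereSet hΛ).symm⟩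
  · rw [cone_L hΛ]
    intro p hp v hv
    have hpW := hW.subset hp
    have h1 := hd.hessian_conormalDefining_pos hεk hC hp hv
    have hc : base p ∈ (chartAt (EuclideanSpace ℝ (Fin n)) (base p)).source :=
      mem_chart_source _ _
    have hsymm : Filter.Tendsto (extChartAt (cotModel n) p).symm
        (𝓝 (extChartAt (cotModel n) p p)) (𝓝 p) := by
      have h1 := continuousAt_extChartAt_symm (I := cotModel n) p
      rwa [ContinuousAt, extChartAt_cot_left_inv hc] at h1
    have h2 : lift (sphereFun (S.conormalDefining V ℓ C)) ∘ (extChartAt (cotModel n) p).symm =ᶠ[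
        𝓝 (extChartAt (cotModel n) p p)]
        S.conormalDefining V ℓ C ∘ (extChartAt (cotModel n) p).symm :=
      hsymm.eventually (hW.lift_eventuallyEq hpW)
    rwa [hessian, (h2.iteratedFDeriv ℝ 2).eq_of_nhds]

end HorizonData

end Setting

/-! ### Invariance of the conormal set -/

/-- A linear differential inequality: `f' ≤ a f` implies `f t ≤ exp (a (t - s)) f s`. -/
theorem le_exp_mul_of_deriv_le {f f' : ℝ → ℝ} {J : Set ℝ} {a s t : ℝ} (hJ : Convex ℝ J)
    (hf : ∀ t ∈ J, HasDerivWithinAt f (f' t) J t) (hle : ∀ t ∈ J, f' t ≤ a * f t)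
    (hs : s ∈ J) (ht : t ∈ J) (hst : s ≤ t) : f t ≤ Real.exp (a * (t - s)) * f s := by
  have hg : ∀ t ∈ J, HasDerivWithinAt (fun t => Real.exp (-a * t) * f t)
      (Real.exp (-a * t) * (f' t - a * f t)) J t := by
    intro t ht
    have h1 : HasDerivAt (fun t => Real.exp (-a * t)) (Real.exp (-a * t) * (-a * 1)) t :=
      ((hasDerivAt_id t).const_mul (-a)).exp
    refine (h1.hasDerivWithinAt.mul (hf t ht)).congr_deriv ?_
    ring
  have hanti : AntitoneOn (fun t => Real.exp (-a * t) * f t) J := by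
    refine antitoneOn_of_hasDerivWithinAt_nonpos hJ
      (fun t ht => (hg t ht).continuousWithinAt)
      (fun t ht => (hg t (interior_subset ht)).mono interior_subset) fun t ht => ?_
    have h1 := hle t (interior_subset ht)
    exact mul_nonpos_of_nonneg_of_nonpos (Real.exp_pos _).le (by linarith)
  have h1 := hanti hs ht hst
  have h2 := mul_le_mul_of_nonneg_left h1 (Real.exp_pos (a * t)).le
  simp only [← mul_assoc, ← Real.exp_add] at h2
  have h3 : a * t + -a * t = 0 := by ring
  have h4 : a * t + -a * s = a * (t - s) := by ring
  rwa [h3, h4, Real.exp_zero, one_mul] at h2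

namespace Setting

variable {n : ℕ} {M : Type*} [TopologicalSpace M] [ChartedSpace (EuclideanHalfSpace (n + 1)) M]
  [IsManifold (𝓡∂ (n + 1)) ∞ M]
  {X : Type*} [TopologicalSpace X] [ChartedSpace (EuclideanSpace ℝ (Fin n)) X]
  [IsManifold (𝓡 n) ∞ X] {S : Setting n M X}

variable (S) in
/-- The point on the ray through `p` at which `ρ̂ = 1`. -/
def normalize (p : BCotangent n X) : BCotangent n X := dilate (S.rhoHat p) p

theorem normalize_dilate {c : ℝ} (hc : 0 < c) (p : BCotangent n X) :
    S.normalize (dilate c p) = S.normalize p := by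
  rw [normalize, normalize, S.rhoHat_dilate hc, dilate_dilate, mul_right_comm,
    inv_mul_cancel₀ hc.ne', one_mul]

theorem rhoHat_normalize {p : BCotangent n X} (hp : S.timeFunction p ≠ 0) :
    S.rhoHat (S.normalize p) = 1 := by
  have h := S.rhoHat_pos hp
  rw [normalize, S.rhoHat_dilate h, inv_mul_cancel₀ h.ne']

theorem normalize_mem_iff {O : Set (BCotangent n X)} (hO : IsConic O) {p : BCotangent n X}
    (hp : S.timeFunction p ≠ 0) : S.normalize p ∈ O ↔ p ∈ O := by
  have h := S.rhoHat_pos hp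
  refine ⟨fun h1 => ?_, fun h1 => hO p h1 _ h⟩
  have h2 := hO _ h1 _ (inv_pos.2 h)
  rwa [normalize, dilate_dilate, inv_mul_cancel₀ h.ne', dilate_one] at h2

theorem continuousAt_normalize {p : BCotangent n X} (hp : S.timeFunction p ≠ 0) :
    ContinuousAt S.normalize p :=
  ContinuousAt.comp (f := fun p => (S.rhoHat p, p)) continuous_dilate.continuousAt
    ((contMDiffAt_rhoHat hp).continuousAt.prodMk continuousAt_id)

theorem isClosed_slice : IsClosed {p | S.rhoHat p = 1} := by
  have h1 : {p | S.rhoHat p = 1} = {p | |2 * S.timeFunction p| = 1} := by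
    ext p
    exact inv_eq_one
  rw [h1]
  exact isClosed_eq ((continuous_const.mul (contMDiff_timeFunction (S := S)).continuous).abs)
    continuous_const

/-- The derivative of a function along an integral curve of `d ρ̂ H_G`. -/
theorem hasDerivWithinAt_comp_curve {d : ℝ} {c : ℝ → BCotangent n X} {J : Set ℝ}
    (hc : IsMIntegralCurveOn (I := cotModel n) c (fun p => d • S.rescaledHamilton p) J)
    {f : BCotangent n X → ℝ} {t : ℝ} (ht : t ∈ J)
    (hf : MDifferentiableAt (cotModel n) 𝓘(ℝ) f (c t)) :
    HasDerivWithinAt (f ∘ c) (d * diff (cotModel n) f (c t) (S.rescaledHamilton (c t))) J t := by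
  let A : ℝ →L[ℝ] ℝ := (mfderiv (cotModel n) 𝓘(ℝ) f (c t)).comp
    ((1 : ℝ →L[ℝ] ℝ).smulRight (d • S.rescaledHamilton (c t)))
  have h1 : HasFDerivWithinAt (f ∘ c) A J t :=
    (hf.hasMFDerivAt.comp_hasMFDerivWithinAt t (hc t ht)).hasFDerivWithinAt
  have h2 := h1.hasDerivWithinAt
  have h3 : (mfderiv (cotModel n) 𝓘(ℝ) f (c t)) ((1 : ℝ) • (d • S.rescaledHamilton (c t))) =
      d * diff (cotModel n) f (c t) (S.rescaledHamilton (c t)) := by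
    rw [one_smul]
    exact ContinuousLinearMap.map_smul _ _ _
  rw [← h3]
  exact h2

namespace IsLyapunov

variable {H : Set X} {s e δ b L : ℝ} {ρ : BCotangent n X → ℝ} {W : Set (BCotangent n X)}
  (hW : S.IsLyapunov H s e δ b L ρ W)

include hW

/-- An integral curve inside `W` meeting the conormal set stays in it, by Gronwall's inequality. -/
theorem mem_of_curve {d : ℝ} (hd : |d| ≤ 1) {c : ℝ → BCotangent n X} {J : Set ℝ}
    (hJ : Convex ℝ J)
    (hc : IsMIntegralCurveOn (I := cotModel n) c (fun p => d • S.rescaledHamilton p) J)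
    (hcW : ∀ t ∈ J, c t ∈ W) {t₀ t : ℝ} (ht₀ : t₀ ∈ J) (ht : t ∈ J)
    (h0 : c t₀ ∈ S.halfConormal H s) : c t ∈ S.halfConormal H s := by
  have hder := fun t (ht : t ∈ J) => hasDerivWithinAt_comp_curve hc ht
    ((hW.smooth _ (hcW t ht)).mdifferentiableAt (by simp))
  have habs : ∀ t ∈ J, |d * diff (cotModel n) ρ (c t) (S.rescaledHamilton (c t))| ≤
      L * (ρ ∘ c) t := by
    intro t ht
    rw [abs_mul]
    refine le_trans ?_ (hW.abs_diff_le _ (hcW t ht))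
    exact mul_le_of_le_one_left (abs_nonneg _) hd
  have hz : (ρ ∘ c) t₀ = 0 := (hW.eq_zero_iff _ (hcW t₀ ht₀)).2 h0
  have hle : (ρ ∘ c) t ≤ 0 := by
    rcases le_total t₀ t with h | h
    · have h1 := le_exp_mul_of_deriv_le hJ hder (fun t ht => (le_abs_self _).trans (habs t ht))
        ht₀ ht h
      rwa [hz, mul_zero] at h1
    · have h1 := le_exp_mul_of_deriv_le (f := -(ρ ∘ c)) (a := -L) hJ
        (fun t ht => (hder t ht).neg) (fun t ht => by
          have h2 := (neg_le_abs _).trans (habs t ht)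
          rw [Pi.neg_apply, neg_mul_neg]
          exact h2) ht ht₀ h
      rw [Pi.neg_apply, Pi.neg_apply, hz, neg_zero] at h1
      have h2 := Real.exp_pos (-L * (t₀ - t))
      by_contra! hcon
      have := mul_pos h2 hcon
      linarith
  exact (hW.eq_zero_iff _ (hcW t ht)).1 (le_antisymm hle (hW.nonneg _ (hcW t ht)))

theorem isInvariant [T2Space X] (hΛ : IsConic (S.halfConormal H s))
    (hcpt : IsCompact {p | p ∈ S.halfConormal H s ∧ S.rhoHat p = 1}) :
    S.IsInvariant (S.L H s) := by
  have : T2Space (BCotangent n X) := t2Space_bCotangent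
  rintro γ J hJ h0 ⟨c, hγ, htime, hc⟩ hγ0 t ht
  have hmem : ∀ t ∈ J, γ t ∈ S.L H s ↔ (c t).1 ∈ S.halfConormal H s := fun t ht => by
    rw [hγ t ht]; exact toSphere_mem_sphereSet hΛ
  rw [hmem 0 h0] at hγ0
  rw [hmem t ht]
  set c' : J → BCotangent n X := fun t => (c t).1 with hc'
  have hcont : Continuous c' := continuousOn_iff_continuous_domRestrict.1 hc.continuousOn
  have : PreconnectedSpace J := Subtype.preconnectedSpace hJ.isPreconnected
  have hclopen : IsClopen {t : J | c' t ∈ S.halfConormal H s} := by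
    constructor
    · have h1 : {t : J | c' t ∈ S.halfConormal H s} =
          (fun t => S.normalize (c' t)) ⁻¹' {p | p ∈ S.halfConormal H s ∧ S.rhoHat p = 1} := by
        ext t
        exact ⟨fun h => ⟨(normalize_mem_iff hΛ (htime t t.2)).2 h, rhoHat_normalize (htime t t.2)⟩,
          fun h => (normalize_mem_iff hΛ (htime t t.2)).1 h.1⟩
      rw [h1]
      refine hcpt.isClosed.preimage (continuous_iff_continuousAt.2 fun t => ?_)
      exact ContinuousAt.comp (f := c') (continuousAt_normalize (htime t t.2)) hcont.continuousAt
    · rw [isOpen_iff_mem_nhds]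
      intro t₁ ht₁
      have h1 : c' ⁻¹' W ∈ 𝓝 t₁ :=
        (hW.isOpen.preimage hcont).mem_nhds (hW.subset ht₁)
      obtain ⟨r, hr, hball⟩ := Metric.mem_nhds_iff.1 h1
      filter_upwards [Metric.ball_mem_nhds t₁ hr] with t₂ ht₂
      refine hW.mem_of_curve (d := 1) (by simp) (J := Metric.ball t₁.1 r ∩ J)
        ((convex_ball _ _).inter hJ.convex) (hc.mono inter_subset_right) ?_
        ⟨Metric.mem_ball_self hr, t₁.2⟩ ⟨ht₂, t₂.2⟩ ht₁
      intro t ht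
      exact hball (show (⟨t, ht.2⟩ : J) ∈ Metric.ball t₁ r from ht.1)
  have := hclopen.eq_univ ⟨⟨0, h0⟩, hγ0⟩
  exact this.ge (mem_univ (⟨t, ht⟩ : J))

end IsLyapunov

end Setting

/-! ### Existence of flow lines -/

/-- The flow lines of a vector field of class `C¹` starting near `x₀` exist for a uniform time, in
which they do not leave a given neighbourhood of `x₀`. -/
theorem exists_flow_near {E : Type*} [NormedAddCommGroup E] [NormedSpace ℝ E] [CompleteSpace E]
    {f : E → E} {x₀ : E} (hf : ContDiffAt ℝ 1 f x₀) {U : Set E} (hU : U ∈ 𝓝 x₀) :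
    ∃ h : ℝ, 0 < h ∧ ∀ᶠ x in 𝓝 x₀, ∃ α : ℝ → E, α 0 = x ∧
      ∀ t ∈ Icc 0 h, α t ∈ U ∧ HasDerivAt α (f (α t)) t := by
  obtain ⟨ε, hε, a, r, K, K', hr, hpl⟩ := IsPicardLindelof.of_contDiffAt_one hf
  obtain ⟨α, hα, hcont⟩ := (hpl 0).exists_forall_mem_closedBall_eq_hasDerivWithinAt_continuousOn
  rw [zero_sub, zero_add] at *
  have hx₀ : α (x₀, 0) = x₀ := (hα x₀ (Metric.mem_closedBall_self r.2)).1
  have hnhds : Metric.closedBall x₀ (r : ℝ) ×ˢ Icc (-ε) ε ∈ 𝓝 ((x₀, 0) : E × ℝ) :=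
    prod_mem_nhds (Metric.closedBall_mem_nhds _ hr) (Icc_mem_nhds (by linarith) hε)
  have hmem : α ⁻¹' U ∈ 𝓝 ((x₀, 0) : E × ℝ) :=
    (hcont.continuousAt hnhds).preimage_mem_nhds (by rwa [hx₀])
  rw [nhds_prod_eq, Filter.mem_prod_iff] at hmem
  obtain ⟨A, hA, B, hB, hAB⟩ := hmem
  obtain ⟨η, hη, hηB⟩ := Metric.mem_nhds_iff.1 hB
  refine ⟨min η ε / 2, by positivity, ?_⟩
  filter_upwards [hA, Metric.closedBall_mem_nhds x₀ (show (0 : ℝ) < r from hr)] with x hxA hxr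
  refine ⟨fun t => α (x, t), (hα x hxr).1, fun t ht => ⟨?_, ?_⟩⟩
  · refine hAB ⟨hxA, hηB ?_⟩
    rw [Metric.mem_ball, Real.dist_eq, sub_zero, abs_of_nonneg ht.1]
    have h1 := min_le_left η ε
    have h2 := ht.2
    linarith
  · have h1 := min_le_right η ε
    have h2 := ht.2
    have h3 := ht.1
    exact ((hα x hxr).2 t ⟨by linarith, by linarith⟩).hasDerivAt
      (Icc_mem_nhds (by linarith) (by linarith))

section Concatenation

variable {E : Type*} [NormedAddCommGroup E] [NormedSpace ℝ E] {H : Type*} [TopologicalSpace H]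
  {I : ModelWithCorners ℝ E H} {P : Type*} [TopologicalSpace P] [ChartedSpace H P]
  {v : ∀ x : P, TangentSpace I x}

/-- If the flow lines starting in `O` stay in `O` for a uniform time, they exist for all positive
times. -/
theorem exists_isMIntegralCurveOn_Ici {O : Set P} {h : ℝ} (hh : 0 < h)
    (hO : ∀ p ∈ O, ∃ c : ℝ → P, c 0 = p ∧ (∀ t ∈ Icc 0 h, c t ∈ O) ∧
      IsMIntegralCurveOn c v (Icc 0 h)) {p : P} (hp : p ∈ O) :
    ∃ c : ℝ → P, c 0 = p ∧ (∀ t ∈ Ici (0 : ℝ), c t ∈ O) ∧ IsMIntegralCurveOn c v (Ici 0) := by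
  choose! Γ hΓ0 hΓO hΓ using hO
  let q : ℕ → P := fun k => Nat.rec p (fun _ x => Γ x h) k
  have hqO : ∀ k, q k ∈ O := by
    intro k
    induction k with
    | zero => exact hp
    | succ k ih => exact hΓO _ ih h ⟨hh.le, le_rfl⟩
  let c : ℝ → P := fun t => Γ (q ⌊t / h⌋₊) (t + -(⌊t / h⌋₊ * h))
  -- the curve agrees on the closed intervals between multiples of `h` with translates of
  -- the given curves
  have hc : ∀ k : ℕ, ∀ t ∈ Icc (k * h) ((k + 1) * h), c t = Γ (q k) (t + -(k * h)) := by
    intro k t ht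
    rcases ht.2.lt_or_eq with h1 | h1
    · have h2 : ⌊t / h⌋₊ = k := by
        rw [Nat.floor_eq_iff (div_nonneg ((by positivity : 0 ≤ (k : ℝ) * h).trans ht.1) hh.le),
          le_div_iff₀ hh, div_lt_iff₀ hh]
        exact ⟨ht.1, h1⟩
      simp only [c, h2]
    · have h2 : ⌊t / h⌋₊ = k + 1 := by
        rw [h1, mul_div_cancel_right₀ _ hh.ne']
        exact_mod_cast Nat.floor_natCast (R := ℝ) (k + 1)
      simp only [c, h2]
      have h3 : t + -(((k + 1 : ℕ) : ℝ) * h) = 0 := by rw [h1]; push_cast; ring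
      have h4 : t + -(k * h) = h := by rw [h1]; ring
      rw [h3, h4]
      exact hΓ0 _ (hqO (k + 1))
  have hcurve : ∀ k : ℕ, ∀ t ∈ Icc (k * h) ((k + 1) * h),
      HasMFDerivWithinAt 𝓘(ℝ) I c (Icc (k * h) ((k + 1) * h)) t
        ((1 : ℝ →L[ℝ] ℝ).smulRight (v (c t))) := by
    intro k t ht
    have hsub : Icc (k * h) ((k + 1) * h) ⊆ {t | t + -(k * h) ∈ Icc 0 h} := fun t ht =>
      ⟨by linarith [ht.1], by linarith [ht.2]⟩
    have h1 := (((hΓ _ (hqO k)).comp_add (-(k * h))).mono hsub) t ht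
    have h2 := h1.congr_of_eventuallyEq
      (f₁ := c) (Filter.eventuallyEq_of_mem self_mem_nhdsWithin (hc k)) (hc k t ht)
    refine h2.congr_mfderiv ?_
    have h3 : ∀ x y : P, x = y → (v x : E) = (v y : E) := by rintro x _ rfl; rfl
    exact congrArg (fun w : E => (1 : ℝ →L[ℝ] ℝ).smulRight w) (h3 _ _ (hc k t ht).symm)
  have hfloor : ∀ t, 0 ≤ t → t ∈ Ico (⌊t / h⌋₊ * h) ((⌊t / h⌋₊ + 1) * h) := fun t ht =>
    ⟨(le_div_iff₀ hh).1 (Nat.floor_le (div_nonneg ht hh.le)),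
      (div_lt_iff₀ hh).1 (Nat.lt_floor_add_one _)⟩
  have hright : ∀ t, 0 ≤ t → HasMFDerivWithinAt 𝓘(ℝ) I c (Ici t) t
      ((1 : ℝ →L[ℝ] ℝ).smulRight (v (c t))) := by
    intro t ht
    have h1 := hfloor t ht
    exact (hcurve _ t ⟨h1.1, h1.2.le⟩).mono_of_mem_nhdsWithin (Icc_mem_nhdsGE_of_mem h1)
  refine ⟨c, ?_, ?_, ?_⟩
  · rw [hc 0 0 ⟨by simp, by simpa using hh.le⟩]
    simp only [Nat.cast_zero, zero_mul, neg_zero, add_zero]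
    exact hΓ0 _ hp
  · intro t ht
    have h1 := hfloor t ht
    rw [hc _ t ⟨h1.1, h1.2.le⟩]
    exact hΓO _ (hqO _) _ ⟨by linarith [h1.1], by linarith [h1.2]⟩
  · intro t ht
    rcases (mem_Ici.1 ht).eq_or_lt with h0 | h0
    · rw [← h0]; exact hright 0 le_rfl
    obtain ⟨k, hk⟩ : ∃ k : ℕ, t ∈ Ioc (k * h) ((k + 1) * h) := by
      have h1 : 0 < ⌈t / h⌉₊ := Nat.ceil_pos.2 (div_pos h0 hh)
      obtain ⟨k, hk⟩ := Nat.exists_eq_succ_of_ne_zero h1.ne'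
      refine ⟨k, (lt_div_iff₀ hh).1 (Nat.lt_ceil.1 (by omega)), (div_le_iff₀ hh).1 ?_⟩
      have h2 := Nat.le_ceil (t / h)
      rw [hk] at h2
      exact_mod_cast h2
    have hleft : HasMFDerivWithinAt 𝓘(ℝ) I c (Iic t) t
        ((1 : ℝ →L[ℝ] ℝ).smulRight (v (c t))) :=
      (hcurve k t ⟨hk.1.le, hk.2⟩).mono_of_mem_nhdsWithin (Icc_mem_nhdsLE_of_mem hk)
    exact (hleft.union (hright t h0.le)).mono (by rw [Iic_union_Ici]; exact subset_univ _)

end Concatenation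

namespace Setting

variable {n : ℕ} {M : Type*} [TopologicalSpace M] [ChartedSpace (EuclideanHalfSpace (n + 1)) M]
  [IsManifold (𝓡∂ (n + 1)) ∞ M]
  {X : Type*} [TopologicalSpace X] [ChartedSpace (EuclideanSpace ℝ (Fin n)) X]
  [IsManifold (𝓡 n) ∞ X] {S : Setting n M X}

theorem exists_curve_near (d : ℝ) {p₀ : BCotangent n X} (hp₀ : S.timeFunction p₀ ≠ 0) :
    ∃ h : ℝ, 0 < h ∧ ∀ᶠ p in 𝓝 p₀, ∃ c : ℝ → BCotangent n X, c 0 = p ∧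
      (∀ t ∈ Icc 0 h, S.timeFunction (c t) ≠ 0) ∧
      IsMIntegralCurveOn (I := cotModel n) c (fun p => d • S.rescaledHamilton p) (Icc 0 h) := by
  have hc : base p₀ ∈ (chartAt (EuclideanSpace ℝ (Fin n)) (base p₀)).source := mem_chart_source _ _
  set D := S.localData (fun _ => 0) 0 (fun _ => 0) (base p₀) with hD
  have hm : D.IsMetricOn _ := S.isMetricOn_localData (fun _ => 0) 0 (fun _ => 0) (base p₀)
  have ht₀ : D.tm (extChartAt (cotModel n) p₀ p₀) ≠ 0 := by
    rw [hD, tm_chart _ _ _ hc]; exact hp₀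
  have hz₀ := extChartAt_cot_mem (p₀ := p₀) hc
  have hF : ContDiffAt ℝ ∞ (fun z => d • (D.rh z • D.ham z)) (extChartAt (cotModel n) p₀ p₀) :=
    ((hm.contDiffAt_rh hz₀ ht₀).smul (hm.contDiffAt_ham hz₀)).const_smul d
  have hU : {z | z ∈ (extChartAt (cotModel n) p₀).target ∧ D.tm z ≠ 0} ∈
      𝓝 (extChartAt (cotModel n) p₀ p₀) :=
    Filter.inter_mem ((isOpen_extChartAt_target (I := cotModel n) p₀).mem_nhds
      (mem_extChartAt_target p₀)) ((hm.contDiffAt_tm hz₀).continuousAt.eventually_ne ht₀)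
  obtain ⟨h, hh, hev⟩ := exists_flow_near (hF.of_le (by simp)) hU
  refine ⟨h, hh, ?_⟩
  filter_upwards [(continuousAt_extChartAt (I := cotModel n) p₀).eventually hev,
    eventually_base_mem hc] with p ⟨α, hα0, hα⟩ hp
  refine ⟨fun t => (extChartAt (cotModel n) p₀).symm (α t), ?_, fun t ht => ?_, fun t ht => ?_⟩
  · change (extChartAt (cotModel n) p₀).symm (α 0) = p
    rw [hα0, extChartAt_cot_left_inv hp]
  · obtain ⟨⟨h1, h2⟩, -⟩ := hα t ht
    rwa [hD, localData_tm ((mem_extChartAt_cot_target p₀ _).1 h1)] at h2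
  · obtain ⟨⟨h1, h2⟩, h3⟩ := hα t ht
    have hz := (mem_extChartAt_cot_target p₀ _).1 h1
    have h4 : MDifferentiableAt
        𝓘(ℝ, ℝ × (EuclideanSpace ℝ (Fin n) × (EuclideanSpace ℝ (Fin n) →L[ℝ] ℝ))) (cotModel n)
        (extChartAt (cotModel n) p₀).symm (α t) :=
      ((contMDiffOn_extChartAt_symm (n := ∞) p₀).contMDiffAt
        ((isOpen_extChartAt_target (I := cotModel n) p₀).mem_nhds h1)).mdifferentiableAt (by simp)
    have h5 := h4.hasMFDerivAt.comp_hasMFDerivWithinAt t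
      (h3.hasDerivWithinAt (s := Icc 0 h)).hasFDerivWithinAt.hasMFDerivWithinAt
    refine h5.congr_mfderiv (ContinuousLinearMap.ext fun (r : ℝ) => ?_)
    have h6 := mfderiv_chart_symm_ham (S := S) (p₀ := p₀) (fun _ => 0) 0 (fun _ => 0) hz
    have h7 := localData_rh (S := S) (V := fun _ => 0) (k := 0) (ℓ := fun _ => 0) hz
    change mfderiv _ (cotModel n) (extChartAt (cotModel n) p₀).symm (α t)
      (r • (d • (D.rh (α t) • D.ham (α t)))) = r • (d • S.rescaledHamilton _)
    rw [rescaledHamilton, ← h6, ← h7]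
    refine (ContinuousLinearMap.map_smul _ _ _).trans (congrArg (r • ·) ?_)
    refine (ContinuousLinearMap.map_smul _ _ _).trans (congrArg (d • ·) ?_)
    exact ContinuousLinearMap.map_smul _ _ _

theorem isMIntegralCurveOn_dilate {d a : ℝ} (ha : 0 < a) {c : ℝ → BCotangent n X} {J : Set ℝ}
    (hc : IsMIntegralCurveOn (I := cotModel n) c (fun p => d • S.rescaledHamilton p) J) :
    IsMIntegralCurveOn (I := cotModel n) (fun t => dilate a (c t))
      (fun p => d • S.rescaledHamilton p) J := by
  intro t ht
  have h1 := ((contMDiff_dilate a (c t)).mdifferentiableAt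
    (by simp)).hasMFDerivAt.comp_hasMFDerivWithinAt t (hc t ht)
  refine h1.congr_mfderiv (ContinuousLinearMap.ext fun (r : ℝ) => ?_)
  change mfderiv (cotModel n) (cotModel n) (dilate a) (c t) (r • (d • S.rescaledHamilton (c t))) =
    r • (d • S.rescaledHamilton (dilate a (c t)))
  rw [← mfderiv_dilate_rescaledHamilton ha]
  refine (ContinuousLinearMap.map_smul _ _ _).trans (congrArg (r • ·) ?_)
  exact ContinuousLinearMap.map_smul _ _ _

/-- The flow lines starting in a set whose projection to `ᵇS*_XM` is relatively compact exist for a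
uniform time. -/
theorem exists_uniform_time (d : ℝ) {K : Set (BCotangent n X)} (hK : IsCompact K)
    (hKt : ∀ p ∈ K, S.timeFunction p ≠ 0) :
    ∃ h : ℝ, 0 < h ∧ ∀ p, S.timeFunction p ≠ 0 → S.normalize p ∈ K →
      ∃ c : ℝ → BCotangent n X, c 0 = p ∧ (∀ t ∈ Icc 0 h, S.timeFunction (c t) ≠ 0) ∧
      IsMIntegralCurveOn (I := cotModel n) c (fun p => d • S.rescaledHamilton p) (Icc 0 h) := by
  have key : ∃ h : ℝ, 0 < h ∧ ∀ p ∈ K,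
      ∃ c : ℝ → BCotangent n X, c 0 = p ∧ (∀ t ∈ Icc 0 h, S.timeFunction (c t) ≠ 0) ∧
      IsMIntegralCurveOn (I := cotModel n) c (fun p => d • S.rescaledHamilton p) (Icc 0 h) := by
    refine hK.induction_on (p := fun A => ∃ h : ℝ, 0 < h ∧ ∀ p ∈ A,
      ∃ c : ℝ → BCotangent n X, c 0 = p ∧ (∀ t ∈ Icc 0 h, S.timeFunction (c t) ≠ 0) ∧
      IsMIntegralCurveOn (I := cotModel n) c (fun p => d • S.rescaledHamilton p) (Icc 0 h))
      ⟨1, one_pos, fun p hp => hp.elim⟩ ?_ ?_ ?_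
    · rintro A A' hAA' ⟨h, hh, hA⟩
      exact ⟨h, hh, fun p hp => hA p (hAA' hp)⟩
    · rintro A A' ⟨h, hh, hA⟩ ⟨h', hh', hA'⟩
      refine ⟨min h h', lt_min hh hh', ?_⟩
      rintro p (hp | hp)
      · obtain ⟨c, h0, h1, h2⟩ := hA p hp
        have hs : Icc 0 (min h h') ⊆ Icc 0 h := Icc_subset_Icc_right (min_le_left _ _)
        exact ⟨c, h0, fun t ht => h1 t (hs ht), h2.mono hs⟩
      · obtain ⟨c, h0, h1, h2⟩ := hA' p hp
        have hs : Icc 0 (min h h') ⊆ Icc 0 h' := Icc_subset_Icc_right (min_le_right _ _)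
        exact ⟨c, h0, fun t ht => h1 t (hs ht), h2.mono hs⟩
    · intro p hp
      obtain ⟨h, hh, hev⟩ := exists_curve_near (S := S) d (hKt p hp)
      exact ⟨_, mem_nhdsWithin_of_mem_nhds hev, h, hh, fun q hq => hq⟩
  obtain ⟨h, hh, hc⟩ := key
  refine ⟨h, hh, fun p hp hpK => ?_⟩
  obtain ⟨c, h0, h1, h2⟩ := hc _ hpK
  have hr := S.rhoHat_pos hp
  refine ⟨fun t => dilate (S.rhoHat p)⁻¹ (c t), ?_, fun t ht => ?_,
    isMIntegralCurveOn_dilate (inv_pos.2 hr) h2⟩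
  · change dilate (S.rhoHat p)⁻¹ (c 0) = p
    rw [h0, normalize, dilate_dilate, inv_mul_cancel₀ hr.ne', dilate_one]
  · rw [timeFunction_dilate]
    exact mul_ne_zero (inv_ne_zero hr.ne') (h1 t ht)

end Setting

namespace Setting

variable {n : ℕ} {M : Type*} [TopologicalSpace M] [ChartedSpace (EuclideanHalfSpace (n + 1)) M]
  [IsManifold (𝓡∂ (n + 1)) ∞ M]
  {X : Type*} [TopologicalSpace X] [ChartedSpace (EuclideanSpace ℝ (Fin n)) X]
  [IsManifold (𝓡 n) ∞ X] {S : Setting n M X}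

/-! ### Asymptotic stability of the conormal set -/

/-- A conic neighbourhood `O` of the conormal set which the flow lines of `d ρ̂ H_G` do not leave,
along which `ρ` decays exponentially. Its projection to `ᵇS*_XM` is relatively compact, so that
smallness of `ρ` means closeness to the conormal set. -/
structure IsTrap (S : Setting n M X) (H : Set X) (s d b r : ℝ) (ρ : BCotangent n X → ℝ)
    (O : Set (BCotangent n X)) : Prop where
  isOpen : IsOpen O
  isConic : IsConic O
  subset : S.halfConormal H s ⊆ O
  timeFunction_ne_zero : ∀ p ∈ O, S.timeFunction p ≠ 0
  lt : ∀ p ∈ O, ρ p < r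
  exists_isCompact : ∃ K : Set (BCotangent n X), IsCompact K ∧ (∀ p ∈ K, S.timeFunction p ≠ 0) ∧
    ∀ p ∈ O, S.normalize p ∈ K
  exists_mem : ∀ N : Set (BCotangent n X), IsOpen N → IsConic N → S.halfConormal H s ⊆ N →
    ∃ r' : ℝ, 0 < r' ∧ ∀ p ∈ O, ρ p < r' → p ∈ N
  decay : ∀ (c : ℝ → BCotangent n X) (T : ℝ), (∀ t ∈ Icc 0 T, S.timeFunction (c t) ≠ 0) →
    IsMIntegralCurveOn (I := cotModel n) c (fun p => d • S.rescaledHamilton p) (Icc 0 T) →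
    c 0 ∈ O → ∀ t ∈ Icc 0 T, c t ∈ O ∧ ρ (c t) ≤ Real.exp (-b * t) * ρ (c 0)

theorem IsLyapunov.exists_isTrap [T2Space X] {H : Set X} {s e b L : ℝ} {ρ : BCotangent n X → ℝ}
    {W : Set (BCotangent n X)} (hW : S.IsLyapunov H s e (1 / 2) b L ρ W) (hb : 0 < b)
    (hΛ : IsConic (S.halfConormal H s))
    (hcpt : IsCompact {p | p ∈ S.halfConormal H s ∧ S.rhoHat p = 1}) :
    ∃ r O, S.IsTrap H s (-e) b r ρ O := by
  have : T2Space (BCotangent n X) := t2Space_bCotangent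
  have : LocallyCompactSpace (BCotangent n X) :=
    Manifold.locallyCompact_of_finiteDimensional (cotModel n)
  obtain ⟨C, hC, hΛC, hCW⟩ := exists_compact_between hcpt hW.isOpen
    (fun p hp => hW.subset hp.1)
  have hρW : ContinuousOn ρ W := fun p hp => (hW.smooth p hp).continuousAt.continuousWithinAt
  have hρC : ContinuousOn ρ C := hρW.mono hCW
  -- away from the conormal set, `ρ` is bounded below on the compact set `C ∩ {ρ̂ = 1}`
  have hsep : ∀ N : Set (BCotangent n X), IsOpen N →
      {p | p ∈ S.halfConormal H s ∧ S.rhoHat p = 1} ⊆ N →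
      ∃ r : ℝ, 0 < r ∧ ∀ p ∈ C, S.rhoHat p = 1 → ρ p < r → p ∈ N := by
    intro N hN hΛN
    have hK : IsCompact (C ∩ ({p | S.rhoHat p = 1} ∩ Nᶜ)) :=
      hC.inter_right (isClosed_slice.inter hN.isClosed_compl)
    obtain ⟨r, hr, hle⟩ := hK.exists_forall_le' (f := ρ) (hρC.mono inter_subset_left) (a := 0)
      (fun p hp => lt_of_le_of_ne (hW.nonneg p (hCW hp.1)) fun h0 =>
        hp.2.2 (hΛN ⟨(hW.eq_zero_iff p (hCW hp.1)).1 h0.symm, hp.2.1⟩))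
    refine ⟨r, hr, fun p hp h1 hlt => ?_⟩
    by_contra hN
    exact absurd (hle p ⟨hp, h1, hN⟩) (not_le.2 hlt)
  obtain ⟨r, hr, hrC⟩ := hsep (interior C) isOpen_interior hΛC
  have hρn : ∀ p, S.timeFunction p ≠ 0 → ρ (S.normalize p) = ρ p := fun p hp =>
    hW.dilate _ (S.rhoHat_pos hp) p
  have hmemW : ∀ p, S.timeFunction p ≠ 0 → S.normalize p ∈ C → p ∈ W := fun p hp h =>
    (normalize_mem_iff hW.isConic hp).1 (hCW h)
  have htΛ : ∀ p ∈ S.halfConormal H s, S.timeFunction p ≠ 0 := fun p hp =>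
    hW.timeFunction_ne_zero p (hW.subset hp)
  have htd : ∀ c : ℝ, 0 < c → ∀ p : BCotangent n X, S.timeFunction p ≠ 0 →
      S.timeFunction (BHorizon.dilate c p) ≠ 0 := fun c hc p hp => by
    rw [timeFunction_dilate]; exact mul_ne_zero hc.ne' hp
  refine ⟨r, {p | S.timeFunction p ≠ 0 ∧ S.normalize p ∈ interior C ∧ ρ p < r}, ?_⟩
  refine { isOpen := ?_, isConic := ?_, subset := ?_, timeFunction_ne_zero := fun p hp => hp.1,
           lt := fun p hp => hp.2.2, exists_isCompact := ?_, exists_mem := ?_, decay := ?_ }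
  · rw [isOpen_iff_mem_nhds]
    rintro p ⟨h1, h2, h3⟩
    have hpW := hmemW p h1 (interior_subset h2)
    filter_upwards [(contMDiff_timeFunction (S := S)).continuous.continuousAt.eventually_ne h1,
      (continuousAt_normalize h1).eventually (isOpen_interior.mem_nhds h2),
      (hW.smooth p hpW).continuousAt.eventually (gt_mem_nhds h3)] with q q1 q2 q3
    exact ⟨q1, q2, q3⟩
  · rintro p ⟨h1, h2, h3⟩ c hc
    refine ⟨htd c hc p h1, ?_, ?_⟩
    · rwa [normalize_dilate hc]
    · rwa [hW.dilate c hc]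
  · intro p hp
    refine ⟨htΛ p hp, hΛC ⟨(normalize_mem_iff hΛ (htΛ p hp)).2 hp, rhoHat_normalize (htΛ p hp)⟩, ?_⟩
    rwa [(hW.eq_zero_iff p (hW.subset hp)).2 hp]
  · exact ⟨C, hC, fun p hp => hW.timeFunction_ne_zero p (hCW hp), fun p hp =>
      interior_subset hp.2.1⟩
  · intro N hN hNc hΛN
    obtain ⟨r', hr', h⟩ := hsep N hN fun p hp => hΛN hp.1
    refine ⟨r', hr', fun p hp hlt => (normalize_mem_iff hNc hp.1).1 ?_⟩
    exact h _ (interior_subset hp.2.1) (rhoHat_normalize hp.1) (by rwa [hρn p hp.1])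
  · intro c T htime hc h0
    have hderiv : ∀ J ⊆ Icc 0 T, (∀ t ∈ J, c t ∈ W) → ∀ t ∈ J,
        HasDerivWithinAt (ρ ∘ c) (-e * diff (cotModel n) ρ (c t) (S.rescaledHamilton (c t))) J t :=
      fun J hJ hJW t ht => hasDerivWithinAt_comp_curve (hc.mono hJ) ht
        ((hW.smooth _ (hJW t ht)).mdifferentiableAt (by simp))
    have hle : ∀ p ∈ W, -e * diff (cotModel n) ρ p (S.rescaledHamilton p) ≤ -b * ρ p := by
      intro p hp
      have h1 := hW.le_diff p hp
      have h2 := mul_le_mul_of_nonneg_right (hW.le_beta p hp) (hW.nonneg p hp)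
      linarith
    set g : ℝ → BCotangent n X := fun t => S.normalize (c t) with hg
    have hgcont : ContinuousOn g (Icc 0 T) := fun t ht =>
      ContinuousAt.comp_continuousWithinAt (continuousAt_normalize (htime t ht))
        (hc.continuousOn t ht)
    set B : Set (BCotangent n X) := C ∩ ρ ⁻¹' Iic (ρ (c 0)) with hB
    have hBcl : IsClosed B := hρC.preimage_isClosed_of_isClosed hC.isClosed isClosed_Iic
    have hint : ∀ t ∈ Icc 0 T, g t ∈ B → g t ∈ interior C := fun t ht htB =>
      hrC _ htB.1 (rhoHat_normalize (htime t ht)) (lt_of_le_of_lt htB.2 h0.2.2)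
    have hall : ∀ t ∈ Icc 0 T, g t ∈ B := by
      intro t ht
      have h0T : (0 : ℝ) ∈ Icc 0 T := ⟨le_rfl, ht.1.trans ht.2⟩
      refine IsClosed.Icc_subset_of_forall_mem_nhdsWithin (s := g ⁻¹' B) ?_ ?_ ?_ ht
      · rw [inter_comm]
        exact hgcont.preimage_isClosed_of_isClosed isClosed_Icc hBcl
      · exact ⟨interior_subset h0.2.1, (hρn _ h0.1).le⟩
      · rintro x ⟨hxB, hx⟩
        have hxI : x ∈ Icc 0 T := Ico_subset_Icc_self hx
        have h1 : g ⁻¹' interior C ∈ 𝓝[Icc 0 T] x :=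
          (hgcont x hxI).preimage_mem_nhdsWithin (isOpen_interior.mem_nhds (hint x hxI hxB))
        obtain ⟨ε, hε, hball⟩ := Metric.mem_nhdsWithin_iff.1 h1
        filter_upwards [Ioo_mem_nhdsGT (show x < min (x + ε) T from
          lt_min (by linarith) hx.2)] with t ht
        have ht1 := ht.2.trans_le (min_le_left _ _)
        have ht2 := ht.2.trans_le (min_le_right _ _)
        have hsub : Icc x t ⊆ Icc 0 T := Icc_subset_Icc hxI.1 ht2.le
        have hJ : ∀ u ∈ Icc x t, g u ∈ interior C := fun u hu => by
          refine hball ⟨?_, hsub hu⟩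
          rw [Metric.mem_ball, Real.dist_eq, abs_of_nonneg (by linarith [hu.1])]
          linarith [hu.2]
        have hJW : ∀ u ∈ Icc x t, c u ∈ W := fun u hu =>
          hmemW _ (htime u (hsub hu)) (interior_subset (hJ u hu))
        have h2 := le_exp_mul_of_deriv_le (a := 0) (convex_Icc x t) (hderiv _ hsub hJW)
          (fun u hu => (hle _ (hJW u hu)).trans (by
            have := mul_nonneg hb.le (hW.nonneg _ (hJW u hu))
            rw [zero_mul]
            linarith)) (left_mem_Icc.2 ht.1.le) (right_mem_Icc.2 ht.1.le) ht.1.le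
        rw [zero_mul, Real.exp_zero, one_mul] at h2
        refine ⟨interior_subset (hJ t (right_mem_Icc.2 ht.1.le)), ?_⟩
        have h3 : ρ (g x) ≤ ρ (c 0) := hxB.2
        change ρ (g t) ≤ ρ (c 0)
        have h4 := hρn _ (htime x hxI)
        have h5 := hρn _ (htime t (hsub (right_mem_Icc.2 ht.1.le)))
        have h6 : ρ (c t) ≤ ρ (c x) := h2
        linarith
    intro t ht
    have h0T : (0 : ℝ) ∈ Icc 0 T := ⟨le_rfl, ht.1.trans ht.2⟩
    have hallW : ∀ t ∈ Icc 0 T, c t ∈ W := fun t ht => hmemW _ (htime t ht) (hall t ht).1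
    have h2 := le_exp_mul_of_deriv_le (convex_Icc 0 T) (hderiv _ subset_rfl hallW)
      (fun u hu => hle _ (hallW u hu)) h0T ht ht.1
    rw [sub_zero] at h2
    refine ⟨⟨htime t ht, hint t ht (hall t ht), ?_⟩, h2⟩
    have h3 : ρ (g t) ≤ ρ (c 0) := (hall t ht).2
    have h4 := hρn _ (htime t ht)
    have h5 := h0.2.2
    change ρ (S.normalize (c t)) ≤ ρ (c 0) at h3
    linarith

theorem IsTrap.isAttracting {H : Set X} {s e δ b L d r : ℝ} {ρ : BCotangent n X → ℝ}
    {W O : Set (BCotangent n X)} (hO : S.IsTrap H s d b r ρ O)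
    (hW : S.IsLyapunov H s e δ b L ρ W) (hb : 0 < b) :
    S.IsAttracting d (S.L H s) := by
  have hLO : ∀ {N : Set (BCotangent n X)}, S.halfConormal H s ⊆ N → S.L H s ⊆ sphereSet N := by
    rintro N hN z ⟨p, hp, rfl⟩
    exact ⟨p, hN hp, rfl⟩
  have hcN : ∀ {N : Set (BSphere n X)}, S.L H s ⊆ N → S.halfConormal H s ⊆ cone N := by
    intro N hN p hp
    exact ⟨hp.2.1, hN ⟨⟨p, hp.2.1⟩, hp, rfl⟩⟩
  refine ⟨⟨sphereSet O, isOpen_sphereSet hO.isConic hO.isOpen, hLO hO.subset, ?_, ?_⟩, ?_⟩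
  · rintro z ⟨p, hp, rfl⟩
    obtain ⟨K, hK, hKt, hOK⟩ := hO.exists_isCompact
    obtain ⟨h, hh, hc⟩ := exists_uniform_time d hK hKt
    obtain ⟨c, hc0, hcO, hcurve⟩ := exists_isMIntegralCurveOn_Ici (I := cotModel n)
      (v := fun p => d • S.rescaledHamilton p) (O := O) hh (fun q hq => by
        obtain ⟨c, h0, h1, h2⟩ := hc q (hO.timeFunction_ne_zero q hq) (hOK q hq)
        exact ⟨c, h0, fun t ht => (hO.decay c h h1 h2 (by rwa [h0]) t ht).1, h2⟩) hp
    -- the values of the curve at negative times are irrelevant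
    have hne : ∀ t, ¬((c (max t 0)).1 = 0 ∧ (c (max t 0)).2.snd = 0) := fun t =>
      nonzero_of_timeFunction_ne_zero (hO.timeFunction_ne_zero _ (hcO _ (le_max_right t 0)))
    have heq : ∀ t ∈ Ici (0 : ℝ), c (max t 0) = c t := fun t ht => by rw [max_eq_left ht]
    refine ⟨fun t => toSphere ⟨c (max t 0), hne t⟩, ?_, fun t => ⟨c (max t 0), hne t⟩,
      fun t _ => rfl, fun t ht => hO.timeFunction_ne_zero _ (hcO _ (le_max_right t 0)), ?_⟩
    · refine congrArg toSphere (Subtype.ext ?_)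
      change c (max 0 0) = p
      rw [max_self, hc0]
    · intro t ht
      have h1 := (hcurve t ht).congr_of_eventuallyEq (f₁ := fun t => c (max t 0))
        (Filter.eventuallyEq_of_mem self_mem_nhdsWithin heq) (heq t ht)
      refine h1.congr_mfderiv ?_
      have h3 : ∀ x y : BCotangent n X, x = y →
          (d • S.rescaledHamilton x :
            ℝ × (EuclideanSpace ℝ (Fin n) × (EuclideanSpace ℝ (Fin n) →L[ℝ] ℝ))) =
          d • S.rescaledHamilton y := by rintro x _ rfl; rfl
      exact congrArg (fun w : ℝ × (EuclideanSpace ℝ (Fin n) × (EuclideanSpace ℝ (Fin n) →L[ℝ] ℝ)) =>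
        (1 : ℝ →L[ℝ] ℝ).smulRight w) (h3 _ _ (heq t ht).symm)
  · intro N hN hLN
    obtain ⟨r', hr', hmem⟩ := hO.exists_mem (cone N) (isOpen_cone hN) (isConic_cone N) (hcN hLN)
    -- the time after which `exp (-b t) r` is smaller than `r'`
    obtain ⟨T, hT⟩ : ∃ T : ℝ, ∀ t, T ≤ t → Real.exp (-b * t) * r < r' := by
      have h1 : Filter.Tendsto (fun t : ℝ => Real.exp (-b * t) * r) Filter.atTop (𝓝 (0 * r)) :=
        (Real.tendsto_exp_atBot.comp
          (Filter.tendsto_id.const_mul_atTop_of_neg (neg_lt_zero.2 hb))).mul_const r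
      rw [zero_mul] at h1
      exact Filter.eventually_atTop.1 (h1.eventually (gt_mem_nhds hr'))
    refine ⟨max T 0, le_max_right _ _, ?_⟩
    rintro γ ⟨c, hγ, htime, hc⟩ hγ0 t ht
    have ht0 : 0 ≤ t := (le_max_right _ _).trans ht
    rw [hγ 0 (mem_Ici.2 le_rfl), toSphere_mem_sphereSet hO.isConic] at hγ0
    have hsub : Icc 0 t ⊆ Ici (0 : ℝ) := Icc_subset_Ici_self
    obtain ⟨h1, h2⟩ := hO.decay (fun t => (c t).1) t (fun u hu => htime u (hsub hu))
      (hc.mono hsub) hγ0 t ⟨ht0, le_rfl⟩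
    rw [hγ t ht0]
    have h3 := mul_le_mul_of_nonneg_left (hO.lt _ hγ0).le (Real.exp_pos (-b * t)).le
    have h4 := hT t ((le_max_left _ _).trans ht)
    obtain ⟨_, h5⟩ := hmem _ h1 (lt_of_le_of_lt (h2.trans h3) h4)
    exact h5
  · intro N hN hLN
    obtain ⟨r', hr', hmem⟩ := hO.exists_mem (cone N) (isOpen_cone hN) (isConic_cone N) (hcN hLN)
    have hO'c : IsConic (O ∩ (W ∩ {p | ρ p < r'})) := fun p hp c hc =>
      ⟨hO.isConic p hp.1 c hc, hW.isConic p hp.2.1 c hc,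
        show ρ (dilate c p) < r' by rw [hW.dilate c hc]; exact hp.2.2⟩
    have hO'o : IsOpen (O ∩ (W ∩ {p | ρ p < r'})) :=
      hO.isOpen.inter (ContinuousOn.isOpen_inter_preimage
        (fun p hp => (hW.smooth p hp).continuousAt.continuousWithinAt) hW.isOpen isOpen_Iio)
    refine ⟨sphereSet (O ∩ (W ∩ {p | ρ p < r'})), isOpen_sphereSet hO'c hO'o,
      hLO fun p hp => ⟨hO.subset hp, hW.subset hp, ?_⟩, ?_⟩
    · exact ((hW.eq_zero_iff p (hW.subset hp)).2 hp).trans_lt hr'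
    · rintro γ T ⟨c, hγ, htime, hc⟩ hγ0 t ht
      rw [hγ 0 ⟨le_rfl, ht.1.trans ht.2⟩, toSphere_mem_sphereSet hO'c] at hγ0
      obtain ⟨h1, h2⟩ := hO.decay (fun t => (c t).1) T htime hc hγ0.1 t ht
      rw [hγ t ht]
      have h3 : Real.exp (-b * t) ≤ 1 := Real.exp_le_one_iff.2 (by nlinarith [ht.1])
      have h4 := mul_le_mul_of_nonneg_right h3 (hW.nonneg _ hγ0.2.1)
      have h5 : ρ (c 0).1 < r' := hγ0.2.2
      obtain ⟨_, h6⟩ := hmem _ h1 (show ρ (c t).1 < r' by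
        have : ρ (c t).1 ≤ Real.exp (-b * t) * ρ (c 0).1 := h2
        linarith)
      exact h6

end Setting

/-! ### The dynamics near the horizon -/

namespace Setting.HorizonData

variable {n : ℕ} {M : Type*} [TopologicalSpace M] [ChartedSpace (EuclideanHalfSpace (n + 1)) M]
  [IsManifold (𝓡∂ (n + 1)) ∞ M]
  {X : Type*} [TopologicalSpace X] [ChartedSpace (EuclideanSpace ℝ (Fin n)) X]
  [IsManifold (𝓡 n) ∞ X] {S : Setting n M X}

/-- The dynamics near the conormal set, with the quadratic defining function for `δ = 1/2`. The set
attracts the flow lines of `-sε ρ̂ H_G`, along which this function decays. -/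
theorem isInvariant_and_isAttracting [T2Space X] {V : ∀ x : X, TangentSpace (𝓡 n) x} {k : X → ℝ}
    {ℓ : ∀ x : X, TangentSpace (𝓡 n) x →L[ℝ] TangentSpace (𝓡 n) x →L[ℝ] ℝ} {H : Set X}
    (hd : S.HorizonData V k ℓ H) {s ε : ℝ} (hs : s = 1 ∨ s = -1) (hε : ε = 1 ∨ ε = -1)
    (hεk : ∀ x ∈ H, 0 < ε * k x) :
    S.IsInvariant (S.L H s) ∧ S.IsAttracting (-(s * ε)) (S.L H s) := by
  obtain ⟨b, L, C, hb, hC, W, hW⟩ := hd.exists_isLyapunov hs hε hεk one_half_pos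
  obtain ⟨r, O, hO⟩ := hW.exists_isTrap hb (hd.isConic_halfConormal s) (hd.isCompact_slice hs)
  exact ⟨hW.isInvariant (hd.isConic_halfConormal s) (hd.isCompact_slice hs),
    hO.isAttracting hW hb⟩

end Setting.HorizonData

end BHorizon

/-- Source/sink dynamics at a nondegenerate b-horizon. Here `s = ±1` stands for the sign `±`, and
`ε` is the (constant) sign of the surface gravity `κ`. -/
theorem theorem1 {n : ℕ} {M : Type*} [TopologicalSpace M] [T2Space M] [SecondCountableTopology M]
    [ChartedSpace (EuclideanHalfSpace (n + 1)) M] [IsManifold (𝓡∂ (n + 1)) ∞ M]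
    {X : Type*} [TopologicalSpace X] [ChartedSpace (EuclideanSpace ℝ (Fin n)) X]
    [IsManifold (𝓡 n) ∞ X]
    (S : BHorizon.Setting n M X) (hS : S.IsTimelike)
    (H : Set X) (κ : X → ℝ)
    (hH : S.IsBHorizon H κ ∨ ∃ V : ∀ x : X, TangentSpace (𝓡 n) x, S.IsBHorizonGeneratedBy V H κ)
    (hκ : ∀ x ∈ H, κ x ≠ 0) :
    ∃ ε : ℝ, (ε = 1 ∨ ε = -1) ∧ (∀ x ∈ H, 0 < ε * κ x) ∧
      ∀ s : ℝ, (s = 1 ∨ s = -1) →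
        S.IsInvariant (S.L H s) ∧
        (s = ε → S.IsSource (S.L H s)) ∧
        (s = -ε → S.IsSink (S.L H s)) ∧
        (∀ p ∈ S.halfConormal H s, S.beta p = |κ (BHorizon.base p)|) ∧
        ∀ δ : ℝ, 0 < δ → ∃ ρ : BHorizon.BSphere n X → ℝ,
          BHorizon.IsQuadraticDefiningFunction (S.L H s) ρ ∧
          ∃ U : Set (BHorizon.BSphere n X), IsOpen U ∧ S.L H s ⊆ U ∧
            ∀ p ∈ BHorizon.cone U, S.timeFunction p ≠ 0 ∧ 0 < S.beta p ∧
              2 * (1 - δ) * S.beta p * BHorizon.lift ρ p ≤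
                s * ε * BHorizon.diff (BHorizon.cotModel n) (BHorizon.lift ρ) p (S.rescaledHamilton p) := by
  have : T2Space X := S.isBoundaryInclusion.isEmbedding.t2Space
  obtain ⟨V, k, ℓ, hd, hk, hpre⟩ : ∃ V k ℓ, S.HorizonData V k ℓ H ∧ (∀ x ∈ H, k x = κ x) ∧
      IsPreconnected H := by
    rcases hH with h | ⟨V, h⟩
    · obtain ⟨k, ℓ, hd, hk⟩ := BHorizon.Setting.horizonData_of_bHorizon hS h hκ
      obtain ⟨x₀, -, hx₀⟩ := h.component
      exact ⟨_, k, ℓ, hd, hk, hx₀ ▸ isPreconnected_connectedComponentIn⟩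
    · obtain ⟨k, ℓ, hd, hk⟩ := BHorizon.Setting.horizonData_of_generatedBy h hκ
      obtain ⟨x₀, -, hx₀⟩ := h.component
      exact ⟨V, k, ℓ, hd, hk, hx₀ ▸ isPreconnected_connectedComponentIn⟩
  obtain ⟨ε, hε, hεk⟩ := hd.exists_sign hpre
  have hεε : ε * ε = 1 := by rcases hε with rfl | rfl <;> norm_num
  refine ⟨ε, hε, fun x hx => hk x hx ▸ hεk x hx, fun s hs => ?_⟩
  obtain ⟨hinv, hatt⟩ := hd.isInvariant_and_isAttracting hs hε hεk
  refine ⟨hinv, ?_, ?_, fun p hp => ?_, fun δ hδ => ?_⟩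
  · rintro rfl
    rwa [hεε] at hatt
  · rintro rfl
    rwa [neg_mul, hεε, neg_neg] at hatt
  · rw [hd.beta_conormal hs hp, hk _ hp.1.1]
  · obtain ⟨b, L, C, hb, hC, W, hW⟩ := hd.exists_isLyapunov hs hε hεk hδ
    exact ⟨_, hd.isQuadraticDefiningFunction hεk hC hW, hW.exists_le_diff_lift hb⟩
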